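/- Conventions. $V=\coprod_{n\in\mathbb Z}V_{(n)}$ is a vertex operator algebra over $\mathbb C$, $G$ is a group of automorphisms of $V$, and for $z\in\mathbb C^\times$, $p\in\mathbb Z$ put $l_p(z)=\log|z|+i\arg z+2\pi ip$ with $0\le\arg z<2\pi$; $\log z=l_0(z)$. The $p$-th branch of a series $\sum a_{n,k}x^{n}(\log x)^k$ is obtained by $x^n=e^{nl_p(z)}$, $\log x=l_p(z)$. For $g\in G$, a generalized $g$-twisted $V$-module (without $g$-action) is a $\mathbb C$-graded space $W=\coprod_{n\in\mathbb C}W_{[n]}$ with a linear map $Y_W:V\otimes W\to W\{x\}[\log x]$, $Y_W(v,x)w=\sum_{n,k}Y_{n,k}(v)w\,x^{-n-1}(\log x)^k$, homogeneous in the sense that $Y_{n,k}(v)W_{[r]}\subset W_{[r+d-n-1]}$ for $v\in V_{(d)}$ (the $L(0)$-commutator formula), satisfying: equivariance $Y_W^{p+1}(gv,z)=Y_W^{p}(v,z)$; $Y_W(\mathbf 1,x)=1$; duality: for $u,v\in V$, $w\in W$, $w'\in W'=\coprod W_{[n]}^*$ there is $f(z_1,z_2)=\sum_{i,j,k,l=0}^N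 a_{ijkl}z_1^{m_i}z_2^{n_j}(\log z_1)^k(\log z_2)^l(z_1-z_2)^{-t}$ such that, for every $p$, $\langle w',Y_W^p(u,z_1)Y_W^p(v,z_2)w\rangle$, $\langle w',Y_W^p(v,z_2)Y_W^p(u,z_1)w\rangle$ and $\langle w',Y_W^p(Y_V(u,z_1-z_2)v,z_2)w\rangle$ converge absolutely for $|z_1|>|z_2|>0$, $|z_2|>|z_1|>0$, $|z_2|>|z_1-z_2|>0$, with sum the branch $f^{p,p}$ (in the third case when $|\arg z_1-\arg z_2|<\pi/2$); $W_{[n]}$ consists of generalized eigenvectors of $L(0)$ with eigenvalue $n$; and $\frac{d}{dx}Y_W(v,x)=Y_W(L(-1)v,x)$. It is grading-restricted if $\dim W_{[n]}<\infty$ and $W_{[n+l]}=0$ for every $n$ and sufficiently negative real $l$. A module with a $G$-action carries in addition a left $G$-module structure and a grading $W=\coprod_{n\in\mathbb C,\alpha\in\mathbb C/\mathbb Z}W_{[n]}^{[\alpha]}$ with $W_{[n]}=\coprod_\alpha W_{[n]}^{[\alpha]}$, a $\Lambda\in\mathbb Z_+$ with $(g-e^{2\pi i\alpha})^\Lambda=0$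 on all $W^{[\alpha]}=\coprod_n W^{[\alpha]}_{[n]}$, and $gY_W(v,x)w=Y_W(gv,x)gw$; the dual of the action of every $h\in G$ is required to preserve the graded dual $W'\subset W^*$ (so that $G$ acts on $W'$), and nothing else is required of the elements $h\neq g$. The contragredient $W'$, with $\langle Y_{W'}(v,x)w',w\rangle=\langle w',Y_W(e^{xL(1)}(-x^{-2})^{L(0)}v,x^{-1})w\rangle$, is a $g^{-1}$-twisted module. Module maps are the linear maps commuting with the vertex operator maps (compatibility with $G$-actions is not required); a module is irreducible if it is nonzero and has no proper nonzero subspace stable under all $Y_{n,k}(v)$. Let $M^n=\{z\in\mathbb C^n: z_i\ne0,\ z_i\neq z_j\ (i\ne j)\}$. For grading-restricted $g_1$-, $g_2$-, $g_1g_2$-twisted modules $W_1,W_2,W_3$, a twisted intertwining operator of type $\binom{W_3}{W_1W_2}$ is a linear map $\mathcal Y:W_1\otimes W_2\to W_3\{x\}[\log x]$, homogeneous in the same sense ($\mathcal Y_{n,k}$ maps $(W_1)_{[r]}\otimes(W_2)_{[s]}$ to $(W_3)_{[r+s-n-1]}$), with: lower truncation; duality: for $u\in V$, $w_i\in W_i$,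 $w_3'\in W_3'$ there is a maximally extended multivalued analytic function on $M^2$, with a preferred single-valued branch $f^e$ on $M^2$ cut along $z_1,z_2,z_1-z_2\in\mathbb R_+$ (the cuts being attached to the upper half planes), such that $\langle w_3',Y_{W_3}(u,z_1)\mathcal Y(w_1,z_2)w_2\rangle$, $\langle w_3',\mathcal Y(w_1,z_2)Y_{W_2}(u,z_1)w_2\rangle$, $\langle w_3',\mathcal Y(Y_{W_1}(u,z_1-z_2)w_1,z_2)w_2\rangle$ converge absolutely for $|z_1|>|z_2|>0$, $|z_2|>|z_1|>0$, $|z_2|>|z_1-z_2|>0$, with sum $f^e(z_1,z_2)$ when moreover $|\arg(z_1-z_2)-\arg z_1|<\frac\pi2$, $-\frac{3\pi}2<\arg(z_1-z_2)-\arg z_2<-\frac\pi2$, $|\arg z_1-\arg z_2|<\frac\pi2$, respectively; for $k\ge3$ the products $\langle w_3',Y_{W_3}(u_1,z_1)\cdots Y_{W_3}(u_{k-1},z_{k-1})\mathcal Y(w_1,z_k)w_2\rangle$ converge absolutely for $|z_1|>\cdots>|z_k|>0$ and extend to a multivalued analytic function on $M^k$ all of whose component-isolated singularities are regular (if $\zeta=zA-\beta$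 with $A\in GL(k,\mathbb C)$ and $M^k$ contains a punctured polydisc around a point $\zeta=\delta\in\{0,\infty\}^k$, then all branches there, cut along $\zeta_i\in\mathbb R_+$, have absolutely convergent expansions in the $\zeta_i^{a_i}(\log\zeta_i)^{j_i}$ with $j_i$ bounded and $a_i$ in finitely many sets $r+\mathbb N$ if $\delta_i=0$, $r-\mathbb N$ if $\delta_i=\infty$); and $\frac{d}{dx}\mathcal Y(w_1,x)=\mathcal Y(L(-1)w_1,x)$. The fusion rule $N_{W_1W_2}^{W_3}$ is the dimension of the space of these operators. For $z\in\mathbb C^\times$, a twisted $P(z)$-intertwining map of this type is a map $I:W_1\otimes W_2\to\overline{W_3}=\prod_n (W_3)_{[n]}$, $I(w_1\otimes w_2)=\mathcal Y(w_1,z)w_2$. Let $\mathcal C$ be either the category $\mathcal C_1$ of grading-restricted $g$-twisted $V$-modules without $g$-actions, $g\in G$, or the category $\mathcal C_2$ of grading-restricted $g$-twisted $V$-modules with $G$-actions, $g\in G$. For a $g_1$-twisted $W_1$ and a $g_2$-twisted $W_2$ in $\mathcal C$ let $W_1\,\tilde\boxtimes_{P(z)}W_2\subset(W_1\otimes W_2)^*$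 be the span of the functionals $\lambda_{I,w_3'}(w_1\otimes w_2)=\langle w_3',I(w_1\otimes w_2)\rangle$, over all $g_1g_2$-twisted $W_3$ in $\mathcal C$, all twisted $P(z)$-intertwining maps $I$ of type $\binom{W_3}{W_1W_2}$ and all $w_3'\in W_3'$, with the vertex operator map $Y(v,x)\lambda_{I,w_3'}=\lambda_{I,Y_{W_3'}(v,x)w_3'}$ and with $\lambda_{I,w_3'}$ of weight $n$ for $w_3'\in (W_3')_{[n]}$. Theorem. Assume that (1) for each $g\in G$ there are only finitely many inequivalent irreducible grading-restricted $g$-twisted $V$-modules in $\mathcal C$; (2) every object of $\mathcal C$ is a direct sum of irreducible objects of $\mathcal C$; (3) for all $g_1,g_2\in G$ and all $g_1$-, $g_2$-, $g_1g_2$-twisted modules $W_1,W_2,W_3$ in $\mathcal C$ the fusion rule $N_{W_1W_2}^{W_3}$ is finite. Then for every $z\in\mathbb C^\times$, all $g_1,g_2\in G$, and all $g_1$- and $g_2$-twisted $W_1$, $W_2$ in $\mathcal C$, $W_1\,\tilde\boxtimes_{P(z)}W_2$ is a $(g_1g_2)^{-1}$-twisted module in $\mathcal C$ (for $\mathcal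 C=\mathcal C_2$: it admits a $G$-action and a grading by generalized eigenspaces of $(g_1g_2)^{-1}$ making it an object of $\mathcal C_2$). Consequently $\mathcal C$ satisfies the three conditions of the tensor product assumption: (i) $W_1\,\tilde\boxtimes_{P(z)}W_2$ is in $\mathcal C$ for all $W_1,W_2$ in $\mathcal C$; (ii) the contragredient of an object of $\mathcal C$ is in $\mathcal C$; (iii) the double contragredient of an object of $\mathcal C$ is equivalent to the object. -/

import Mathlib

open scoped TensorProduct
open Filter Topology
open VertexOperator (ncoeff)

universe v u u₁ u₂ u₃

noncomputable section

/-! ### Vertex operator algebras and their automorphisms -/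

/-- A vertex operator algebra over `ℂ`: `ncoeff (Y u) n` is the coefficient `u_n` in
`Y(u, x) = ∑ n, u_n x^(-n-1)`; the lower truncation property is built into `VertexOperator`;
`jacobi` is the Jacobi identity written in components. -/
structure VOA (V : Type v) [AddCommGroup V] [Module ℂ V] where
  wt : ℤ → Submodule ℂ V
  internal : DirectSum.IsInternal wt
  finite_wt : ∀ n, FiniteDimensional ℂ (wt n)
  lower_bounded : ∃ N : ℤ, ∀ n < N, wt n = ⊥
  Y : V →ₗ[ℂ] VertexOperator ℂ V
  vac : V
  ω : V
  charge : ℂ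
  vac_mem : vac ∈ wt 0
  ω_mem : ω ∈ wt 2
  graded : ∀ (a b n : ℤ) (u v : V), u ∈ wt a → v ∈ wt b → ncoeff (Y u) n v ∈ wt (a + b - n - 1)
  identity : ∀ (n : ℤ) (v : V), ncoeff (Y vac) n v = if n = -1 then v else 0
  creation : ∀ v : V, ncoeff (Y v) (-1) vac = v
  creation_regular : ∀ (n : ℤ) (v : V), 0 ≤ n → ncoeff (Y v) n vac = 0
  jacobi : ∀ (l m n : ℤ) (u v w : V),
    ∑ᶠ i : ℕ, ((Ring.choose m i : ℤ) : ℂ) • ncoeff (Y (ncoeff (Y u) (l + i) v)) (m + n - i) w =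
      ∑ᶠ i : ℕ, ((-1 : ℂ) ^ i * ((Ring.choose l i : ℤ) : ℂ)) •
        (ncoeff (Y u) (l + m - i) (ncoeff (Y v) (n + i) w) -
          (-1 : ℂ) ^ l • ncoeff (Y v) (l + n - i) (ncoeff (Y u) (m + i) w))
  virasoro : ∀ (m n : ℤ) (v : V),
    ncoeff (Y ω) (m + 1) (ncoeff (Y ω) (n + 1) v) - ncoeff (Y ω) (n + 1) (ncoeff (Y ω) (m + 1) v) =
      ((m : ℂ) - n) • ncoeff (Y ω) (m + n + 1) v +
        (if m + n = 0 then (((m : ℂ) ^ 3 - m) / 12 * charge) • v else 0)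
  L0_grading : ∀ (n : ℤ) (v : V), v ∈ wt n → ncoeff (Y ω) 1 v = (n : ℂ) • v
  L_neg_one_derivative : ∀ (n : ℤ) (v w : V),
    ncoeff (Y (ncoeff (Y ω) 0 v)) (n) w = (-(n : ℂ)) • ncoeff (Y v) (n - 1) w

namespace VOA

variable {V : Type v} [AddCommGroup V] [Module ℂ V] (𝒱 : VOA V)

/-- The Virasoro operator `L(n)` on `V`. -/
def L (n : ℤ) : V →ₗ[ℂ] V := ncoeff (𝒱.Y 𝒱.ω) (n + 1)

/-- The decomposition of a vector into its homogeneous components. -/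
def decompose : V ≃ₗ[ℂ] DirectSum ℤ (fun n => 𝒱.wt n) :=
  (LinearEquiv.ofBijective (DirectSum.coeLinearMap 𝒱.wt) 𝒱.internal).symm

/-- The component of weight `n`. -/
def proj (n : ℤ) : V →ₗ[ℂ] V :=
  (𝒱.wt n).subtype ∘ₗ DirectSum.component ℂ ℤ (fun n => 𝒱.wt n) n ∘ₗ 𝒱.decompose.toLinearMap

/-- `π_r (Y_V(u, z) v)` for a nonzero complex number `z`. -/
def evalY (u : V) (z : ℂ) (v : V) (r : ℤ) : V :=
  ∑ᶠ n : ℤ, z ^ (-n - 1) • 𝒱.proj r (ncoeff (𝒱.Y u) n v)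

/-- An integer below which all weight spaces vanish. -/
def minWt : ℤ := 𝒱.lower_bounded.choose

/-- Automorphisms of a vertex operator algebra. -/
def IsAutomorphism (g : V ≃ₗ[ℂ] V) : Prop :=
  (∀ (n : ℤ) (u v : V), g (ncoeff (𝒱.Y u) n v) = ncoeff (𝒱.Y (g u)) n (g v)) ∧
    g 𝒱.vac = 𝒱.vac ∧ g 𝒱.ω = 𝒱.ω

end VOA

/-! ### Branches of logarithms and evaluation of formal series -/

/-- The argument normalised by `0 ≤ arg z < 2π`. -/
def argPos (z : ℂ) : ℝ := if Complex.arg z < 0 then Complex.arg z + 2 * Real.pi else Complex.arg z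

/-- `l_p(z) = log |z| + i arg z + 2πpi` with `0 ≤ arg z < 2π`. -/
def logBranch (p : ℤ) (z : ℂ) : ℂ :=
  (Real.log ‖z‖ : ℂ) + ((argPos z : ℝ) : ℂ) * Complex.I + 2 * Real.pi * p * Complex.I

/-- The value at `log x = l` of `∑ a_{n,k} x^(-n-1) (log x)^k`, for a series with only finitely
many nonzero coefficients. -/
def evalLog {A : Type*} [AddCommGroup A] [Module ℂ A] (a : ℂ → ℕ → A) (l : ℂ) : A :=
  ∑ᶠ q : ℂ × ℕ, (Complex.exp ((-q.1 - 1) * l) * l ^ q.2) • a q.1 q.2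

/-- The coefficients `T_{n,k}` of a map
`(a, b) ↦ ∑ T_{n,k}(a)b x^(-n-1) (log x)^k` from `A ⊗ B` to series in `x` and `log x`. -/
abbrev LogOperator (A : Type*) (B : Type*) (W : Type*) [AddCommGroup A] [Module ℂ A]
    [AddCommGroup B] [Module ℂ B] [AddCommGroup W] [Module ℂ W] :=
  ℂ → ℕ → A →ₗ[ℂ] B →ₗ[ℂ] W

/-! ### Graded spaces with a vertex operator map -/

/-- A `ℂ`-graded vector space with a homogeneous vertex operator map
`Y(v, x)w = ∑ Y_{n,k}(v)w x^(-n-1) (log x)^k`.  Homogeneity is what makes the evaluated series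
`Y(v, z)w` an element of the algebraic completion; for twisted modules it is equivalent to the
`L(0)`-commutator formula. -/
structure TwData {V : Type v} [AddCommGroup V] [Module ℂ V] (𝒱 : VOA V)
    (W : Type u) [AddCommGroup W] [Module ℂ W] where
  wt : ℂ → Submodule ℂ W
  internal : DirectSum.IsInternal wt
  Y : LogOperator V W W
  graded : ∀ (d : ℤ) (r n : ℂ) (k : ℕ) (v : V) (w : W), v ∈ 𝒱.wt d → w ∈ wt r →
    Y n k v w ∈ wt (r + d - n - 1)

namespace TwData

section

variable {V : Type v} [AddCommGroup V] [Module ℂ V] {𝒱 : VOA V}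
  {W : Type u} [AddCommGroup W] [Module ℂ W] (M : TwData 𝒱 W)

/-- The Virasoro operator `L(n)`, the coefficient of `x^(-n-2)` in `Y(ω, x)`. -/
def L (n : ℤ) : W →ₗ[ℂ] W := M.Y ((n : ℂ) + 1) 0 𝒱.ω

/-- The decomposition of a vector into its homogeneous components. -/
def decompose : W ≃ₗ[ℂ] DirectSum ℂ (fun r => M.wt r) :=
  (LinearEquiv.ofBijective (DirectSum.coeLinearMap M.wt) M.internal).symm

/-- The projection `π_r` onto the weight space of weight `r`. -/
def proj (r : ℂ) : W →ₗ[ℂ] M.wt r :=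
  DirectSum.component ℂ ℂ (fun r => M.wt r) r ∘ₗ M.decompose.toLinearMap

/-- The algebraic completion `∏ r, W_[r]`. -/
abbrev Completion : Type u := ∀ r : ℂ, M.wt r

/-- The graded dual `W' = ∐ r, (W_[r])*`: the functionals which are nonzero on only finitely
many weight spaces. -/
def gradedDual : Submodule ℂ (Module.Dual ℂ W) where
  carrier := {f | {r : ℂ | ∃ w ∈ M.wt r, f w ≠ 0}.Finite}
  zero_mem' := by simp
  add_mem' := by
    intro f g hf hg
    refine (hf.union hg).subset ?_
    rintro r ⟨w, hw, hne⟩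
    by_cases h : f w = 0
    · exact Or.inr ⟨w, hw, by simpa [h] using hne⟩
    · exact Or.inl ⟨w, hw, h⟩
  smul_mem' := by
    intro c f hf
    refine hf.subset ?_
    rintro r ⟨w, hw, hne⟩
    exact ⟨w, hw, fun h => hne (by simp [h])⟩

/-- The pairing of an element of the graded dual with the algebraic completion. -/
def pairing (w' : M.gradedDual) : M.Completion →ₗ[ℂ] ℂ :=
  ∑ r ∈ Set.Finite.toFinset (s := {r : ℂ | ∃ w ∈ M.wt r, w'.1 w ≠ 0}) w'.2,
    w'.1 ∘ₗ (M.wt r).subtype ∘ₗ LinearMap.proj r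

/-- The element of the algebraic completion obtained from the formal series
`∑ s_{n,k} x^(-n-1) (log x)^k` by putting `log x = l`. -/
def evalAt (s : ℂ → ℕ → W) (l : ℂ) : M.Completion :=
  fun r => evalLog (fun n k => M.proj r (s n k)) l

/-- The `p`-th analytic branch `Y^p(v, z)w`. -/
def evalY (p : ℤ) (v : V) (z : ℂ) (w : W) : M.Completion :=
  M.evalAt (fun n k => M.Y n k v w) (logBranch p z)

/-- The term `Y(u₁, z₁) π_{s₁} Y(u₂, z₂) π_{s₂} ⋯ Y(u_m, z_m) π_{s_m} x` of an iterated product,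
for `x` in the algebraic completion. -/
def nested : (m : ℕ) → (Fin m → V) → (Fin m → ℂ) → (Fin m → ℂ) → M.Completion → M.Completion
  | 0, _, _, _, x => x
  | m + 1, u, z, s, x =>
      M.evalY 0 (u 0) (z 0) ((nested m (Fin.tail u) (Fin.tail z) (Fin.tail s) x (s 0) : M.wt _) : W)

/-! ### Twisted modules -/

/-- The branch `∑ a_{ijkl} z₁^{m_i} z₂^{n_j} (log z₁)^k (log z₂)^l (z₁ - z₂)^{-t}` for which the
powers and logarithms of `z₁`, `z₂` are computed with `l_p`. -/
def correlation (N : ℕ) (a : ℕ → ℕ → ℕ → ℕ → ℂ) (m n : ℕ → ℂ) (t : ℕ) (p : ℤ) (z₁ z₂ : ℂ) : ℂ :=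
  ∑ i ∈ Finset.range (N + 1), ∑ j ∈ Finset.range (N + 1),
    ∑ k ∈ Finset.range (N + 1), ∑ l ∈ Finset.range (N + 1),
      a i j k l * Complex.exp (m i * logBranch p z₁) * Complex.exp (n j * logBranch p z₂) *
        logBranch p z₁ ^ k * logBranch p z₂ ^ l * ((z₁ - z₂) ^ t)⁻¹

/-- Generalized `g`-twisted modules without a `g`-action. -/
structure IsGeneralizedTwisted (g : V ≃ₗ[ℂ] V) : Prop where
  /-- `Y(v, x)w` involves only finitely many powers of `log x`. -/
  log_bounded : ∀ (v : V) (w : W), ∃ K : ℕ, ∀ (n : ℂ) (k : ℕ), K < k → M.Y n k v w = 0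
  equivariance : ∀ (p : ℤ) (z : ℂ), z ≠ 0 → ∀ (v : V) (w : W),
    M.evalY (p + 1) (g v) z w = M.evalY p v z w
  identity : ∀ (n : ℂ) (k : ℕ) (w : W), M.Y n k 𝒱.vac w = if n = -1 ∧ k = 0 then w else 0
  duality : ∀ (u v : V) (w : W) (w' : M.gradedDual),
    ∃ (N : ℕ) (a : ℕ → ℕ → ℕ → ℕ → ℂ) (m n : ℕ → ℂ) (t : ℕ), ∀ (p : ℤ) (z₁ z₂ : ℂ),
      (‖z₂‖ < ‖z₁‖ → 0 < ‖z₂‖ →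
        HasSum (fun r : ℂ => M.pairing w' (M.evalY p u z₁ (M.evalY p v z₂ w r : W)))
          (correlation N a m n t p z₁ z₂)) ∧
      (‖z₁‖ < ‖z₂‖ → 0 < ‖z₁‖ →
        HasSum (fun r : ℂ => M.pairing w' (M.evalY p v z₂ (M.evalY p u z₁ w r : W)))
          (correlation N a m n t p z₁ z₂)) ∧
      (‖z₁ - z₂‖ < ‖z₂‖ → 0 < ‖z₁ - z₂‖ →
        Summable (fun r : ℤ => M.pairing w' (M.evalY p (𝒱.evalY u (z₁ - z₂) v r) z₂ w)) ∧
        (|argPos z₁ - argPos z₂| < Real.pi / 2 →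
          HasSum (fun r : ℤ => M.pairing w' (M.evalY p (𝒱.evalY u (z₁ - z₂) v r) z₂ w))
            (correlation N a m n t p z₁ z₂)))
  L0_grading : ∀ (r : ℂ) (w : W), w ∈ M.wt r →
    ∃ K : ℕ, ((M.L 0 - r • LinearMap.id : Module.End ℂ W) ^ K) w = 0
  L_neg_one_derivative : ∀ (n : ℂ) (k : ℕ) (v : V) (w : W),
    M.Y n k (𝒱.L (-1) v) w = (-n) • M.Y (n - 1) k v w + ((k : ℂ) + 1) • M.Y (n - 1) (k + 1) v w

/-- Lower-bounded with finite-dimensional weight spaces. -/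
def IsGradingRestricted : Prop :=
  (∀ r : ℂ, ∃ B : ℝ, ∀ l : ℝ, l < B → M.wt (r + l) = ⊥) ∧
    ∀ r : ℂ, FiniteDimensional ℂ (M.wt r)

/-- The structure of a `g`-twisted module with a `G`-action: `W` is a left `G`-module; the action
of the element `g` has generalized eigenspaces refining the weight grading, with the
`g`-weights in `ℂ/ℤ`, and is compatible with the vertex operator map.  The actions of the other
elements of `G` have no relation to the vertex operator map; it is only required that the dual
action preserves the graded dual, so that `G` acts on the contragredient. -/
structure GAction (G : Subgroup (V ≃ₗ[ℂ] V)) (g : G) where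
  ρ : Representation ℂ G W
  dual_preserved : ∀ (h : G) (f : Module.Dual ℂ W), f ∈ M.gradedDual → f ∘ₗ ρ h ∈ M.gradedDual
  gwt : ℂ → AddCircle (1 : ℂ) → Submodule ℂ W
  internal : letI := Classical.decEq (ℂ × AddCircle (1 : ℂ))
    DirectSum.IsInternal (fun q : ℂ × AddCircle (1 : ℂ) => gwt q.1 q.2)
  iSup_gwt : ∀ r : ℂ, ⨆ α, gwt r α = M.wt r
  g_grading : ∃ Λ : ℕ, 0 < Λ ∧ ∀ (α : ℂ) (w : W), w ∈ ⨆ r, gwt r (α : AddCircle (1 : ℂ)) →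
    ((ρ g - Complex.exp (2 * Real.pi * Complex.I * α) • LinearMap.id : Module.End ℂ W) ^ Λ) w = 0
  compatible : ∀ (n : ℂ) (k : ℕ) (v : V) (w : W),
    ρ g (M.Y n k v w) = M.Y n k ((g : V ≃ₗ[ℂ] V) v) (ρ g w)

/-- Irreducibility: nonzero, and no proper nonzero subspace is stable under all `Y_{n,k}(v)`. -/
def IsIrreducible : Prop :=
  Nontrivial W ∧ ∀ U : Submodule ℂ W,
    (∀ (n : ℂ) (k : ℕ) (v : V), ∀ w ∈ U, M.Y n k v w ∈ U) → U = ⊥ ∨ U = ⊤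

/-- Module maps. -/
def IsModuleMap {W₂ : Type u₂} [AddCommGroup W₂] [Module ℂ W₂] (M₂ : TwData 𝒱 W₂)
    (f : W →ₗ[ℂ] W₂) : Prop :=
  (∀ (n : ℂ) (k : ℕ) (v : V) (w : W), f (M.Y n k v w) = M₂.Y n k v (f w)) ∧
    ∀ (r : ℂ), ∀ w ∈ M.wt r, f w ∈ M₂.wt r

/-- Equivalence of twisted modules. -/
def Equivalent {W₂ : Type u₂} [AddCommGroup W₂] [Module ℂ W₂] (M₂ : TwData 𝒱 W₂) : Prop :=
  ∃ e : W ≃ₗ[ℂ] W₂, M.IsModuleMap M₂ e.toLinearMap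

/-! ### Contragredient modules -/

/-- The coefficient of `x^(-n-1) (log x)^k` in `Y(e^{xL(1)} (-x^{-2})^{L(0)} v, x^{-1})`.  For `v`
of weight `d` it equals `∑ m, (-1)^(k+d) / m! • Y_{2d-m-n-2,k}(L(1)^m v)`; the sum over `m` stops
where `L(1)^m v` vanishes for degree reasons. -/
def opp (n : ℂ) (k : ℕ) : V →ₗ[ℂ] W →ₗ[ℂ] W :=
  DirectSum.toModule ℂ ℤ (W →ₗ[ℂ] W)
      (fun d => ∑ m ∈ Finset.range ((d - 𝒱.minWt).toNat + 1),
        ((-1 : ℂ) ^ k * (-1 : ℂ) ^ d / (m.factorial : ℂ)) •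
          (M.Y (2 * d - m - n - 2) k ∘ₗ (𝒱.L 1 ^ m : Module.End ℂ V) ∘ₗ (𝒱.wt d).subtype)) ∘ₗ
    𝒱.decompose.toLinearMap

theorem opp_graded (d : ℤ) (r n : ℂ) (k : ℕ) (v : V) (w : W) (hv : v ∈ 𝒱.wt d)
    (hw : w ∈ M.wt r) : M.opp n k v w ∈ M.wt (r - d + n + 1) := by
  have hL : ∀ m : ℕ, ((𝒱.L 1 ^ m : Module.End ℂ V)) v ∈ 𝒱.wt (d - m) := by
    intro m
    induction m with
    | zero => simpa using hv
    | succ m ih =>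
      have h := 𝒱.graded 2 (d - m) 2 𝒱.ω _ 𝒱.ω_mem ih
      rw [pow_succ', Module.End.mul_apply]
      have e : (2 : ℤ) + (d - m) - 2 - 1 = d - ((m + 1 : ℕ) : ℤ) := by push_cast; ring
      rw [e] at h
      exact h
  have hdec : 𝒱.decompose v = DirectSum.lof ℂ ℤ (fun n => 𝒱.wt n) d ⟨v, hv⟩ := by
    rw [VOA.decompose, LinearEquiv.symm_apply_eq]
    exact (DirectSum.coeLinearMap_lof 𝒱.wt d ⟨v, hv⟩).symm
  simp only [opp, LinearMap.comp_apply, LinearEquiv.coe_coe, hdec, DirectSum.toModule_lof,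
    LinearMap.sum_apply, LinearMap.smul_apply]
  refine Submodule.sum_mem _ fun m _ => Submodule.smul_mem _ _ ?_
  have h := M.graded (d - m) r (2 * d - m - n - 2) k _ w (hL m) hw
  have e : r + ((d - (m : ℤ) : ℤ) : ℂ) - (2 * d - m - n - 2) - 1 = r - d + n + 1 := by
    push_cast; ring
  rw [e] at h
  exact h

theorem opp_preserves (n : ℂ) (k : ℕ) (v : V) (f : Module.Dual ℂ W) (hf : f ∈ M.gradedDual) :
    f ∘ₗ M.opp n k v ∈ M.gradedDual := by
  have hv : v ∈ ⨆ d, 𝒱.wt d := by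
    rw [𝒱.internal.submodule_iSup_eq_top]; trivial
  induction hv using Submodule.iSup_induction' with
  | mem d v hv =>
    have hf' : {r : ℂ | ∃ w ∈ M.wt r, f w ≠ 0}.Finite := hf
    refine (hf'.image (fun r => r + d - n - 1)).subset ?_
    rintro r ⟨w, hw, hne⟩
    exact ⟨r - d + n + 1, ⟨_, M.opp_graded d r n k v w hv hw, hne⟩, by ring⟩
  | zero =>
    rw [map_zero, LinearMap.comp_zero]
    exact Submodule.zero_mem _
  | add x y _ _ hx hy =>
    rw [map_add, LinearMap.comp_add]
    exact Submodule.add_mem _ hx hy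

/-- The weight spaces of the graded dual. -/
def dualWt (r : ℂ) : Submodule ℂ M.gradedDual where
  carrier := {f | ∀ s : ℂ, s ≠ r → ∀ w ∈ M.wt s, f.1 w = 0}
  zero_mem' := by simp
  add_mem' := by
    intro f g hf hg s hs w hw
    simp [hf s hs w hw, hg s hs w hw]
  smul_mem' := by
    intro c f hf s hs w hw
    simp [hf s hs w hw]

theorem eq_zero_of_homogeneous (f : Module.Dual ℂ W) (h : ∀ r, ∀ w ∈ M.wt r, f w = 0) :
    f = 0 := by
  ext w
  have hw : w ∈ ⨆ r, M.wt r := by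
    rw [M.internal.submodule_iSup_eq_top]; trivial
  induction hw using Submodule.iSup_induction' with
  | mem r w hw => simpa using h r w hw
  | zero => simp
  | add x y _ _ hx hy => simpa using by rw [hx, hy]; simp

theorem proj_of_mem (r : ℂ) (w : W) (hw : w ∈ M.wt r) : (M.proj r w : W) = w := by
  have hdec : M.decompose w = DirectSum.lof ℂ ℂ (fun n => M.wt n) r ⟨w, hw⟩ := by
    rw [decompose, LinearEquiv.symm_apply_eq]
    exact (DirectSum.coeLinearMap_lof M.wt r ⟨w, hw⟩).symm
  simp [proj, hdec, DirectSum.component.lof_self]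

theorem proj_of_mem_ne (r s : ℂ) (hrs : r ≠ s) (w : W) (hw : w ∈ M.wt r) :
    (M.proj s w : W) = 0 := by
  have hdec : M.decompose w = DirectSum.lof ℂ ℂ (fun n => M.wt n) r ⟨w, hw⟩ := by
    rw [decompose, LinearEquiv.symm_apply_eq]
    exact (DirectSum.coeLinearMap_lof M.wt r ⟨w, hw⟩).symm
  simp [proj, hdec, DirectSum.component.of, hrs]

theorem dualWt_internal : DirectSum.IsInternal M.dualWt := by
  rw [DirectSum.isInternal_submodule_iff_iSupIndep_and_iSup_eq_top]
  constructor
  · intro r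
    rw [Submodule.disjoint_def]
    intro f hf hf'
    have key : ∀ w ∈ M.wt r, f.1 w = 0 := by
      intro w hw
      clear hf
      induction hf' using Submodule.iSup_induction' with
      | mem s f hf =>
        by_cases hs : s = r
        · simp only [hs, ne_eq, not_true_eq_false, iSup_false, Submodule.mem_bot] at hf
          simp [hf]
        · simp only [ne_eq, hs, not_false_eq_true, iSup_pos] at hf
          exact hf r (fun h => hs h.symm) w hw
      | zero => simp
      | add x y _ _ hx hy => simp [hx, hy]
    apply Subtype.ext
    refine M.eq_zero_of_homogeneous _ fun s w hw => ?_
    by_cases hs : s = r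
    · subst hs; exact key w hw
    · exact hf s hs w hw
  · rw [eq_top_iff]
    rintro f -
    have hfin : {r : ℂ | ∃ w ∈ M.wt r, f.1 w ≠ 0}.Finite := f.2
    have hmem : ∀ r : ℂ, f.1 ∘ₗ (M.wt r).subtype ∘ₗ M.proj r ∈ M.gradedDual := by
      intro r
      refine (Set.finite_singleton r).subset ?_
      rintro s ⟨w, hw, hne⟩
      by_contra hs
      exact hne (by simp [M.proj_of_mem_ne s r hs w hw])
    have hf : f = ∑ r ∈ hfin.toFinset,
        (⟨f.1 ∘ₗ (M.wt r).subtype ∘ₗ M.proj r, hmem r⟩ : M.gradedDual) := by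
      apply Subtype.ext
      rw [← sub_eq_zero]
      refine M.eq_zero_of_homogeneous _ fun s w hw => ?_
      rw [AddSubmonoidClass.coe_finsetSum, LinearMap.sub_apply, LinearMap.sum_apply]
      simp only [LinearMap.comp_apply, Submodule.subtype_apply]
      by_cases hs : s ∈ hfin.toFinset
      · rw [Finset.sum_eq_single_of_mem s hs, M.proj_of_mem s w hw, sub_self]
        intro r _ hr
        rw [M.proj_of_mem_ne s r (Ne.symm hr) w hw, map_zero]
      · have h0 : f.1 w = 0 := by
          by_contra h
          exact hs (hfin.mem_toFinset.2 ⟨w, hw, h⟩)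
        rw [h0, Finset.sum_eq_zero, sub_self]
        intro r hr
        rw [M.proj_of_mem_ne s r (by rintro rfl; exact hs hr) w hw, map_zero]
    rw [hf]
    refine Submodule.sum_mem _ fun r _ => Submodule.mem_iSup_of_mem r ?_
    intro s hs w hw
    simp [M.proj_of_mem_ne s r hs w hw]

/-- The contragredient `W'`, with the vertex operator map given by
`⟨Y'(v, x)w', w⟩ = ⟨w', Y(e^{xL(1)} (-x^{-2})^{L(0)} v, x^{-1})w⟩`. -/
def contragredient : TwData 𝒱 M.gradedDual where
  wt := M.dualWt
  internal := M.dualWt_internal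
  Y n k :=
    LinearMap.mk₂ ℂ (fun v f => ⟨f.1 ∘ₗ M.opp n k v, M.opp_preserves n k v f.1 f.2⟩)
      (by intro x y f; apply Subtype.ext; simp [LinearMap.comp_add])
      (by intro c x f; apply Subtype.ext; simp [LinearMap.comp_smul])
      (by intro x f g; apply Subtype.ext; simp [LinearMap.add_comp])
      (by intro c x f; apply Subtype.ext; simp [LinearMap.smul_comp])
  graded := by
    intro d r n k v f hv hf s hs w hw
    refine hf (s - d + n + 1) ?_ _ (M.opp_graded d s n k v w hv hw)
    intro h
    apply hs
    rw [← h]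
    ring

end

end TwData

/-! ### Multivalued analytic functions -/

/-- The germ of `h` at the end of the path `γ` is obtained from the germ of `f` at its start by
analytic continuation along `γ`. -/
def Continuation {E : Type*} [NormedAddCommGroup E] [NormedSpace ℂ E] (f h : E → ℂ)
    (γ : C(unitInterval, E)) : Prop :=
  ∃ H : unitInterval → E → ℂ,
    (∀ t, AnalyticAt ℂ (H t) (γ t)) ∧
    H 0 =ᶠ[𝓝 (γ 0)] f ∧ H 1 =ᶠ[𝓝 (γ 1)] h ∧
    ∀ t, ∀ᶠ s in 𝓝 t, H s =ᶠ[𝓝 (γ s)] H t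

/-- The complement of the closed positive half line. -/
def slitPos : Set ℂ := {z | -z ∈ Complex.slitPlane}

/-- `M² = {(z₁, z₂) | z₁ ≠ 0, z₂ ≠ 0, z₁ ≠ z₂}`. -/
def M2 : Set (ℂ × ℂ) := {z | z.1 ≠ 0 ∧ z.2 ≠ 0 ∧ z.1 ≠ z.2}

/-- The interior of `M₀²`: `M²` cut along the positive real lines in the `z₁`-, `z₂`- and
`(z₁ - z₂)`-planes. -/
def M2Slit : Set (ℂ × ℂ) := {z | z.1 ∈ slitPos ∧ z.2 ∈ slitPos ∧ z.1 - z.2 ∈ slitPos}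

/-- `f` is the preferred single-valued branch on `M₀²` of a maximally extended multivalued
analytic function on `M²`.  The cuts are attached to the upper half planes: moving from a point of
`M²` by `(2εi, εi)` with small `ε > 0` moves each of `z₁`, `z₂`, `z₁ - z₂` upwards, so it leads
into the open cut region and stays on the side to which the point is attached. -/
structure IsPreferredBranch (f : ℂ × ℂ → ℂ) : Prop where
  analytic : AnalyticOnNhd ℂ f M2Slit
  attached : ∀ z ∈ M2, Tendsto
    (fun ε : ℝ => f (z.1 + 2 * ε * Complex.I, z.2 + ε * Complex.I)) (𝓝[>] 0) (𝓝 (f z))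
  extends_along : ∀ γ : C(unitInterval, ℂ × ℂ), γ 0 ∈ M2Slit → (∀ t, γ t ∈ M2) →
    ∃ h, Continuation f h γ

/-- `M^n = {(z₁, …, z_n) | z_i ≠ 0, z_i ≠ z_j for i ≠ j}`. -/
def Mn (n : ℕ) : Set (Fin n → ℂ) := {z | (∀ i, z i ≠ 0) ∧ ∀ i j, i ≠ j → z i ≠ z j}

/-- The region `|z₁| > ⋯ > |z_n| > 0`. -/
def orderedRegion (n : ℕ) : Set (Fin n → ℂ) :=
  {z | (∀ i, z i ≠ 0) ∧ ∀ i j, i < j → ‖z j‖ < ‖z i‖}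

/-- The part of the region `|z₁| > ⋯ > |z_n| > 0` off the cuts along the positive real lines. -/
def orderedSlit (n : ℕ) : Set (Fin n → ℂ) := {z ∈ orderedRegion n | ∀ i, z i ∈ slitPos}

/-- The punctured polydisc `Δ^×(δ, r)`; `δ i = true` means `δ_i = ∞` and `δ i = false` means
`δ_i = 0`. -/
def puncturedPolydisc {n : ℕ} (δ : Fin n → Bool) (r : Fin n → ℝ) : Set (Fin n → ℂ) :=
  {ζ | ∀ i, if δ i then r i < ‖ζ i‖ else 0 < ‖ζ i‖ ∧ ‖ζ i‖ < r i}

/-- The exponents `r_j + ℕ` (at `0`) or `r_j - ℕ` (at `∞`) for finitely many `r_j`. -/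
def exponentSet (atInfinity : Bool) (R : Finset ℂ) : Set ℂ :=
  {a | ∃ r ∈ R, ∃ m : ℕ, a = if atInfinity then r - m else r + m}

/-- All component-isolated singularities of the multivalued function on `Ω` which is obtained by
continuing `f` along paths in `Ω` that start in `base` are regular.  Here a component-isolated
singularity is given by new variables `ζ = zA - β`, with `A` invertible, and a point
`δ ∈ {0, ∞}^n` such that some punctured polydisc around `ζ = δ` is contained in `Ω`; it is regular
if every single-valued branch `h` (in the variables `ζ`, cut along the positive real lines) has
an absolutely convergent expansion in powers and logarithms of the `ζ_i`. -/
def HasRegularSingularities {n : ℕ} (Ω base : Set (Fin n → ℂ)) (f : (Fin n → ℂ) → ℂ) : Prop :=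
  ∀ (A : GL (Fin n) ℂ) (β : Fin n → ℂ) (δ : Fin n → Bool) (r : Fin n → ℝ), (∀ i, 0 < r i) →
    (∀ ζ ∈ puncturedPolydisc δ r, Matrix.vecMul (ζ + β) (A⁻¹ : GL (Fin n) ℂ).1 ∈ Ω) →
    ∃ (K : ℕ) (R : Fin n → Finset ℂ), ∀ h : (Fin n → ℂ) → ℂ,
      AnalyticOnNhd ℂ h {ζ ∈ puncturedPolydisc δ r | ∀ i, ζ i ∈ slitPos} →
      (∃ γ : C(unitInterval, Fin n → ℂ), γ 0 ∈ base ∧ (∀ t, γ t ∈ Ω) ∧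
        (Matrix.vecMul (γ 1) A.1 - β ∈ puncturedPolydisc δ r ∧
          ∀ i, (Matrix.vecMul (γ 1) A.1 - β) i ∈ slitPos) ∧
        Continuation f (fun z => h (Matrix.vecMul z A.1 - β)) γ) →
      ∃ (r' : Fin n → ℝ) (α : (Fin n → ℂ) → (Fin n → Fin (K + 1)) → ℂ), (∀ i, 0 < r' i) ∧
        (∀ a j, α a j ≠ 0 → ∀ i, a i ∈ exponentSet (δ i) (R i)) ∧
        ∀ ζ ∈ puncturedPolydisc δ r ∩ puncturedPolydisc δ r', (∀ i, ζ i ∈ slitPos) →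
          HasSum (fun q : (Fin n → ℂ) × (Fin n → Fin (K + 1)) =>
            α q.1 q.2 * ∏ i, (Complex.exp (q.1 i * logBranch 0 (ζ i)) *
              logBranch 0 (ζ i) ^ (q.2 i : ℕ))) (h ζ)

/-! ### Twisted intertwining operators -/

namespace TwData

section

variable {V : Type v} [AddCommGroup V] [Module ℂ V] {𝒱 : VOA V}
  {W₁ : Type u₁} [AddCommGroup W₁] [Module ℂ W₁]
  {W₂ : Type u₂} [AddCommGroup W₂] [Module ℂ W₂]
  {W₃ : Type u₃} [AddCommGroup W₃] [Module ℂ W₃]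
  (M₁ : TwData 𝒱 W₁) (M₂ : TwData 𝒱 W₂) (M₃ : TwData 𝒱 W₃)

/-- The element `𝒴(w₁, z)w₂` of the algebraic completion (preferred branch). -/
def evalOp (𝒴 : LogOperator W₁ W₂ W₃) (w₁ : W₁) (z : ℂ) (w₂ : W₂) : M₃.Completion :=
  M₃.evalAt (fun n k => 𝒴 n k w₁ w₂) (logBranch 0 z)

/-- The sum of the products of several twisted vertex operators and one intertwining operator. -/
def productSum (𝒴 : LogOperator W₁ W₂ W₃) (m : ℕ) (u : Fin m → V) (w₁ : W₁) (w₂ : W₂)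
    (w' : M₃.gradedDual) (z : Fin (m + 1) → ℂ) : ℂ :=
  ∑' s : Fin m → ℂ, M₃.pairing w'
    (M₃.nested m u (Fin.init z) s (M₃.evalOp 𝒴 w₁ (z (Fin.last m)) w₂))

/-- Twisted intertwining operators of type `W₃` over `W₁ W₂`.  As for twisted modules, `graded` is
what makes `𝒴(w₁, z)w₂` an element of the algebraic completion of `W₃`. -/
structure IsTwistedIntertwining (𝒴 : LogOperator W₁ W₂ W₃) : Prop where
  log_bounded : ∀ (w₁ : W₁) (w₂ : W₂), ∃ K : ℕ, ∀ (n : ℂ) (k : ℕ), K < k → 𝒴 n k w₁ w₂ = 0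
  graded : ∀ (r₁ r₂ n : ℂ) (k : ℕ), ∀ w₁ ∈ M₁.wt r₁, ∀ w₂ ∈ M₂.wt r₂,
    𝒴 n k w₁ w₂ ∈ M₃.wt (r₁ + r₂ - n - 1)
  lower_truncation : ∀ (w₁ : W₁) (w₂ : W₂) (n : ℂ) (k : ℕ),
    ∃ B : ℕ, ∀ l : ℕ, B ≤ l → 𝒴 (n + l) k w₁ w₂ = 0
  duality : ∀ (u : V) (w₁ : W₁) (w₂ : W₂) (w' : M₃.gradedDual),
    ∃ f : ℂ × ℂ → ℂ, IsPreferredBranch f ∧ ∀ z₁ z₂ : ℂ,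
      (‖z₂‖ < ‖z₁‖ → 0 < ‖z₂‖ →
        Summable (fun r : ℂ =>
          M₃.pairing w' (M₃.evalY 0 u z₁ (M₃.evalOp 𝒴 w₁ z₂ w₂ r : W₃))) ∧
        (|argPos (z₁ - z₂) - argPos z₁| < Real.pi / 2 →
          HasSum (fun r : ℂ =>
            M₃.pairing w' (M₃.evalY 0 u z₁ (M₃.evalOp 𝒴 w₁ z₂ w₂ r : W₃))) (f (z₁, z₂)))) ∧
      (‖z₁‖ < ‖z₂‖ → 0 < ‖z₁‖ →
        Summable (fun r : ℂ =>
          M₃.pairing w' (M₃.evalOp 𝒴 w₁ z₂ (M₂.evalY 0 u z₁ w₂ r : W₂))) ∧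
        (-(3 * Real.pi / 2) < argPos (z₁ - z₂) - argPos z₂ →
          argPos (z₁ - z₂) - argPos z₂ < -(Real.pi / 2) →
          HasSum (fun r : ℂ =>
            M₃.pairing w' (M₃.evalOp 𝒴 w₁ z₂ (M₂.evalY 0 u z₁ w₂ r : W₂))) (f (z₁, z₂)))) ∧
      (‖z₁ - z₂‖ < ‖z₂‖ → 0 < ‖z₁ - z₂‖ →
        Summable (fun r : ℂ =>
          M₃.pairing w' (M₃.evalOp 𝒴 (M₁.evalY 0 u (z₁ - z₂) w₁ r : W₁) z₂ w₂)) ∧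
        (|argPos z₁ - argPos z₂| < Real.pi / 2 →
          HasSum (fun r : ℂ =>
            M₃.pairing w' (M₃.evalOp 𝒴 (M₁.evalY 0 u (z₁ - z₂) w₁ r : W₁) z₂ w₂))
            (f (z₁, z₂))))
  /-- Convergence and analytic extension for products with more than one twisted vertex
  operator. -/
  products : ∀ (m : ℕ), 2 ≤ m → ∀ (u : Fin m → V) (w₁ : W₁) (w₂ : W₂) (w' : M₃.gradedDual),
    (∀ z ∈ orderedRegion (m + 1), Summable (fun s : Fin m → ℂ => M₃.pairing w'
      (M₃.nested m u (Fin.init z) s (M₃.evalOp 𝒴 w₁ (z (Fin.last m)) w₂)))) ∧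
    (∀ γ : C(unitInterval, Fin (m + 1) → ℂ), γ 0 ∈ orderedSlit (m + 1) →
      (∀ t, γ t ∈ Mn (m + 1)) →
      ∃ h, Continuation (M₃.productSum 𝒴 m u w₁ w₂ w') h γ) ∧
    HasRegularSingularities (Mn (m + 1)) (orderedSlit (m + 1)) (M₃.productSum 𝒴 m u w₁ w₂ w')
  L_neg_one_derivative : ∀ (n : ℂ) (k : ℕ) (w₁ : W₁) (w₂ : W₂),
    𝒴 n k (M₁.L (-1) w₁) w₂ = (-n) • 𝒴 (n - 1) k w₁ w₂ + ((k : ℂ) + 1) • 𝒴 (n - 1) (k + 1) w₁ w₂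

/-- The space of twisted intertwining operators of type `W₃` over `W₁ W₂`, whose dimension is the
fusion rule. (The set of intertwining operators is closed under linear combinations.) -/
def intertwiningSpace : Submodule ℂ (LogOperator W₁ W₂ W₃) :=
  Submodule.span ℂ {𝒴 | IsTwistedIntertwining M₁ M₂ M₃ 𝒴}

/-- Twisted `P(z)`-intertwining maps: the maps `w₁ ⊗ w₂ ↦ 𝒴(w₁, z)w₂` for twisted intertwining
operators `𝒴`. -/
def IsPzIntertwiningMap (z : ℂ) (I : W₁ ⊗[ℂ] W₂ →ₗ[ℂ] M₃.Completion) : Prop :=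
  ∃ 𝒴 : LogOperator W₁ W₂ W₃, IsTwistedIntertwining M₁ M₂ M₃ 𝒴 ∧
    ∀ (w₁ : W₁) (w₂ : W₂), I (w₁ ⊗ₜ[ℂ] w₂) = M₃.evalOp 𝒴 w₁ z w₂

/-- The functional `λ_{I, w'}(w₁ ⊗ w₂) = ⟨w', I(w₁ ⊗ w₂)⟩`. -/
def lam (I : W₁ ⊗[ℂ] W₂ →ₗ[ℂ] M₃.Completion) (w' : M₃.gradedDual) :
    Module.Dual ℂ (W₁ ⊗[ℂ] W₂) :=
  M₃.pairing w' ∘ₗ I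

end

end TwData

/-! ### The categories of grading-restricted twisted modules -/

/-- A bundled vector space with grading and vertex operator map. -/
structure TwMod {V : Type v} [AddCommGroup V] [Module ℂ V] (𝒱 : VOA V) where
  carrier : Type u
  [addCommGroup : AddCommGroup carrier]
  [module : Module ℂ carrier]
  data : TwData 𝒱 carrier

attribute [instance] TwMod.addCommGroup TwMod.module

/-- `noAction` stands for the category of grading-restricted `g`-twisted modules without
`g`-actions for `g ∈ G`, `withAction` for the category of grading-restricted `g`-twisted modules
with actions of `G`. -/
inductive CatKind
  | noAction
  | withAction

section

variable {V : Type v} [AddCommGroup V] [Module ℂ V] {𝒱 : VOA V}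

/-- The data `M` underlie a `g`-twisted module in the category.  (Morphisms in both
categories are the module maps, so for `withAction` only the existence of the action matters.) -/
def InCat (G : Subgroup (V ≃ₗ[ℂ] V)) (c : CatKind) (g : G) {W : Type u} [AddCommGroup W]
    [Module ℂ W] (M : TwData 𝒱 W) : Prop :=
  M.IsGeneralizedTwisted (g : V ≃ₗ[ℂ] V) ∧ M.IsGradingRestricted ∧
    match c with
    | .noAction => True
    | .withAction => Nonempty (M.GAction G g)

variable (𝒱)

/-- For each `g ∈ G` there are only finitely many inequivalent irreducible `g`-twisted modules in
the category. -/
def FinitelyManyIrreducibles (G : Subgroup (V ≃ₗ[ℂ] V)) (c : CatKind) : Prop :=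
  ∀ g : G, ∃ (N : ℕ) (X : Fin N → TwMod.{v, u} 𝒱), ∀ W : TwMod.{v, u} 𝒱,
    InCat G c g W.data → W.data.IsIrreducible → ∃ i, W.data.Equivalent (X i).data

open Classical in
/-- Every object of the category is a direct sum of irreducible objects of the category. -/
def CompletelyReducible (G : Subgroup (V ≃ₗ[ℂ] V)) (c : CatKind) : Prop :=
  ∀ (g : G) (W : TwMod.{v, u} 𝒱), InCat G c g W.data →
    ∃ (ι : Type u) (X : ι → TwMod.{v, u} 𝒱) (f : ∀ i, (X i).carrier →ₗ[ℂ] W.carrier),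
      (∀ i, InCat G c g (X i).data ∧ (X i).data.IsIrreducible ∧
        (X i).data.IsModuleMap W.data (f i)) ∧
      Function.Bijective (DirectSum.toModule ℂ ι W.carrier f)

/-- All fusion rules in the category are finite. -/
def FiniteFusionRules (G : Subgroup (V ≃ₗ[ℂ] V)) (c : CatKind) : Prop :=
  ∀ (g₁ g₂ : G) (W₁ W₂ W₃ : TwMod.{v, u} 𝒱), InCat G c g₁ W₁.data → InCat G c g₂ W₂.data →
    InCat G c (g₁ * g₂) W₃.data →
    FiniteDimensional ℂ (TwData.intertwiningSpace W₁.data W₂.data W₃.data)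

variable {𝒱}

/-- The subspace of `(W₁ ⊗ W₂)*` spanned by the `λ_{I, w'}` for all `P(z)`-products `(W₃, I)` of
the `g₁`-twisted module `W₁` and the `g₂`-twisted module `W₂` in the category. -/
def boxSpace (G : Subgroup (V ≃ₗ[ℂ] V)) (c : CatKind) (z : ℂ) (g₁ g₂ : G)
    (W₁ W₂ : TwMod.{v, u} 𝒱) :
    Submodule ℂ (Module.Dual ℂ (W₁.carrier ⊗[ℂ] W₂.carrier)) :=
  Submodule.span ℂ {f | ∃ W₃ : TwMod.{v, u} 𝒱, InCat G c (g₁ * g₂) W₃.data ∧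
    ∃ I : W₁.carrier ⊗[ℂ] W₂.carrier →ₗ[ℂ] W₃.data.Completion,
      TwData.IsPzIntertwiningMap W₁.data W₂.data W₃.data z I ∧
      ∃ w' : W₃.data.gradedDual, f = W₃.data.lam I w'}

/-- The grading and the vertex operator map of `boxSpace` are the ones induced from the
contragredients: `Y(v, x)λ_{I, w'} = λ_{I, Y'(v, x)w'}`, and `w' ↦ λ_{I, w'}` preserves weights. -/
def IsBoxStructure (G : Subgroup (V ≃ₗ[ℂ] V)) (c : CatKind) (z : ℂ) (g₁ g₂ : G)
    (W₁ W₂ : TwMod.{v, u} 𝒱) (D : TwData 𝒱 (boxSpace G c z g₁ g₂ W₁ W₂)) : Prop :=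
  ∀ (W₃ : TwMod.{v, u} 𝒱), InCat G c (g₁ * g₂) W₃.data →
    ∀ I : W₁.carrier ⊗[ℂ] W₂.carrier →ₗ[ℂ] W₃.data.Completion,
      TwData.IsPzIntertwiningMap W₁.data W₂.data W₃.data z I →
      ∀ (w' : W₃.data.gradedDual) (x : boxSpace G c z g₁ g₂ W₁ W₂), x.1 = W₃.data.lam I w' →
        (∀ (n : ℂ) (k : ℕ) (v : V),
          (D.Y n k v x).1 = W₃.data.lam I (W₃.data.contragredient.Y n k v w')) ∧
        ∀ r : ℂ, w' ∈ W₃.data.contragredient.wt r → x ∈ D.wt r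

/-- `boxSpace`, with its induced structure, is a `(g₁g₂)⁻¹`-twisted module in the category. -/
def BoxInCat (G : Subgroup (V ≃ₗ[ℂ] V)) (c : CatKind) (z : ℂ) (g₁ g₂ : G)
    (W₁ W₂ : TwMod.{v, u} 𝒱) : Prop :=
  ∃ D : TwData 𝒱 (boxSpace G c z g₁ g₂ W₁ W₂),
    IsBoxStructure G c z g₁ g₂ W₁ W₂ D ∧ InCat G c (g₁ * g₂)⁻¹ D

variable (𝒱)

/-- The assumption under which `P(z)`-tensor products are constructed. -/
structure TensorAssumption (G : Subgroup (V ≃ₗ[ℂ] V)) (c : CatKind) (z : ℂ) : Prop where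
  box_mem : ∀ (g₁ g₂ : G) (W₁ W₂ : TwMod.{v, u} 𝒱), InCat G c g₁ W₁.data →
    InCat G c g₂ W₂.data → BoxInCat G c z g₁ g₂ W₁ W₂
  contragredient_mem : ∀ (g : G) (W : TwMod.{v, u} 𝒱), InCat G c g W.data →
    InCat G c g⁻¹ W.data.contragredient
  double_contragredient : ∀ (g : G) (W : TwMod.{v, u} 𝒱), InCat G c g W.data →
    InCat G c g W.data.contragredient.contragredient ∧
      W.data.contragredient.contragredient.Equivalent W.data

end

end

noncomputable section

/-! ### Homogeneous components -/

/-! The space `boxSpace` turns out to be a finite direct sum of contragredients of irreducible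
modules. An element of the graded dual of W₃ sees finitely many weight spaces, all
finite-dimensional, hence finitely many irreducible summands of W₃ (`exists_finset_dualMap`). So
every λ_{I,w'} is a finite sum of such functionals with irreducible target (`lam_dualMap`), the
target can be taken from finitely many representatives, and the operator from a finite spanning set
of intertwining operators. The box is therefore the sum of the images of finitely many maps w' ↦
λ_{I,w'} defined on irreducible contragredients.

The crux is that relations Σ λ_{I_i,f_i} = 0 are stable under the contragredient vertex operators
(`contragredient_Y_mem_relations`). Then the induced structure is well defined, and superfluous maps
can be discarded until the sum is direct, as for sums of simple modules (`exists_finset_injective`,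
`boxInCat_of_family`).

For stability, a relation at one point holds at all points, because differentiation replaces w₁ by
L(-1)w₁ (`relations_le`). At z₂ = -1 it annihilates the iterates with Y(u, z₁ - z₂)w₁ term by term.
Duality and analytic continuation in z₁ carry the vanishing over to the products with Y(u, z₁)
(`exists_hasSum_of_mem_relations`). To extract coefficients, u is taken to be a generalized
eigenvector of g. Equivariance puts the exponents in one coset of ℤ, and an induction on the
nilpotency order shows that the combined series contains no logarithms, so uniqueness of power
series applies (`transposeY_mem_relations_of_pure`).

The remaining work shows that the contragredient of a g-twisted module is g⁻¹-twisted. Transposition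
reverses products and replaces log z by -log z. The branch intervals become half-open at the other
end, which is repaired by a limit argument on polynomials of bounded degree
(`DualAt.hasSum_of_im_mem`). For iterates, conjugation by e^{xL(1)} matches the substitution x ↦
-x/(1+x) (`iterCoeff_contragredient`, `IsAsymp.euler`). The construction is an involution because
e^{-xL(1)}e^{xL(1)} = 1 (`contragredient_opp`). -/

theorem DirectSum.IsInternal.induction {κ A : Type*} [DecidableEq κ] [AddCommGroup A] [Module ℂ A]
    {p : κ → Submodule ℂ A} (hp : DirectSum.IsInternal p) {motive : A → Prop}
    (mem : ∀ r, ∀ w ∈ p r, motive w) (zero : motive 0)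
    (add : ∀ x y, motive x → motive y → motive (x + y)) (w : A) : motive w :=
  Submodule.iSup_induction p (motive := motive)
    (by rw [hp.submodule_iSup_eq_top]; trivial) mem zero add

namespace VOA

variable {V : Type v} [AddCommGroup V] [Module ℂ V] (𝒱 : VOA V)

theorem decompose_of_mem {d : ℤ} {v : V} (hv : v ∈ 𝒱.wt d) :
    𝒱.decompose v = DirectSum.lof ℂ ℤ (fun n => 𝒱.wt n) d ⟨v, hv⟩ := by
  rw [decompose, LinearEquiv.symm_apply_eq]
  exact (DirectSum.coeLinearMap_lof 𝒱.wt d ⟨v, hv⟩).symm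

theorem proj_of_mem {d : ℤ} {v : V} (hv : v ∈ 𝒱.wt d) : 𝒱.proj d v = v := by
  simp [proj, 𝒱.decompose_of_mem hv, DirectSum.component.lof_self]

theorem proj_of_mem_ne {d e : ℤ} (h : d ≠ e) {v : V} (hv : v ∈ 𝒱.wt d) : 𝒱.proj e v = 0 := by
  simp [proj, 𝒱.decompose_of_mem hv, DirectSum.component.of, h]

theorem proj_mem (d : ℤ) (v : V) : 𝒱.proj d v ∈ 𝒱.wt d := Subtype.prop _

theorem wt_eq_bot_of_lt {d : ℤ} (h : d < 𝒱.minWt) : 𝒱.wt d = ⊥ := 𝒱.lower_bounded.choose_spec d h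

theorem L_one_pow_mem {d : ℤ} {v : V} (hv : v ∈ 𝒱.wt d) (m : ℕ) :
    (𝒱.L 1 ^ m : Module.End ℂ V) v ∈ 𝒱.wt (d - m) := by
  induction m with
  | zero => simpa using hv
  | succ m ih =>
    have h := 𝒱.graded 2 (d - m) 2 𝒱.ω _ 𝒱.ω_mem ih
    rw [pow_succ', Module.End.mul_apply]
    have e : (2 : ℤ) + (d - m) - 2 - 1 = d - ((m + 1 : ℕ) : ℤ) := by push_cast; ring
    rwa [e] at h

theorem L_one_pow_eq_zero {d : ℤ} {v : V} (hv : v ∈ 𝒱.wt d) {m : ℕ}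
    (hm : (d - 𝒱.minWt).toNat + 1 ≤ m) : (𝒱.L 1 ^ m : Module.End ℂ V) v = 0 := by
  have h := 𝒱.L_one_pow_mem hv m
  rwa [𝒱.wt_eq_bot_of_lt (by omega), Submodule.mem_bot] at h

/-- The projections onto weight spaces intertwine `L 0` with scalars, so an eigenvector of `L 0` has
a single component. Automorphisms fix ω, hence commute with `L 0`, and this is how they are seen to
preserve weights. -/
theorem mem_wt_iff {d : ℤ} {v : V} : v ∈ 𝒱.wt d ↔ 𝒱.L 0 v = (d : ℂ) • v := by
  refine ⟨fun h => 𝒱.L0_grading d v h, fun h => ?_⟩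
  have comm : ∀ (e : ℤ) (x : V), 𝒱.proj e (𝒱.L 0 x) = (e : ℂ) • 𝒱.proj e x := by
    intro e x
    refine 𝒱.internal.induction (motive := fun x => 𝒱.proj e (𝒱.L 0 x) = (e : ℂ) • 𝒱.proj e x)
      (fun f x hx => ?_) (by simp) (fun x y hx hy => by simp [hx, hy]) x
    rw [show 𝒱.L 0 x = (f : ℂ) • x from 𝒱.L0_grading f x hx, map_smul]
    by_cases hf : f = e
    · rw [hf]
    · rw [𝒱.proj_of_mem_ne hf hx]; simp
  have hsum : v = ∑ᶠ e, 𝒱.proj e v ∧ (Function.support fun e => 𝒱.proj e v).Finite := by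
    refine 𝒱.internal.induction
      (motive := fun v => v = ∑ᶠ e, 𝒱.proj e v ∧ (Function.support fun e => 𝒱.proj e v).Finite)
      (fun f x hx => ?_) (by simp) (fun x y hx hy => ?_) v
    · constructor
      · rw [finsum_eq_single _ f (fun e he => 𝒱.proj_of_mem_ne (Ne.symm he) hx), 𝒱.proj_of_mem hx]
      · refine (Set.finite_singleton f).subset fun e he => ?_
        by_contra hne
        exact he (𝒱.proj_of_mem_ne (fun h => hne h.symm) hx)
    · constructor
      · simp only [map_add]
        rw [finsum_add_distrib hx.2 hy.2, ← hx.1, ← hy.1]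
      · simp only [map_add]
        exact (hx.2.union hy.2).subset (Function.support_add _ _)
  have hz : ∀ e, e ≠ d → 𝒱.proj e v = 0 := by
    intro e he
    have h1 := comm e v
    rw [h, map_smul, ← sub_eq_zero, ← sub_smul, smul_eq_zero, sub_eq_zero] at h1
    exact h1.resolve_left fun h2 => he (by exact_mod_cast h2.symm)
  rw [hsum.1, finsum_eq_single _ d hz]
  exact 𝒱.proj_mem d v

/-- A `finsum` with infinite support is zero by convention, so additivity of `evalY` needs this
finiteness. It holds since, for homogeneous vectors, the weight r determines n. -/
theorem finite_proj_ncoeff (u v : V) (r : ℤ) :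
    {n : ℤ | 𝒱.proj r (ncoeff (𝒱.Y u) n v) ≠ 0}.Finite := by
  refine 𝒱.internal.induction
    (motive := fun u => {n : ℤ | 𝒱.proj r (ncoeff (𝒱.Y u) n v) ≠ 0}.Finite)
    (fun a u hu => ?_) (by simp) (fun x y hx hy => ?_) u
  · refine 𝒱.internal.induction
      (motive := fun v => {n : ℤ | 𝒱.proj r (ncoeff (𝒱.Y u) n v) ≠ 0}.Finite)
      (fun b v hv => ?_) (by simp) (fun x y hx hy => ?_) v
    · refine (Set.finite_singleton (a + b - r - 1)).subset fun n hn => ?_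
      by_contra h
      refine hn (𝒱.proj_of_mem_ne ?_ (𝒱.graded a b n u v hu hv))
      rintro rfl
      exact h (by simp only [Set.mem_singleton_iff]; ring)
    · refine (hx.union hy).subset fun n hn => ?_
      by_contra h
      simp only [Set.mem_union, Set.mem_ofPred_eq, not_or, not_not] at h
      exact hn (by simp [h.1, h.2])
  · refine (hx.union hy).subset fun n hn => ?_
    by_contra h
    simp only [Set.mem_union, Set.mem_ofPred_eq, not_or, not_not] at h
    exact hn (by simp [h.1, h.2])

theorem evalY_add_left (u u' : V) (z : ℂ) (v : V) (r : ℤ) :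
    𝒱.evalY (u + u') z v r = 𝒱.evalY u z v r + 𝒱.evalY u' z v r := by
  rw [evalY, evalY, evalY, ← finsum_add_distrib]
  · simp
  · exact (𝒱.finite_proj_ncoeff u v r).subset fun n hn h => hn (by simp [h])
  · exact (𝒱.finite_proj_ncoeff u' v r).subset fun n hn h => hn (by simp [h])

theorem evalY_add_right (u : V) (z : ℂ) (v v' : V) (r : ℤ) :
    𝒱.evalY u z (v + v') r = 𝒱.evalY u z v r + 𝒱.evalY u z v' r := by
  rw [evalY, evalY, evalY, ← finsum_add_distrib]
  · simp
  · exact (𝒱.finite_proj_ncoeff u v r).subset fun n hn h => hn (by simp [h])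
  · exact (𝒱.finite_proj_ncoeff u v' r).subset fun n hn h => hn (by simp [h])

theorem evalY_of_mem {a b : ℤ} {u v : V} (hu : u ∈ 𝒱.wt a) (hv : v ∈ 𝒱.wt b) (z : ℂ) (r : ℤ) :
    𝒱.evalY u z v r = z ^ (r - a - b) • ncoeff (𝒱.Y u) (a + b - r - 1) v := by
  rw [evalY, finsum_eq_single _ (a + b - r - 1)]
  · have h := 𝒱.graded a b (a + b - r - 1) u v hu hv
    rw [show a + b - (a + b - r - 1) - 1 = r by ring] at h
    rw [𝒱.proj_of_mem h]
    congr 2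
    ring
  · intro n hn
    rw [𝒱.proj_of_mem_ne (fun h => hn (by omega)) (𝒱.graded a b n u v hu hv), smul_zero]

end VOA

/-! ### Evaluation of logarithmic series -/

section EvalLog

variable {A B : Type*} [AddCommGroup A]

/-- Only finitely many coefficients are nonzero. -/
def FinSupp (a : ℂ → ℕ → A) : Prop := {q : ℂ × ℕ | a q.1 q.2 ≠ 0}.Finite

theorem FinSupp.zero : FinSupp (fun _ _ => 0 : ℂ → ℕ → A) := by simp [FinSupp]

theorem FinSupp.add {a b : ℂ → ℕ → A} (ha : FinSupp a) (hb : FinSupp b) :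
    FinSupp (fun n k => a n k + b n k) := by
  refine (Set.Finite.union ha hb).subset fun q hq => ?_
  by_contra h
  simp only [Set.mem_union, Set.mem_ofPred_eq, not_or, not_not] at h
  exact hq (by simp [h.1, h.2])

variable [Module ℂ A] [AddCommGroup B] [Module ℂ B]

theorem FinSupp.map {a : ℂ → ℕ → A} (ha : FinSupp a) (f : A →ₗ[ℂ] B) :
    FinSupp (fun n k => f (a n k)) :=
  Set.Finite.subset ha fun q hq h => hq (by simp [h])

theorem evalLog_eq_sum {a : ℂ → ℕ → A} {F : Finset (ℂ × ℕ)} (h : ∀ n k, (n, k) ∉ F → a n k = 0)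
    (l : ℂ) : evalLog a l = ∑ q ∈ F, (Complex.exp ((-q.1 - 1) * l) * l ^ q.2) • a q.1 q.2 := by
  refine finsum_eq_sum_of_support_subset _ fun q hq => ?_
  by_contra hF
  exact hq (by simp [h q.1 q.2 hF])

theorem evalLog_homog {a : ℂ → ℕ → A} {c : ℂ} {K : ℕ} (h : ∀ n k, a n k ≠ 0 → n = c ∧ k < K)
    (l : ℂ) : evalLog a l =
      ∑ k ∈ Finset.range K, (Complex.exp ((-c - 1) * l) * l ^ k) • a c k := by
  rw [evalLog_eq_sum (F := {c} ×ˢ Finset.range K), Finset.sum_product, Finset.sum_singleton]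
  intro n k hnk
  by_contra h0
  obtain ⟨rfl, hk⟩ := h n k h0
  exact hnk (by simpa using hk)

theorem evalLog_zero (l : ℂ) : evalLog (fun _ _ => 0 : ℂ → ℕ → A) l = 0 := by simp [evalLog]

theorem evalLog_add {a b : ℂ → ℕ → A} (ha : FinSupp a) (hb : FinSupp b) (l : ℂ) :
    evalLog (fun n k => a n k + b n k) l = evalLog a l + evalLog b l := by
  simp only [evalLog, smul_add]
  exact finsum_add_distrib (Set.Finite.subset ha fun q hq h => hq (by simp [h]))
    (Set.Finite.subset hb fun q hq h => hq (by simp [h]))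

theorem FinSupp.map_evalLog {a : ℂ → ℕ → A} (ha : FinSupp a) (f : A →ₗ[ℂ] B) (l : ℂ) :
    f (evalLog a l) = evalLog (fun n k => f (a n k)) l := by
  have h : ∀ n k, (n, k) ∉ ha.toFinset → a n k = 0 := fun n k h => by
    simpa using mt (Set.Finite.mem_toFinset ha (a := (n, k))).2 h
  rw [evalLog_eq_sum h, evalLog_eq_sum (F := ha.toFinset) fun n k hk => by rw [h n k hk, map_zero]]
  simp [map_sum]

end EvalLog

/-! ### Evaluation of series in the algebraic completion. -/

namespace TwData

section

variable {V : Type v} [AddCommGroup V] [Module ℂ V] {𝒱 : VOA V}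
  {W : Type u} [AddCommGroup W] [Module ℂ W] (M : TwData 𝒱 W)

theorem proj_ne {r s : ℂ} (h : r ≠ s) {w : W} (hw : w ∈ M.wt r) : M.proj s w = 0 :=
  Subtype.ext (M.proj_of_mem_ne r s h w hw)

theorem dual_proj {s : ℂ} {f : M.gradedDual} (hf : f ∈ M.dualWt s) (w : W) :
    f.1 (M.proj s w) = f.1 w := by
  refine M.internal.induction (motive := fun w => f.1 (M.proj s w) = f.1 w) (fun r w hw => ?_)
    (by simp) (fun x y hx hy => by simp [hx, hy]) w
  by_cases h : r = s
  · subst h; rw [M.proj_of_mem r w hw]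
  · rw [M.proj_of_mem_ne r s h w hw, hf r h w hw, map_zero]

theorem pairing_eq_sum {f : M.gradedDual} {F : Finset ℂ} (h : ∀ r ∉ F, ∀ w ∈ M.wt r, f.1 w = 0)
    (x : M.Completion) : M.pairing f x = ∑ r ∈ F, f.1 (x r) := by
  rw [pairing, LinearMap.sum_apply]
  refine Finset.sum_subset_zero_on_sdiff (fun r hr => ?_) (fun r hr => ?_) (fun r _ => rfl)
  · by_contra hF
    obtain ⟨w, hw, hne⟩ := (Set.Finite.mem_toFinset _).1 hr
    exact hne (h r hF w hw)
  · by_contra hne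
    exact (Finset.mem_sdiff.1 hr).2 ((Set.Finite.mem_toFinset _).2 ⟨x r, (x r).2, hne⟩)

theorem pairing_of_mem {s : ℂ} {f : M.gradedDual} (hf : f ∈ M.dualWt s) (x : M.Completion) :
    M.pairing f x = f.1 (x s) := by
  rw [M.pairing_eq_sum (F := {s}) fun r hr => hf r (by simpa using hr), Finset.sum_singleton]

theorem exists_finset_dual (f : M.gradedDual) :
    ∃ F : Finset ℂ, ∀ r ∉ F, ∀ w ∈ M.wt r, f.1 w = 0 := by
  have h : {r : ℂ | ∃ w ∈ M.wt r, f.1 w ≠ 0}.Finite := f.2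
  refine ⟨h.toFinset, fun r hr w hw => ?_⟩
  by_contra hne
  exact hr (h.mem_toFinset.2 ⟨w, hw, hne⟩)

theorem pairing_add (f g : M.gradedDual) (x : M.Completion) :
    M.pairing (f + g) x = M.pairing f x + M.pairing g x := by
  obtain ⟨F, hF⟩ := M.exists_finset_dual f
  obtain ⟨F', hF'⟩ := M.exists_finset_dual g
  have h : ∀ r ∉ F ∪ F', r ∉ F ∧ r ∉ F' := fun r hr => by simpa [not_or] using hr
  rw [M.pairing_eq_sum fun r hr => hF r (h r hr).1, M.pairing_eq_sum fun r hr => hF' r (h r hr).2,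
    M.pairing_eq_sum (f := f + g) fun r hr w hw => ?_, ← Finset.sum_add_distrib]
  · rfl
  · simp [hF r (h r hr).1 w hw, hF' r (h r hr).2 w hw]

theorem pairing_smul (c : ℂ) (f : M.gradedDual) (x : M.Completion) :
    M.pairing (c • f) x = c * M.pairing f x := by
  obtain ⟨F, hF⟩ := M.exists_finset_dual f
  rw [M.pairing_eq_sum hF, M.pairing_eq_sum (f := c • f)
    fun r hr w hw => by simp [hF r hr w hw], Finset.mul_sum]
  rfl

/-- The pairing as a linear map in its first argument. -/
def pairingLeft (x : M.Completion) : M.gradedDual →ₗ[ℂ] ℂ where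
  toFun f := M.pairing f x
  map_add' f g := M.pairing_add f g x
  map_smul' c f := M.pairing_smul c f x

theorem pairingLeft_apply (x : M.Completion) (f : M.gradedDual) :
    M.pairingLeft x f = M.pairing f x := rfl

/-- Every homogeneous component of the series has finitely many nonzero coefficients. -/
def LocFin (s : ℂ → ℕ → W) : Prop := ∀ r, FinSupp (fun n k => M.proj r (s n k))

variable {M}

theorem LocFin.zero : M.LocFin (fun _ _ => 0) := fun r => by simpa using FinSupp.zero

theorem LocFin.add {s t : ℂ → ℕ → W} (hs : M.LocFin s) (ht : M.LocFin t) :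
    M.LocFin (fun n k => s n k + t n k) := fun r => by simpa using (hs r).add (ht r)

/-- A component of weight r forces n = c - r, so only the power of the logarithm is left to vary,
and it is bounded. -/
theorem locFin_of_homog {s : ℂ → ℕ → W} {c : ℂ} {K : ℕ} (hc : ∀ n k, s n k ∈ M.wt (c - n))
    (hK : ∀ n k, K ≤ k → s n k = 0) : M.LocFin s := by
  intro r
  refine (({c - r} : Finset ℂ) ×ˢ Finset.range K).finite_toSet.subset ?_
  rintro ⟨n, k⟩ h
  simp only [Finset.coe_product, Finset.coe_singleton, Set.mem_prod, Set.mem_singleton_iff,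
    Finset.coe_range, Set.mem_Iio]
  constructor
  · by_contra hn
    exact h (M.proj_ne (fun e => hn (by rw [← e]; ring)) (hc n k))
  · by_contra hk
    exact h (by simp [hK n k (not_lt.1 hk)])

theorem evalAt_zero (l : ℂ) : M.evalAt (fun _ _ => 0) l = 0 := by
  funext r; simp [evalAt, evalLog_zero]

theorem evalAt_add {s t : ℂ → ℕ → W} (hs : M.LocFin s) (ht : M.LocFin t) (l : ℂ) :
    M.evalAt (fun n k => s n k + t n k) l = M.evalAt s l + M.evalAt t l := by
  funext r
  simp only [evalAt, map_add, Pi.add_apply]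
  exact evalLog_add (hs r) (ht r) l

theorem evalAt_homog {s : ℂ → ℕ → W} {c : ℂ} {K : ℕ} (hc : ∀ n k, s n k ∈ M.wt (c - n))
    (hK : ∀ n k, K ≤ k → s n k = 0) (l r : ℂ) :
    (M.evalAt s l r : W) =
      ∑ k ∈ Finset.range K, (Complex.exp ((r - c - 1) * l) * l ^ k) • s (c - r) k := by
  rw [evalAt, evalLog_homog (c := c - r) (K := K)]
  · rw [AddSubmonoidClass.coe_finsetSum]
    refine Finset.sum_congr rfl fun k _ => ?_
    have h := hc (c - r) k
    rw [sub_sub_cancel] at h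
    rw [Submodule.coe_smul, M.proj_of_mem r _ h]
    congr 4
    ring
  · intro n k h
    constructor
    · by_contra hn
      exact h (M.proj_ne (fun e => hn (by rw [← e]; ring)) (hc n k))
    · by_contra hk
      exact h (by simp [hK n k (not_lt.1 hk)])

theorem LocFin.dual {s : ℂ → ℕ → W} (hs : M.LocFin s) (f : M.gradedDual) :
    FinSupp (fun n k => f.1 (s n k)) := by
  refine M.dualWt_internal.induction (motive := fun f => FinSupp (fun n k => f.1 (s n k)))
    (fun r f hf => ?_) (by simpa using FinSupp.zero) (fun x y hx hy => by simpa using hx.add hy) f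
  rw [show (fun n k => f.1 (s n k)) = fun n k => f.1 (M.proj r (s n k)) from
    funext fun n => funext fun k => (M.dual_proj hf _).symm]
  exact (hs r).map (f.1 ∘ₗ (M.wt r).subtype)

theorem LocFin.pairing_evalAt {s : ℂ → ℕ → W} (hs : M.LocFin s) (f : M.gradedDual) (l : ℂ) :
    M.pairing f (M.evalAt s l) = evalLog (fun n k => f.1 (s n k)) l := by
  refine M.dualWt_internal.induction
    (motive := fun f => M.pairing f (M.evalAt s l) = evalLog (fun n k => f.1 (s n k)) l)
    (fun r f hf => ?_) ?_ (fun x y hx hy => ?_) f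
  · rw [M.pairing_of_mem hf]
    rw [show (fun n k => f.1 (s n k)) = fun n k => f.1 (M.proj r (s n k)) from
      funext fun n => funext fun k => (M.dual_proj hf _).symm]
    exact (hs r).map_evalLog (f.1 ∘ₗ (M.wt r).subtype) l
  · rw [← pairingLeft_apply, map_zero]
    exact (evalLog_zero l).symm
  · rw [M.pairing_add, hx, hy, ← evalLog_add (hs.dual x) (hs.dual y)]
    rfl

variable (M)

/-- `Y(v, x)w` at `log x = l`. -/
def ev (l : ℂ) (v : V) (w : W) : M.Completion := M.evalAt (fun n k => M.Y n k v w) l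

theorem evalY_eq_ev (p : ℤ) (v : V) (z : ℂ) (w : W) :
    M.evalY p v z w = M.ev (logBranch p z) v w := rfl

/-- `Y(v, x)w` involves only finitely many powers of `log x`. -/
def LogBounded : Prop := ∀ (v : V) (w : W), ∃ K : ℕ, ∀ (n : ℂ) (k : ℕ), K < k → M.Y n k v w = 0

variable {M}

/-- This guarantees that the `finsum` in `evalLog` is a genuine finite sum, on which the bilinearity
of `ev` and the formulas for its matrix coefficients rest. -/
theorem LogBounded.locFin (h : M.LogBounded) (v : V) (w : W) :
    M.LocFin (fun n k => M.Y n k v w) := by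
  refine 𝒱.internal.induction (motive := fun v => M.LocFin (fun n k => M.Y n k v w))
    (fun d v hv => ?_) (by simpa using LocFin.zero) (fun x y hx hy => by simpa using hx.add hy) v
  refine M.internal.induction (motive := fun w => M.LocFin (fun n k => M.Y n k v w))
    (fun r w hw => ?_) (by simpa using LocFin.zero) (fun x y hx hy => by simpa using hx.add hy) w
  obtain ⟨K, hK⟩ := h v w
  refine locFin_of_homog (c := r + d - 1) (K := K + 1) (fun n k => ?_) fun n k hk => hK n k hk
  convert M.graded d r n k v w hv hw using 2
  ring

theorem LogBounded.ev_add_left (h : M.LogBounded) (l : ℂ) (v v' : V) (w : W) :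
    M.ev l (v + v') w = M.ev l v w + M.ev l v' w := by
  simp only [ev, map_add, LinearMap.add_apply]
  exact evalAt_add (h.locFin v w) (h.locFin v' w) l

theorem LogBounded.ev_add_right (h : M.LogBounded) (l : ℂ) (v : V) (w w' : W) :
    M.ev l v (w + w') = M.ev l v w + M.ev l v w' := by
  simp only [ev, map_add]
  exact evalAt_add (h.locFin v w) (h.locFin v w') l

theorem ev_zero_left (l : ℂ) (w : W) : M.ev l 0 w = 0 := by
  simp only [ev, map_zero, LinearMap.zero_apply, evalAt_zero]

theorem ev_zero_right (l : ℂ) (v : V) : M.ev l v 0 = 0 := by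
  simp only [ev, map_zero, evalAt_zero]

theorem LogBounded.ev_smul_left (h : M.LogBounded) (l c : ℂ) (v : V) (w : W) :
    M.ev l (c • v) w = c • M.ev l v w := by
  funext r
  have := (h.locFin v w r).map_evalLog (c • LinearMap.id) l
  simpa [ev, evalAt] using this.symm

theorem LogBounded.ev_smul_right (h : M.LogBounded) (l c : ℂ) (v : V) (w : W) :
    M.ev l v (c • w) = c • M.ev l v w := by
  funext r
  have := (h.locFin v w r).map_evalLog (c • LinearMap.id) l
  simpa [ev, evalAt] using this.symm

/-- `Y(v, x)w` at `log x = l`, as a bilinear map. -/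
def LogBounded.evₗ (h : M.LogBounded) (l : ℂ) : V →ₗ[ℂ] W →ₗ[ℂ] M.Completion :=
  LinearMap.mk₂ ℂ (M.ev l) (h.ev_add_left l) (h.ev_smul_left l) (h.ev_add_right l)
    (h.ev_smul_right l)

theorem ev_homog {d : ℤ} {r₀ : ℂ} {v : V} {w : W} (hv : v ∈ 𝒱.wt d) (hw : w ∈ M.wt r₀) {K : ℕ}
    (hK : ∀ n k, K ≤ k → M.Y n k v w = 0) (l r : ℂ) :
    (M.ev l v w r : W) = ∑ k ∈ Finset.range K,
      (Complex.exp ((r - r₀ - d) * l) * l ^ k) • M.Y (r₀ + d - r - 1) k v w := by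
  rw [ev, evalAt_homog (c := r₀ + d - 1) (K := K) (fun n k => ?_) hK]
  · refine Finset.sum_congr rfl fun k _ => ?_
    rw [show r - (r₀ + d - 1) - 1 = r - r₀ - d by ring, show r₀ + d - 1 - r = r₀ + d - r - 1 by ring]
  · convert M.graded d r₀ n k v w hv hw using 2
    ring

end

end TwData

/-! ### Branches of the logarithm -/

theorem argPos_nonneg (z : ℂ) : 0 ≤ argPos z := by
  unfold argPos
  split_ifs with h
  · linarith [Complex.neg_pi_lt_arg z, Real.pi_pos]
  · exact not_lt.1 h

theorem argPos_lt (z : ℂ) : argPos z < 2 * Real.pi := by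
  unfold argPos
  split_ifs with h
  · linarith
  · linarith [Complex.arg_le_pi z, Real.pi_pos]

theorem logBranch_eq (p : ℤ) (z : ℂ) :
    ∃ k : ℤ, logBranch p z = Complex.log z + k * (2 * Real.pi * Complex.I) := by
  unfold logBranch argPos Complex.log
  split_ifs with h
  · exact ⟨p + 1, by push_cast; ring⟩
  · exact ⟨p, by ring⟩

theorem exp_logBranch (p : ℤ) {z : ℂ} (hz : z ≠ 0) : Complex.exp (logBranch p z) = z := by
  obtain ⟨k, hk⟩ := logBranch_eq p z
  rw [hk, Complex.exp_add, Complex.exp_log hz, Complex.exp_int_mul_two_pi_mul_I, mul_one]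

theorem logBranch_im (p : ℤ) (z : ℂ) : (logBranch p z).im = argPos z + 2 * Real.pi * p := by
  simp [logBranch]

theorem logBranch_re (p : ℤ) (z : ℂ) : (logBranch p z).re = Real.log ‖z‖ := by
  simp [logBranch]

theorem logBranch_succ (p : ℤ) (z : ℂ) :
    logBranch (p + 1) z = logBranch p z + 2 * Real.pi * Complex.I := by
  simp only [logBranch]; push_cast; ring

theorem logBranch_exp {p : ℤ} {l : ℂ} (h₁ : 2 * Real.pi * p ≤ l.im)
    (h₂ : l.im < 2 * Real.pi * (p + 1)) : logBranch p (Complex.exp l) = l := by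
  have he := exp_logBranch p (Complex.exp_ne_zero l)
  obtain ⟨k, hk⟩ := Complex.exp_eq_exp_iff_exists_int.1 he
  have him := logBranch_im p (Complex.exp l)
  rw [hk] at him
  have e : (l + k * (2 * Real.pi * Complex.I)).im = l.im + k * (2 * Real.pi) := by simp
  rw [e] at him
  have hp := Real.pi_pos
  have h0 := argPos_nonneg (Complex.exp l)
  have h3 := argPos_lt (Complex.exp l)
  have hk0 : k = 0 := by
    have a1 : (k : ℝ) < 1 := by
      by_contra hc
      nlinarith [not_lt.1 hc]
    have a2 : (-1 : ℝ) < k := by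
      by_contra hc
      nlinarith [not_lt.1 hc]
    have b1 : k < 1 := by exact_mod_cast a1
    have b2 : -1 < k := by exact_mod_cast a2
    omega
  rw [hk, hk0]
  simp

/-- With p the integer part of Im l / 2π, any complex number is a value of some branch. Conditions
imposed on the branches at z thus become statements about an arbitrary logarithm l. -/
theorem exists_logBranch_eq (l : ℂ) : ∃ p : ℤ, 2 * Real.pi * p ≤ l.im ∧
    l.im < 2 * Real.pi * (p + 1) ∧ logBranch p (Complex.exp l) = l := by
  have hp : 0 < 2 * Real.pi := by positivity
  have h1 : 2 * Real.pi * (⌊l.im / (2 * Real.pi)⌋ : ℤ) ≤ l.im := by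
    have := mul_le_mul_of_nonneg_left (Int.floor_le (l.im / (2 * Real.pi))) hp.le
    rwa [mul_div_cancel₀ _ hp.ne'] at this
  have h2 : l.im < 2 * Real.pi * ((⌊l.im / (2 * Real.pi)⌋ : ℤ) + 1) := by
    have := mul_lt_mul_of_pos_left (Int.lt_floor_add_one (l.im / (2 * Real.pi))) hp
    rwa [mul_div_cancel₀ _ hp.ne'] at this
  exact ⟨_, h1, h2, logBranch_exp h1 h2⟩

/-! ### Correlation functions in logarithmic variables -/

/-- The algebra generated by the functions `exp (m l₁)`, `exp (n l₂)`, `l₁` and `l₂`. -/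
def expPoly : Subalgebra ℂ (ℂ × ℂ → ℂ) :=
  Algebra.adjoin ℂ ({f | ∃ m : ℂ, f = fun q => Complex.exp (m * q.1)} ∪
    {f | ∃ m : ℂ, f = fun q => Complex.exp (m * q.2)} ∪ {fun q => q.1, fun q => q.2})

theorem expPoly_fst (m : ℂ) : (fun q : ℂ × ℂ => Complex.exp (m * q.1)) ∈ expPoly :=
  Algebra.subset_adjoin (Or.inl (Or.inl ⟨m, rfl⟩))

theorem expPoly_snd (m : ℂ) : (fun q : ℂ × ℂ => Complex.exp (m * q.2)) ∈ expPoly :=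
  Algebra.subset_adjoin (Or.inl (Or.inr ⟨m, rfl⟩))

theorem expPoly_log_fst : (fun q : ℂ × ℂ => q.1) ∈ expPoly :=
  Algebra.subset_adjoin (Or.inr (Or.inl rfl))

theorem expPoly_log_snd : (fun q : ℂ × ℂ => q.2) ∈ expPoly :=
  Algebra.subset_adjoin (Or.inr (Or.inr rfl))

theorem expPoly_sub : (fun q : ℂ × ℂ => Complex.exp q.1 - Complex.exp q.2) ∈ expPoly := by
  have h1 := expPoly_fst 1
  have h2 := expPoly_snd 1
  simp only [one_mul] at h1 h2
  exact expPoly.sub_mem h1 h2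

theorem expPoly_neg {N : ℂ × ℂ → ℂ} (h : N ∈ expPoly) : (fun q => N (-q)) ∈ expPoly := by
  induction h using Algebra.adjoin_induction with
  | mem f hf =>
    rcases hf with (⟨m, rfl⟩ | ⟨m, rfl⟩) | (rfl | rfl)
    · simpa using expPoly_fst (-m)
    · simpa using expPoly_snd (-m)
    · exact expPoly.neg_mem expPoly_log_fst
    · exact expPoly.neg_mem expPoly_log_snd
  | algebraMap c => exact expPoly.algebraMap_mem c
  | add f g _ _ hf hg => exact expPoly.add_mem hf hg
  | mul f g _ _ hf hg => exact expPoly.mul_mem hf hg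

theorem expPoly_differentiable {N : ℂ × ℂ → ℂ} (h : N ∈ expPoly) : Differentiable ℂ N := by
  induction h using Algebra.adjoin_induction with
  | mem f hf =>
    rcases hf with (⟨m, rfl⟩ | ⟨m, rfl⟩) | (rfl | rfl) <;> fun_prop
  | algebraMap c => exact differentiable_const c
  | add f g _ _ hf hg => exact hf.add hg
  | mul f g _ _ hf hg => exact hf.mul hg

/-- An adjoined subalgebra is spanned by the monoid generated by its generators, and here products
of generators are monomials in two exponentials and two logarithms. -/
theorem expPoly_eq_sum {N : ℂ × ℂ → ℂ} (h : N ∈ expPoly) :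
    ∃ (Q : ℕ) (c m n : ℕ → ℂ) (k l : ℕ → ℕ), ∀ q : ℂ × ℂ, N q = ∑ i ∈ Finset.range Q,
      c i * Complex.exp (m i * q.1) * Complex.exp (n i * q.2) * q.1 ^ k i * q.2 ^ l i := by
  have hN : N ∈ Subalgebra.toSubmodule expPoly := h
  rw [expPoly, Algebra.adjoin_eq_span, Submodule.mem_span_set'] at hN
  obtain ⟨Q, c, g, rfl⟩ := hN
  have hg : ∀ i : Fin Q, ∃ (m n : ℂ) (k l : ℕ), (g i : ℂ × ℂ → ℂ) = fun q =>
      Complex.exp (m * q.1) * Complex.exp (n * q.2) * q.1 ^ k * q.2 ^ l := by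
    intro i
    obtain ⟨x, hx⟩ := g i
    induction hx using Submonoid.closure_induction with
    | mem f hf =>
      rcases hf with (⟨m, rfl⟩ | ⟨m, rfl⟩) | (rfl | rfl)
      · exact ⟨m, 0, 0, 0, by simp⟩
      · exact ⟨0, m, 0, 0, by simp⟩
      · exact ⟨0, 0, 1, 0, by simp⟩
      · exact ⟨0, 0, 0, 1, by simp⟩
    | one => exact ⟨0, 0, 0, 0, by funext q; simp⟩
    | mul x y _ _ hx hy =>
      obtain ⟨m, n, k, l, hx⟩ := hx
      obtain ⟨m', n', k', l', hy⟩ := hy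
      refine ⟨m + m', n + n', k + k', l + l', ?_⟩
      funext q
      simp only at hx hy
      simp only [hx, hy, Pi.mul_apply, add_mul, Complex.exp_add, pow_add]
      ring
  choose m n k l hg using hg
  refine ⟨Q, fun i => if h : i < Q then c ⟨i, h⟩ else 0, fun i => if h : i < Q then m ⟨i, h⟩ else 0,
    fun i => if h : i < Q then n ⟨i, h⟩ else 0, fun i => if h : i < Q then k ⟨i, h⟩ else 0,
    fun i => if h : i < Q then l ⟨i, h⟩ else 0, fun q => ?_⟩
  rw [Finset.sum_range, Finset.sum_apply]
  refine Finset.sum_congr rfl fun i _ => ?_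
  simp [hg i, mul_assoc]

/-- Functions of `l₁ = log z₁`, `l₂ = log z₂` of the form `N(l₁, l₂) (z₁ - z₂)^(-t)`. -/
def IsCorr (F : ℂ × ℂ → ℂ) : Prop :=
  ∃ t : ℕ, ∃ N ∈ expPoly, ∀ q : ℂ × ℂ, Complex.exp q.1 ≠ Complex.exp q.2 →
    F q = N q * ((Complex.exp q.1 - Complex.exp q.2) ^ t)⁻¹

theorem IsCorr.zero : IsCorr 0 := ⟨0, 0, expPoly.zero_mem, by simp⟩

theorem IsCorr.add {F F' : ℂ × ℂ → ℂ} (h : IsCorr F) (h' : IsCorr F') : IsCorr (F + F') := by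
  obtain ⟨t, N, hN, h⟩ := h
  obtain ⟨t', N', hN', h'⟩ := h'
  refine ⟨t + t', _, expPoly.add_mem (expPoly.mul_mem hN (expPoly.pow_mem expPoly_sub t'))
    (expPoly.mul_mem hN' (expPoly.pow_mem expPoly_sub t)), fun q hq => ?_⟩
  have := sub_ne_zero.2 hq
  simp only [Pi.add_apply, Pi.mul_apply, Pi.pow_apply, h q hq, h' q hq, pow_add]
  field_simp

theorem IsCorr.mul {F N : ℂ × ℂ → ℂ} (hN : N ∈ expPoly) (h : IsCorr F) : IsCorr (N * F) := by
  obtain ⟨t, N', hN', h⟩ := h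
  exact ⟨t, _, expPoly.mul_mem hN hN', fun q hq => by simp [h q hq, mul_assoc]⟩

theorem IsCorr.sum {ι : Type*} (s : Finset ι) {F : ι → ℂ × ℂ → ℂ} (h : ∀ i ∈ s, IsCorr (F i)) :
    IsCorr (∑ i ∈ s, F i) := by
  classical
  induction s using Finset.induction_on with
  | empty => exact IsCorr.zero
  | insert a s ha ih =>
    rw [Finset.sum_insert ha]
    exact (h a (by simp)).add (ih fun i hi => h i (by simp [hi]))

/-- In logarithmic coordinates this is the inversion zᵢ ↦ zᵢ⁻¹ used by contragredients; the
denominator is handled by (z₁⁻¹ - z₂⁻¹)⁻¹ = -z₁z₂(z₁ - z₂)⁻¹. -/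
theorem IsCorr.neg {F : ℂ × ℂ → ℂ} (h : IsCorr F) : IsCorr (fun q => F (-q)) := by
  obtain ⟨t, N, hN, h⟩ := h
  have h1 := expPoly_fst 1
  have h2 := expPoly_snd 1
  simp only [one_mul] at h1 h2
  refine ⟨t, _, expPoly.mul_mem (expPoly_neg hN) (expPoly.pow_mem (expPoly.neg_mem
    (expPoly.mul_mem h1 h2)) t), fun q hq => ?_⟩
  have hq' : Complex.exp (-q).1 ≠ Complex.exp (-q).2 := by
    simpa [Complex.exp_neg] using hq
  have e : (Complex.exp (-q).1 - Complex.exp (-q).2)⁻¹ =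
      -(Complex.exp q.1 * Complex.exp q.2) * (Complex.exp q.1 - Complex.exp q.2)⁻¹ := by
    have h3 := sub_ne_zero.2 hq
    have h4 := sub_ne_zero.2 hq.symm
    have h5 := Complex.exp_ne_zero q.1
    have h6 := Complex.exp_ne_zero q.2
    rw [Prod.fst_neg, Prod.snd_neg, Complex.exp_neg, Complex.exp_neg, inv_sub_inv h5 h6, inv_div,
      div_eq_mul_inv, ← neg_sub (Complex.exp q.1), inv_neg]
    ring
  simp only [h _ hq', ← inv_pow, e, mul_pow, Pi.mul_apply, Pi.pow_apply, Pi.neg_apply]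
  ring

/-- One function of (log z₁, log z₂) encodes all branches at once, since F does not depend on p. -/
theorem isCorr_correlation (N : ℕ) (a : ℕ → ℕ → ℕ → ℕ → ℂ) (m n : ℕ → ℂ) (t : ℕ) :
    ∃ F, IsCorr F ∧ ∀ (p : ℤ) (z₁ z₂ : ℂ), z₁ ≠ 0 → z₂ ≠ 0 →
      TwData.correlation N a m n t p z₁ z₂ = F (logBranch p z₁, logBranch p z₂) := by
  refine ⟨(fun q => (∑ i ∈ Finset.range (N + 1), ∑ j ∈ Finset.range (N + 1),
    ∑ k ∈ Finset.range (N + 1), ∑ l ∈ Finset.range (N + 1),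
      (fun q : ℂ × ℂ => a i j k l * Complex.exp (m i * q.1) * Complex.exp (n j * q.2) *
        q.1 ^ k * q.2 ^ l)) q * ((Complex.exp q.1 - Complex.exp q.2) ^ t)⁻¹),
    ⟨t, _, ?_, fun q _ => rfl⟩, fun p z₁ z₂ h₁ h₂ => ?_⟩
  · refine expPoly.sum_mem fun i _ => expPoly.sum_mem fun j _ => expPoly.sum_mem fun k _ =>
      expPoly.sum_mem fun l _ => ?_
    exact expPoly.mul_mem (expPoly.mul_mem (expPoly.mul_mem (expPoly.mul_mem
      (expPoly.algebraMap_mem (a i j k l)) (expPoly_fst _)) (expPoly_snd _))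
      (expPoly.pow_mem expPoly_log_fst k)) (expPoly.pow_mem expPoly_log_snd l)
  · simp only [TwData.correlation, Finset.sum_apply, Finset.sum_mul, exp_logBranch p h₁,
      exp_logBranch p h₂]

theorem IsCorr.exists_correlation {F : ℂ × ℂ → ℂ} (h : IsCorr F) :
    ∃ (N : ℕ) (a : ℕ → ℕ → ℕ → ℕ → ℂ) (m n : ℕ → ℂ) (t : ℕ), ∀ (p : ℤ) (z₁ z₂ : ℂ),
      z₁ ≠ 0 → z₂ ≠ 0 → z₁ ≠ z₂ →
      TwData.correlation N a m n t p z₁ z₂ = F (logBranch p z₁, logBranch p z₂) := by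
  obtain ⟨t, P, hP, h⟩ := h
  obtain ⟨Q, c, m, n, k, l, hs⟩ := expPoly_eq_sum hP
  -- `correlation` has a single bound for all four indices, so N must dominate both the number of
  -- monomials and every logarithmic degree. The coefficients are supported on j = i, one monomial
  -- for each i.
  let N := Q + ∑ i ∈ Finset.range Q, (k i + l i)
  refine ⟨N, fun i j k' l' => if i < Q then if j = i then if k' = k i then if l' = l i then c i
    else 0 else 0 else 0 else 0, m, n, t, fun p z₁ z₂ h₁ h₂ hne => ?_⟩
  rw [h _ (by simpa [exp_logBranch p h₁, exp_logBranch p h₂] using hne), hs]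
  simp only [TwData.correlation, exp_logBranch p h₁, exp_logBranch p h₂, Finset.sum_mul]
  have hsub : Finset.range Q ⊆ Finset.range (N + 1) := by
    intro i hi
    simp only [Finset.mem_range] at hi ⊢
    omega
  rw [← Finset.sum_subset hsub]
  · refine Finset.sum_congr rfl fun i hi => ?_
    have hb : k i + l i ≤ ∑ i ∈ Finset.range Q, (k i + l i) :=
      Finset.single_le_sum (f := fun i => k i + l i) (fun _ _ => Nat.zero_le _) hi
    have hiQ := Finset.mem_range.1 hi
    rw [Finset.sum_eq_single_of_mem i (Finset.mem_range.2 (by omega)) fun j _ hj => by simp [hj],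
      Finset.sum_eq_single_of_mem (k i) (Finset.mem_range.2 (by omega)) fun j _ hj => by simp [hj],
      Finset.sum_eq_single_of_mem (l i) (Finset.mem_range.2 (by omega)) fun j _ hj => by simp [hj]]
    simp [hiQ]
  · intro i _ hi
    simp [show ¬ i < Q by simpa using hi]

/-! ### Duality in logarithmic coordinates. -/

namespace TwData

section

variable {V : Type v} [AddCommGroup V] [Module ℂ V] {𝒱 : VOA V}
  {W : Type u} [AddCommGroup W] [Module ℂ W] (M : TwData 𝒱 W)

/-- The matrix coefficients of products and iterates of `Y(u, z₁)` and `Y(v, z₂)` are given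
by `F`. -/
def DualAt (u v : V) (w : W) (f : M.gradedDual) (F : ℂ × ℂ → ℂ) : Prop :=
  ∀ (p : ℤ) (z₁ z₂ : ℂ),
    (‖z₂‖ < ‖z₁‖ → 0 < ‖z₂‖ →
      HasSum (fun r : ℂ => M.pairing f (M.ev (logBranch p z₁) u (M.ev (logBranch p z₂) v w r : W)))
        (F (logBranch p z₁, logBranch p z₂))) ∧
    (‖z₁‖ < ‖z₂‖ → 0 < ‖z₁‖ →
      HasSum (fun r : ℂ => M.pairing f (M.ev (logBranch p z₂) v (M.ev (logBranch p z₁) u w r : W)))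
        (F (logBranch p z₁, logBranch p z₂))) ∧
    (‖z₁ - z₂‖ < ‖z₂‖ → 0 < ‖z₁ - z₂‖ →
      Summable (fun r : ℤ =>
        M.pairing f (M.ev (logBranch p z₂) (𝒱.evalY u (z₁ - z₂) v r) w)) ∧
      (|argPos z₁ - argPos z₂| < Real.pi / 2 →
        HasSum (fun r : ℤ => M.pairing f (M.ev (logBranch p z₂) (𝒱.evalY u (z₁ - z₂) v r) w))
          (F (logBranch p z₁, logBranch p z₂))))

/-- Duality for given vectors. -/
def Dual (u v : V) (w : W) (f : M.gradedDual) : Prop := ∃ F, IsCorr F ∧ M.DualAt u v w f F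

variable {M}

theorem IsGeneralizedTwisted.dual {g : V ≃ₗ[ℂ] V} (h : M.IsGeneralizedTwisted g) (u v : V) (w : W)
    (f : M.gradedDual) : M.Dual u v w f := by
  obtain ⟨N, a, m, n, t, h⟩ := h.duality u v w f
  obtain ⟨F, hF, hc⟩ := isCorr_correlation N a m n t
  refine ⟨F, hF, fun p z₁ z₂ => ⟨fun h1 h2 => ?_, fun h1 h2 => ?_, fun h1 h2 => ?_⟩⟩
  · rw [← hc p z₁ z₂ (norm_pos_iff.1 (h2.trans h1)) (norm_pos_iff.1 h2)]
    exact (h p z₁ z₂).1 h1 h2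
  · rw [← hc p z₁ z₂ (norm_pos_iff.1 h2) (norm_pos_iff.1 (h2.trans h1))]
    exact (h p z₁ z₂).2.1 h1 h2
  · rw [← hc p z₁ z₂ (by rintro rfl; simp at h1) (by rintro rfl; simp at h1; linarith [norm_nonneg z₁])]
    exact (h p z₁ z₂).2.2 h1 h2

theorem Dual.exists_correlation {u v : V} {w : W} {f : M.gradedDual} (h : M.Dual u v w f) :
    ∃ (N : ℕ) (a : ℕ → ℕ → ℕ → ℕ → ℂ) (m n : ℕ → ℂ) (t : ℕ), ∀ (p : ℤ) (z₁ z₂ : ℂ),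
      (‖z₂‖ < ‖z₁‖ → 0 < ‖z₂‖ →
        HasSum (fun r : ℂ => M.pairing f (M.evalY p u z₁ (M.evalY p v z₂ w r : W)))
          (correlation N a m n t p z₁ z₂)) ∧
      (‖z₁‖ < ‖z₂‖ → 0 < ‖z₁‖ →
        HasSum (fun r : ℂ => M.pairing f (M.evalY p v z₂ (M.evalY p u z₁ w r : W)))
          (correlation N a m n t p z₁ z₂)) ∧
      (‖z₁ - z₂‖ < ‖z₂‖ → 0 < ‖z₁ - z₂‖ →
        Summable (fun r : ℤ => M.pairing f (M.evalY p (𝒱.evalY u (z₁ - z₂) v r) z₂ w)) ∧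
        (|argPos z₁ - argPos z₂| < Real.pi / 2 →
          HasSum (fun r : ℤ => M.pairing f (M.evalY p (𝒱.evalY u (z₁ - z₂) v r) z₂ w))
            (correlation N a m n t p z₁ z₂))) := by
  obtain ⟨F, hF, h⟩ := h
  obtain ⟨N, a, m, n, t, hc⟩ := hF.exists_correlation
  refine ⟨N, a, m, n, t, fun p z₁ z₂ => ⟨fun h1 h2 => ?_, fun h1 h2 => ?_, fun h1 h2 => ?_⟩⟩
  · rw [hc p z₁ z₂ (norm_pos_iff.1 (h2.trans h1)) (norm_pos_iff.1 h2) (by rintro rfl; simp at h1)]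
    exact (h p z₁ z₂).1 h1 h2
  · rw [hc p z₁ z₂ (norm_pos_iff.1 h2) (norm_pos_iff.1 (h2.trans h1)) (by rintro rfl; simp at h1)]
    exact (h p z₁ z₂).2.1 h1 h2
  · rw [hc p z₁ z₂ (by rintro rfl; simp at h1) (by rintro rfl; simp at h1; linarith [norm_nonneg z₁])
      (by rintro rfl; simp at h2)]
    exact (h p z₁ z₂).2.2 h1 h2

theorem Dual.add {u v : V} {w : W} {f : M.gradedDual}
    {u₁ u₂ v₁ v₂ : V} {w₁ w₂ : W} {f₁ f₂ : M.gradedDual}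
    (h₁ : M.Dual u₁ v₁ w₁ f₁) (h₂ : M.Dual u₂ v₂ w₂ f₂)
    (hp : ∀ l l' r, M.pairing f (M.ev l u (M.ev l' v w r : W)) =
      M.pairing f₁ (M.ev l u₁ (M.ev l' v₁ w₁ r : W)) +
        M.pairing f₂ (M.ev l u₂ (M.ev l' v₂ w₂ r : W)))
    (hp' : ∀ l l' r, M.pairing f (M.ev l v (M.ev l' u w r : W)) =
      M.pairing f₁ (M.ev l v₁ (M.ev l' u₁ w₁ r : W)) +
        M.pairing f₂ (M.ev l v₂ (M.ev l' u₂ w₂ r : W)))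
    (hi : ∀ l z r, M.pairing f (M.ev l (𝒱.evalY u z v r) w) =
      M.pairing f₁ (M.ev l (𝒱.evalY u₁ z v₁ r) w₁) + M.pairing f₂ (M.ev l (𝒱.evalY u₂ z v₂ r) w₂)) :
    M.Dual u v w f := by
  obtain ⟨F, hF, h⟩ := h₁
  obtain ⟨F', hF', h'⟩ := h₂
  refine ⟨F + F', hF.add hF', fun p z₁ z₂ => ⟨fun h1 h2 => ?_, fun h1 h2 => ?_, fun h1 h2 => ?_⟩⟩
  · simp only [hp]
    exact ((h p z₁ z₂).1 h1 h2).add ((h' p z₁ z₂).1 h1 h2)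
  · simp only [hp']
    exact ((h p z₁ z₂).2.1 h1 h2).add ((h' p z₁ z₂).2.1 h1 h2)
  · simp only [hi]
    exact ⟨((h p z₁ z₂).2.2 h1 h2).1.add ((h' p z₁ z₂).2.2 h1 h2).1,
      fun h3 => (((h p z₁ z₂).2.2 h1 h2).2 h3).add (((h' p z₁ z₂).2.2 h1 h2).2 h3)⟩

theorem dual_zero {u v : V} {w : W} {f : M.gradedDual} (h : u = 0 ∨ v = 0 ∨ w = 0 ∨ f = 0) :
    M.Dual u v w f := by
  have hpz : ∀ x, M.pairing 0 x = 0 := fun x => (M.pairingLeft x).map_zero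
  have hz : ∀ z r, 𝒱.evalY 0 z v r = 0 := fun z r => by simp [VOA.evalY]
  have hz' : ∀ z r, 𝒱.evalY u z 0 r = 0 := fun z r => by simp [VOA.evalY]
  refine ⟨0, IsCorr.zero, fun p z₁ z₂ => ?_⟩
  rcases h with rfl | rfl | rfl | rfl <;>
  simp [ev_zero_left, ev_zero_right, hasSum_zero, summable_zero, hpz, hz, hz']

/-- Duality needs to be verified for homogeneous vectors only. -/
theorem LogBounded.dual_of_homogeneous (hM : M.LogBounded)
    (h : ∀ (a b : ℤ) (r s : ℂ), ∀ u ∈ 𝒱.wt a, ∀ v ∈ 𝒱.wt b, ∀ w ∈ M.wt r, ∀ f ∈ M.dualWt s,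
      M.Dual u v w f) (u v : V) (w : W) (f : M.gradedDual) : M.Dual u v w f := by
  refine 𝒱.internal.induction (motive := fun u => M.Dual u v w f) (fun a u hu => ?_)
    (dual_zero (by simp)) (fun x y hx hy => hx.add hy ?_ ?_ ?_) u
  · refine 𝒱.internal.induction (motive := fun v => M.Dual u v w f) (fun b v hv => ?_)
      (dual_zero (by simp)) (fun x y hx hy => hx.add hy ?_ ?_ ?_) v
    · refine M.internal.induction (motive := fun w => M.Dual u v w f) (fun r w hw => ?_)
        (dual_zero (by simp)) (fun x y hx hy => hx.add hy ?_ ?_ ?_) w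
      · refine M.dualWt_internal.induction (motive := fun f => M.Dual u v w f) (fun s f hf => ?_)
          (dual_zero (by simp)) (fun x y hx hy => hx.add hy ?_ ?_ ?_) f
        · exact h a b r s u hu v hv w hw f hf
        all_goals intros; rw [M.pairing_add]
      all_goals intros; simp [hM.ev_add_right]
    all_goals intros; simp [hM.ev_add_right, hM.ev_add_left, 𝒱.evalY_add_right]
  all_goals intros; simp [hM.ev_add_right, hM.ev_add_left, 𝒱.evalY_add_left]

end

end TwData

/-! ### Polynomials and translations -/

section

open Polynomial

/-- If q has degree m + 1, the coefficient of degree m in q(X + c) - q(X) is (m + 1)c times the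
leading coefficient. The difference operator thus lowers the degree by exactly one, which is how
nilpotency of g bounds the powers of the logarithm. -/
theorem Polynomial.coeff_eq_zero_of_taylor_sub {q : ℂ[X]} {c : ℂ} (hc : c ≠ 0) {j : ℕ}
    (h : ∀ k, j ≤ k → (taylor c q - q).coeff k = 0) (k : ℕ) (hk : j + 1 ≤ k) : q.coeff k = 0 := by
  by_cases hm : q.natDegree < k
  · exact coeff_eq_zero_of_natDegree_lt hm
  exfalso
  obtain ⟨m, hm'⟩ : ∃ m, q.natDegree = m + 1 := ⟨q.natDegree - 1, by omega⟩
  have h1 := h m (by omega)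
  have hd : (hasseDeriv m q).natDegree < 2 := by
    have := natDegree_hasseDeriv_le q m
    omega
  rw [coeff_sub, taylor_coeff, eval_eq_sum_range' hd, Finset.sum_range_succ, Finset.sum_range_one,
    hasseDeriv_coeff, hasseDeriv_coeff] at h1
  have h2 : (1 + m).choose m = m + 1 := by rw [add_comm]; simp
  simp only [zero_add, Nat.choose_self, Nat.cast_one, one_mul, pow_zero, mul_one, pow_one, h2,
    add_sub_cancel_left, mul_eq_zero, hc, or_false] at h1
  rcases h1 with h1 | h1
  · exact absurd h1 (Nat.cast_ne_zero.2 (Nat.succ_ne_zero m))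
  · rw [add_comm, ← hm', coeff_natDegree, leadingCoeff_eq_zero] at h1
    rw [h1] at hm'
    simp at hm'

/-- The polynomial with the given coefficients in degrees less than `K`. -/
def logPoly (K : ℕ) (c : ℕ → ℂ) : ℂ[X] := ∑ k ∈ Finset.range K, C (c k) * X ^ k

theorem logPoly_coeff {K : ℕ} {c : ℕ → ℂ} (h : ∀ k, K ≤ k → c k = 0) (k : ℕ) :
    (logPoly K c).coeff k = c k := by
  simp only [logPoly, finsetSum_coeff, coeff_C_mul_X_pow]
  by_cases hk : k < K
  · simp [hk]
  · simp [hk, h k (not_lt.1 hk)]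

theorem logPoly_eval (K : ℕ) (c : ℕ → ℂ) (l : ℂ) :
    (logPoly K c).eval l = ∑ k ∈ Finset.range K, c k * l ^ k := by
  simp [logPoly, eval_finsetSum]

theorem Polynomial.taylor_eq_of_eval {q q' : ℂ[X]} {c μ : ℂ}
    (h : ∀ l, q.eval (l + c) = μ * q'.eval l) : taylor c q = μ • q' :=
  Polynomial.funext fun l => by rw [taylor_eval, eval_smul, smul_eq_mul, ← h l]

/-- Translation preserves the leading coefficient, so a nonzero polynomial cannot be an eigenvector
with eigenvalue other than 1. -/
theorem Polynomial.eq_zero_of_taylor_eq_smul {q : ℂ[X]} {c μ : ℂ} (hμ : μ ≠ 1)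
    (h : taylor c q = μ • q) : q = 0 := by
  have h1 := congrArg leadingCoeff h
  rw [smul_eq_C_mul, leadingCoeff_mul, leadingCoeff_C, leadingCoeff_taylor] at h1
  have h2 : (μ - 1) * q.leadingCoeff = 0 := by linear_combination -h1
  exact leadingCoeff_eq_zero.1 ((mul_eq_zero.1 h2).resolve_left (sub_ne_zero.2 hμ))

end

/-! ### Automorphisms -/

namespace VOA

variable {V : Type v} [AddCommGroup V] [Module ℂ V] {𝒱 : VOA V} {g : V ≃ₗ[ℂ] V}

theorem IsAutomorphism.map_L (hg : 𝒱.IsAutomorphism g) (n : ℤ) (v : V) :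
    g (𝒱.L n v) = 𝒱.L n (g v) := by
  rw [L, hg.1, hg.2.2]

theorem IsAutomorphism.map_L_pow (hg : 𝒱.IsAutomorphism g) (n : ℤ) (m : ℕ) (v : V) :
    g ((𝒱.L n ^ m : Module.End ℂ V) v) = (𝒱.L n ^ m : Module.End ℂ V) (g v) := by
  induction m with
  | zero => rfl
  | succ m ih => rw [pow_succ', Module.End.mul_apply, hg.map_L, ih, Module.End.mul_apply]

theorem IsAutomorphism.mem_wt (hg : 𝒱.IsAutomorphism g) {d : ℤ} {v : V} (hv : v ∈ 𝒱.wt d) :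
    g v ∈ 𝒱.wt d := by
  rw [mem_wt_iff, ← hg.map_L, (𝒱.mem_wt_iff).1 hv, map_smul]

/-- `V` is spanned by homogeneous generalized eigenvectors of `g`. -/
theorem IsAutomorphism.induction (hg : 𝒱.IsAutomorphism g) {motive : V → Prop}
    (mem : ∀ (d : ℤ) (lam : ℂ) (j : ℕ), ∀ u ∈ 𝒱.wt d,
      ((g.toLinearMap - lam • LinearMap.id : Module.End ℂ V) ^ j) u = 0 → motive u)
    (zero : motive 0) (add : ∀ x y, motive x → motive y → motive (x + y)) (u : V) :
    motive u := by
  refine 𝒱.internal.induction (fun d u hu => ?_) zero add u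
  have hres : ∀ x ∈ 𝒱.wt d, g.toLinearMap x ∈ 𝒱.wt d := fun x hx => hg.mem_wt hx
  let f : Module.End ℂ (𝒱.wt d) := g.toLinearMap.restrict hres
  -- Over ℂ a finite-dimensional weight space is the sum of the generalized eigenspaces of the
  -- restriction of g.
  have := 𝒱.finite_wt d
  have key : ∀ x : 𝒱.wt d, motive x := by
    intro x
    refine Submodule.iSup_induction _ (motive := fun x : 𝒱.wt d => motive x)
      (show x ∈ ⨆ μ, f.maxGenEigenspace μ by
        rw [Module.End.iSup_maxGenEigenspace_eq_top]; trivial) (fun μ x hx => ?_) zero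
      (fun x y hx hy => add x y hx hy)
    obtain ⟨j, hj⟩ := (Module.End.mem_maxGenEigenspace _ _ _).1 hx
    refine mem d μ j x x.2 ?_
    have hpow : ∀ (j : ℕ) (x : 𝒱.wt d), (((f - μ • 1) ^ j) x : V) =
        ((g.toLinearMap - μ • LinearMap.id : Module.End ℂ V) ^ j) x := by
      intro j
      induction j with
      | zero => intro x; rfl
      | succ j ih => intro x; rw [pow_succ, Module.End.mul_apply, ih, pow_succ]; rfl
    rw [← hpow, hj, Submodule.coe_zero]
  exact key ⟨u, hu⟩

end VOA

/-! ### Consequences of equivariance -/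

namespace TwData

section

variable {V : Type v} [AddCommGroup V] [Module ℂ V] {𝒱 : VOA V}
  {W : Type u} [AddCommGroup W] [Module ℂ W] {M : TwData 𝒱 W} {g : V ≃ₗ[ℂ] V}

theorem IsGeneralizedTwisted.logBounded (h : M.IsGeneralizedTwisted g) : M.LogBounded :=
  h.log_bounded

theorem IsGeneralizedTwisted.ev_add_two_pi (h : M.IsGeneralizedTwisted g) (l : ℂ) (v : V) (w : W) :
    M.ev (l + 2 * Real.pi * Complex.I) (g v) w = M.ev l v w := by
  obtain ⟨p, -, -, hp⟩ := exists_logBranch_eq l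
  have := h.equivariance p _ (Complex.exp_ne_zero l) v w
  rwa [evalY_eq_ev, evalY_eq_ev, logBranch_succ, hp] at this

theorem ev_weight {d : ℤ} {r₀ : ℂ} {v : V} {w : W} (hv : v ∈ 𝒱.wt d) (hw : w ∈ M.wt r₀) {K : ℕ}
    (hK : ∀ n k, K ≤ k → M.Y n k v w = 0) (l n : ℂ) :
    (M.ev l v w (r₀ + d - n - 1) : W) =
      Complex.exp ((-n - 1) * l) • ∑ k ∈ Finset.range K, l ^ k • M.Y n k v w := by
  rw [ev_homog hv hw hK, Finset.smul_sum]
  refine Finset.sum_congr rfl fun k _ => ?_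
  rw [smul_smul, show r₀ + d - n - 1 - r₀ - d = -n - 1 by ring,
    show r₀ + d - (r₀ + d - n - 1) - 1 = n by ring]

/-- Equivariance is compared in the weight selecting the exponent n. The factor e^{(-n-1)l} changes
by e^{-2πi(n+1)} under l ↦ l + 2πi, and what remains is an identity between polynomials in l. -/
theorem IsGeneralizedTwisted.equivariance_sum (h : M.IsGeneralizedTwisted g)
    (hg : 𝒱.IsAutomorphism g) {d : ℤ} {r : ℂ} {v : V} {w : W} (hv : v ∈ 𝒱.wt d) (hw : w ∈ M.wt r)
    {K : ℕ} (hK : ∀ n k, K ≤ k → M.Y n k v w = 0) (hK' : ∀ n k, K ≤ k → M.Y n k (g v) w = 0)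
    (l n : ℂ) :
    ∑ k ∈ Finset.range K, (l + 2 * Real.pi * Complex.I) ^ k • M.Y n k (g v) w =
      Complex.exp (2 * Real.pi * Complex.I * (n + 1)) •
        ∑ k ∈ Finset.range K, l ^ k • M.Y n k v w := by
  have h1 := congrArg (fun x : M.Completion => (x (r + d - n - 1) : W)) (h.ev_add_two_pi l v w)
  simp only [ev_weight hv hw hK, ev_weight (hg.mem_wt hv) hw hK'] at h1
  have h2 := congrArg (fun x => Complex.exp ((n + 1) * (l + 2 * Real.pi * Complex.I)) • x) h1
  simp only [smul_smul, ← Complex.exp_add] at h2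
  rw [show (n + 1) * (l + 2 * Real.pi * Complex.I) + (-n - 1) * (l + 2 * Real.pi * Complex.I) = 0
    by ring, Complex.exp_zero, one_smul] at h2
  rw [h2]
  congr 2
  ring

/-- For a generalized eigenvector `u` of `g`, the powers of `x` in `Y(u, x)` lie in one coset of
`ℤ` and the powers of `log x` are bounded. -/
theorem IsGeneralizedTwisted.coeff_eq_zero (h : M.IsGeneralizedTwisted g)
    (hg : 𝒱.IsAutomorphism g) {d : ℤ} {lam : ℂ} {j : ℕ} {u : V} (hu : u ∈ 𝒱.wt d)
    (hj : ((g.toLinearMap - lam • LinearMap.id : Module.End ℂ V) ^ j) u = 0) {n : ℂ} {k : ℕ}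
    (hk : j ≤ k ∨ Complex.exp (2 * Real.pi * Complex.I * (n + 1)) ≠ lam) (w : W) :
    M.Y n k u w = 0 := by
  refine M.internal.induction (motive := fun w => M.Y n k u w = 0) (fun r w hw => ?_) (by simp)
    (fun x y hx hy => by simp [hx, hy]) w
  rw [← Module.forall_dual_apply_eq_zero_iff ℂ]
  intro ψ
  induction j generalizing u k with
  | zero => rw [pow_zero, Module.End.one_apply] at hj; simp [hj]
  | succ j ih =>
    set N : Module.End ℂ V := g.toLinearMap - lam • LinearMap.id with hN
    have hNu : N u = g u - lam • u := by simp [hN]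
    have hNm : N u ∈ 𝒱.wt d := by
      rw [hNu]; exact Submodule.sub_mem _ (hg.mem_wt hu) (Submodule.smul_mem _ _ hu)
    rw [pow_succ, Module.End.mul_apply] at hj
    replace ih := fun k hk => ih (u := N u) (k := k) hNm hj hk
    obtain ⟨K₁, hK₁⟩ := h.log_bounded u w
    obtain ⟨K₂, hK₂⟩ := h.log_bounded (g u) w
    set K := max K₁ K₂ + 1
    have hKu : ∀ n k, K ≤ k → M.Y n k u w = 0 := fun n k hk => hK₁ n k (by omega)
    have hKg : ∀ n k, K ≤ k → M.Y n k (g u) w = 0 := fun n k hk => hK₂ n k (by omega)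
    have hKN : ∀ n k, K ≤ k → M.Y n k (N u) w = 0 := fun n k hk => by
      rw [hNu]; simp [hKu n k hk, hKg n k hk]
    have hc := h.equivariance_sum hg hu hw hKu hKg
    set μ := Complex.exp (2 * Real.pi * Complex.I * (n + 1))
    set q : V → Polynomial ℂ := fun u => logPoly K fun k => ψ (M.Y n k u w) with hq
    have hqg : q (g u) = q (N u) + lam • q u := by
      simp only [hq, logPoly, Finset.smul_sum, ← Finset.sum_add_distrib, hNu]
      refine Finset.sum_congr rfl fun k _ => ?_
      rw [Polynomial.smul_eq_C_mul, ← mul_assoc, ← Polynomial.C_mul, ← add_mul, ← Polynomial.C_add]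
      simp
    have hT : Polynomial.taylor (2 * Real.pi * Complex.I) (q (g u)) = μ • q u := by
      refine Polynomial.taylor_eq_of_eval fun l => ?_
      have := congrArg ψ (hc l n)
      simp only [map_sum, map_smul, smul_eq_mul] at this
      simp only [hq, logPoly_eval, mul_comm (ψ _)]
      exact this
    rw [hqg, map_add, map_smul] at hT
    have hcoef : ∀ k, (q u).coeff k = ψ (M.Y n k u w) :=
      logPoly_coeff fun k hk => by rw [hKu n k hk, map_zero]
    have hcoefN : ∀ k, (q (N u)).coeff k = ψ (M.Y n k (N u) w) :=
      logPoly_coeff fun k hk => by rw [hKN n k hk, map_zero]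
    have hμ : μ ≠ 0 := Complex.exp_ne_zero _
    -- With N = g - lam, `hT` says that the translates of q(Nu) and lam·q(u) add up to μ·q(u). If μ
    -- = lam, the translation difference of q(u) has degree below j, so q(u) has degree at most j.
    -- Otherwise q(Nu) = 0 by induction, and q(u) would be an eigenvector of a translation with
    -- eigenvalue different from 1.
    by_cases hml : μ = lam
    · have hlam : lam ≠ 0 := hml ▸ hμ
      have hdeg : (Polynomial.taylor (2 * Real.pi * Complex.I) (q (N u))).degree < j := by
        rw [Polynomial.degree_taylor, Polynomial.degree_lt_iff_coeff_zero]
        intro k hk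
        rw [hcoefN]
        exact ih k (Or.inl hk)
      rw [← hcoef]
      refine Polynomial.coeff_eq_zero_of_taylor_sub (c := 2 * Real.pi * Complex.I) (j := j)
        (by simp) (fun k hk => ?_) k (hk.resolve_right fun hne => hne hml)
      have h0 := (Polynomial.degree_lt_iff_coeff_zero _ _).1 hdeg k hk
      have h1 := congrArg (fun p => p.coeff k) hT
      simp only [Polynomial.coeff_add, Polynomial.coeff_smul, h0, hml, smul_eq_mul, zero_add] at h1
      rw [Polynomial.coeff_sub, mul_left_cancel₀ hlam h1, sub_self]
    · have hN0 : q (N u) = 0 := by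
        ext k
        rw [hcoefN, Polynomial.coeff_zero]
        exact ih k (Or.inr hml)
      rw [hN0, map_zero, zero_add] at hT
      have hq0 : q u = 0 := by
        by_cases hlam : lam = 0
        · rw [hlam, zero_smul] at hT
          exact (smul_eq_zero.1 hT.symm).resolve_left hμ
        · refine Polynomial.eq_zero_of_taylor_eq_smul (c := 2 * Real.pi * Complex.I)
            (μ := lam⁻¹ * μ) (fun h => hml ?_) ?_
          · field_simp at h; exact h
          · rw [mul_smul, ← hT, smul_smul, inv_mul_cancel₀ hlam, one_smul]
      rw [← hcoef, hq0, Polynomial.coeff_zero]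

/-- The axiom `log_bounded` allows the bound to depend on w; equivariance removes this dependence.
Uniformity is needed to compose with functionals for the contragredient, and to bound polynomial
degrees over all intermediate weights. -/
theorem IsGeneralizedTwisted.exists_log_bound (h : M.IsGeneralizedTwisted g)
    (hg : 𝒱.IsAutomorphism g) (u : V) : ∃ K : ℕ, ∀ n k, K ≤ k → ∀ w, M.Y n k u w = 0 := by
  refine hg.induction (motive := fun u => ∃ K : ℕ, ∀ n k, K ≤ k → ∀ w, M.Y n k u w = 0)
    (fun d lam j u hu hj => ⟨j, fun n k hk w => h.coeff_eq_zero hg hu hj (Or.inl hk) w⟩)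
    ⟨0, by simp⟩ ?_ u
  rintro x y ⟨K, hK⟩ ⟨K', hK'⟩
  refine ⟨max K K', fun n k hk w => ?_⟩
  simp [hK n k (le_trans (le_max_left _ _) hk), hK' n k (le_trans (le_max_right _ _) hk)]

theorem IsGeneralizedTwisted.equivariance_op (h : M.IsGeneralizedTwisted g)
    (hg : 𝒱.IsAutomorphism g) {d : ℤ} {v : V} (hv : v ∈ 𝒱.wt d) {K : ℕ}
    (hK : ∀ n k, K ≤ k → ∀ w, M.Y n k v w = 0) (hK' : ∀ n k, K ≤ k → ∀ w, M.Y n k (g v) w = 0)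
    (l n : ℂ) :
    ∑ k ∈ Finset.range K, (l + 2 * Real.pi * Complex.I) ^ k • M.Y n k (g v) =
      Complex.exp (2 * Real.pi * Complex.I * (n + 1)) •
        ∑ k ∈ Finset.range K, l ^ k • M.Y n k v := by
  ext w
  refine M.internal.induction (motive := fun w =>
    (∑ k ∈ Finset.range K, (l + 2 * Real.pi * Complex.I) ^ k • M.Y n k (g v)) w =
      (Complex.exp (2 * Real.pi * Complex.I * (n + 1)) •
        ∑ k ∈ Finset.range K, l ^ k • M.Y n k v) w)
    (fun r w hw => ?_) (by simp) (fun x y hx hy => by rw [map_add, map_add, hx, hy]) w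
  simpa using h.equivariance_sum hg hv hw (fun n k hk => hK n k hk w) (fun n k hk => hK' n k hk w)
    l n

end

end TwData

/-! ### Power series of one variable -/

section PowerSeries

open FormalMultilinearSeries Asymptotics

theorem ofScalars_apply_const (b : ℕ → ℂ) (n : ℕ) (x : ℂ) :
    (ofScalars ℂ b n fun _ => x) = b n * x ^ n := by
  simp [ofScalars]

theorem hasFPowerSeriesAt_tsum {b : ℕ → ℂ} {x : ℂ} (hx : x ≠ 0)
    (h : Summable fun k => b k * x ^ k) :
    HasFPowerSeriesAt (fun x => ∑' k, b k * x ^ k) (ofScalars ℂ b) 0 := by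
  have hr : (‖x‖₊ : ENNReal) ≤ (ofScalars ℂ b).radius := by
    refine le_radius_of_summable_norm _ ?_
    refine h.norm.congr fun k => ?_
    rw [ofScalars_norm, norm_mul, norm_pow, coe_nnnorm]
  have hpos : 0 < (ofScalars ℂ b).radius :=
    lt_of_lt_of_le (by simpa using hx) hr
  have h1 := ((ofScalars ℂ b).hasFPowerSeriesOnBall hpos).hasFPowerSeriesAt
  refine h1.congr (Eventually.of_forall fun y => ?_)
  simp only [FormalMultilinearSeries.sum, ofScalars_apply_const]

/-- By Cauchy's theorem the Taylor series converges on every disc of holomorphy, and the Taylor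
coefficients are unique. -/
theorem hasSum_of_hasFPowerSeriesAt {b : ℕ → ℂ} {G : ℂ → ℂ} {R : ℝ}
    (hG : DifferentiableOn ℂ G (Metric.ball 0 R)) (h : HasFPowerSeriesAt G (ofScalars ℂ b) 0)
    {x : ℂ} (hx : ‖x‖ < R) : HasSum (fun k => b k * x ^ k) (G x) := by
  obtain ⟨r, hr1, hr2⟩ := exists_between hx
  have hr0 : 0 < r := (norm_nonneg x).trans_lt hr1
  lift r to NNReal using hr0.le
  have hd : DifferentiableOn ℂ G (Metric.closedBall 0 r) :=
    hG.mono (Metric.closedBall_subset_ball hr2)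
  have h1 := hd.hasFPowerSeriesOnBall (by exact_mod_cast hr0)
  have h2 := h1.hasFPowerSeriesAt.eq_formalMultilinearSeries h
  have h3 := h1.hasSum (y := x) (by simpa [← NNReal.coe_lt_coe] using hr1)
  rw [h2, zero_add] at h3
  simpa only [ofScalars_apply_const] using h3

/-- By the identity theorem, agreement at points accumulating at 0 suffices. Convergence at one
nonzero point already makes the series analytic at 0. -/
theorem hasSum_of_frequently {b : ℕ → ℂ} {G : ℂ → ℂ} {R : ℝ} (hR : 0 < R)
    (hG : DifferentiableOn ℂ G (Metric.ball 0 R))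
    (h : ∃ᶠ x in 𝓝[≠] (0 : ℂ), HasSum (fun k => b k * x ^ k) (G x)) :
    HasFPowerSeriesAt G (ofScalars ℂ b) 0 ∧
      ∀ x : ℂ, ‖x‖ < R → HasSum (fun k => b k * x ^ k) (G x) := by
  obtain ⟨x₀, hx₀, hne⟩ := (h.and_eventually self_mem_nhdsWithin).exists
  have h1 := hasFPowerSeriesAt_tsum hne hx₀.summable
  have hGa : AnalyticAt ℂ G 0 := hG.analyticAt (Metric.ball_mem_nhds 0 hR)
  have h2 := (h1.analyticAt.frequently_eq_iff_eventually_eq hGa).1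
    (h.mono fun x hx => hx.tsum_eq)
  have h3 := h1.congr h2
  exact ⟨h3, fun x hx => hasSum_of_hasFPowerSeriesAt hG h3 hx⟩

/-- `G` has the asymptotic expansion `∑ b_k x^k` at `0`. -/
def IsAsymp (G : ℂ → ℂ) (b : ℕ → ℂ) : Prop :=
  ∀ N : ℕ, (fun x => G x - ∑ k ∈ Finset.range N, b k * x ^ k) =O[𝓝 0] fun x => x ^ N

theorem HasFPowerSeriesAt.isAsymp {b : ℕ → ℂ} {G : ℂ → ℂ}
    (h : HasFPowerSeriesAt G (ofScalars ℂ b) 0) : IsAsymp G b := by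
  intro N
  have h1 := h.isBigO_sub_partialSum_pow N
  simp only [zero_add, partialSum, ofScalars_apply_const] at h1
  refine h1.trans (isBigO_of_le _ fun x => ?_)
  simp

/-- For an analytic function an asymptotic expansion can only be the Taylor expansion. Substitutions
can therefore be carried out with remainder estimates instead of rearrangements of convergent
series. -/
theorem IsAsymp.hasFPowerSeriesAt {b : ℕ → ℂ} {G : ℂ → ℂ} (hG : AnalyticAt ℂ G 0)
    (h : IsAsymp G b) : HasFPowerSeriesAt G (ofScalars ℂ b) 0 := by
  obtain ⟨p, hp⟩ := hG
  have hpe : p = ofScalars ℂ p.coeff := by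
    funext n
    refine (p.mkPiRing_coeff_eq n).symm.trans (ContinuousMultilinearMap.ext fun m => ?_)
    simp [ofScalars, List.prod_ofFn, mul_comm]
  rw [hpe] at hp
  have h' := hp.isAsymp
  have heq : ∀ n, p.coeff n = b n := by
    intro n
    induction n using Nat.strong_induction_on with
    | _ n ih =>
      have h1 := (h (n + 1)).sub (h' (n + 1))
      have h2 : (fun x : ℂ => (p.coeff n - b n) * x ^ n) =O[𝓝 0] fun x => x ^ (n + 1) := by
        refine h1.congr_left fun x => ?_
        have h3 : ∑ k ∈ Finset.range n, b k * x ^ k = ∑ k ∈ Finset.range n, p.coeff k * x ^ k :=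
          Finset.sum_congr rfl fun k hk => by rw [ih k (Finset.mem_range.1 hk)]
        rw [Finset.sum_range_succ, Finset.sum_range_succ, h3]
        ring
      by_contra hne
      have hc := sub_ne_zero.2 hne
      have h3 : (fun x : ℂ => x ^ n) =O[𝓝 0] fun x => x ^ (n + 1) :=
        (isBigO_const_mul_left_iff hc).1 h2
      have h4 : (fun x : ℂ => x ^ (n + 1)) =o[𝓝[≠] 0] fun x => x ^ n :=
        (isLittleO_pow_pow (by omega)).mono nhdsWithin_le_nhds
      have h5 := (h3.mono nhdsWithin_le_nhds).trans_isLittleO h4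
      refine isLittleO_irrefl (Eventually.frequently ?_) h5
      filter_upwards [self_mem_nhdsWithin] with x hx
      exact pow_ne_zero n hx
  rwa [show p.coeff = b from funext heq] at hp

theorem isAsymp_one_add_zpow (e : ℤ) :
    IsAsymp (fun x => (1 + x) ^ e) (fun l => ((Ring.choose e l : ℤ) : ℂ)) := by
  have h := Complex.one_add_cpow_hasFPowerSeriesAt_zero (a := (e : ℂ))
  have hb : binomialSeries ℂ (e : ℂ) = ofScalars ℂ fun l => ((Ring.choose e l : ℤ) : ℂ) := by
    unfold binomialSeries
    congr 1
    funext l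
    exact (Ring.map_choose (Int.castRingHom ℂ) e l).symm
  simp only [Complex.cpow_intCast] at h
  rw [hb] at h
  exact h.isAsymp

/-- The expansion of `(1 + x)^e G(-x / (1 + x))`. -/
theorem IsAsymp.euler {G : ℂ → ℂ} {b : ℕ → ℂ} (h : IsAsymp G b) (e : ℤ) :
    IsAsymp (fun x => (1 + x) ^ e * G (-x / (1 + x))) (fun n =>
      ∑ q ∈ Finset.HasAntidiagonal.antidiagonal n, b q.1 * (-1) ^ q.1 * ((Ring.choose (e - q.1) q.2 : ℤ) : ℂ)) := by
  intro N
  have hy : Tendsto (fun x : ℂ => -x / (1 + x)) (𝓝 0) (𝓝 0) := by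
    have : ContinuousAt (fun x : ℂ => -x / (1 + x)) 0 := by
      refine ContinuousAt.div (by fun_prop) (by fun_prop) (by simp)
    simpa [ContinuousAt] using this
  have hpow : ∀ e : ℤ, (fun x : ℂ => (1 + x) ^ e) =O[𝓝 0] fun _ => (1 : ℂ) := by
    intro e
    have : ContinuousAt (fun x : ℂ => (1 + x) ^ e) 0 :=
      ContinuousAt.zpow₀ (by fun_prop) _ (by simp)
    exact this.tendsto.isBigO_one ℂ
  have hne : ∀ᶠ x : ℂ in 𝓝 0, 1 + x ≠ 0 := by
    have : ContinuousAt (fun x : ℂ => 1 + x) 0 := by fun_prop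
    exact this.eventually_ne (by simp)
  -- Since -x/(1+x) = O(x), replacing G by its partial sum of order N costs O(x^N).
  have h1 : (fun x : ℂ => (1 + x) ^ e * G (-x / (1 + x)) - ∑ k ∈ Finset.range N,
      b k * (-1) ^ k * x ^ k * (1 + x) ^ (e - k)) =O[𝓝 0] fun x => x ^ N := by
    have h2 := (hpow (e - N)).mul ((h N).comp_tendsto hy)
    have h3 := (hpow e).mul ((h N).comp_tendsto hy)
    have h4 : (fun x : ℂ => (1 : ℂ) * ((fun x => x ^ N) ∘ fun x => -x / (1 + x)) x) =O[𝓝 0]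
        fun x => x ^ N := by
      refine ((hpow (-N)).mul (isBigO_refl (fun x : ℂ => (-x) ^ N) (𝓝 0))).congr'
        (hne.mono fun x hx => ?_) EventuallyEq.rfl |>.trans ?_
      · simp [div_pow, zpow_neg]
        ring
      · exact isBigO_of_le _ fun x => by simp
    refine (h3.trans h4).congr' (hne.mono fun x hx => ?_) EventuallyEq.rfl
    simp only [Function.comp_apply, mul_sub, Finset.mul_sum]
    congr 1
    refine Finset.sum_congr rfl fun k _ => ?_
    rw [div_pow, neg_pow, zpow_sub₀ hx, zpow_natCast]
    ring
  -- The k-th term already carries x^k, so its binomial series may be cut at degree N - k.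
  have h2 : (fun x : ℂ => ∑ k ∈ Finset.range N, b k * (-1) ^ k * x ^ k * ((1 + x) ^ (e - k) -
      ∑ l ∈ Finset.range (N - k), ((Ring.choose (e - k) l : ℤ) : ℂ) * x ^ l)) =O[𝓝 0]
        fun x => x ^ N := by
    refine IsBigO.fun_sum fun k hk => ?_
    have h3 := (isBigO_refl (fun x : ℂ => b k * (-1) ^ k * x ^ k) (𝓝 0)).mul
      (isAsymp_one_add_zpow (e - k) (N - k))
    refine h3.trans ?_
    have : (fun x : ℂ => b k * (-1) ^ k * x ^ k * x ^ (N - k)) =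
        fun x => (b k * (-1) ^ k) * x ^ N := by
      funext x
      rw [mul_assoc, ← pow_add, Nat.add_sub_cancel' (Finset.mem_range.1 hk).le]
    rw [this]
    exact isBigO_const_mul_self _ _ _
  refine (h1.add h2).congr_left fun x => ?_
  rw [sub_add_eq_add_sub, add_sub_assoc, ← Finset.sum_sub_distrib]
  simp only [mul_sub, sub_sub_cancel_left]
  rw [Finset.sum_neg_distrib, ← sub_eq_add_neg]
  congr 1
  simp only [Finset.mul_sum, Finset.sum_mul]
  rw [Finset.sum_sigma', Finset.sum_sigma']
  -- The pairs with k + l < N are regrouped by their total degree.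
  refine Finset.sum_bij' (fun p _ => ⟨p.1 + p.2, (p.1, p.2)⟩) (fun p _ => ⟨p.2.1, p.2.2⟩)
    ?_ ?_ ?_ ?_ ?_
  · rintro ⟨k, l⟩ hp
    simp only [Finset.mem_sigma, Finset.mem_range, Finset.HasAntidiagonal.mem_antidiagonal, and_true] at hp ⊢
    omega
  · rintro ⟨n, k, l⟩ hp
    simp only [Finset.mem_sigma, Finset.mem_range, Finset.HasAntidiagonal.mem_antidiagonal] at hp ⊢
    omega
  · rintro ⟨k, l⟩ hp; rfl
  · rintro ⟨n, k, l⟩ hp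
    simp only [Finset.mem_sigma, Finset.HasAntidiagonal.mem_antidiagonal] at hp
    simp [hp.2]
  · rintro ⟨k, l⟩ hp
    simp only [pow_add]
    ring

/-- Multiplication by x^T turns a Laurent series with pole of order at most T into a power series.
-/
theorem hasSum_int_iff {c : ℤ → ℂ} {T : ℕ} (hc : ∀ m, m < -(T : ℤ) → c m = 0) {x : ℂ} (hx : x ≠ 0)
    {S : ℂ} : HasSum (fun m : ℤ => x ^ m * c m) S ↔
      HasSum (fun k : ℕ => c (k - T) * x ^ k) (x ^ T * S) := by
  have hinj : Function.Injective (fun k : ℕ => (k : ℤ) - T) := fun a b h => by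
    simpa using h
  rw [← hinj.hasSum_iff]
  · rw [← hasSum_mul_left_iff (pow_ne_zero T hx)]
    refine iff_of_eq (congrArg (fun f => HasSum f _) (funext fun k => ?_))
    simp only [Function.comp_apply]
    rw [zpow_sub₀ hx, zpow_natCast, zpow_natCast]
    field_simp
  · intro m hm
    rw [hc m, mul_zero]
    by_contra h
    exact hm ⟨(m + T).toNat, by simp only; omega⟩

end PowerSeries

/-! ### Sums of polynomials at a boundary point -/

/-- By Lagrange interpolation the value at any point of a polynomial of degree below D is a fixed
linear combination of its values at D nodes in (0, δ). Summability at 0 follows without any uniform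
estimate, and continuity of F identifies the sum. -/
theorem hasSum_eval_zero_of_forall_pos {ι : Type*} {D : ℕ} {q : ι → Polynomial ℂ}
    (hq : ∀ i, (q i).degree < D) {F : ℝ → ℂ} (hF : ContinuousAt F 0) {δ : ℝ} (hδ : 0 < δ)
    (h : ∀ ε : ℝ, 0 < ε → ε < δ → HasSum (fun i => (q i).eval (ε : ℂ)) (F ε)) :
    HasSum (fun i => (q i).eval 0) (F 0) := by
  -- The nodes are distinct; the shift by 2 keeps even the first one strictly below δ.
  let x : ℕ → ℝ := fun j => δ / (j + 2)
  have hx0 : ∀ j, 0 < x j := fun j => by positivity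
  have hxδ : ∀ j, x j < δ := fun j => by
    rw [div_lt_iff₀ (by positivity)]
    nlinarith [(Nat.cast_nonneg j : (0 : ℝ) ≤ j)]
  have hinj : Set.InjOn (fun j => ((x j : ℝ) : ℂ)) (Finset.range D : Set ℕ) := by
    intro a _ b _ hab
    have h1 : x a = x b := Complex.ofReal_injective hab
    simp only [x] at h1
    rw [div_eq_div_iff (by positivity) (by positivity)] at h1
    have h2 := mul_left_cancel₀ hδ.ne' h1
    have h3 : (a : ℝ) = b := by linarith
    exact_mod_cast h3
  let B : ℂ → ℂ := fun y => ∑ j ∈ Finset.range D, F (x j) *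
    (Lagrange.basis (Finset.range D) (fun j => ((x j : ℝ) : ℂ)) j).eval y
  have hS : ∀ y : ℂ, HasSum (fun i => (q i).eval y) (B y) := by
    intro y
    have h1 : ∀ i, (q i).eval y = ∑ j ∈ Finset.range D, (q i).eval ((x j : ℝ) : ℂ) *
        (Lagrange.basis (Finset.range D) (fun j => ((x j : ℝ) : ℂ)) j).eval y := by
      intro i
      conv_lhs => rw [Lagrange.eq_interpolate (f := q i) hinj (by simpa using hq i)]
      simp [Lagrange.interpolate_apply, Polynomial.eval_finsetSum]
    simp only [h1]
    exact hasSum_sum fun j _ => (h _ (hx0 j) (hxδ j)).mul_right _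
  have hB : Continuous B := by
    refine continuous_finsetSum _ fun j _ => ?_
    fun_prop
  have hlim1 : Tendsto (fun ε : ℝ => B ε) (𝓝[>] 0) (𝓝 (B 0)) := by
    have : Continuous fun ε : ℝ => B ε := by fun_prop
    simpa using (this.tendsto 0).mono_left nhdsWithin_le_nhds
  have hlim2 : Tendsto (fun ε : ℝ => B ε) (𝓝[>] 0) (𝓝 (F 0)) := by
    refine (hF.tendsto.mono_left nhdsWithin_le_nhds).congr' ?_
    filter_upwards [Ioo_mem_nhdsGT hδ] with ε hε
    exact (h ε hε.1 hε.2).unique (hS ε)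
  have := hS 0
  rwa [tendsto_nhds_unique hlim1 hlim2] at this

/-! ### Generalized binomial coefficients and sums over antidiagonals -/

theorem Ring.succ_mul_choose_succ (b : ℤ) (q : ℕ) :
    ((q : ℤ) + 1) * Ring.choose b (q + 1) = (b - q) * Ring.choose b q := by
  have h1 := Ring.descPochhammer_eq_factorial_smul_choose b (q + 1)
  have h2 := Ring.descPochhammer_eq_factorial_smul_choose b q
  rw [descPochhammer_succ_right, Polynomial.smeval_mul, h2, Polynomial.smeval_sub,
    Polynomial.smeval_X, Polynomial.smeval_natCast, Nat.factorial_succ] at h1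
  simp only [nsmul_eq_mul, pow_one, pow_zero, mul_one] at h1
  have h3 : (q.factorial : ℤ) ≠ 0 := by exact_mod_cast q.factorial_ne_zero
  apply mul_left_cancel₀ h3
  push_cast at h1
  linear_combination -h1

/-- Upper negation converts the binomials produced by conjugation with e^{xL(1)} into those of the
expansion of (1 + x)^e. -/
theorem Ring.choose_sub_succ (b : ℤ) (q : ℕ) :
    Ring.choose (-b - 1 + q) q = (-1) ^ q * Ring.choose b q := by
  have h := Ring.choose_neg (b + 1 - q) q
  rw [show -(b + 1 - q) = -b - 1 + q by ring, show b + 1 - q + q - 1 = b by ring] at h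
  rw [h, Units.smul_def, Int.coe_negOnePow_natCast, smul_eq_mul]

section Antidiagonal

open Finset

variable {A : Type*} [AddCommMonoid A]

/-- The sum of `g i j q` over all `i + j + q = k`. -/
def tripleSum (k : ℕ) (g : ℕ → ℕ → ℕ → A) : A :=
  ∑ p ∈ HasAntidiagonal.antidiagonal k, ∑ r ∈ HasAntidiagonal.antidiagonal p.2, g p.1 r.1 r.2

/-- The three shift lemmas turn the degree k sum obtained after applying L(1) into a sum of degree k
+ 1; the boundary terms vanish because the new coefficients carry the shifted index as a factor. -/
theorem tripleSum_shift_fst (k : ℕ) (g : ℕ → ℕ → ℕ → A) (h : ∀ j q, g 0 j q = 0) :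
    tripleSum k (fun i j q => g (i + 1) j q) = tripleSum (k + 1) g := by
  rw [tripleSum, tripleSum, Nat.sum_antidiagonal_succ]
  simp [h]

theorem tripleSum_shift_snd (k : ℕ) (g : ℕ → ℕ → ℕ → A) (h : ∀ i q, g i 0 q = 0) :
    tripleSum k (fun i j q => g i (j + 1) q) = tripleSum (k + 1) g := by
  rw [tripleSum, tripleSum, Nat.sum_antidiagonal_succ']
  simp [h, Nat.sum_antidiagonal_succ]

theorem tripleSum_shift_trd (k : ℕ) (g : ℕ → ℕ → ℕ → A) (h : ∀ i j, g i j 0 = 0) :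
    tripleSum k (fun i j q => g i j (q + 1)) = tripleSum (k + 1) g := by
  rw [tripleSum, tripleSum, Nat.sum_antidiagonal_succ']
  simp [h, Nat.sum_antidiagonal_succ']

theorem tripleSum_add (k : ℕ) (g g' : ℕ → ℕ → ℕ → A) :
    tripleSum k (fun i j q => g i j q + g' i j q) = tripleSum k g + tripleSum k g' := by
  simp [tripleSum, sum_add_distrib]

theorem tripleSum_congr (k : ℕ) {g g' : ℕ → ℕ → ℕ → A}
    (h : ∀ i j q, i + j + q = k → g i j q = g' i j q) : tripleSum k g = tripleSum k g' := by
  refine sum_congr rfl fun p hp => sum_congr rfl fun r hr => h _ _ _ ?_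
  rw [HasAntidiagonal.mem_antidiagonal] at hp hr
  omega

theorem sum_antidiagonal_box {K N₁ N₂ : ℕ} (hK : N₁ + N₂ ≤ K) (h : ℕ → ℕ → A)
    (h₁ : ∀ i s, N₁ ≤ i → h i s = 0) (h₂ : ∀ i s, N₂ ≤ s → h i s = 0) :
    ∑ k ∈ range K, ∑ p ∈ HasAntidiagonal.antidiagonal k, h p.1 p.2 =
      ∑ i ∈ range N₁, ∑ s ∈ range N₂, h i s := by
  rw [← sum_product' (range N₁) (range N₂) h,
    ← sum_fiberwise_of_maps_to (s := range N₁ ×ˢ range N₂) (t := range K) (g := fun p => p.1 + p.2)]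
  · refine sum_congr rfl fun k _ => (sum_subset (fun p hp => ?_) fun p hp hp' => ?_).symm
    · simpa using (mem_filter.1 hp).2
    · rw [HasAntidiagonal.mem_antidiagonal] at hp
      simp only [mem_filter, mem_product, mem_range, hp, and_true, not_and_or, not_lt] at hp'
      rcases hp' with h | h
      · exact h₁ _ _ h
      · exact h₂ _ _ h
  · intro p hp
    simp only [mem_product, mem_range] at hp ⊢
    omega

theorem sum_tripleSum {K N₁ N₂ N₃ : ℕ} (hK : N₁ + N₂ + N₃ ≤ K) (g : ℕ → ℕ → ℕ → A)
    (h₁ : ∀ i j q, N₁ ≤ i → g i j q = 0) (h₂ : ∀ i j q, N₂ ≤ j → g i j q = 0)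
    (h₃ : ∀ i j q, N₃ ≤ q → g i j q = 0) :
    ∑ k ∈ range K, tripleSum k g =
      ∑ i ∈ range N₁, ∑ j ∈ range N₂, ∑ q ∈ range N₃, g i j q := by
  have h0 : ∀ i s, N₂ + N₃ ≤ s → ∑ r ∈ HasAntidiagonal.antidiagonal s, g i r.1 r.2 = 0 := by
    intro i s hs
    refine sum_eq_zero fun r hr => ?_
    rw [HasAntidiagonal.mem_antidiagonal] at hr
    by_cases hj : N₂ ≤ r.1
    · exact h₂ _ _ _ hj
    · exact h₃ _ _ _ (by omega)
  unfold tripleSum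
  rw [sum_antidiagonal_box (N₁ := N₁) (N₂ := N₂ + N₃) (by omega)
    (fun i s => ∑ r ∈ HasAntidiagonal.antidiagonal s, g i r.1 r.2)
    (fun i s hi => sum_eq_zero fun r _ => h₁ _ _ _ hi) h0]
  refine sum_congr rfl fun i _ => ?_
  exact sum_antidiagonal_box le_rfl (g i) (h₂ i) (h₃ i)

end Antidiagonal

/-! ### The action of `L(1)` -/

namespace VOA

variable {V : Type v} [AddCommGroup V] [Module ℂ V] (𝒱 : VOA V)

/-- This is the Jacobi identity for ω with l = 0 and m = 2. The binomials 1, 2, 1 multiply the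
contributions of L(-1)u, L(0)u and L(1)u, and the first two combine through the L(-1)-derivative
property and the weight of u. -/
theorem L_one_commutator {a : ℤ} {u : V} (hu : u ∈ 𝒱.wt a) (n : ℤ) (v : V) :
    𝒱.L 1 (ncoeff (𝒱.Y u) n v) = ncoeff (𝒱.Y u) n (𝒱.L 1 v) + ncoeff (𝒱.Y (𝒱.L 1 u)) n v +
      (2 * (a : ℂ) - n - 2) • ncoeff (𝒱.Y u) (n + 1) v := by
  have h := 𝒱.jacobi 0 2 n 𝒱.ω u v
  rw [finsum_eq_sum_of_support_subset (s := Finset.range 3), finsum_eq_single _ 0] at h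
  · simp only [Finset.sum_range_succ, Finset.sum_range_zero] at h
    have c1 : Ring.choose (2 : ℤ) 1 = 2 := Ring.choose_one_right 2
    have c2 : Ring.choose (2 : ℤ) 2 = 1 := by
      have := Ring.choose_natCast (R := ℤ) 2 2
      simpa using this
    have c3 : Ring.choose (0 : ℤ) 0 = 1 := Ring.choose_zero_right 0
    have c4 : Ring.choose (2 : ℤ) 0 = 1 := Ring.choose_zero_right 2
    have e0 := 𝒱.L_neg_one_derivative (2 + n) u v
    have e1 : ncoeff (𝒱.Y 𝒱.ω) 1 u = (a : ℂ) • u := 𝒱.L0_grading a u hu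
    simp only [c1, c2, c3, c4, Nat.cast_zero, Nat.cast_one, Nat.cast_ofNat, zero_add, sub_zero,
      add_zero, pow_zero, zpow_zero, one_mul, Int.cast_one, one_smul, e0, e1, Int.cast_ofNat] at h
    rw [show (2 : ℤ) + n - 1 = n + 1 by ring, show (2 : ℤ) + n - 2 = n by ring] at h
    have h' := eq_add_of_sub_eq h.symm
    change ncoeff (𝒱.Y 𝒱.ω) 2 _ = ncoeff (𝒱.Y u) n (ncoeff (𝒱.Y 𝒱.ω) 2 v) +
      ncoeff (𝒱.Y (ncoeff (𝒱.Y 𝒱.ω) 2 u)) n v + _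
    rw [h']
    simp only [map_smul, Pi.smul_apply, LinearMap.smul_apply]
    push_cast
    module
  · intro i hi
    rw [Ring.choose_zero_pos ℤ (Nat.pos_of_ne_zero hi)]
    simp
  · intro i hi
    by_contra hi'
    simp only [Finset.coe_range, Set.mem_Iio, not_lt] at hi'
    refine hi ?_
    have := Ring.choose_natCast (R := ℤ) 2 i
    rw [Nat.choose_eq_zero_of_lt (by omega)] at this
    simp only [Nat.cast_ofNat, Nat.cast_zero] at this
    simp [this]

theorem L_one_L_one_pow (m : ℕ) (v : V) :
    𝒱.L 1 ((𝒱.L 1 ^ m : Module.End ℂ V) v) = (𝒱.L 1 ^ (m + 1) : Module.End ℂ V) v := by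
  rw [pow_succ', Module.End.mul_apply]

/-- The conjugation formula for `exp(xL(1))`, in components. -/
theorem L_one_pow_ncoeff {a : ℤ} {u : V} (hu : u ∈ 𝒱.wt a) (n : ℤ) (v : V) (k : ℕ) :
    ((k.factorial : ℂ)⁻¹) • (𝒱.L 1 ^ k : Module.End ℂ V) (ncoeff (𝒱.Y u) n v) =
      tripleSum k fun i j q =>
        (((Ring.choose (2 * a - i - n - 2) q : ℤ) : ℂ) * (i.factorial : ℂ)⁻¹ *
          (j.factorial : ℂ)⁻¹) •
        ncoeff (𝒱.Y ((𝒱.L 1 ^ i : Module.End ℂ V) u)) (n + q)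
          ((𝒱.L 1 ^ j : Module.End ℂ V) v) := by
  induction k with
  | zero => simp [tripleSum]
  | succ k ih =>
    let Z : ℕ → ℕ → ℕ → V := fun i j q => ((i.factorial : ℂ)⁻¹ * (j.factorial : ℂ)⁻¹) •
      ncoeff (𝒱.Y ((𝒱.L 1 ^ i : Module.End ℂ V) u)) (n + q) ((𝒱.L 1 ^ j : Module.End ℂ V) v)
    let C : ℤ → ℕ → ℂ := fun i q => ((Ring.choose (2 * a - i - n - 2) q : ℤ) : ℂ)
    -- The last term of the commutator raises the mode by one. E records its coefficient at the
    -- shifted index, with value 0 at q = 0, where nothing arrives.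
    let E : ℕ → ℕ → ℂ := fun i q => match q with
      | 0 => 0
      | q + 1 => (2 * (a : ℂ) - 2 * i - n - q - 2) * C i q
    have hfac : ∀ i : ℕ, ((i + 1 : ℕ) : ℂ) * ((i + 1).factorial : ℂ)⁻¹ = (i.factorial : ℂ)⁻¹ := by
      intro i
      have h1 : ((i + 1 : ℕ) : ℂ) ≠ 0 := by exact_mod_cast Nat.succ_ne_zero i
      rw [Nat.factorial_succ, Nat.cast_mul, mul_inv, mul_inv_cancel_left₀ h1]
    have hk : ((k + 1 : ℕ) : ℂ) ≠ 0 := by exact_mod_cast Nat.succ_ne_zero k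
    have key : tripleSum k (fun i j q => 𝒱.L 1 (C i q • Z i j q)) =
        tripleSum (k + 1) (fun i j q => ((k + 1 : ℕ) : ℂ) • C i q • Z i j q) := by
      have hA := tripleSum_shift_snd k (fun i j q => ((j : ℂ) * C i q) • Z i j q) (by simp)
      have hB := tripleSum_shift_fst k (fun i j q => ((i : ℂ) * C ((i : ℤ) - 1) q) • Z i j q)
        (by simp)
      have hD := tripleSum_shift_trd k (fun i j q => E i q • Z i j q) (by simp [E])
      have h1 : tripleSum k (fun i j q => 𝒱.L 1 (C i q • Z i j q)) =
          tripleSum k (fun i j q => (((j + 1 : ℕ) : ℂ) * C i q) • Z i (j + 1) q +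
            (((i + 1 : ℕ) : ℂ) * C (((i + 1 : ℕ) : ℤ) - 1) q) • Z (i + 1) j q +
            E i (q + 1) • Z i j (q + 1)) := by
        refine tripleSum_congr k fun i j q _ => ?_
        simp only [Z, map_smul, 𝒱.L_one_commutator (𝒱.L_one_pow_mem hu i), E,
          L_one_L_one_pow]
        rw [← hfac i, ← hfac j]
        push_cast
        rw [add_sub_cancel_right, add_assoc n]
        module
      rw [h1, tripleSum_add, tripleSum_add, hA, hB, hD, ← tripleSum_add, ← tripleSum_add]
      refine tripleSum_congr _ fun i j q hijq => ?_
      -- Pascal's rule and (q + 1)·choose b (q + 1) = (b - q)·choose b q make the three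
      -- contributions add up to (i + j + q) times the expected coefficient.
      have hz : (j : ℂ) * C i q + i * C ((i : ℤ) - 1) q + E i q = ((k + 1 : ℕ) : ℂ) * C i q := by
        rw [← hijq]
        rcases q with _ | q
        · simp only [C, E, Ring.choose_zero_right]
          push_cast
          ring
        · have c1 := Ring.choose_succ_succ (2 * a - i - n - 2) q
          have c2 := Ring.succ_mul_choose_succ (2 * a - i - n - 2) q
          have e1 : 2 * a - ((i : ℤ) - 1) - n - 2 = 2 * a - i - n - 2 + 1 := by ring
          have c2' := congrArg (fun x : ℤ => (x : ℂ)) c2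
          simp only [C, E, e1, c1]
          push_cast at c2' ⊢
          linear_combination -c2'
      rw [← add_smul, ← add_smul, hz, mul_smul]
    have ih' : ((k.factorial : ℂ)⁻¹) • (𝒱.L 1 ^ k : Module.End ℂ V) (ncoeff (𝒱.Y u) n v) =
        tripleSum k fun i j q => C i q • Z i j q := by
      rw [ih]
      refine tripleSum_congr k fun i j q _ => ?_
      simp only [C, Z, smul_smul, mul_assoc]
    have h2 := congrArg (𝒱.L 1) ih'
    have h3 : 𝒱.L 1 (tripleSum k fun i j q => C i q • Z i j q) =
        tripleSum k (fun i j q => 𝒱.L 1 (C i q • Z i j q)) := by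
      simp only [tripleSum, map_sum]
    rw [h3, key, map_smul, ← Module.End.mul_apply, ← pow_succ', ← hfac k, mul_smul] at h2
    have h4 : tripleSum (k + 1) (fun i j q => ((k + 1 : ℕ) : ℂ) • C i q • Z i j q) =
        ((k + 1 : ℕ) : ℂ) • tripleSum (k + 1) (fun i j q => C i q • Z i j q) := by
      simp only [tripleSum, Finset.smul_sum]
    rw [h4] at h2
    rw [smul_right_injective V hk h2]
    refine tripleSum_congr _ fun i j q _ => ?_
    simp only [C, Z, smul_smul, mul_assoc]

/-- From [L(1), L(-1)] = 2L(0), moving L(-1) past m + 1 factors L(1) collects the sum of 2(d - i)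
over 0 ≤ i ≤ m, which is (m + 1)(2d - m). -/
theorem L_one_pow_L_neg_one {d : ℤ} {v : V} (hv : v ∈ 𝒱.wt d) (m : ℕ) :
    (𝒱.L 1 ^ (m + 1) : Module.End ℂ V) (𝒱.L (-1) v) =
      𝒱.L (-1) ((𝒱.L 1 ^ (m + 1) : Module.End ℂ V) v) +
        (((m : ℂ) + 1) * (2 * d - m)) • (𝒱.L 1 ^ m : Module.End ℂ V) v := by
  have hc : ∀ (e : ℤ), ∀ x ∈ 𝒱.wt e, 𝒱.L 1 (𝒱.L (-1) x) = 𝒱.L (-1) (𝒱.L 1 x) + (2 * (e : ℂ)) • x := by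
    intro e x hx
    have h := 𝒱.virasoro 1 (-1) x
    have h0 : ncoeff (𝒱.Y 𝒱.ω) 1 x = (e : ℂ) • x := 𝒱.L0_grading e x hx
    norm_num [h0] at h
    have h1 := eq_add_of_sub_eq' h
    rw [smul_smul] at h1
    exact h1
  induction m with
  | zero => simp [hc d v hv]
  | succ m ih =>
    rw [← L_one_L_one_pow, ih, map_add, hc _ _ (𝒱.L_one_pow_mem hv (m + 1)), map_smul,
      L_one_L_one_pow, L_one_L_one_pow, add_assoc, ← add_smul]
    congr 2
    push_cast
    ring

theorem L_one_vac (m : ℕ) (hm : m ≠ 0) : (𝒱.L 1 ^ m : Module.End ℂ V) 𝒱.vac = 0 := by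
  obtain ⟨m, rfl⟩ := Nat.exists_eq_succ_of_ne_zero hm
  rw [pow_succ, Module.End.mul_apply, show 𝒱.L 1 𝒱.vac = 0 from 𝒱.creation_regular 2 _ (by norm_num),
    map_zero]

/-- Since ω = L(-2)𝟏, the commutator of L(1) and L(-2) gives 3L(-1)𝟏 = 0, without a central term. -/
theorem L_one_omega : 𝒱.L 1 𝒱.ω = 0 := by
  have h := 𝒱.virasoro 1 (-2) 𝒱.vac
  have h1 := 𝒱.creation 𝒱.ω
  have h2 := 𝒱.creation_regular 0 𝒱.ω le_rfl
  have h3 := 𝒱.creation_regular 2 𝒱.ω (by norm_num)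
  norm_num [h1, h2, h3] at h
  exact h

end VOA

/-- This is the substitution x ↦ x⁻¹: exponents are reflected, log x changes sign, and the remaining
power of x comes from the convention x^{-n-1}. -/
theorem evalLog_reflect (a : ℂ → ℕ → ℂ) (c l : ℂ) :
    evalLog (fun n k => (-1) ^ k * a (c - n) k) l =
      Complex.exp ((-c - 2) * l) * evalLog a (-l) := by
  unfold evalLog
  rw [← smul_eq_mul, smul_finsum,
    ← finsum_comp_equiv ((Equiv.subLeft c).prodCongr (Equiv.refl ℕ))]
  refine finsum_congr fun q => ?_
  simp only [Equiv.prodCongr_apply, Prod.map_fst, Prod.map_snd, Equiv.subLeft_apply,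
    Equiv.refl_apply, smul_eq_mul, sub_sub_cancel]
  rw [show (-(c - q.1) - 1) * l = (-c - 2) * l + (-q.1 - 1) * -l by ring, Complex.exp_add, neg_pow]
  ring

theorem evalLog_const_mul {a : ℂ → ℕ → ℂ} (ha : FinSupp a) (c l : ℂ) :
    evalLog (fun n k => c * a n k) l = c * evalLog a l := by
  simpa using (ha.map_evalLog (LinearMap.mulLeft ℂ c) l).symm

theorem FinSupp.const_mul {a : ℂ → ℕ → ℂ} (ha : FinSupp a) (c : ℂ) :
    FinSupp (fun n k => c * a n k) := by
  simpa using ha.map (LinearMap.mulLeft ℂ c)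

theorem FinSupp.reflect {a : ℂ → ℕ → ℂ} (ha : FinSupp a) (c : ℂ) :
    FinSupp (fun n k => (-1) ^ k * a (c - n) k) := by
  refine (Set.Finite.preimage (((Equiv.subLeft c).prodCongr (Equiv.refl ℕ)).injective.injOn)
    ha).subset ?_
  intro q hq h
  exact hq (by simpa using h)

theorem evalLog_finset_sum {ι : Type*} {s : Finset ι} {a : ι → ℂ → ℕ → ℂ}
    (ha : ∀ i ∈ s, FinSupp (a i)) (l : ℂ) :
    evalLog (fun n k => ∑ i ∈ s, a i n k) l = ∑ i ∈ s, evalLog (a i) l ∧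
      FinSupp (fun n k => ∑ i ∈ s, a i n k) := by
  classical
  induction s using Finset.induction_on with
  | empty => simp [evalLog_zero, FinSupp.zero]
  | insert i s hi ih =>
    obtain ⟨h1, h2⟩ := ih fun j hj => ha j (by simp [hj])
    have h3 := ha i (by simp)
    simp only [Finset.sum_insert hi]
    exact ⟨by rw [evalLog_add h3 h2, h1], h3.add h2⟩

/-! ### Evaluation of contragredient vertex operators. -/

namespace TwData

section

variable {V : Type v} [AddCommGroup V] [Module ℂ V] {𝒱 : VOA V}
  {W : Type u} [AddCommGroup W] [Module ℂ W] {M : TwData 𝒱 W} {g : V ≃ₗ[ℂ] V}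

/-- Terms beyond the defining cutoff vanish because L(1) lowers the weight below the bottom of V. A
free cutoff lets several vectors share one N. -/
theorem opp_eq {d : ℤ} {v : V} (hv : v ∈ 𝒱.wt d) {N : ℕ} (hN : (d - 𝒱.minWt).toNat + 1 ≤ N)
    (n : ℂ) (k : ℕ) (w : W) :
    M.opp n k v w = ∑ m ∈ Finset.range N, ((-1 : ℂ) ^ k * (-1 : ℂ) ^ d / (m.factorial : ℂ)) •
      M.Y (2 * d - m - n - 2) k ((𝒱.L 1 ^ m : Module.End ℂ V) v) w := by
  simp only [opp, LinearMap.comp_apply, LinearEquiv.coe_coe, 𝒱.decompose_of_mem hv,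
    DirectSum.toModule_lof, LinearMap.sum_apply, LinearMap.smul_apply, Submodule.subtype_apply]
  refine Finset.sum_subset (Finset.range_subset_range.2 hN) fun m _ hm => ?_
  rw [𝒱.L_one_pow_eq_zero hv (by simpa using hm), map_zero, LinearMap.zero_apply, smul_zero]

theorem contragredient_Y (n : ℂ) (k : ℕ) (v : V) (f : M.gradedDual) (w : W) :
    (M.contragredient.Y n k v f).1 w = f.1 (M.opp n k v w) := rfl

theorem IsGeneralizedTwisted.exists_opp_bound (h : M.IsGeneralizedTwisted g)
    (hg : 𝒱.IsAutomorphism g) (v : V) : ∃ K : ℕ, ∀ n k, K ≤ k → ∀ w, M.opp n k v w = 0 := by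
  refine 𝒱.internal.induction
    (motive := fun v => ∃ K : ℕ, ∀ n k, K ≤ k → ∀ w, M.opp n k v w = 0) (fun d v hv => ?_)
    ⟨0, by simp⟩ ?_ v
  · choose K hK using fun m : ℕ => h.exists_log_bound hg ((𝒱.L 1 ^ m : Module.End ℂ V) v)
    refine ⟨∑ m ∈ Finset.range ((d - 𝒱.minWt).toNat + 1), K m, fun n k hk w => ?_⟩
    rw [opp_eq hv le_rfl]
    refine Finset.sum_eq_zero fun m hm => ?_
    rw [hK m _ k ((Finset.single_le_sum (fun _ _ => Nat.zero_le _) hm).trans hk), smul_zero]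
  · rintro x y ⟨K, hK⟩ ⟨K', hK'⟩
    refine ⟨max K K', fun n k hk w => ?_⟩
    simp [hK n k (le_trans (le_max_left _ _) hk), hK' n k (le_trans (le_max_right _ _) hk)]

theorem IsGeneralizedTwisted.contragredient_logBounded (h : M.IsGeneralizedTwisted g)
    (hg : 𝒱.IsAutomorphism g) : M.contragredient.LogBounded := by
  intro v f
  obtain ⟨K, hK⟩ := h.exists_opp_bound hg v
  refine ⟨K, fun n k hk => Subtype.ext (LinearMap.ext fun w => ?_)⟩
  rw [contragredient_Y, hK n k hk.le, map_zero]
  rfl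

theorem contragredient_proj_apply (r : ℂ) (f : M.gradedDual) {w : W} (hw : w ∈ M.wt r) :
    (M.contragredient.proj r f : M.gradedDual).1 w = f.1 w := by
  refine M.contragredient.internal.induction
    (motive := fun f => (M.contragredient.proj r f : M.gradedDual).1 w = f.1 w) (fun s f hf => ?_)
    (by simp) (fun x y hx hy => by simp [hx, hy]) f
  by_cases h : s = r
  · subst h; rw [M.contragredient.proj_of_mem s f hf]
  · rw [M.contragredient.proj_of_mem_ne s r h f hf, hf r (Ne.symm h) w hw]
    rfl

/-- The scalar in front of `Y(L(1)^m v, x⁻¹)` in the contragredient vertex operator. -/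
def oppCoeff (d : ℤ) (m : ℕ) (l : ℂ) : ℂ :=
  (-1 : ℂ) ^ d / (m.factorial : ℂ) * Complex.exp ((m - 2 * d) * l)

/-- The formal definition of `opp` is made numerical: each power of L(1) contributes a series
reflected to log x = -l, and (-x^{-2})^{L(0)} together with x^m becomes `oppCoeff`. -/
theorem IsGeneralizedTwisted.contragredient_ev (h : M.IsGeneralizedTwisted g)
    (hg : 𝒱.IsAutomorphism g) {d : ℤ} {v : V} (hv : v ∈ 𝒱.wt d) {N : ℕ}
    (hN : (d - 𝒱.minWt).toNat + 1 ≤ N) (l : ℂ) (f : M.gradedDual) {r : ℂ} {w : W}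
    (hw : w ∈ M.wt r) :
    (M.contragredient.ev l v f r : M.gradedDual).1 w = ∑ m ∈ Finset.range N,
      oppCoeff d m l * M.pairing f (M.ev (-l) ((𝒱.L 1 ^ m : Module.End ℂ V) v) w) := by
  have h1 := ((h.contragredient_logBounded hg).locFin v f r).map_evalLog
    ((LinearMap.applyₗ w : Module.Dual ℂ W →ₗ[ℂ] ℂ) ∘ₗ M.gradedDual.subtype ∘ₗ
      (M.contragredient.wt r).subtype) l
  simp only [LinearMap.comp_apply, Submodule.subtype_apply, LinearMap.applyₗ_apply_apply,
    contragredient_proj_apply _ _ hw, contragredient_Y] at h1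
  rw [ev, evalAt, h1]
  have h2 : ∀ m : ℕ, FinSupp fun n k => f.1 (M.Y n k ((𝒱.L 1 ^ m : Module.End ℂ V) v) w) :=
    fun m => (h.logBounded.locFin _ w).dual f
  have h3 : (fun n k => f.1 (M.opp n k v w)) = fun n k => ∑ m ∈ Finset.range N,
      ((-1 : ℂ) ^ d / (m.factorial : ℂ)) * ((-1) ^ k * (fun n k => f.1 (M.Y n k
        ((𝒱.L 1 ^ m : Module.End ℂ V) v) w)) ((2 * d - m - 2) - n) k) := by
    funext n k
    rw [opp_eq hv hN, map_sum]
    refine Finset.sum_congr rfl fun m _ => ?_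
    rw [map_smul, smul_eq_mul, show (2 * d - m - 2 - n : ℂ) = 2 * d - m - n - 2 by ring]
    ring
  rw [h3, (evalLog_finset_sum (fun m _ => ((h2 m).reflect _).const_mul _) l).1]
  refine Finset.sum_congr rfl fun m _ => ?_
  have h4 := evalLog_reflect (fun n k => f.1 (M.Y n k ((𝒱.L 1 ^ m : Module.End ℂ V) v) w))
    (2 * d - m - 2) l
  rw [evalLog_const_mul ((h2 m).reflect _), h4,
    ← (h.logBounded.locFin _ w).pairing_evalAt f (-l), oppCoeff, ← mul_assoc, ev]
  congr 4
  ring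

/-- A linear functional on `W` in the graded dual, from a functional on one weight space. -/
def extendDual (M : TwData 𝒱 W) (r : ℂ) : Module.Dual ℂ (M.wt r) →ₗ[ℂ] M.gradedDual where
  toFun ψ := ⟨ψ ∘ₗ M.proj r, by
    refine (Set.finite_singleton r).subset ?_
    rintro s ⟨w, hw, hne⟩
    by_contra hs
    exact hne (by simp [M.proj_ne hs hw])⟩
  map_add' _ _ := rfl
  map_smul' _ _ := rfl

theorem extendDual_apply (r : ℂ) (ψ : Module.Dual ℂ (M.wt r)) (w : W) :
    (M.extendDual r ψ).1 w = ψ (M.proj r w) := rfl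

/-- Finite-dimensional weight spaces are reflexive, so homogeneous functionals on the graded dual
are evaluations. Matrix coefficients of the contragredient thereby reduce to matrix coefficients of
W. -/
theorem exists_eval_of_mem {r : ℂ} (hfin : FiniteDimensional ℂ (M.wt r))
    {φ : M.contragredient.gradedDual} (hφ : φ ∈ M.contragredient.dualWt r) :
    ∃ w ∈ M.wt r, ∀ f, φ.1 f = f.1 w := by
  obtain ⟨w, hw⟩ := (Module.evalEquiv ℂ (M.wt r)).surjective (φ.1 ∘ₗ M.extendDual r)
  refine ⟨w, w.2, fun f => ?_⟩
  have h1 : φ.1 f = φ.1 (M.extendDual r (f.1 ∘ₗ (M.wt r).subtype)) := by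
    rw [← M.contragredient.dual_proj hφ f]
    congr 1
    apply Subtype.ext
    refine sub_eq_zero.1 (M.eq_zero_of_homogeneous _ fun s x hx => ?_)
    rw [LinearMap.sub_apply, sub_eq_zero, extendDual_apply, LinearMap.comp_apply,
      Submodule.subtype_apply]
    by_cases hs : s = r
    · subst hs
      rw [contragredient_proj_apply s f hx, M.proj_of_mem s x hx]
    · rw [M.proj_of_mem_ne s r hs x hx, map_zero]
      exact (M.contragredient.proj r f).2 s hs x hx
  rw [h1]
  have h2 := congrArg (fun F => F (f.1 ∘ₗ (M.wt r).subtype)) hw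
  simpa using h2.symm

end

end TwData

/-! ### Products at the closed end of a branch -/

theorem IsCorr.differentiableAt {F : ℂ × ℂ → ℂ} (h : IsCorr F) {q : ℂ × ℂ}
    (hq : Complex.exp q.1 ≠ Complex.exp q.2) : DifferentiableAt ℂ F q := by
  obtain ⟨t, N, hN, h⟩ := h
  have hd : DifferentiableAt ℂ
      (fun q : ℂ × ℂ => N q * ((Complex.exp q.1 - Complex.exp q.2) ^ t)⁻¹) q := by
    refine (expPoly_differentiable hN q).mul (DifferentiableAt.inv ?_ ?_)
    · fun_prop
    · exact pow_ne_zero _ (sub_ne_zero.2 hq)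
  refine hd.congr_of_eventuallyEq ?_
  have ho : IsOpen {q : ℂ × ℂ | Complex.exp q.1 ≠ Complex.exp q.2} :=
    isOpen_ne_fun (by fun_prop) (by fun_prop)
  filter_upwards [ho.mem_nhds hq] with q' hq' using h q' hq'

theorem exp_ne_exp_of_re_lt {a b : ℂ} (h : a.re < b.re) : Complex.exp a ≠ Complex.exp b := by
  intro e
  have := congrArg norm e
  rw [Complex.norm_exp, Complex.norm_exp, Real.exp_eq_exp] at this
  exact h.ne this

namespace TwData

section

variable {V : Type v} [AddCommGroup V] [Module ℂ V] {𝒱 : VOA V}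
  {W : Type u} [AddCommGroup W] [Module ℂ W] {M : TwData 𝒱 W} {g : V ≃ₗ[ℂ] V}

theorem ev_mem (l : ℂ) (v : V) (w : W) (r : ℂ) : (M.ev l v w r : W) ∈ M.wt r := (M.ev l v w r).2

/-- For homogeneous vectors the contribution of each intermediate weight r is one exponential times
a polynomial in the two logarithms. The degree bounds do not depend on r because K and K' are
uniform in the vector. -/
theorem pairing_ev_ev {a b : ℤ} {r₀ s : ℂ} {u v : V} {w : W} {f : M.gradedDual} (hu : u ∈ 𝒱.wt a)
    (hv : v ∈ 𝒱.wt b) (hw : w ∈ M.wt r₀) (hf : f ∈ M.dualWt s) {K K' : ℕ}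
    (hK : ∀ n k, K ≤ k → ∀ w, M.Y n k u w = 0) (hK' : ∀ n k, K' ≤ k → ∀ w, M.Y n k v w = 0)
    (l l' r : ℂ) :
    M.pairing f (M.ev l u (M.ev l' v w r : W)) =
      Complex.exp ((s - r - a) * l + (r - r₀ - b) * l') *
        ∑ k ∈ Finset.range K, ∑ k' ∈ Finset.range K', l ^ k * l' ^ k' *
          f.1 (M.Y (r + a - s - 1) k u (M.Y (r₀ + b - r - 1) k' v w)) := by
  rw [M.pairing_of_mem hf, ev_homog hu (ev_mem l' v w r) (fun n k hk => hK n k hk _),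
    ev_homog hv hw (fun n k hk => hK' n k hk _), map_sum, Finset.mul_sum]
  refine Finset.sum_congr rfl fun k _ => ?_
  simp only [map_smul, map_sum, smul_eq_mul, Finset.mul_sum]
  refine Finset.sum_congr rfl fun k' _ => ?_
  rw [Complex.exp_add]
  ring

/-- Shifting both logarithms by the same amount changes the exponential by a factor independent of
r. After dividing it out, the terms are polynomials in ε of bounded degree, so the sum extends to ε
= 0. -/
theorem hasSum_pairing_ev_ev_of_shift {a b : ℤ} {r₀ s : ℂ} {u v : V} {w : W} {f : M.gradedDual}
    (hu : u ∈ 𝒱.wt a) (hv : v ∈ 𝒱.wt b) (hw : w ∈ M.wt r₀) (hf : f ∈ M.dualWt s) {K K' : ℕ}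
    (hK : ∀ n k, K ≤ k → ∀ w, M.Y n k u w = 0) (hK' : ∀ n k, K' ≤ k → ∀ w, M.Y n k v w = 0)
    {l l' : ℂ} {F : ℝ → ℂ} (hF : ContinuousAt F 0) {δ : ℝ} (hδ : 0 < δ)
    (h : ∀ ε : ℝ, 0 < ε → ε < δ → HasSum (fun r : ℂ => M.pairing f
      (M.ev (l - ε * Complex.I) u (M.ev (l' - ε * Complex.I) v w r : W))) (F ε)) :
    HasSum (fun r : ℂ => M.pairing f (M.ev l u (M.ev l' v w r : W))) (F 0) := by
  let q : ℂ → Polynomial ℂ := fun r =>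
    ∑ k ∈ Finset.range K, ∑ k' ∈ Finset.range K',
      Polynomial.C (Complex.exp ((s - r - a) * l + (r - r₀ - b) * l') *
        f.1 (M.Y (r + a - s - 1) k u (M.Y (r₀ + b - r - 1) k' v w))) *
      ((Polynomial.C l - Polynomial.C Complex.I * Polynomial.X) ^ k *
        (Polynomial.C l' - Polynomial.C Complex.I * Polynomial.X) ^ k')
  have hq : ∀ r (ε : ℂ), (q r).eval ε = Complex.exp ((s - a - r₀ - b) * (ε * Complex.I)) *
      M.pairing f (M.ev (l - ε * Complex.I) u (M.ev (l' - ε * Complex.I) v w r : W)) := by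
    intro r ε
    rw [pairing_ev_ev hu hv hw hf hK hK', ← mul_assoc, ← Complex.exp_add, Polynomial.eval_finsetSum,
      Finset.mul_sum]
    refine Finset.sum_congr rfl fun k _ => ?_
    rw [Polynomial.eval_finsetSum, Finset.mul_sum]
    refine Finset.sum_congr rfl fun k' _ => ?_
    simp only [Polynomial.eval_mul, Polynomial.eval_C, Polynomial.eval_pow, Polynomial.eval_sub,
      Polynomial.eval_X]
    rw [show (s - a - r₀ - b) * (ε * Complex.I) + ((s - r - a) * (l - ε * Complex.I) +
      (r - r₀ - b) * (l' - ε * Complex.I)) = (s - r - a) * l + (r - r₀ - b) * l' by ring]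
    ring
  have hdeg : ∀ r, (q r).degree < ((K + K' + 1 : ℕ) : WithBot ℕ) := by
    have hlin : ∀ (c : ℂ) (k : ℕ),
        ((Polynomial.C c - Polynomial.C Complex.I * Polynomial.X) ^ k).natDegree ≤ k := by
      intro c k
      refine Polynomial.natDegree_pow_le.trans ?_
      have : (Polynomial.C c - Polynomial.C Complex.I * Polynomial.X).natDegree ≤ 1 := by
        compute_degree
      nlinarith
    intro r
    refine lt_of_le_of_lt Polynomial.degree_le_natDegree ?_
    rw [Nat.cast_lt, Nat.lt_succ_iff]
    refine Polynomial.natDegree_sum_le_of_forall_le _ _ fun k hk => ?_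
    refine Polynomial.natDegree_sum_le_of_forall_le _ _ fun k' hk' => ?_
    refine (Polynomial.natDegree_C_mul_le _ _).trans (Polynomial.natDegree_mul_le.trans ?_)
    have := hlin l k
    have := hlin l' k'
    have := Finset.mem_range.1 hk
    have := Finset.mem_range.1 hk'
    omega
  have key := hasSum_eval_zero_of_forall_pos (q := q) hdeg
    (F := fun ε : ℝ => Complex.exp ((s - a - r₀ - b) * (ε * Complex.I)) * F ε) ?_ hδ ?_
  · simpa [hq] using key
  · exact ContinuousAt.mul (by fun_prop) hF
  · intro ε h1 h2
    simp only [hq]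
    exact (h ε h1 h2).mul_left _

theorem continuousAt_shift {F : ℂ × ℂ → ℂ} (hF : IsCorr F) {l l' : ℂ}
    (hl : Complex.exp l ≠ Complex.exp l') :
    ContinuousAt (fun ε : ℝ => F (l - ε * Complex.I, l' - ε * Complex.I)) 0 := by
  have h := (hF.differentiableAt (q := (l, l')) hl).continuousAt
  refine ContinuousAt.comp (g := F) (f := fun ε : ℝ => (l - ε * Complex.I, l' - ε * Complex.I)) ?_
    (by fun_prop)
  simpa using h

theorem logBranch_exp_shift {q : ℤ} {l : ℂ}
    (h₂ : l.im ≤ 2 * Real.pi * (q + 1)) {ε : ℝ} (hε : 0 < ε) (h : ε < l.im - 2 * Real.pi * q) :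
    logBranch q (Complex.exp (l - ε * Complex.I)) = l - ε * Complex.I := by
  refine logBranch_exp ?_ ?_ <;> simp <;> linarith

/-- Duality extends to pairs of logarithms with imaginary parts in `(2πq, 2π(q+1)]`. -/
theorem DualAt.hasSum_of_im_mem {a b : ℤ} {r₀ s : ℂ} {u v : V} {w : W} {f : M.gradedDual}
    (hM : M.IsGeneralizedTwisted g) (hg : 𝒱.IsAutomorphism g) {F : ℂ × ℂ → ℂ}
    (hd : M.DualAt u v w f F) (hF : IsCorr F)
    (hu : u ∈ 𝒱.wt a) (hv : v ∈ 𝒱.wt b) (hw : w ∈ M.wt r₀) (hf : f ∈ M.dualWt s) {q : ℤ}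
    {l l' : ℂ} (h₁ : 2 * Real.pi * q < l.im) (h₂ : l.im ≤ 2 * Real.pi * (q + 1))
    (h₁' : 2 * Real.pi * q < l'.im) (h₂' : l'.im ≤ 2 * Real.pi * (q + 1)) :
    (l'.re < l.re →
      HasSum (fun r : ℂ => M.pairing f (M.ev l u (M.ev l' v w r : W))) (F (l, l'))) ∧
    (l.re < l'.re →
      HasSum (fun r : ℂ => M.pairing f (M.ev l' v (M.ev l u w r : W))) (F (l, l'))) := by
  obtain ⟨K, hK⟩ := hM.exists_log_bound hg u
  obtain ⟨K', hK'⟩ := hM.exists_log_bound hg v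
  -- For ε below this bound, both logarithms shifted down by εi lie strictly inside the range of
  -- branch q, where the original duality applies.
  have hδ : 0 < min (l.im - 2 * Real.pi * q) (l'.im - 2 * Real.pi * q) :=
    lt_min (by linarith) (by linarith)
  have hnorm : ∀ (l : ℂ) (ε : ℝ), ‖Complex.exp (l - ε * Complex.I)‖ = Real.exp l.re := by
    intro l ε
    rw [Complex.norm_exp]
    simp
  constructor
  · intro hre
    have h := hasSum_pairing_ev_ev_of_shift hu hv hw hf hK hK' (l := l) (l' := l')
      (F := fun ε : ℝ => F (l - ε * Complex.I, l' - ε * Complex.I))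
      (continuousAt_shift hF (exp_ne_exp_of_re_lt hre).symm) hδ fun ε hε hεδ => ?_
    · simpa using h
    · have h := (hd q (Complex.exp (l - ε * Complex.I)) (Complex.exp (l' - ε * Complex.I))).1
      rw [hnorm, hnorm, logBranch_exp_shift h₂ hε (hεδ.trans_le (min_le_left _ _)),
        logBranch_exp_shift h₂' hε (hεδ.trans_le (min_le_right _ _))] at h
      exact h (Real.exp_lt_exp.2 hre) (Real.exp_pos _)
  · intro hre
    have h := hasSum_pairing_ev_ev_of_shift hv hu hw hf hK' hK (l := l') (l' := l)
      (F := fun ε : ℝ => F (l - ε * Complex.I, l' - ε * Complex.I))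
      (continuousAt_shift hF (exp_ne_exp_of_re_lt hre)) hδ fun ε hε hεδ => ?_
    · simpa using h
    · have h := (hd q (Complex.exp (l - ε * Complex.I)) (Complex.exp (l' - ε * Complex.I))).2.1
      rw [hnorm, hnorm, logBranch_exp_shift h₂ hε (hεδ.trans_le (min_le_left _ _)),
        logBranch_exp_shift h₂' hε (hεδ.trans_le (min_le_right _ _))] at h
      exact h (Real.exp_lt_exp.2 hre) (Real.exp_pos _)

end

end TwData

/-- With z₁ = (1 + x)z₂ one has z₁ - z₂ = z₂x, so the only singularity in |x| < 1 is a pole at 0,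
cleared by x^T; log(1 + x) is analytic there. -/
theorem IsCorr.exists_disc {F : ℂ × ℂ → ℂ} (h : IsCorr F) (l : ℂ) : ∃ t : ℕ, ∀ T, t ≤ T →
    ∃ G : ℂ → ℂ, DifferentiableOn ℂ G (Metric.ball 0 1) ∧
      ∀ x, x ≠ 0 → ‖x‖ < 1 → x ^ T * F (l + Complex.log (1 + x), l) = G x := by
  obtain ⟨t, N, hN, h⟩ := h
  refine ⟨t, fun T hT => ⟨fun x => x ^ (T - t) * (N (l + Complex.log (1 + x), l) *
    (Complex.exp l ^ t)⁻¹), fun x hx => ?_, fun x hx hx1 => ?_⟩⟩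
  · have hx1 : ‖x‖ < 1 := by simpa using hx
    have hs := Complex.mem_slitPlane_of_norm_lt_one hx1
    refine DifferentiableAt.differentiableWithinAt ?_
    refine DifferentiableAt.mul (by fun_prop) (DifferentiableAt.mul_const ?_ _)
    have h1 : DifferentiableAt ℂ (fun x : ℂ => (l + Complex.log (1 + x), l)) x := by
      refine DifferentiableAt.prodMk (DifferentiableAt.const_add _ ?_) (by fun_prop)
      exact (DifferentiableAt.clog (by fun_prop) hs)
    exact (expPoly_differentiable hN _).comp x h1
  · have hne : (1 : ℂ) + x ≠ 0 := Complex.slitPlane_ne_zero (Complex.mem_slitPlane_of_norm_lt_one hx1)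
    have he : Complex.exp (l + Complex.log (1 + x)) - Complex.exp l = Complex.exp l * x := by
      rw [Complex.exp_add, Complex.exp_log hne]
      ring
    have hz := Complex.exp_ne_zero l
    rw [h]
    · simp only [he]
      obtain ⟨j, rfl⟩ := Nat.exists_eq_add_of_le hT
      rw [Nat.add_sub_cancel_left, pow_add, mul_pow]
      field_simp
    · rw [← sub_ne_zero]
      simp only [he]
      exact mul_ne_zero hz hx

/-- The bound on the arguments ensures that the difference of the two logarithms is the principal
logarithm of z₁/z₂. -/
theorem logBranch_eq_add_log {z₁ z₂ : ℂ} (h₁ : z₁ ≠ 0) (h₂ : z₂ ≠ 0) (p : ℤ)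
    (h : |argPos z₁ - argPos z₂| < Real.pi / 2) :
    logBranch p z₁ = logBranch p z₂ + Complex.log (z₁ / z₂) := by
  have hd : Complex.exp (logBranch p z₁ - logBranch p z₂) = z₁ / z₂ := by
    rw [Complex.exp_sub, exp_logBranch p h₁, exp_logBranch p h₂]
  have him : (logBranch p z₁ - logBranch p z₂).im = argPos z₁ - argPos z₂ := by
    rw [Complex.sub_im, logBranch_im, logBranch_im]
    ring
  rw [abs_lt] at h
  rw [← hd, Complex.log_exp]
  · ring
  · rw [him]
    linarith [Real.pi_pos]
  · rw [him]
    linarith [Real.pi_pos]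

theorem VOA.ncoeff_eq_zero {V : Type v} [AddCommGroup V] [Module ℂ V] (𝒱 : VOA V) {a b : ℤ}
    {u v : V} (hu : u ∈ 𝒱.wt a) (hv : v ∈ 𝒱.wt b) {n : ℤ} (hn : a + b - 𝒱.minWt ≤ n) :
    ncoeff (𝒱.Y u) n v = 0 := by
  have h := 𝒱.graded a b n u v hu hv
  rwa [𝒱.wt_eq_bot_of_lt (by omega), Submodule.mem_bot] at h

/-! ### Iterates in the coordinate x = z₁/z₂ - 1. -/

namespace TwData

section

variable {V : Type v} [AddCommGroup V] [Module ℂ V] {𝒱 : VOA V}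
  {W : Type u} [AddCommGroup W] [Module ℂ W] {M : TwData 𝒱 W} {g : V ≃ₗ[ℂ] V}

variable (M) in
/-- The coefficient of `x^m` in the expansion of an iterate at `z₁ = (1 + x)z₂`. -/
def iterCoeff (u v : V) (w : W) (f : M.gradedDual) (l : ℂ) (m : ℤ) : ℂ :=
  Complex.exp l ^ m * M.pairing f (M.ev l (ncoeff (𝒱.Y u) (-m - 1) v) w)

variable (M) in
/-- The expansion of `x^T F(log (1 + x) + l, l)` is that of the iterate. -/
def DiscAt (u v : V) (w : W) (f : M.gradedDual) (F : ℂ × ℂ → ℂ) (l : ℂ) (T : ℕ) : Prop :=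
  ∃ G : ℂ → ℂ, DifferentiableOn ℂ G (Metric.ball 0 1) ∧
    (∀ x, x ≠ 0 → ‖x‖ < 1 → x ^ T * F (l + Complex.log (1 + x), l) = G x) ∧
    HasFPowerSeriesAt G
      (FormalMultilinearSeries.ofScalars ℂ fun k : ℕ => M.iterCoeff u v w f l (k - T)) 0

theorem iterCoeff_eq_zero {a b : ℤ} {u v : V} (hu : u ∈ 𝒱.wt a) (hv : v ∈ 𝒱.wt b) (w : W)
    (f : M.gradedDual) (l : ℂ) {T : ℕ} (hT : (a + b - 𝒱.minWt).toNat ≤ T) {m : ℤ}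
    (hm : m < -(T : ℤ)) : M.iterCoeff u v w f l m = 0 := by
  rw [iterCoeff, 𝒱.ncoeff_eq_zero hu hv (by omega), ev_zero_left, map_zero, mul_zero]

theorem LogBounded.hasSum_iterate_iff (hM : M.LogBounded) {a b : ℤ} {u v : V} (hu : u ∈ 𝒱.wt a)
    (hv : v ∈ 𝒱.wt b) (w : W) (f : M.gradedDual) (l x S : ℂ) :
    HasSum (fun r : ℤ => M.pairing f (M.ev l (𝒱.evalY u (Complex.exp l * x) v r) w)) S ↔
      HasSum (fun m : ℤ => x ^ m * M.iterCoeff u v w f l m) S := by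
  rw [← (Equiv.addRight (a + b)).hasSum_iff]
  refine iff_of_eq (congrArg (fun f => HasSum f S) (funext fun m => ?_))
  simp only [Function.comp_apply, Equiv.coe_addRight, iterCoeff]
  rw [𝒱.evalY_of_mem hu hv, hM.ev_smul_left, map_smul, smul_eq_mul,
    show m + (a + b) - a - b = m by ring, show a + b - (m + (a + b)) - 1 = -m - 1 by ring, mul_zpow]
  ring

/-- Duality gives the sum of the iterate only where the arguments are close, but points x
accumulating at 0 already determine a power series. -/
theorem DualAt.exists_discAt (hM : M.LogBounded) {a b : ℤ} {u v : V} {w : W} {f : M.gradedDual}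
    {F : ℂ × ℂ → ℂ} (hd : M.DualAt u v w f F) (hF : IsCorr F) (hu : u ∈ 𝒱.wt a) (hv : v ∈ 𝒱.wt b)
    (l : ℂ) : ∃ t : ℕ, ∀ T, t ≤ T → M.DiscAt u v w f F l T := by
  obtain ⟨t, ht⟩ := hF.exists_disc l
  refine ⟨max t (a + b - 𝒱.minWt).toNat, fun T hT => ?_⟩
  obtain ⟨G, hG, hGF⟩ := ht T ((le_max_left _ _).trans hT)
  refine ⟨G, hG, hGF, (hasSum_of_frequently one_pos hG ?_).1⟩
  obtain ⟨p, hp1, hp2, hp⟩ := exists_logBranch_eq l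
  -- The points x = is with s > 0 turn z₂ slightly upwards. The logarithm l may lie on the lower
  -- edge of its branch, so the upward direction is the one that stays in it.
  have hten : Tendsto (fun s : ℝ => (s : ℂ) * Complex.I) (𝓝[>] 0) (𝓝[≠] 0) := by
    refine tendsto_nhdsWithin_iff.2 ⟨?_, ?_⟩
    · have : ContinuousAt (fun s : ℝ => (s : ℂ) * Complex.I) 0 := by fun_prop
      refine (tendsto_nhdsWithin_of_tendsto_nhds ?_)
      simpa [ContinuousAt] using this
    · filter_upwards [self_mem_nhdsWithin] with s hs
      have : s ≠ 0 := (Set.mem_Ioi.1 hs).ne'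
      simp [this]
  refine hten.frequently (Eventually.frequently ?_)
  have hargt : Tendsto (fun s : ℝ => Complex.arg (1 + s * Complex.I)) (𝓝[>] 0) (𝓝 0) := by
    have : ContinuousAt (fun s : ℝ => Complex.arg (1 + s * Complex.I)) 0 := by
      refine ContinuousAt.comp (g := Complex.arg) (Complex.continuousAt_arg ?_) (by fun_prop)
      simp
    refine (tendsto_nhdsWithin_of_tendsto_nhds ?_)
    simpa [ContinuousAt] using this
  have hδ : 0 < min (2 * Real.pi * (p + 1) - l.im) (Real.pi / 2) :=
    lt_min (by linarith) (by positivity)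
  filter_upwards [self_mem_nhdsWithin, hargt.eventually_lt_const hδ,
    Ioo_mem_nhdsGT (zero_lt_one (α := ℝ))] with s hs harg hs1
  have hs0 : s ≠ 0 := (Set.mem_Ioi.1 hs).ne'
  have hx : (s : ℂ) * Complex.I ≠ 0 := by simp [hs0]
  have hx1 : ‖(s : ℂ) * Complex.I‖ < 1 := by
    simp only [norm_mul, Complex.norm_real, Complex.norm_I, mul_one, Real.norm_eq_abs]
    rw [abs_lt]
    exact ⟨by linarith [hs1.1], hs1.2⟩
  have hne : (1 : ℂ) + s * Complex.I ≠ 0 :=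
    Complex.slitPlane_ne_zero (Complex.mem_slitPlane_of_norm_lt_one hx1)
  have harg0 : 0 ≤ Complex.arg (1 + s * Complex.I) := by
    rw [Complex.arg_nonneg_iff]
    simpa using hs1.1.le
  have hl : logBranch p (Complex.exp l * (1 + s * Complex.I)) =
      l + Complex.log (1 + s * Complex.I) := by
    conv_lhs => rw [← Complex.exp_log hne, ← Complex.exp_add]
    refine logBranch_exp ?_ ?_ <;> rw [Complex.add_im, Complex.log_im]
    · linarith
    · linarith [harg.trans_le (min_le_left _ _)]
  have hz := Complex.exp_ne_zero l
  have hsum : HasSum (fun m : ℤ => ((s : ℂ) * Complex.I) ^ m * M.iterCoeff u v w f l m)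
      (F (l + Complex.log (1 + s * Complex.I), l)) := by
    rw [← hM.hasSum_iterate_iff hu hv]
    have h := (hd p (Complex.exp l * (1 + s * Complex.I)) (Complex.exp l)).2.2
    rw [hl, hp, show Complex.exp l * (1 + s * Complex.I) - Complex.exp l =
      Complex.exp l * (s * Complex.I) by ring, norm_mul] at h
    refine (h (mul_lt_of_lt_one_right (norm_pos_iff.2 hz) hx1)
      (mul_pos (norm_pos_iff.2 hz) (norm_pos_iff.2 hx))).2 ?_
    have e1 := logBranch_im p (Complex.exp l * (1 + s * Complex.I))
    have e2 := logBranch_im p (Complex.exp l)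
    rw [hl, Complex.add_im, Complex.log_im] at e1
    rw [hp] at e2
    rw [show argPos (Complex.exp l * (1 + s * Complex.I)) - argPos (Complex.exp l) =
      Complex.arg (1 + s * Complex.I) by linarith, abs_of_nonneg harg0]
    exact harg.trans_le (min_le_right _ _)
  rw [hasSum_int_iff (fun m hm => iterCoeff_eq_zero hu hv w f l
    ((le_max_right _ _).trans hT) hm) hx, hGF _ hx hx1] at hsum
  exact hsum

/-- Conversely, expansions on the discs |x| < 1 around all logarithms yield absolute convergence for
|z₁ - z₂| < |z₂|, with the prescribed sum wherever log z₁ is l + log(1 + x). -/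
theorem LogBounded.iterate_of_discAt (hM : M.LogBounded) {a b : ℤ} {u v : V} {w : W}
    {f : M.gradedDual} {F : ℂ × ℂ → ℂ} (hu : u ∈ 𝒱.wt a) (hv : v ∈ 𝒱.wt b)
    (h : ∀ l, ∃ T : ℕ, (a + b - 𝒱.minWt).toNat ≤ T ∧ M.DiscAt u v w f F l T) (p : ℤ) (z₁ z₂ : ℂ)
    (h₁ : ‖z₁ - z₂‖ < ‖z₂‖) (h₂ : 0 < ‖z₁ - z₂‖) :
    Summable (fun r : ℤ => M.pairing f (M.ev (logBranch p z₂) (𝒱.evalY u (z₁ - z₂) v r) w)) ∧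
      (|argPos z₁ - argPos z₂| < Real.pi / 2 →
        HasSum (fun r : ℤ => M.pairing f (M.ev (logBranch p z₂) (𝒱.evalY u (z₁ - z₂) v r) w))
          (F (logBranch p z₁, logBranch p z₂))) := by
  obtain ⟨T, hT, G, hG, hGF, hps⟩ := h (logBranch p z₂)
  have hz₂ : z₂ ≠ 0 := norm_pos_iff.1 (h₂.trans h₁)
  have hz₁ : z₁ ≠ 0 := by
    rintro rfl
    simp at h₁
  let x := (z₁ - z₂) / z₂
  have hx : x ≠ 0 := div_ne_zero (norm_pos_iff.1 h₂) hz₂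
  have hx1 : ‖x‖ < 1 := by
    rw [norm_div, div_lt_one (norm_pos_iff.2 hz₂)]
    exact h₁
  have he : z₁ - z₂ = Complex.exp (logBranch p z₂) * x := by
    rw [exp_logBranch p hz₂]
    simp only [x]
    field_simp
  have hs : HasSum (fun r : ℤ => M.pairing f (M.ev (logBranch p z₂) (𝒱.evalY u (z₁ - z₂) v r) w))
      (F (logBranch p z₂ + Complex.log (1 + x), logBranch p z₂)) := by
    rw [he, hM.hasSum_iterate_iff hu hv, hasSum_int_iff
      (fun m hm => iterCoeff_eq_zero hu hv w f _ hT hm) hx, hGF x hx hx1]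
    exact hasSum_of_hasFPowerSeriesAt hG hps hx1
  refine ⟨hs.summable, fun harg => ?_⟩
  rw [logBranch_eq_add_log hz₁ hz₂ p harg]
  convert hs using 5
  simp only [x]
  field_simp
  ring

end

end TwData

/-! ### Duality for contragredient modules -/

theorem oppCoeff_fst_mem (d : ℤ) (m : ℕ) : (fun q : ℂ × ℂ => TwData.oppCoeff d m q.1) ∈ expPoly := by
  exact expPoly.smul_mem (expPoly_fst _) ((-1 : ℂ) ^ d / (m.factorial : ℂ))

theorem oppCoeff_snd_mem (d : ℤ) (m : ℕ) : (fun q : ℂ × ℂ => TwData.oppCoeff d m q.2) ∈ expPoly := by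
  exact expPoly.smul_mem (expPoly_snd _) ((-1 : ℂ) ^ d / (m.factorial : ℂ))

/-- The matrix coefficient of the contragredient in terms of those of the module. -/
def oppCorr (a b : ℤ) (N : ℕ) (F : ℕ → ℕ → ℂ × ℂ → ℂ) : ℂ × ℂ → ℂ := fun q =>
  ∑ i ∈ Finset.range N, ∑ j ∈ Finset.range N, TwData.oppCoeff a i q.1 * TwData.oppCoeff b j q.2 * F i j (-q)

theorem isCorr_oppCorr (a b : ℤ) (N : ℕ) {F : ℕ → ℕ → ℂ × ℂ → ℂ} (h : ∀ i j, IsCorr (F i j)) :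
    IsCorr (oppCorr a b N F) := by
  have : oppCorr a b N F = ∑ i ∈ Finset.range N, ∑ j ∈ Finset.range N,
      ((fun q : ℂ × ℂ => TwData.oppCoeff a i q.1) * (fun q : ℂ × ℂ => TwData.oppCoeff b j q.2)) *
        (fun q => F i j (-q)) := by
    funext q
    simp [oppCorr, Finset.sum_apply]
  rw [this]
  exact IsCorr.sum _ fun i _ => IsCorr.sum _ fun j _ =>
    (h i j).neg.mul (expPoly.mul_mem (oppCoeff_fst_mem a i) (oppCoeff_snd_mem b j))

theorem sum_antidiagonal_snd {A : Type*} [AddCommMonoid A] (n : ℕ) (f : ℕ × ℕ → A) :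
    ∑ p ∈ Finset.HasAntidiagonal.antidiagonal n, f p =
      ∑ q ∈ Finset.range (n + 1), f (n - q, q) := by
  rw [Finset.Nat.antidiagonal_eq_map', Finset.sum_map]
  rfl

namespace TwData

section

variable {V : Type v} [AddCommGroup V] [Module ℂ V] {𝒱 : VOA V}
  {W : Type u} [AddCommGroup W] [Module ℂ W] {M : TwData 𝒱 W} {g : V ≃ₗ[ℂ] V}

/-- Transposition reverses the order of the two operators while inversion exchanges |z₁| > |z₂| with
its opposite. The correlation functions of W therefore also serve for W'. -/
theorem pairing_contragredient_ev_ev (hM : M.IsGeneralizedTwisted g) (hg : 𝒱.IsAutomorphism g)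
    {a b : ℤ} {s : ℂ} {u v : V} (hu : u ∈ 𝒱.wt a) (hv : v ∈ 𝒱.wt b) (f : M.gradedDual)
    {φ : M.contragredient.gradedDual} (hφ : φ ∈ M.contragredient.dualWt s) {w : W}
    (hw : w ∈ M.wt s) (hφw : ∀ f, φ.1 f = f.1 w) {N : ℕ} (hNa : (a - 𝒱.minWt).toNat + 1 ≤ N)
    (hNb : (b - 𝒱.minWt).toNat + 1 ≤ N) (l l' r : ℂ) :
    M.contragredient.pairing φ
        (M.contragredient.ev l u (M.contragredient.ev l' v f r : M.gradedDual)) =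
      ∑ i ∈ Finset.range N, ∑ j ∈ Finset.range N, oppCoeff a i l * oppCoeff b j l' *
        M.pairing f (M.ev (-l') ((𝒱.L 1 ^ j : Module.End ℂ V) v)
          (M.ev (-l) ((𝒱.L 1 ^ i : Module.End ℂ V) u) w r : W)) := by
  rw [M.contragredient.pairing_of_mem hφ, hφw, hM.contragredient_ev hg hu hNa l _ hw]
  refine Finset.sum_congr rfl fun i _ => ?_
  rw [M.pairing_of_mem (ev_mem (M := M.contragredient) l' v f r),
    hM.contragredient_ev hg hv hNb l' _ (ev_mem (-l) _ w r), Finset.mul_sum]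
  exact Finset.sum_congr rfl fun j _ => by ring

/-- Negating a logarithm moves the included endpoint of the branch interval from the bottom to the
top, which is why duality is needed at the closed upper end. -/
theorem neg_logBranch_im (p : ℤ) (z : ℂ) :
    2 * Real.pi * ((-p - 1 : ℤ) : ℝ) < (-logBranch p z).im ∧
      (-logBranch p z).im ≤ 2 * Real.pi * (((-p - 1 : ℤ) : ℝ) + 1) := by
  rw [Complex.neg_im, logBranch_im]
  push_cast
  constructor <;> linarith [argPos_nonneg z, argPos_lt z]

/-- The right side has exactly the coefficients that `IsAsymp.euler` attaches to (1 + x)^e G(-x/(1 +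
x)) with e = i - 2a + T. The proof rewrites L(1)^k on the modes of u on v by `L_one_pow_ncoeff` and
compares binomials. -/
theorem iterCoeff_contragredient (hM : M.IsGeneralizedTwisted g) (hg : 𝒱.IsAutomorphism g)
    {a b : ℤ} {s : ℂ} {u v : V} (hu : u ∈ 𝒱.wt a) (hv : v ∈ 𝒱.wt b) (f : M.gradedDual)
    {φ : M.contragredient.gradedDual} (hφ : φ ∈ M.contragredient.dualWt s) {w : W}
    (hw : w ∈ M.wt s) (hφw : ∀ f, φ.1 f = f.1 w) {N : ℕ} (hNa : (a - 𝒱.minWt).toNat + 1 ≤ N)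
    (hNb : (b - 𝒱.minWt).toNat + 1 ≤ N) (l : ℂ) {T : ℕ} (hT : (a + b - 𝒱.minWt).toNat ≤ T)
    (n : ℕ) :
    M.contragredient.iterCoeff u v f φ l (n - T) =
      ∑ i ∈ Finset.range N, ∑ j ∈ Finset.range N,
        ((-1) ^ (a + b + T) * Complex.exp l ^ (i - 2 * a + j - 2 * b) * (i.factorial : ℂ)⁻¹ *
          (j.factorial : ℂ)⁻¹) *
        ∑ q ∈ Finset.HasAntidiagonal.antidiagonal n,
          M.iterCoeff ((𝒱.L 1 ^ i : Module.End ℂ V) u) ((𝒱.L 1 ^ j : Module.End ℂ V) v) w f (-l)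
            (q.1 - T) * (-1) ^ q.1 * ((Ring.choose ((i - 2 * a + T) - q.1) q.2 : ℤ) : ℂ) := by
  have hL := hM.logBounded
  have hz := Complex.exp_ne_zero l
  let Φ : V →ₗ[ℂ] ℂ := M.pairing f ∘ₗ (hL.evₗ (-l)).flip w
  have hΦ : ∀ x, M.pairing f (M.ev (-l) x w) = Φ x := fun x => rfl
  have hd := 𝒱.graded a b (-((n : ℤ) - T) - 1) u v hu hv
  let d : ℤ := a + b - (-((n : ℤ) - T) - 1) - 1
  -- K exceeds the nilpotency bound for L(1) on the iterated vector and also covers the box i, j <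
  -- N, q ≤ n. Outside this box the terms vanish.
  let K := N + N + (n + 1) + (d - 𝒱.minWt).toNat + 1
  rw [iterCoeff, M.contragredient.pairing_of_mem hφ, hφw,
    hM.contragredient_ev hg hd (N := K) (by omega) l f hw]
  have hterm : ∀ k : ℕ, oppCoeff d k l * M.pairing f (M.ev (-l)
      ((𝒱.L 1 ^ k : Module.End ℂ V) (ncoeff (𝒱.Y u) (-((n : ℤ) - T) - 1) v)) w) =
      tripleSum k fun i j q => (-1) ^ d * Complex.exp l ^ (i + j + q - 2 * d) *
        (((Ring.choose (2 * a - i - (-((n : ℤ) - T) - 1) - 2) q : ℤ) : ℂ) * (i.factorial : ℂ)⁻¹ *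
          (j.factorial : ℂ)⁻¹) *
        Φ (ncoeff (𝒱.Y ((𝒱.L 1 ^ i : Module.End ℂ V) u)) (-((n : ℤ) - T) - 1 + q)
          ((𝒱.L 1 ^ j : Module.End ℂ V) v)) := by
    intro k
    have h := congrArg Φ (𝒱.L_one_pow_ncoeff hu (-((n : ℤ) - T) - 1) v k)
    rw [map_smul, smul_eq_mul] at h
    rw [hΦ, oppCoeff, div_eq_mul_inv,
      show (-1 : ℂ) ^ d * (k.factorial : ℂ)⁻¹ * Complex.exp ((k - 2 * d) * l) * Φ
        ((𝒱.L 1 ^ k : Module.End ℂ V) (ncoeff (𝒱.Y u) (-((n : ℤ) - T) - 1) v)) =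
        (-1 : ℂ) ^ d * Complex.exp ((k - 2 * d) * l) * ((k.factorial : ℂ)⁻¹ * Φ
        ((𝒱.L 1 ^ k : Module.End ℂ V) (ncoeff (𝒱.Y u) (-((n : ℤ) - T) - 1) v))) by ring, h]
    simp only [tripleSum, map_sum, map_smul, smul_eq_mul, Finset.mul_sum]
    refine Finset.sum_congr rfl fun p hp => Finset.sum_congr rfl fun p' hp' => ?_
    have e1 := Finset.HasAntidiagonal.mem_antidiagonal.1 hp
    have e2 := Finset.HasAntidiagonal.mem_antidiagonal.1 hp'
    have e3 : Complex.exp (((k : ℂ) - 2 * (d : ℤ)) * l) =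
        Complex.exp l ^ ((p.1 : ℤ) + p'.1 + p'.2 - 2 * d) := by
      rw [← Complex.exp_int_mul, ← e1, ← e2]
      congr 1
      push_cast
      ring
    rw [e3]
    ring
  rw [Finset.sum_congr rfl fun k _ => hterm k, sum_tripleSum (N₁ := N) (N₂ := N) (N₃ := n + 1)
    (by omega), Finset.mul_sum]
  · refine Finset.sum_congr rfl fun i _ => ?_
    rw [Finset.mul_sum]
    refine Finset.sum_congr rfl fun j _ => ?_
    rw [Finset.mul_sum, Finset.mul_sum, sum_antidiagonal_snd]
    refine Finset.sum_congr rfl fun q hq => ?_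
    obtain ⟨k, rfl⟩ := Nat.exists_eq_add_of_le' (Nat.lt_succ_iff.1 (Finset.mem_range.1 hq))
    simp only [Nat.add_sub_cancel, iterCoeff, hΦ]
    -- The binomial top is rewritten as -b - 1 + q, the form to which upper negation applies.
    rw [show (2 * a - i - (-(((k + q : ℕ) : ℤ) - T) - 1) - 2) =
        -((i : ℤ) - 2 * a + T - k) - 1 + q by push_cast; ring, Ring.choose_sub_succ,
      show -(((k + q : ℕ) : ℤ) - T) - 1 + q = -((k : ℤ) - T) - 1 by push_cast; ring]
    have hd' : d = a + b + T + k + q - 2 * T := by simp only [d]; push_cast; ring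
    have e1 : (-1 : ℂ) ^ d = (-1) ^ (a + b + T) * (-1) ^ k * (-1) ^ q := by
      rw [hd', zpow_sub₀ (by norm_num), zpow_add₀ (by norm_num), zpow_add₀ (by norm_num)]
      simp [zpow_mul]
    have e2 : Complex.exp l ^ (((k + q : ℕ) : ℤ) - T) * Complex.exp l ^ ((i : ℤ) + j + q - 2 * d) =
        Complex.exp l ^ ((i : ℤ) - 2 * a + j - 2 * b) * Complex.exp (-l) ^ ((k : ℤ) - T) := by
      rw [Complex.exp_neg, inv_zpow', ← zpow_add₀ hz, ← zpow_add₀ hz, hd']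
      congr 1
      push_cast
      ring
    have e3 : (-1 : ℂ) ^ q * (-1) ^ q = 1 := by rw [← mul_pow]; simp
    rw [e1]
    push_cast
    push_cast at e2
    linear_combination ((-1) ^ (a + b + T) * (-1 : ℂ) ^ k * ((-1) ^ q * (-1) ^ q) *
      ((Ring.choose ((i : ℤ) - 2 * a + T - k) q : ℤ) : ℂ) * (i.factorial : ℂ)⁻¹ *
      (j.factorial : ℂ)⁻¹ * Φ (ncoeff (𝒱.Y ((𝒱.L 1 ^ i : Module.End ℂ V) u)) (-((k : ℤ) - T) - 1)
        ((𝒱.L 1 ^ j : Module.End ℂ V) v))) * e2 +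
      ((-1) ^ (a + b + T) * (-1 : ℂ) ^ k *
      ((Ring.choose ((i : ℤ) - 2 * a + T - k) q : ℤ) : ℂ) * (i.factorial : ℂ)⁻¹ *
      (j.factorial : ℂ)⁻¹ * Φ (ncoeff (𝒱.Y ((𝒱.L 1 ^ i : Module.End ℂ V) u)) (-((k : ℤ) - T) - 1)
        ((𝒱.L 1 ^ j : Module.End ℂ V) v))) * (Complex.exp l ^ ((i : ℤ) - 2 * a + j - 2 * b) *
        Complex.exp (-l) ^ ((k : ℤ) - T)) * e3
  · intro i j q hi
    rw [𝒱.L_one_pow_eq_zero hu (hNa.trans hi), map_zero, map_zero]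
    simp
  · intro i j q hj
    rw [𝒱.L_one_pow_eq_zero hv (hNb.trans hj)]
    simp
  · intro i j q hq
    rw [𝒱.ncoeff_eq_zero (𝒱.L_one_pow_mem hu i) (𝒱.L_one_pow_mem hv j) (by omega), map_zero,
      mul_zero]

end

end TwData

theorem IsAsymp.const_mul {G : ℂ → ℂ} {b : ℕ → ℂ} (h : IsAsymp G b) (c : ℂ) :
    IsAsymp (fun x => c * G x) (fun n => c * b n) := by
  intro N
  refine ((h N).const_mul_left c).congr_left fun x => ?_
  rw [mul_sub, Finset.mul_sum]
  simp only [mul_assoc]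

theorem IsAsymp.sum {ι : Type*} {s : Finset ι} {G : ι → ℂ → ℂ} {b : ι → ℕ → ℂ}
    (h : ∀ i ∈ s, IsAsymp (G i) (b i)) :
    IsAsymp (fun x => ∑ i ∈ s, G i x) (fun n => ∑ i ∈ s, b i n) := by
  intro N
  refine (Asymptotics.IsBigO.sum fun i hi => h i hi N).congr_left fun x => ?_
  simp only [Finset.sum_apply, Finset.sum_mul]
  rw [Finset.sum_sub_distrib]
  congr 1
  exact Finset.sum_comm

theorem log_one_add_neg_div {x : ℂ} (hx : ‖x‖ < 1) :
    Complex.log (1 + -x / (1 + x)) = -Complex.log (1 + x) := by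
  have hs := Complex.mem_slitPlane_of_norm_lt_one hx
  have hne := Complex.slitPlane_ne_zero hs
  rw [show 1 + -x / (1 + x) = (1 + x)⁻¹ by field_simp; ring, Complex.log_inv]
  exact (Complex.mem_slitPlane_iff_arg.1 hs).1

theorem norm_neg_div_one_add_lt {x : ℂ} (hx : ‖x‖ < 1 / 2) : ‖-x / (1 + x)‖ < 1 := by
  have h : 1 - ‖x‖ ≤ ‖1 + x‖ := by
    have := norm_sub_norm_le (1 : ℂ) (-x)
    simpa using this
  rw [norm_div, norm_neg, div_lt_one (by linarith)]
  linarith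

namespace TwData

section

variable {V : Type v} [AddCommGroup V] [Module ℂ V] {𝒱 : VOA V}
  {W : Type u} [AddCommGroup W] [Module ℂ W] {M : TwData 𝒱 W} {g : V ≃ₗ[ℂ] V}

theorem oppCoeff_add_log (d : ℤ) (m : ℕ) (l : ℂ) {x : ℂ} (hx : 1 + x ≠ 0) :
    oppCoeff d m (l + Complex.log (1 + x)) = oppCoeff d m l * (1 + x) ^ ((m : ℤ) - 2 * d) := by
  have h : (1 + x) ^ ((m : ℤ) - 2 * d) = Complex.exp ((m - 2 * d) * Complex.log (1 + x)) := by
    conv_lhs => rw [← Complex.exp_log hx, ← Complex.exp_int_mul]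
    push_cast
    rfl
  rw [oppCoeff, oppCoeff, mul_add, Complex.exp_add, h]
  ring

theorem oppCoeff_mul_oppCoeff (a b : ℤ) (i j : ℕ) (l : ℂ) :
    oppCoeff a i l * oppCoeff b j l = (-1) ^ (a + b) *
      Complex.exp l ^ ((i : ℤ) - 2 * a + j - 2 * b) * (i.factorial : ℂ)⁻¹ *
        (j.factorial : ℂ)⁻¹ := by
  rw [oppCoeff, oppCoeff, zpow_add₀ (by norm_num), ← Complex.exp_int_mul, div_eq_mul_inv,
    div_eq_mul_inv]
  rw [show (((i : ℤ) - 2 * a + j - 2 * b : ℤ) : ℂ) * l = (i - 2 * a) * l + (j - 2 * b) * l by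
    push_cast; ring, Complex.exp_add]
  ring

/-- If z₁ = (1 + x)z₂, then z₁⁻¹ = (1 - x/(1 + x))z₂⁻¹. The expansion of the transformed correlation
is thus obtained from those of W by substituting -x/(1 + x), and its coefficients are the
contragredient iterates. -/
theorem discAt_contragredient (hM : M.IsGeneralizedTwisted g) (hg : 𝒱.IsAutomorphism g)
    {a b : ℤ} {s : ℂ} {u v : V} (hu : u ∈ 𝒱.wt a) (hv : v ∈ 𝒱.wt b) (f : M.gradedDual)
    {φ : M.contragredient.gradedDual} (hφ : φ ∈ M.contragredient.dualWt s) {w : W}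
    (hw : w ∈ M.wt s) (hφw : ∀ f, φ.1 f = f.1 w) {N : ℕ} (hNa : (a - 𝒱.minWt).toNat + 1 ≤ N)
    (hNb : (b - 𝒱.minWt).toNat + 1 ≤ N) {F : ℕ → ℕ → ℂ × ℂ → ℂ} (hF : ∀ i j, IsCorr (F i j))
    (hd : ∀ i j : ℕ, M.DualAt ((𝒱.L 1 ^ i : Module.End ℂ V) u) ((𝒱.L 1 ^ j : Module.End ℂ V) v)
      w f (F i j)) (l : ℂ) :
    ∃ T : ℕ, (a + b - 𝒱.minWt).toNat ≤ T ∧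
      M.contragredient.DiscAt u v f φ (oppCorr a b N F) l T := by
  have hD := fun i j => (hd i j).exists_discAt hM.logBounded (hF i j) (𝒱.L_one_pow_mem hu i)
    (𝒱.L_one_pow_mem hv j) (-l)
  choose t ht using hD
  obtain ⟨t', ht'⟩ := (isCorr_oppCorr a b N hF).exists_disc l
  -- One exponent clears the poles of the transformed correlation and of all the finitely many
  -- original ones, and exceeds the truncation bound.
  let T := t' + (a + b - 𝒱.minWt).toNat + ∑ i ∈ Finset.range N, ∑ j ∈ Finset.range N, t i j
  have hT : ∀ i ∈ Finset.range N, ∀ j ∈ Finset.range N, t i j ≤ T := by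
    intro i hi j hj
    have h1 := Finset.single_le_sum (f := fun j => t i j) (fun _ _ => Nat.zero_le _) hj
    have h2 := Finset.single_le_sum (f := fun i => ∑ j ∈ Finset.range N, t i j)
      (fun _ _ => Nat.zero_le _) hi
    simp only [T]
    omega
  have hT' : (a + b - 𝒱.minWt).toNat ≤ T := by simp only [T]; omega
  -- Outside the finite range G is 0, so that the choice gives a family indexed by all i and j.
  have hD : ∀ i j, ∃ G : ℂ → ℂ, i ∈ Finset.range N → j ∈ Finset.range N →
      (∀ x, x ≠ 0 → ‖x‖ < 1 → x ^ T * F i j (-l + Complex.log (1 + x), -l) = G x) ∧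
      HasFPowerSeriesAt G (FormalMultilinearSeries.ofScalars ℂ fun k : ℕ =>
        M.iterCoeff ((𝒱.L 1 ^ i : Module.End ℂ V) u) ((𝒱.L 1 ^ j : Module.End ℂ V) v) w f (-l)
          (k - T)) 0 := by
    intro i j
    by_cases hi : i ∈ Finset.range N
    · by_cases hj : j ∈ Finset.range N
      · obtain ⟨G, -, h1, h2⟩ := ht i j T (hT i hi j hj)
        exact ⟨G, fun _ _ => ⟨h1, h2⟩⟩
      · exact ⟨0, fun _ h => absurd h hj⟩
    · exact ⟨0, fun h => absurd h hi⟩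
  choose G hG using hD
  obtain ⟨G', hG', hGF'⟩ := ht' T (by simp only [T]; omega)
  refine ⟨T, hT', G', hG', hGF', ?_⟩
  let κ : ℕ → ℕ → ℂ := fun i j => (-1) ^ (a + b + T) *
    Complex.exp l ^ ((i : ℤ) - 2 * a + j - 2 * b) * (i.factorial : ℂ)⁻¹ * (j.factorial : ℂ)⁻¹
  let H : ℂ → ℂ := fun x => ∑ i ∈ Finset.range N, ∑ j ∈ Finset.range N,
    κ i j * ((1 + x) ^ ((i : ℤ) - 2 * a + T) * G i j (-x / (1 + x)))
  have hHan : AnalyticAt ℂ H 0 := by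
    refine Finset.analyticAt_fun_sum _ fun i hi => Finset.analyticAt_fun_sum _ fun j hj => ?_
    refine analyticAt_const.mul (AnalyticAt.mul (AnalyticAt.zpow (by fun_prop) (by simp)) ?_)
    refine AnalyticAt.fun_comp ?_ (AnalyticAt.div (by fun_prop) (by fun_prop) (by simp))
    simpa using (hG i j hi hj).2.analyticAt
  have hHas : IsAsymp H fun n => M.contragredient.iterCoeff u v f φ l (n - T) := by
    have h := IsAsymp.sum (s := Finset.range N) fun i hi =>
      IsAsymp.sum (s := Finset.range N) fun j hj =>
        ((hG i j hi hj).2.isAsymp.euler ((i : ℤ) - 2 * a + T)).const_mul (κ i j)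
    convert h using 2 with n
    exact iterCoeff_contragredient hM hg hu hv f hφ hw hφw hNa hNb l hT' n
  -- Both functions are continuous at 0, so it suffices to compare them on a punctured
  -- neighbourhood. The radius 1/2 keeps -x/(1 + x) inside the unit disc.
  have hGH : G' =ᶠ[𝓝 0] H := by
    have hc : ContinuousAt G' 0 :=
      (hG'.differentiableAt (Metric.ball_mem_nhds 0 one_pos)).continuousAt
    rw [← hc.eventuallyEq_nhds_iff_eventuallyEq_nhdsNE hHan.continuousAt]
    have hb : Metric.ball (0 : ℂ) (1 / 2) ∈ 𝓝[≠] 0 :=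
      nhdsWithin_le_nhds (Metric.ball_mem_nhds 0 (by norm_num))
    filter_upwards [hb, self_mem_nhdsWithin] with x hx hx0
    have hx2 : ‖x‖ < 1 / 2 := by simpa using hx
    have hx1 : ‖x‖ < 1 := by linarith
    have hx0 : x ≠ 0 := hx0
    have hne := Complex.slitPlane_ne_zero (Complex.mem_slitPlane_of_norm_lt_one hx1)
    rw [← hGF' x hx0 hx1, oppCorr, Finset.mul_sum]
    refine Finset.sum_congr rfl fun i hi => ?_
    rw [Finset.mul_sum]
    refine Finset.sum_congr rfl fun j hj => ?_
    rw [← (hG i j hi hj).1 _ (div_ne_zero (neg_ne_zero.2 hx0) hne) (norm_neg_div_one_add_lt hx2),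
      log_one_add_neg_div hx1, oppCoeff_add_log _ _ _ hne]
    simp only [κ, Prod.neg_mk, neg_add]
    have e := oppCoeff_mul_oppCoeff a b i j l
    have e2 : ((-x) / (1 + x)) ^ T = (-1) ^ T * x ^ T * (1 + x) ^ (-(T : ℤ)) := by
      rw [div_pow, neg_pow, zpow_neg, zpow_natCast, div_eq_mul_inv]
    have e3 : (-1 : ℂ) ^ (a + b + T) = (-1) ^ (a + b) * (-1) ^ T := by
      rw [zpow_add₀ (by norm_num), zpow_natCast]
    have e4 : (1 + x) ^ ((i : ℤ) - 2 * a + T) * (1 + x) ^ (-(T : ℤ)) =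
        (1 + x) ^ ((i : ℤ) - 2 * a) := by
      rw [← zpow_add₀ hne]
      congr 1
      ring
    have e5 : (-1 : ℂ) ^ T * (-1) ^ T = 1 := by rw [← mul_pow]; simp
    rw [e2, e3]
    calc _ = (oppCoeff a i l * oppCoeff b j l) * (x ^ T * (1 + x) ^ ((i : ℤ) - 2 * a) *
          F i j (-l + -Complex.log (1 + x), -l)) := by ring
      _ = _ := by
        rw [e, ← e4]
        linear_combination (-(x ^ T * ((1 + x) ^ ((i : ℤ) - 2 * a + T) * (1 + x) ^ (-(T : ℤ))) *
          F i j (-l + -Complex.log (1 + x), -l)) * ((-1) ^ (a + b) *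
          Complex.exp l ^ ((i : ℤ) - 2 * a + j - 2 * b) * (i.factorial : ℂ)⁻¹ *
          (j.factorial : ℂ)⁻¹)) * e5
  exact (hHas.hasFPowerSeriesAt hHan).congr hGH.symm

/-- Duality for the contragredient. -/
theorem IsGeneralizedTwisted.contragredient_dual (hM : M.IsGeneralizedTwisted g)
    (hg : 𝒱.IsAutomorphism g) (hfin : ∀ r, FiniteDimensional ℂ (M.wt r)) (u v : V)
    (f : M.gradedDual) (φ : M.contragredient.gradedDual) : M.contragredient.Dual u v f φ := by
  refine (hM.contragredient_logBounded hg).dual_of_homogeneous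
    (fun a b r₀ s u hu v hv f hf φ hφ => ?_) u v f φ
  obtain ⟨w, hw, hφw⟩ := exists_eval_of_mem (hfin s) hφ
  let N := (a - 𝒱.minWt).toNat + 1 + ((b - 𝒱.minWt).toNat + 1)
  have hNa : (a - 𝒱.minWt).toNat + 1 ≤ N := by simp only [N]; omega
  have hNb : (b - 𝒱.minWt).toNat + 1 ≤ N := by simp only [N]; omega
  have hdual := fun i j : ℕ => hM.dual ((𝒱.L 1 ^ i : Module.End ℂ V) u)
    ((𝒱.L 1 ^ j : Module.End ℂ V) v) w f
  choose F hF hd using hdual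
  refine ⟨oppCorr a b N F, isCorr_oppCorr a b N hF, fun p z₁ z₂ => ⟨fun h1 h2 => ?_,
    fun h1 h2 => ?_, fun h1 h2 => (hM.contragredient_logBounded hg).iterate_of_discAt hu hv
      (discAt_contragredient hM hg hu hv f hφ hw hφw hNa hNb hF hd) p z₁ z₂ h1 h2⟩⟩
  -- From |z₂| < |z₁| the negated logarithm of z₁ has the smaller real part, so the reversed product
  -- of W is the convergent one.
  · simp only [pairing_contragredient_ev_ev hM hg hu hv f hφ hw hφw hNa hNb, oppCorr]
    refine hasSum_sum fun i _ => hasSum_sum fun j _ => HasSum.mul_left _ ?_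
    refine ((hd i j).hasSum_of_im_mem hM hg (hF i j) (𝒱.L_one_pow_mem hu i)
      (𝒱.L_one_pow_mem hv j) hw hf (neg_logBranch_im p z₁).1 (neg_logBranch_im p z₁).2
      (neg_logBranch_im p z₂).1 (neg_logBranch_im p z₂).2).2 ?_
    rw [Complex.neg_re, Complex.neg_re, logBranch_re, logBranch_re, neg_lt_neg_iff]
    exact Real.log_lt_log h2 h1
  · simp only [pairing_contragredient_ev_ev hM hg hv hu f hφ hw hφw hNb hNa, oppCorr]
    rw [Finset.sum_comm]
    refine hasSum_sum fun j _ => ?_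
    rw [Finset.sum_congr rfl fun i _ => by rw [mul_comm (oppCoeff a i _)]]
    refine hasSum_sum fun i _ => HasSum.mul_left _ ?_
    refine ((hd i j).hasSum_of_im_mem hM hg (hF i j) (𝒱.L_one_pow_mem hu i)
      (𝒱.L_one_pow_mem hv j) hw hf (neg_logBranch_im p z₁).1 (neg_logBranch_im p z₁).2
      (neg_logBranch_im p z₂).1 (neg_logBranch_im p z₂).2).1 ?_
    rw [Complex.neg_re, Complex.neg_re, logBranch_re, logBranch_re, neg_lt_neg_iff]
    exact Real.log_lt_log h2 h1

end

end TwData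

/-! ### The contragredient of a twisted module -/

namespace TwData

section

variable {V : Type v} [AddCommGroup V] [Module ℂ V] {𝒱 : VOA V}
  {W : Type u} [AddCommGroup W] [Module ℂ W] {M : TwData 𝒱 W} {g : V ≃ₗ[ℂ] V}

theorem contragredient_ext {r : ℂ} {x y : M.contragredient.wt r}
    (h : ∀ w ∈ M.wt r, (x : M.gradedDual).1 w = (y : M.gradedDual).1 w) : x = y := by
  apply Subtype.ext
  apply Subtype.ext
  rw [← sub_eq_zero]
  refine M.eq_zero_of_homogeneous _ fun s w hw => ?_
  by_cases hs : s = r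
  · subst hs
    rw [LinearMap.sub_apply, h w hw, sub_self]
  · rw [LinearMap.sub_apply, x.2 s hs w hw, y.2 s hs w hw, sub_self]

theorem oppCoeff_add_two_pi (d : ℤ) (m : ℕ) (l : ℂ) :
    oppCoeff d m (l + 2 * Real.pi * Complex.I) = oppCoeff d m l := by
  rw [oppCoeff, oppCoeff, mul_add, Complex.exp_add]
  have : Complex.exp (((m : ℂ) - 2 * d) * (2 * Real.pi * Complex.I)) = 1 := by
    have := Complex.exp_int_mul_two_pi_mul_I (m - 2 * d)
    push_cast at this
    exact this
  rw [this, mul_one]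

theorem opp_vac (M : TwData 𝒱 W) (n : ℂ) (k : ℕ) (w : W) :
    M.opp n k 𝒱.vac w = (-1 : ℂ) ^ k • M.Y (-n - 2) k 𝒱.vac w := by
  rw [M.opp_eq 𝒱.vac_mem le_rfl, Finset.sum_eq_single_of_mem 0 (by simp)]
  · simp
  · intro m _ hm
    rw [𝒱.L_one_vac m hm, map_zero, LinearMap.zero_apply, smul_zero]

theorem opp_omega (M : TwData 𝒱 W) (w : W) : M.opp 1 0 𝒱.ω w = M.L 0 w := by
  rw [M.opp_eq 𝒱.ω_mem le_rfl, Finset.sum_eq_single_of_mem 0 (by simp)]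
  · simp only [pow_zero, Nat.factorial_zero, TwData.L, Module.End.one_apply]
    norm_num
  · intro m _ hm
    obtain ⟨m, rfl⟩ := Nat.exists_eq_succ_of_ne_zero hm
    rw [pow_succ, Module.End.mul_apply, 𝒱.L_one_omega, map_zero, map_zero, LinearMap.zero_apply,
      smul_zero]

theorem contragredient_L_zero (f : M.gradedDual) (w : W) :
    (M.contragredient.L 0 f).1 w = f.1 (M.L 0 w) := by
  have h := contragredient_Y (M := M) (((0 : ℤ) : ℂ) + 1) 0 𝒱.ω f w
  rw [show ((0 : ℤ) : ℂ) + 1 = 1 by norm_num, M.opp_omega] at h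
  rw [← h, TwData.L]
  norm_num

theorem L_zero_mem (M : TwData 𝒱 W) {r : ℂ} {w : W} (hw : w ∈ M.wt r) : M.L 0 w ∈ M.wt r := by
  have h := M.graded 2 r (((0 : ℤ) : ℂ) + 1) 0 𝒱.ω w 𝒱.ω_mem hw
  rwa [show r + ((2 : ℤ) : ℂ) - (((0 : ℤ) : ℂ) + 1) - 1 = r by push_cast; ring] at h

theorem sub_smul_pow_mem {A : Type*} [AddCommGroup A] [Module ℂ A] {p : Submodule ℂ A}
    {T : Module.End ℂ A} (hT : ∀ x ∈ p, T x ∈ p) (c : ℂ) (K : ℕ) {x : A} (hx : x ∈ p) :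
    ((T - c • LinearMap.id : Module.End ℂ A) ^ K) x ∈ p := by
  induction K with
  | zero => simpa using hx
  | succ K ih =>
    rw [pow_succ', Module.End.mul_apply]
    exact p.sub_mem (hT _ ih) (p.smul_mem c ih)

/-- A linear operator on the graded dual which is the transpose of an operator on the module. -/
theorem transpose_pow {T : Module.End ℂ W} {T' : Module.End ℂ M.gradedDual}
    (h : ∀ f w, (T' f).1 w = f.1 (T w)) (c : ℂ) (K : ℕ) (f : M.gradedDual) (w : W) :
    (((T' - c • LinearMap.id : Module.End ℂ M.gradedDual) ^ K) f).1 w =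
      f.1 (((T - c • LinearMap.id : Module.End ℂ W) ^ K) w) := by
  induction K generalizing w with
  | zero => simp
  | succ K ih =>
    rw [pow_succ', Module.End.mul_apply, pow_succ, Module.End.mul_apply, ← ih]
    simp only [LinearMap.sub_apply, LinearMap.smul_apply, LinearMap.id_apply, map_sub, map_smul]
    rw [← h]
    simp

/-- Finite dimension makes the nilpotency exponent uniform. A transposed operator must be killed on
the whole weight space at once, so exponents depending on the vector would not suffice. -/
theorem exists_pow_eq_zero_of_finite {A : Type*} [AddCommGroup A] [Module ℂ A]
    {p : Submodule ℂ A} [FiniteDimensional ℂ p] {T : Module.End ℂ A} (hT : ∀ x ∈ p, T x ∈ p)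
    (h : ∀ x ∈ p, ∃ K : ℕ, (T ^ K) x = 0) : ∃ K : ℕ, ∀ x ∈ p, (T ^ K) x = 0 := by
  have hpow : ∀ (K : ℕ) (x : p), (((T.restrict hT) ^ K) x : A) = (T ^ K) x := by
    intro K x
    rw [Module.End.pow_restrict]
    rfl
  have hn : IsNilpotent (T.restrict hT) := by
    rw [Module.End.isNilpotent_iff_of_finite]
    intro x
    obtain ⟨K, hK⟩ := h x x.2
    exact ⟨K, Subtype.ext (by rw [hpow, hK]; rfl)⟩
  obtain ⟨K, hK⟩ := hn
  exact ⟨K, fun x hx => by rw [← hpow K ⟨x, hx⟩, hK]; rfl⟩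

theorem IsGeneralizedTwisted.contragredient_L0_grading (hM : M.IsGeneralizedTwisted g)
    (hfin : ∀ r, FiniteDimensional ℂ (M.wt r)) {r : ℂ} {f : M.gradedDual} (hf : f ∈ M.dualWt r) :
    ∃ K : ℕ, ((M.contragredient.L 0 - r • LinearMap.id : Module.End ℂ M.gradedDual) ^ K) f = 0 := by
  have := hfin r
  obtain ⟨K, hK⟩ := exists_pow_eq_zero_of_finite (p := M.wt r)
    (T := M.L 0 - r • LinearMap.id)
    (fun x hx => (M.wt r).sub_mem (M.L_zero_mem hx) ((M.wt r).smul_mem r hx))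
    (fun x hx => hM.L0_grading r x hx)
  refine ⟨K, Subtype.ext (M.eq_zero_of_homogeneous _ fun s w hw => ?_)⟩
  rw [transpose_pow (M := M) contragredient_L_zero]
  by_cases hs : s = r
  · subst hs
    rw [hK w hw, map_zero]
  · exact hf s hs _ (sub_smul_pow_mem (fun x hx => M.L_zero_mem hx) r K hw)

/-- Moving L(1)^{m+1} past L(-1) produces the factor 2d - m, which cancels the corresponding part of
the exponent in the derivative property. Only -n remains. -/
theorem IsGeneralizedTwisted.opp_L_neg_one (hM : M.IsGeneralizedTwisted g) (n : ℂ) (k : ℕ) (v : V)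
    (w : W) : M.opp n k (𝒱.L (-1) v) w =
      (-n) • M.opp (n - 1) k v w + ((k : ℂ) + 1) • M.opp (n - 1) (k + 1) v w := by
  refine 𝒱.internal.induction (motive := fun v => M.opp n k (𝒱.L (-1) v) w =
      (-n) • M.opp (n - 1) k v w + ((k : ℂ) + 1) • M.opp (n - 1) (k + 1) v w)
    (fun d v hv => ?_) (by simp) (fun x y hx hy => ?_) v
  · have hL : 𝒱.L (-1) v ∈ 𝒱.wt (d + 1) := by
      have h := 𝒱.graded 2 d 0 𝒱.ω v 𝒱.ω_mem hv
      rw [show 2 + d - 0 - 1 = d + 1 by ring] at h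
      exact h
    let N := (d - 𝒱.minWt).toNat + 1
    have hN : (d - 𝒱.minWt).toNat + 1 ≤ N := le_rfl
    -- L(-1)v has weight d + 1 and needs one more term. The index 0 is split off so that the term m
    -- + 1 for L(-1)v can be matched with the term m for v.
    rw [M.opp_eq hL (N := N + 1) (by omega), M.opp_eq hv hN, M.opp_eq hv hN,
      Finset.sum_range_succ']
    have hz := 𝒱.L_one_pow_eq_zero hv hN
    have h1 : ∀ m : ℕ, M.Y (2 * ((d + 1 : ℤ) : ℂ) - ((m + 1 : ℕ) : ℂ) - n - 2) k
        ((𝒱.L 1 ^ (m + 1) : Module.End ℂ V) (𝒱.L (-1) v)) w =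
        M.Y (2 * d - ((m + 1 : ℕ) : ℂ) - n) k
          (𝒱.L (-1) ((𝒱.L 1 ^ (m + 1) : Module.End ℂ V) v)) w +
        (((m : ℂ) + 1) * (2 * d - m)) • M.Y (2 * d - m - (n - 1) - 2) k
          ((𝒱.L 1 ^ m : Module.End ℂ V) v) w := by
      intro m
      rw [𝒱.L_one_pow_L_neg_one hv, map_add, map_smul, LinearMap.add_apply, LinearMap.smul_apply]
      congr 3 <;> push_cast <;> ring_nf
    have h2 : (∑ m ∈ Finset.range N, ((-1 : ℂ) ^ k * (-1 : ℂ) ^ (d + 1) / ((m + 1).factorial : ℂ)) •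
        M.Y (2 * ((d + 1 : ℤ) : ℂ) - ((m + 1 : ℕ) : ℂ) - n - 2) k
          ((𝒱.L 1 ^ (m + 1) : Module.End ℂ V) (𝒱.L (-1) v)) w) +
        ((-1 : ℂ) ^ k * (-1 : ℂ) ^ (d + 1) / (Nat.factorial 0 : ℂ)) •
        M.Y (2 * ((d + 1 : ℤ) : ℂ) - ((0 : ℕ) : ℂ) - n - 2) k
          ((𝒱.L 1 ^ 0 : Module.End ℂ V) (𝒱.L (-1) v)) w =
        ∑ m ∈ Finset.range N, (((-1 : ℂ) ^ k * (-1 : ℂ) ^ (d + 1) / (m.factorial : ℂ)) •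
          M.Y (2 * d - m - n) k (𝒱.L (-1) ((𝒱.L 1 ^ m : Module.End ℂ V) v)) w +
          (((-1 : ℂ) ^ k * (-1 : ℂ) ^ (d + 1) / (m.factorial : ℂ)) * (2 * d - m)) •
            M.Y (2 * d - m - (n - 1) - 2) k ((𝒱.L 1 ^ m : Module.End ℂ V) v) w) := by
      rw [Finset.sum_add_distrib]
      have h3 := Finset.sum_range_succ' (fun m => ((-1 : ℂ) ^ k * (-1 : ℂ) ^ (d + 1) /
        (m.factorial : ℂ)) • M.Y (2 * d - m - n) k
          (𝒱.L (-1) ((𝒱.L 1 ^ m : Module.End ℂ V) v)) w) N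
      rw [Finset.sum_range_succ, hz, map_zero, map_zero, LinearMap.zero_apply, smul_zero,
        add_zero] at h3
      rw [h3, add_right_comm, ← Finset.sum_add_distrib]
      congr 1
      · refine Finset.sum_congr rfl fun m _ => ?_
        rw [h1, smul_add, smul_smul]
        congr 2
        rw [Nat.factorial_succ]
        push_cast
        have h4 : (m.factorial : ℂ) ≠ 0 := by exact_mod_cast m.factorial_ne_zero
        have h5 : (m : ℂ) + 1 ≠ 0 := by exact_mod_cast m.succ_ne_zero
        field_simp
      · simp only [pow_zero, Module.End.one_apply]
        congr 3
        push_cast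
        ring_nf
    rw [h2, Finset.smul_sum, Finset.smul_sum, ← Finset.sum_add_distrib]
    refine Finset.sum_congr rfl fun m _ => ?_
    rw [hM.L_neg_one_derivative, smul_add, smul_smul, smul_smul, smul_smul, smul_smul,
      show 2 * (d : ℂ) - m - n - 1 = 2 * d - m - (n - 1) - 2 by ring, add_right_comm, ← add_smul]
    have h6 : (-1 : ℂ) ^ (d + 1) = -(-1) ^ d := by
      rw [zpow_add₀ (by norm_num)]
      simp
    rw [h6]
    congr 2 <;> ring
  · simp only [map_add, LinearMap.add_apply, hx, hy, smul_add]
    abel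

/-- The contragredient of a `g`-twisted module is `g⁻¹`-twisted. -/
theorem IsGeneralizedTwisted.contragredient (hM : M.IsGeneralizedTwisted g)
    (hg : 𝒱.IsAutomorphism g) (hfin : ∀ r, FiniteDimensional ℂ (M.wt r)) :
    M.contragredient.IsGeneralizedTwisted g⁻¹ where
  log_bounded := hM.contragredient_logBounded hg
  equivariance := by
    intro p z hz v f
    have hb := hM.contragredient_logBounded hg
    rw [evalY_eq_ev, evalY_eq_ev, logBranch_succ]
    refine 𝒱.internal.induction (motive := fun v =>
      M.contragredient.ev (logBranch p z + 2 * Real.pi * Complex.I) (g⁻¹ v) f =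
        M.contragredient.ev (logBranch p z) v f) (fun d v hv => ?_) ?_ (fun x y hx hy => ?_) v
    · have hgi : g (g⁻¹ v) = v := g.apply_symm_apply v
      have hgv : g⁻¹ v ∈ 𝒱.wt d := by
        rw [𝒱.mem_wt_iff]
        apply g.injective
        rw [hg.map_L, map_smul, hgi, (𝒱.mem_wt_iff).1 hv]
      funext r
      refine contragredient_ext fun w hw => ?_
      rw [hM.contragredient_ev hg hgv le_rfl _ f hw, hM.contragredient_ev hg hv le_rfl _ f hw]
      refine Finset.sum_congr rfl fun m _ => ?_
      -- Adding 2πi to log x on W' subtracts it on W. Equivariance for g restores it and turns g⁻¹v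
      -- into v.
      rw [oppCoeff_add_two_pi, ← hM.ev_add_two_pi _ _ w, hg.map_L_pow, hgi,
        show -(logBranch p z + 2 * Real.pi * Complex.I) + 2 * Real.pi * Complex.I =
          -logBranch p z by ring]
    · rw [map_zero, ev_zero_left, ev_zero_left]
    · rw [map_add, hb.ev_add_left, hb.ev_add_left, hx, hy]
  identity := by
    intro n k f
    apply Subtype.ext
    ext w
    rw [contragredient_Y, opp_vac, hM.identity]
    by_cases hn : n = -1 ∧ k = 0
    · obtain ⟨rfl, rfl⟩ := hn
      norm_num
    · rw [if_neg hn, if_neg]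
      · simp
      · rintro ⟨h1, h2⟩
        exact hn ⟨by linear_combination -h1, h2⟩
  duality u v f φ := (hM.contragredient_dual hg hfin u v f φ).exists_correlation
  L0_grading r f hf := hM.contragredient_L0_grading hfin hf
  L_neg_one_derivative := by
    intro n k v f
    apply Subtype.ext
    ext w
    rw [contragredient_Y, hM.opp_L_neg_one, map_add, map_smul, map_smul]
    rfl

theorem IsGradingRestricted.contragredient (h : M.IsGradingRestricted) :
    M.contragredient.IsGradingRestricted := by
  constructor
  · intro r
    obtain ⟨B, hB⟩ := h.1 r
    refine ⟨B, fun l hl => (Submodule.eq_bot_iff _).2 fun f hf => Subtype.ext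
      (M.eq_zero_of_homogeneous _ fun s w hw => ?_)⟩
    by_cases hs : s = r + l
    · subst hs
      rw [hB l hl, Submodule.mem_bot] at hw
      rw [hw, map_zero]
    · exact hf s hs w hw
  · intro r
    have := h.2 r
    let j : M.contragredient.wt r →ₗ[ℂ] Module.Dual ℂ (M.wt r) :=
      (Module.Dual.transpose (R := ℂ) (M.wt r).subtype) ∘ₗ M.gradedDual.subtype ∘ₗ
        (M.contragredient.wt r).subtype
    refine FiniteDimensional.of_injective j fun x y hxy => contragredient_ext fun w hw => ?_
    exact LinearMap.congr_fun hxy ⟨w, hw⟩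

end

end TwData

/-! ### Projections of an internal direct sum -/

section InternalProj

variable {κ A : Type*} [DecidableEq κ] [AddCommGroup A] [Module ℂ A] {p : κ → Submodule ℂ A}

/-- The projection onto a summand of an internal direct sum. -/
def internalProj (hp : DirectSum.IsInternal p) (q : κ) : A →ₗ[ℂ] A :=
  (p q).subtype ∘ₗ DirectSum.component ℂ κ (fun q => p q) q ∘ₗ
    (LinearEquiv.ofBijective (DirectSum.coeLinearMap p) hp).symm.toLinearMap

variable (hp : DirectSum.IsInternal p)

theorem internalProj_mem (q : κ) (x : A) : internalProj hp q x ∈ p q := Subtype.coe_prop _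

theorem symm_of_mem {q : κ} {x : A} (hx : x ∈ p q) :
    (LinearEquiv.ofBijective (DirectSum.coeLinearMap p) hp).symm x =
      DirectSum.lof ℂ κ (fun q => p q) q ⟨x, hx⟩ := by
  rw [LinearEquiv.symm_apply_eq]
  exact (DirectSum.coeLinearMap_lof p q ⟨x, hx⟩).symm

theorem internalProj_of_mem {q : κ} {x : A} (hx : x ∈ p q) : internalProj hp q x = x := by
  simp [internalProj, symm_of_mem hp hx, DirectSum.component.lof_self]

theorem internalProj_of_mem_ne {q q' : κ} {x : A} (hx : x ∈ p q') (h : q' ≠ q) :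
    internalProj hp q x = 0 := by
  simp [internalProj, symm_of_mem hp hx, DirectSum.component.of, h]

theorem exists_finset_internalProj (x : A) : ∃ s : Finset κ, ∀ q ∉ s, internalProj hp q x = 0 := by
  refine hp.induction (motive := fun x => ∃ s : Finset κ, ∀ q ∉ s, internalProj hp q x = 0)
    (fun q x hx => ⟨{q}, fun q' h => internalProj_of_mem_ne hp hx ?_⟩) ⟨∅, by simp⟩ ?_ x
  · rintro rfl
    simp at h
  · rintro x y ⟨s, hs⟩ ⟨t, ht⟩
    refine ⟨s ∪ t, fun q h => ?_⟩
    rw [Finset.mem_union, not_or] at h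
    rw [map_add, hs q h.1, ht q h.2, add_zero]

theorem sum_internalProj {s : Finset κ} {x : A} (hs : ∀ q ∉ s, internalProj hp q x = 0) :
    ∑ q ∈ s, internalProj hp q x = x := by
  have key : ∃ s₀ : Finset κ, ∀ s, s₀ ⊆ s → ∑ q ∈ s, internalProj hp q x = x := by
    refine hp.induction
      (motive := fun x => ∃ s₀ : Finset κ, ∀ s, s₀ ⊆ s → ∑ q ∈ s, internalProj hp q x = x)
      (fun q x hx => ⟨{q}, fun s h => ?_⟩) ⟨∅, by simp⟩ ?_ x
    · rw [Finset.sum_eq_single_of_mem q (h (by simp)), internalProj_of_mem hp hx]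
      exact fun q' _ h => internalProj_of_mem_ne hp hx h.symm
    · rintro x y ⟨s, hs⟩ ⟨t, ht⟩
      refine ⟨s ∪ t, fun u h => ?_⟩
      simp only [map_add, Finset.sum_add_distrib]
      rw [hs u (Finset.union_subset_left h), ht u (Finset.union_subset_right h)]
  obtain ⟨s₀, h₀⟩ := key
  rw [Finset.sum_subset (s₂ := s ∪ s₀) Finset.subset_union_left fun q _ hq => hs q hq]
  exact h₀ _ Finset.subset_union_right

theorem eq_zero_of_internalProj {x : A} (h : ∀ q, internalProj hp q x = 0) : x = 0 := by
  rw [← sum_internalProj hp (s := ∅) fun q _ => h q, Finset.sum_empty]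

/-- A finite-dimensional subspace meets only finitely many summands. -/
theorem exists_finset_internalProj_of_finite {N : Submodule ℂ A} [FiniteDimensional ℂ N] :
    ∃ s : Finset κ, ∀ x ∈ N, ∀ q ∉ s, internalProj hp q x = 0 := by
  obtain ⟨t, rfl⟩ := (Submodule.fg_iff_finiteDimensional N).2 inferInstance
  choose s hs using exists_finset_internalProj hp
  refine ⟨t.biUnion s, fun x hx q hq => ?_⟩
  have hle : Submodule.span ℂ (t : Set A) ≤ LinearMap.ker (internalProj hp q) := by
    rw [Submodule.span_le]
    intro y hy
    exact hs y q fun h => hq (Finset.mem_biUnion.2 ⟨y, hy, h⟩)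
  exact hle hx

end InternalProj

/-- Generalized eigenspaces for distinct eigenvalues are independent, so subspaces of them that
together span everything leave no room. This characterises both weight spaces and g-weight spaces by
operators. -/
theorem eq_maxGenEigenspace_of_iSup_eq_top {κ A : Type*} [AddCommGroup A] [Module ℂ A]
    {p : κ → Submodule ℂ A} (hp : ⨆ i, p i = ⊤) {μ : κ → ℂ} (hμ : Function.Injective μ)
    {T : Module.End ℂ A} (h : ∀ i, p i ≤ T.maxGenEigenspace (μ i)) (i : κ) :
    p i = T.maxGenEigenspace (μ i) := by
  refine le_antisymm (h i) fun x hx => ?_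
  have hind := (T.independent_maxGenEigenspace.comp hμ) i
  have hx' : x ∈ p i ⊔ ⨆ (j) (_ : j ≠ i), p j := by
    have : p i ⊔ ⨆ (j) (_ : j ≠ i), p j = ⊤ := by
      rw [eq_top_iff, ← hp, iSup_le_iff]
      intro j
      by_cases hj : j = i
      · subst hj; exact le_sup_left
      · exact le_sup_of_le_right (le_iSup₂_of_le j hj le_rfl)
    rw [this]
    trivial
  obtain ⟨y, hy, z, hz, rfl⟩ := Submodule.mem_sup.1 hx'
  have hz' : z ∈ ⨆ (j) (_ : j ≠ i), T.maxGenEigenspace (μ j) :=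
    iSup₂_mono (fun j _ => h j) hz
  have hz0 : z ∈ T.maxGenEigenspace (μ i) := by
    have := Submodule.sub_mem _ hx (h i hy)
    rwa [add_sub_cancel_left] at this
  have := Submodule.disjoint_def.1 hind z hz0 hz'
  rwa [this, add_zero]

/-- The components in generalized eigenspaces of a vector of a stable subspace are in the
subspace. -/
theorem mem_of_sum_mem_of_stable {A : Type*} [AddCommGroup A] [Module ℂ A]
    {U : Submodule ℂ A} {T : Module.End ℂ A} (hT : ∀ x ∈ U, T x ∈ U) (s : Finset ℂ) {x : ℂ → A}
    (hx : ∀ i ∈ s, ∃ K : ℕ, ((T - i • LinearMap.id : Module.End ℂ A) ^ K) (x i) = 0)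
    (hsum : ∑ i ∈ s, x i ∈ U) : ∀ i ∈ s, x i ∈ U := by
  classical
  -- In the quotient by U the components sum to zero while lying in distinct generalized
  -- eigenspaces, so each of them vanishes there.
  let T' : Module.End ℂ (A ⧸ U) := U.mapQ U T hT
  have hpow : ∀ (c : ℂ) (K : ℕ) (a : A), ((T' - c • LinearMap.id : Module.End ℂ (A ⧸ U)) ^ K)
      (U.mkQ a) = U.mkQ (((T - c • LinearMap.id : Module.End ℂ A) ^ K) a) := by
    intro c K
    induction K with
    | zero => intro a; rfl
    | succ K ih =>
      intro a
      rw [pow_succ, Module.End.mul_apply, pow_succ, Module.End.mul_apply, ← ih]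
      rfl
  have hmem : ∀ i ∈ s, U.mkQ (x i) ∈ T'.maxGenEigenspace i := by
    intro i hi
    obtain ⟨K, hK⟩ := hx i hi
    refine (Module.End.mem_maxGenEigenspace _ _ _).2 ⟨K, ?_⟩
    have := hpow i K (x i)
    rw [hK, map_zero] at this
    exact this
  have h0 : ∑ i ∈ s, U.mkQ (x i) = 0 := by
    rw [← map_sum]
    exact (Submodule.Quotient.mk_eq_zero U).2 hsum
  intro i hi
  have hind := T'.independent_maxGenEigenspace i
  refine (Submodule.Quotient.mk_eq_zero U).1 (Submodule.disjoint_def.1 hind _ (hmem i hi) ?_)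
  have e : U.mkQ (x i) = -∑ j ∈ s.erase i, U.mkQ (x j) := by
    rw [← Finset.add_sum_erase s _ hi] at h0
    exact eq_neg_of_add_eq_zero_left h0
  change U.mkQ (x i) ∈ _
  rw [e]
  refine Submodule.neg_mem _ (Submodule.sum_mem _ fun j hj => ?_)
  exact Submodule.mem_iSup_of_mem j (Submodule.mem_iSup_of_mem (Finset.ne_of_mem_erase hj)
    (hmem j (Finset.mem_of_mem_erase hj)))

/-! ### Module maps, weight spaces and the double contragredient. -/

namespace TwData

section

variable {V : Type v} [AddCommGroup V] [Module ℂ V] {𝒱 : VOA V}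
  {W : Type u} [AddCommGroup W] [Module ℂ W] {M : TwData 𝒱 W} {g : V ≃ₗ[ℂ] V}
  {W₂ : Type u₂} [AddCommGroup W₂] [Module ℂ W₂] {M₂ : TwData 𝒱 W₂}

theorem proj_mem (r : ℂ) (w : W) : (M.proj r w : W) ∈ M.wt r := (M.proj r w).2

theorem IsModuleMap.map_proj {f : W →ₗ[ℂ] W₂} (hf : M.IsModuleMap M₂ f) (r : ℂ) (w : W) :
    f (M.proj r w) = M₂.proj r (f w) := by
  refine M.internal.induction (motive := fun w => f (M.proj r w) = M₂.proj r (f w))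
    (fun s w hw => ?_) (by simp) (fun x y hx hy => by simp [hx, hy]) w
  by_cases hs : s = r
  · subst hs
    rw [M.proj_of_mem s w hw, M₂.proj_of_mem s _ (hf.2 s w hw)]
  · rw [M.proj_of_mem_ne s r hs w hw, M₂.proj_of_mem_ne s r hs _ (hf.2 s w hw), map_zero]

theorem IsModuleMap.symm {e : W ≃ₗ[ℂ] W₂} (he : M.IsModuleMap M₂ e.toLinearMap) :
    M₂.IsModuleMap M e.symm.toLinearMap := by
  refine ⟨fun n k v w => ?_, fun r w hw => ?_⟩
  · apply e.injective
    have := he.1 n k v (e.symm w)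
    simp only [LinearEquiv.coe_coe, LinearEquiv.apply_symm_apply] at this ⊢
    rw [this]
  · have h := he.map_proj r (e.symm w)
    simp only [LinearEquiv.coe_coe, LinearEquiv.apply_symm_apply, M₂.proj_of_mem r w hw] at h
    rw [LinearEquiv.coe_coe, ← h, LinearEquiv.symm_apply_apply]
    exact M.proj_mem r _

theorem Equivalent.symm (h : M.Equivalent M₂) : M₂.Equivalent M := by
  obtain ⟨e, he⟩ := h
  exact ⟨e.symm, he.symm⟩

theorem IsGeneralizedTwisted.mem_wt (hM : M.IsGeneralizedTwisted g) {r : ℂ} {w : W} {K : ℕ}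
    (h : ((M.L 0 - r • LinearMap.id : Module.End ℂ W) ^ K) w = 0) : w ∈ M.wt r := by
  rw [eq_maxGenEigenspace_of_iSup_eq_top (T := M.L 0) (μ := id) M.internal.submodule_iSup_eq_top
    Function.injective_id fun r w hw => ?_]
  · exact (Module.End.mem_maxGenEigenspace _ _ _).2 ⟨K, h⟩
  · exact (Module.End.mem_maxGenEigenspace _ _ _).2 (hM.L0_grading r w hw)

variable (M)

theorem exists_dual_ne_zero {w : W} (hw : w ≠ 0) : ∃ f : M.gradedDual, f.1 w ≠ 0 := by
  by_contra! h
  refine hw (eq_zero_of_internalProj M.internal fun r => ?_)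
  have h1 : M.proj r w = 0 :=
    (Module.forall_dual_apply_eq_zero_iff ℂ (M.proj r w)).1 fun ψ => h (M.extendDual r ψ)
  exact congrArg Subtype.val h1

/-- Evaluation at a vector, in the double graded dual. -/
def evalDual : W →ₗ[ℂ] M.contragredient.gradedDual where
  toFun w := ⟨LinearMap.applyₗ w ∘ₗ M.gradedDual.subtype, by
    refine M.internal.induction (motive := fun w =>
      (LinearMap.applyₗ w ∘ₗ M.gradedDual.subtype : Module.Dual ℂ M.gradedDual) ∈
        M.contragredient.gradedDual) (fun s w hw => ?_) ?_ (fun x y hx hy => ?_) w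
    · refine (Set.finite_singleton s).subset ?_
      rintro r ⟨f, hf, hne⟩
      by_contra h
      exact hne (hf s (fun e => h e.symm) w hw)
    · rw [map_zero, LinearMap.zero_comp]
      exact Submodule.zero_mem _
    · rw [map_add, LinearMap.add_comp]
      exact Submodule.add_mem _ hx hy⟩
  map_add' x y := by
    apply Subtype.ext
    ext f
    exact f.1.map_add x y
  map_smul' c x := by
    apply Subtype.ext
    ext f
    exact f.1.map_smul c x

theorem evalDual_apply (w : W) (f : M.gradedDual) : (M.evalDual w).1 f = f.1 w := rfl

theorem evalDual_injective : Function.Injective M.evalDual := by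
  rw [injective_iff_map_eq_zero]
  intro w hw
  by_contra hne
  obtain ⟨f, hf⟩ := M.exists_dual_ne_zero hne
  exact hf (by rw [← evalDual_apply, hw]; rfl)

theorem evalDual_surjective (hfin : ∀ r, FiniteDimensional ℂ (M.wt r)) :
    Function.Surjective M.evalDual := by
  intro φ
  refine M.contragredient.dualWt_internal.induction (motive := fun φ => ∃ w, M.evalDual w = φ)
    (fun r φ hφ => ?_) ⟨0, map_zero _⟩ ?_ φ
  · obtain ⟨w, -, h⟩ := exists_eval_of_mem (hfin r) hφ
    exact ⟨w, Subtype.ext (LinearMap.ext fun f => (h f).symm)⟩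
  · rintro x y ⟨w, rfl⟩ ⟨w', rfl⟩
    exact ⟨w + w', map_add _ _ _⟩

/-- These are the coefficients of e^{-x}e^{x} = 1, the identity behind the involutivity of the
contragredient construction. -/
theorem sum_antidiagonal_neg_one_pow_div (m : ℕ) :
    ∑ p ∈ Finset.HasAntidiagonal.antidiagonal m,
      (-1 : ℂ) ^ p.1 * ((p.1.factorial : ℂ)⁻¹ * (p.2.factorial : ℂ)⁻¹) = if m = 0 then 1 else 0 := by
  have h := (Commute.all (-1 : ℂ) 1).add_pow' m
  rw [neg_add_cancel, zero_pow_eq] at h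
  have hm : (m.factorial : ℂ) ≠ 0 := by exact_mod_cast m.factorial_ne_zero
  have h2 : ∑ p ∈ Finset.HasAntidiagonal.antidiagonal m,
      (-1 : ℂ) ^ p.1 * ((p.1.factorial : ℂ)⁻¹ * (p.2.factorial : ℂ)⁻¹) =
      (m.factorial : ℂ)⁻¹ * ∑ p ∈ Finset.HasAntidiagonal.antidiagonal m,
        m.choose p.1 • ((-1 : ℂ) ^ p.1 * 1 ^ p.2) := by
    rw [Finset.mul_sum]
    refine Finset.sum_congr rfl fun p hp => ?_
    obtain rfl := Finset.HasAntidiagonal.mem_antidiagonal.1 hp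
    have e : (((p.1 + p.2).choose p.1 : ℕ) : ℂ) * p.1.factorial * p.2.factorial =
        ((p.1 + p.2).factorial : ℂ) := by
      rw [mul_right_comm, add_comm p.1]
      exact_mod_cast Nat.add_choose_mul_factorial_mul_factorial p.2 p.1
    have h1 : (p.1.factorial : ℂ) ≠ 0 := by exact_mod_cast p.1.factorial_ne_zero
    have h2 : (p.2.factorial : ℂ) ≠ 0 := by exact_mod_cast p.2.factorial_ne_zero
    rw [nsmul_eq_mul, one_pow, mul_one]
    field_simp
    linear_combination -e
  rw [h2, ← h]
  split_ifs with h0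
  · subst h0; simp
  · simp

/-- Applying the opposite construction twice squares the signs away and cancels the two exponentials
of L(1). Besides the double contragredient, this exhibits the transpose of Y_{n,k}(v) as a finite
combination of contragredient operators. -/
theorem contragredient_opp (n : ℂ) (k : ℕ) (v : V) (f : M.gradedDual) (w : W) :
    (M.contragredient.opp n k v f).1 w = f.1 (M.Y n k v w) := by
  refine 𝒱.internal.induction (motive := fun v => (M.contragredient.opp n k v f).1 w =
    f.1 (M.Y n k v w)) (fun d v hv => ?_) (by simp) (fun x y hx hy => ?_) v
  · let N := (d - 𝒱.minWt).toNat + 1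
    have hN : (d - 𝒱.minWt).toNat + 1 ≤ N := le_rfl
    rw [M.contragredient.opp_eq hv hN]
    have hz := fun m hm => 𝒱.L_one_pow_eq_zero hv (m := m) hm
    let Φ : ℕ → ℂ := fun m => f.1 (M.Y (n - m) k ((𝒱.L 1 ^ m : Module.End ℂ V) v) w)
    have hterm : ∀ m : ℕ, (M.contragredient.Y (2 * d - m - n - 2) k
        ((𝒱.L 1 ^ m : Module.End ℂ V) v) f).1 w = ∑ m' ∈ Finset.range N,
          ((-1 : ℂ) ^ k * (-1 : ℂ) ^ (d - m) / (m'.factorial : ℂ)) * Φ (m + m') := by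
      intro m
      rw [contragredient_Y, M.opp_eq (𝒱.L_one_pow_mem hv m) (N := N) (by omega), map_sum]
      refine Finset.sum_congr rfl fun m' _ => ?_
      rw [map_smul, smul_eq_mul, ← Module.End.mul_apply, ← pow_add, add_comm m' m]
      simp only [Φ]
      congr 5
      push_cast
      ring
    have hsgn : (-1 : ℂ) ^ k * (-1) ^ k = 1 := by rw [← mul_pow]; simp
    have h1 : (∑ m ∈ Finset.range N, ((-1 : ℂ) ^ k * (-1 : ℂ) ^ d / (m.factorial : ℂ)) •
        M.contragredient.Y (2 * d - m - n - 2) k ((𝒱.L 1 ^ m : Module.End ℂ V) v) f).1 w =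
        ∑ m ∈ Finset.range N, ∑ m' ∈ Finset.range N,
          ((-1 : ℂ) ^ m * ((m.factorial : ℂ)⁻¹ * (m'.factorial : ℂ)⁻¹)) * Φ (m + m') := by
      rw [AddSubmonoidClass.coe_finsetSum, LinearMap.sum_apply]
      refine Finset.sum_congr rfl fun m _ => ?_
      rw [Submodule.coe_smul, LinearMap.smul_apply, hterm, smul_eq_mul, Finset.mul_sum]
      refine Finset.sum_congr rfl fun m' _ => ?_
      have e : (-1 : ℂ) ^ d * (-1 : ℂ) ^ (d - m) = (-1) ^ m := by
        rw [← zpow_add₀ (by norm_num), show d + (d - m) = 2 * d + (-(m : ℤ)) by ring,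
          zpow_add₀ (by norm_num), zpow_mul, zpow_neg, zpow_natCast, ← inv_pow]
        norm_num
      rw [div_eq_mul_inv, div_eq_mul_inv, ← e]
      linear_combination ((-1 : ℂ) ^ d * (-1 : ℂ) ^ (d - m) * (m.factorial : ℂ)⁻¹ *
        (m'.factorial : ℂ)⁻¹ * Φ (m + m')) * hsgn
    rw [h1, ← sum_antidiagonal_box (K := N + N) le_rfl (fun m m' =>
        ((-1 : ℂ) ^ m * ((m.factorial : ℂ)⁻¹ * (m'.factorial : ℂ)⁻¹)) * Φ (m + m'))]
    · rw [Finset.sum_congr rfl fun M _ => show _ = (if M = 0 then 1 else 0) * Φ M from ?_]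
      · simp [N, Φ]
      · rw [← sum_antidiagonal_neg_one_pow_div, Finset.sum_mul]
        refine Finset.sum_congr rfl fun p hp => ?_
        rw [Finset.HasAntidiagonal.mem_antidiagonal.1 hp]
    · intro i s hi
      simp only [Φ]
      rw [hz _ (by omega)]
      simp
    · intro i s hi
      simp only [Φ]
      rw [hz _ (by omega)]
      simp
  · simp only [map_add, LinearMap.add_apply, Submodule.coe_add, hx, hy]

/-- The double contragredient is equivalent to the module. -/
theorem contragredient_contragredient_equivalent (hfin : ∀ r, FiniteDimensional ℂ (M.wt r)) :
    M.contragredient.contragredient.Equivalent M := by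
  refine Equivalent.symm ⟨LinearEquiv.ofBijective M.evalDual
    ⟨M.evalDual_injective, M.evalDual_surjective hfin⟩, fun n k v w => ?_, fun r w hw => ?_⟩
  · apply Subtype.ext
    ext f
    exact (M.contragredient_opp n k v f w).symm
  · intro s hs f hf
    exact hf r (fun e => hs e.symm) w hw

end

end TwData

/-! ### Contragredients in the categories of twisted modules -/

namespace TwData

section

variable {V : Type v} [AddCommGroup V] [Module ℂ V] {𝒱 : VOA V} {G : Subgroup (V ≃ₗ[ℂ] V)} {g : G}
  {W : Type u} [AddCommGroup W] [Module ℂ W] {M : TwData 𝒱 W}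

theorem opp_map {g : V ≃ₗ[ℂ] V} (hg : 𝒱.IsAutomorphism g) {T : Module.End ℂ W}
    (hT : ∀ n k v w, T (M.Y n k v w) = M.Y n k (g v) (T w)) (n : ℂ) (k : ℕ) (v : V) (w : W) :
    T (M.opp n k v w) = M.opp n k (g v) (T w) := by
  refine 𝒱.internal.induction (motive := fun v => T (M.opp n k v w) = M.opp n k (g v) (T w))
    (fun d v hv => ?_) (by simp) (fun x y hx hy => by simp [hx, hy]) v
  rw [M.opp_eq hv le_rfl, M.opp_eq (hg.mem_wt hv) le_rfl, map_sum]
  refine Finset.sum_congr rfl fun m _ => ?_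
  rw [map_smul, hT, hg.map_L_pow]

namespace GAction

theorem gwt_le (A : M.GAction G g) (r : ℂ) (α : AddCircle (1 : ℂ)) : A.gwt r α ≤ M.wt r := by
  rw [← A.iSup_gwt r]
  exact le_iSup (A.gwt r) α

/-- A number `e^{2πiα}`, for `α ∈ ℂ/ℤ`. -/
def expTwoPi (α : AddCircle (1 : ℂ)) : ℂ :=
  Complex.exp (2 * Real.pi * Complex.I * Quotient.out α)

theorem expTwoPi_injective : Function.Injective expTwoPi := by
  intro α β h
  obtain ⟨n, hn⟩ := Complex.exp_eq_exp_iff_exists_int.1 h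
  have h2 : (Quotient.out α : ℂ) = Quotient.out β + n := by
    have : (2 * Real.pi * Complex.I : ℂ) ≠ 0 := Complex.two_pi_I_ne_zero
    refine mul_left_cancel₀ this ?_
    rw [hn]
    ring
  have hα : ((Quotient.out α : ℂ) : AddCircle (1 : ℂ)) = α := Quotient.out_eq' α
  have hβ : ((Quotient.out β : ℂ) : AddCircle (1 : ℂ)) = β := Quotient.out_eq' β
  rw [← hα, ← hβ, h2, AddCircle.coe_add]
  have : ((n : ℂ) : AddCircle (1 : ℂ)) = 0 := by
    rw [AddCircle.coe_eq_zero_iff]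
    exact ⟨n, by simp⟩
  rw [this, add_zero]

theorem iSup_iSup_gwt (A : M.GAction G g) : ⨆ α, ⨆ r, A.gwt r α = ⊤ := by
  rw [iSup_comm]
  simp only [A.iSup_gwt]
  exact M.internal.submodule_iSup_eq_top

/-- The weight spaces for the grading by `g`-weights are generalized eigenspaces. -/
theorem iSup_gwt_eq (A : M.GAction G g) (α : AddCircle (1 : ℂ)) :
    ⨆ r, A.gwt r α = Module.End.maxGenEigenspace (A.ρ g) (expTwoPi α) := by
  obtain ⟨Λ, -, hΛ⟩ := A.g_grading
  refine eq_maxGenEigenspace_of_iSup_eq_top (p := fun α => ⨆ r, A.gwt r α) A.iSup_iSup_gwt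
    expTwoPi_injective (fun β w hw => ?_) α
  have hβ : ((Quotient.out β : ℂ) : AddCircle (1 : ℂ)) = β := Quotient.out_eq' β
  refine (Module.End.mem_maxGenEigenspace _ _ _).2 ⟨Λ, hΛ _ w ?_⟩
  rw [hβ]
  exact hw

/-- In the joint grading, homogeneity for the first index and for the second each kill all
components with the wrong index. -/
theorem mem_gwt (A : M.GAction G g) {r : ℂ} {α : AddCircle (1 : ℂ)} {w : W} (hr : w ∈ M.wt r)
    (hα : w ∈ ⨆ r, A.gwt r α) : w ∈ A.gwt r α := by
  classical
  have hint : DirectSum.IsInternal (fun q : ℂ × AddCircle (1 : ℂ) => A.gwt q.1 q.2) := by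
    convert A.internal
  have h : ∀ q ∉ ({(r, α)} : Finset _), internalProj hint q w = 0 := by
    rintro ⟨s, β⟩ hq
    by_cases hs : s = r
    · have hβ : β ≠ α := by
        rintro rfl
        exact hq (by simp [hs])
      have hle : ⨆ r, A.gwt r α ≤ LinearMap.ker (internalProj hint (s, β)) := by
        refine iSup_le fun t x hx => ?_
        exact internalProj_of_mem_ne hint (q' := (t, α)) hx fun e => hβ (congrArg Prod.snd e).symm
      exact hle hα
    · have hle : M.wt r ≤ LinearMap.ker (internalProj hint (s, β)) := by
        rw [← A.iSup_gwt]
        refine iSup_le fun γ x hx => ?_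
        exact internalProj_of_mem_ne hint (q' := (r, γ)) hx fun e => hs (congrArg Prod.fst e).symm
      exact hle hr
  have := sum_internalProj hint h
  rw [Finset.sum_singleton] at this
  rw [← this]
  exact internalProj_mem hint (r, α) w

/-- The action of g commutes with L(0) because g fixes ω, so it preserves generalized eigenspaces of
L(0) as well as its own. -/
theorem map_mem_gwt (A : M.GAction G g) (hM : M.IsGeneralizedTwisted (g : V ≃ₗ[ℂ] V))
    (hg : 𝒱.IsAutomorphism (g : V ≃ₗ[ℂ] V)) {r : ℂ} {α : AddCircle (1 : ℂ)} {w : W}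
    (hw : w ∈ A.gwt r α) : A.ρ g w ∈ A.gwt r α := by
  have hL : ∀ x, A.ρ g (M.L 0 x) = M.L 0 (A.ρ g x) := by
    intro x
    rw [TwData.L, A.compatible, hg.2.2]
  refine A.mem_gwt ?_ ?_
  · obtain ⟨K, hK⟩ := hM.L0_grading r w (A.gwt_le r α hw)
    refine hM.mem_wt (K := K) ?_
    have : ∀ (K : ℕ) (x : W), ((M.L 0 - r • LinearMap.id : Module.End ℂ W) ^ K) (A.ρ g x) =
        A.ρ g (((M.L 0 - r • LinearMap.id : Module.End ℂ W) ^ K) x) := by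
      intro K
      induction K with
      | zero => intro x; rfl
      | succ K ih =>
        intro x
        rw [pow_succ, Module.End.mul_apply, Module.End.mul_apply, ← ih]
        simp [hL]
    rw [this, hK, map_zero]
  · have h1 : w ∈ ⨆ r, A.gwt r α := Submodule.mem_iSup_of_mem r hw
    rw [iSup_gwt_eq] at h1 ⊢
    exact Module.End.mapsTo_maxGenEigenspace_of_comm (Commute.refl _) _ h1

/-- The action on the contragredient. -/
def dualRep (A : M.GAction G g) : Representation ℂ G M.gradedDual where
  toFun h :=
    { toFun := fun f => ⟨f.1 ∘ₗ A.ρ h⁻¹, A.dual_preserved h⁻¹ f.1 f.2⟩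
      map_add' := fun _ _ => rfl
      map_smul' := fun _ _ => rfl }
  map_one' := by
    ext f w
    simp
  map_mul' x y := by
    ext f w
    simp

theorem dualRep_apply (A : M.GAction G g) (h : G) (f : M.gradedDual) (w : W) :
    (A.dualRep h f).1 w = f.1 (A.ρ h⁻¹ w) := rfl

/-- The grading of the contragredient dual to the one of the module. -/
def dualGwt (A : M.GAction G g) (r : ℂ) (α : AddCircle (1 : ℂ)) : Submodule ℂ M.gradedDual where
  carrier := {f | ∀ s β, (s, β) ≠ (r, α) → ∀ w ∈ A.gwt s β, f.1 w = 0}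
  zero_mem' := fun _ _ _ _ _ => rfl
  add_mem' := by
    intro f f' hf hf' s β h w hw
    rw [Submodule.coe_add, LinearMap.add_apply, hf s β h w hw, hf' s β h w hw, add_zero]
  smul_mem' := by
    intro c f hf s β h w hw
    rw [Submodule.coe_smul, LinearMap.smul_apply, hf s β h w hw, smul_zero]

theorem dualGwt_le (A : M.GAction G g) (r : ℂ) (α : AddCircle (1 : ℂ)) :
    A.dualGwt r α ≤ M.dualWt r := by
  intro f hf s hs w hw
  have hle : M.wt s ≤ LinearMap.ker f.1 := by
    rw [← A.iSup_gwt]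
    exact iSup_le fun β x hx => hf s β (fun e => hs (congrArg Prod.fst e)) x hx
  exact hle hw

theorem eq_zero_of_gwt (A : M.GAction G g) {f : M.gradedDual}
    (h : ∀ r α, ∀ w ∈ A.gwt r α, f.1 w = 0) : f = 0 := by
  refine Subtype.ext (M.eq_zero_of_homogeneous _ fun s w hw => ?_)
  have hle : M.wt s ≤ LinearMap.ker f.1 := by
    rw [← A.iSup_gwt]
    exact iSup_le fun β x hx => h s β x hx
  exact hle hw

/-- A finite-dimensional weight space meets only finitely many g-weights, so a homogeneous
functional is a finite sum of its restrictions to them. -/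
theorem dualWt_le_iSup (A : M.GAction G g) (hfin : ∀ r, FiniteDimensional ℂ (M.wt r)) (r : ℂ) :
    M.dualWt r ≤ ⨆ α, A.dualGwt r α := by
  classical
  have hint : DirectSum.IsInternal (fun q : ℂ × AddCircle (1 : ℂ) => A.gwt q.1 q.2) := by
    convert A.internal
  intro f hf
  have := hfin r
  obtain ⟨s, hs⟩ := exists_finset_internalProj_of_finite hint (N := M.wt r)
  have hmem : ∀ q : ℂ × AddCircle (1 : ℂ), f.1 ∘ₗ internalProj hint q ∈ M.gradedDual := by
    intro q
    refine (Set.finite_singleton q.1).subset ?_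
    rintro t ⟨w, hw, hne⟩
    by_contra ht
    have hle : M.wt t ≤ LinearMap.ker (f.1 ∘ₗ internalProj hint q) := by
      rw [← A.iSup_gwt]
      refine iSup_le fun β x hx => ?_
      rw [LinearMap.mem_ker, LinearMap.comp_apply,
        internalProj_of_mem_ne hint (q' := (t, β)) hx fun e => ht (congrArg Prod.fst e), map_zero]
    exact hne (hle hw)
  have hsum : f = ∑ q ∈ s.filter (fun q => q.1 = r),
      (⟨f.1 ∘ₗ internalProj hint q, hmem q⟩ : M.gradedDual) := by
    rw [← sub_eq_zero]
    refine A.eq_zero_of_gwt fun t β w hw => ?_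
    rw [Submodule.coe_sub, LinearMap.sub_apply, AddSubmonoidClass.coe_finsetSum,
      LinearMap.sum_apply, sub_eq_zero]
    simp only [LinearMap.comp_apply]
    by_cases hw0 : w = 0
    · simp [hw0]
    by_cases ht : t = r
    · subst ht
      rw [Finset.sum_eq_single (t, β), internalProj_of_mem hint (q := (t, β)) hw]
      · intro q _ hq
        rw [internalProj_of_mem_ne hint (q' := (t, β)) hw hq.symm, map_zero]
      · intro hq
        exfalso
        refine hw0 ?_
        have hq' : (t, β) ∉ s := fun h => hq (Finset.mem_filter.2 ⟨h, rfl⟩)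
        rw [← internalProj_of_mem hint (q := (t, β)) hw]
        exact hs w (A.gwt_le t β hw) _ hq'
    · rw [hf t ht w (A.gwt_le t β hw), Finset.sum_eq_zero]
      intro q hq
      rw [internalProj_of_mem_ne hint (q' := (t, β)) hw, map_zero]
      rintro rfl
      exact ht (Finset.mem_filter.1 hq).2
  rw [hsum]
  refine Submodule.sum_mem _ fun q hq => Submodule.mem_iSup_of_mem q.2 ?_
  intro t β hne w hw
  obtain rfl := (Finset.mem_filter.1 hq).2
  change f.1 (internalProj hint q w) = 0
  rw [internalProj_of_mem_ne hint (q' := (t, β)) hw hne, map_zero]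

theorem dualGwt_internal (A : M.GAction G g) (hfin : ∀ r, FiniteDimensional ℂ (M.wt r)) :
    letI := Classical.decEq (ℂ × AddCircle (1 : ℂ))
    DirectSum.IsInternal (fun q : ℂ × AddCircle (1 : ℂ) => A.dualGwt q.1 q.2) := by
  classical
  suffices h : DirectSum.IsInternal (fun q : ℂ × AddCircle (1 : ℂ) => A.dualGwt q.1 q.2) by
    convert h
  rw [DirectSum.isInternal_submodule_iff_iSupIndep_and_iSup_eq_top]
  constructor
  · rintro ⟨r, α⟩
    rw [Submodule.disjoint_def]
    intro f hf hf'
    refine A.eq_zero_of_gwt fun s β w hw => ?_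
    by_cases hq : (s, β) = (r, α)
    · let ev : M.gradedDual →ₗ[ℂ] ℂ := LinearMap.applyₗ w ∘ₗ M.gradedDual.subtype
      have hle : ⨆ (q : ℂ × AddCircle (1 : ℂ)) (_ : q ≠ (r, α)), A.dualGwt q.1 q.2 ≤
          LinearMap.ker ev := by
        refine iSup₂_le fun q hne x hx => ?_
        exact hx s β (fun e => hne (by rw [← hq, e])) w hw
      exact hle hf'
    · exact hf s β hq w hw
  · rw [eq_top_iff, ← M.dualWt_internal.submodule_iSup_eq_top]
    refine iSup_le fun r => (A.dualWt_le_iSup hfin r).trans (iSup_le fun α => ?_)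
    exact le_iSup (fun q : ℂ × AddCircle (1 : ℂ) => A.dualGwt q.1 q.2) (r, α)

/-- The action on the contragredient. -/
def contragredient (A : M.GAction G g) (hM : M.IsGeneralizedTwisted (g : V ≃ₗ[ℂ] V))
    (hg : 𝒱.IsAutomorphism (g : V ≃ₗ[ℂ] V)) (hfin : ∀ r, FiniteDimensional ℂ (M.wt r)) :
    M.contragredient.GAction G g⁻¹ where
  ρ := A.dualRep
  dual_preserved := by
    intro h φ hφ
    -- A functional on W' is evaluation at some w, and the transposed dual action of h is evaluation
    -- at h⁻¹w.
    obtain ⟨w, hw⟩ := M.evalDual_surjective hfin ⟨φ, hφ⟩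
    have : φ ∘ₗ A.dualRep h = (M.evalDual (A.ρ h⁻¹ w)).1 := by
      ext f
      have := congrArg Subtype.val hw
      rw [LinearMap.comp_apply, ← show (M.evalDual w).1 = φ from this]
      rfl
    rw [this]
    exact (M.evalDual _).2
  gwt := A.dualGwt
  internal := A.dualGwt_internal hfin
  iSup_gwt r := le_antisymm (iSup_le fun α => A.dualGwt_le r α) (A.dualWt_le_iSup hfin r)
  g_grading := by
    obtain ⟨Λ, hΛ0, hΛ⟩ := A.g_grading
    refine ⟨Λ, hΛ0, fun α f hf => ?_⟩
    -- The element g⁻¹ acts on W' as the transpose of g on W, so g-weights and the exponent Λ carry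
    -- over unchanged.
    have hT : ∀ f w, (A.dualRep g⁻¹ f).1 w = f.1 (A.ρ g w) := by
      intro f w
      rw [dualRep_apply, inv_inv]
    have hle : ⨆ r, A.dualGwt r (α : AddCircle (1 : ℂ)) ≤
        LinearMap.ker ((A.dualRep g⁻¹ - Complex.exp (2 * Real.pi * Complex.I * α) •
          LinearMap.id : Module.End ℂ M.gradedDual) ^ Λ) := by
      refine iSup_le fun r x hx => ?_
      refine A.eq_zero_of_gwt fun s β w hw => ?_
      rw [transpose_pow (M := M) hT]
      by_cases hq : (s, β) = (r, (α : AddCircle (1 : ℂ)))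
      · obtain rfl := (Prod.ext_iff.1 hq).2
        rw [hΛ α w (Submodule.mem_iSup_of_mem s hw), map_zero]
      · exact hx s β hq _ (sub_smul_pow_mem (fun y hy => A.map_mem_gwt hM hg hy) _ _ hw)
    exact hle hf
  compatible := by
    intro n k v f
    apply Subtype.ext
    ext w
    rw [contragredient_Y, dualRep_apply, contragredient_Y, dualRep_apply, inv_inv,
      opp_map hg A.compatible]
    congr 3
    exact (((g : V ≃ₗ[ℂ] V)).apply_symm_apply v).symm

end GAction

end

end TwData

section

variable {V : Type v} [AddCommGroup V] [Module ℂ V] {𝒱 : VOA V} {G : Subgroup (V ≃ₗ[ℂ] V)} {g : G}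
  {c : CatKind} {W : Type u} [AddCommGroup W] [Module ℂ W] {M : TwData 𝒱 W}

theorem InCat.contragredient (hG : ∀ g ∈ G, 𝒱.IsAutomorphism g) (h : InCat G c g M) :
    InCat G c g⁻¹ M.contragredient := by
  obtain ⟨h1, h2, h3⟩ := h
  refine ⟨h1.contragredient (hG g g.2) h2.2, h2.contragredient, ?_⟩
  cases c with
  | noAction => trivial
  | withAction => exact h3.map fun A => A.contragredient h1 (hG g g.2) h2.2

end

/-! ### Irreducibility of contragredients. -/

namespace TwData

section

variable {V : Type v} [AddCommGroup V] [Module ℂ V] {𝒱 : VOA V} {g : V ≃ₗ[ℂ] V}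
  {W : Type u} [AddCommGroup W] [Module ℂ W] {M : TwData 𝒱 W}

theorem exists_stable_opp {U : Submodule ℂ M.gradedDual}
    (hU : ∀ n k v, ∀ f ∈ U, M.contragredient.Y n k v f ∈ U) (n : ℂ) (k : ℕ) (v : V)
    {f : M.gradedDual} (hf : f ∈ U) : M.contragredient.opp n k v f ∈ U := by
  refine 𝒱.internal.induction (motive := fun v => M.contragredient.opp n k v f ∈ U)
    (fun d v hv => ?_) (by simp) (fun x y hx hy => ?_) v
  · rw [M.contragredient.opp_eq hv le_rfl]
    exact U.sum_mem fun m _ => U.smul_mem _ (hU _ _ _ f hf)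
  · rw [map_add, LinearMap.add_apply]
    exact U.add_mem hx hy

/-- Stable subspaces of twisted modules are graded. -/
theorem IsGeneralizedTwisted.proj_mem_of_stable (hM : M.IsGeneralizedTwisted g)
    {U : Submodule ℂ W} (hU : ∀ x ∈ U, M.L 0 x ∈ U) {w : W} (hw : w ∈ U) (r : ℂ) :
    (M.proj r w : W) ∈ U := by
  obtain ⟨s, hs⟩ := exists_finset_internalProj M.internal w
  by_cases hr : r ∈ s
  · refine mem_of_sum_mem_of_stable hU s (x := fun r => internalProj M.internal r w)
      (fun i _ => hM.L0_grading i _ (internalProj_mem _ _ _)) ?_ r hr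
    rw [sum_internalProj _ hs]
    exact hw
  · have : (M.proj r w : W) = 0 := hs r hr
    rw [this]
    exact U.zero_mem

/-- The contragredient of an irreducible module is irreducible. -/
theorem IsIrreducible.contragredient (h : M.IsIrreducible)
    (hM' : M.contragredient.IsGeneralizedTwisted g) (hfin : ∀ r, FiniteDimensional ℂ (M.wt r)) :
    M.contragredient.IsIrreducible := by
  obtain ⟨hnt, hirr⟩ := h
  constructor
  · obtain ⟨w, hw⟩ := exists_ne (0 : W)
    obtain ⟨f, hf⟩ := M.exists_dual_ne_zero hw
    exact ⟨f, 0, fun e => hf (by rw [e]; rfl)⟩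
  intro U hU
  -- The common kernel of U is a submodule, since transposes of the operators of W are combinations
  -- of contragredient operators and so preserve U.
  let N : Submodule ℂ W := ⨅ f : U, LinearMap.ker f.1.1
  have hN : ∀ w, w ∈ N ↔ ∀ f ∈ U, f.1 w = 0 := by
    intro w
    simp [N, Submodule.mem_iInf]
  have hstab : ∀ n k v, ∀ w ∈ N, M.Y n k v w ∈ N := by
    intro n k v w hw
    rw [hN]
    intro f hf
    rw [← contragredient_opp]
    exact (hN w).1 hw _ (exists_stable_opp hU n k v hf)
  rcases hirr N hstab with hbot | htop
  · right
    have hgr : ∀ r, M.dualWt r ≤ U := by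
      intro r
      have := hfin r
      let R : M.gradedDual →ₗ[ℂ] Module.Dual ℂ (M.wt r) :=
        (Module.Dual.transpose (R := ℂ) (M.wt r).subtype) ∘ₗ M.gradedDual.subtype
      have hR : ∀ f w, R f w = f.1 w := fun f w => rfl
      -- In a finite-dimensional weight space, functionals without common kernel fill the dual. As U
      -- is graded, it then contains every homogeneous functional.
      have htop : U.map R = ⊤ := by
        have hco : (U.map R).dualCoannihilator = ⊥ := by
          rw [eq_bot_iff]
          intro w hw
          rw [Submodule.mem_dualCoannihilator] at hw
          have hwN : (w : W) ∈ N := by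
            rw [hN]
            intro f hf
            exact hw (R f) (Submodule.mem_map_of_mem hf)
          rw [hbot, Submodule.mem_bot] at hwN
          exact Subtype.ext hwN
        rw [← Subspace.dualCoannihilator_dualAnnihilator_eq (W := U.map R), hco,
          Submodule.dualAnnihilator_bot]
      intro f hf
      have hRf : R f ∈ U.map R := by rw [htop]; trivial
      obtain ⟨f', hf', he⟩ := hRf
      have hp := hM'.proj_mem_of_stable (fun x hx => hU _ _ _ x hx) hf' r
      have : f = (M.contragredient.proj r f' : M.gradedDual) := by
        have := contragredient_ext (M := M) (x := ⟨f, hf⟩) (y := M.contragredient.proj r f')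
          fun w hw => ?_
        · exact congrArg Subtype.val this
        · rw [contragredient_proj_apply r f' hw]
          exact (LinearMap.congr_fun he ⟨w, hw⟩).symm
      rw [this]
      exact hp
    rw [eq_top_iff, ← M.dualWt_internal.submodule_iSup_eq_top]
    exact iSup_le hgr
  · left
    rw [eq_bot_iff]
    intro f hf
    refine Subtype.ext (LinearMap.ext fun w => ?_)
    exact (hN w).1 (by rw [htop]; trivial) f hf

end

end TwData

/-! ### Vanishing of linear combinations of matrix coefficients of intertwining operators -/

/-- Each derivative is a unit times another member of the family, so common vanishing at one point
propagates to infinite order for every member, and entire functions vanishing to infinite order are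
zero. The intended family is indexed by (w₁, w₂), with L(-1) acting on w₁. -/
theorem eq_zero_of_deriv_family {σ : Type*} {φ : σ → ℂ → ℂ} {D : σ → σ}
    (h : ∀ s l, HasDerivAt (φ s) (Complex.exp l * φ (D s) l) l) {l₀ : ℂ} (h₀ : ∀ s, φ s l₀ = 0)
    (s : σ) (l : ℂ) : φ s l = 0 := by
  have han : ∀ s, AnalyticOnNhd ℂ (φ s) Set.univ := fun s =>
    DifferentiableOn.analyticOnNhd (fun l _ => (h s l).differentiableAt.differentiableWithinAt)
      isOpen_univ
  have hord : ∀ (n : ℕ) (s : σ), (n : ℕ∞) ≤ analyticOrderAt (φ s) l₀ := by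
    intro n
    induction n with
    | zero => intro s; simp
    | succ n ih =>
      intro s
      have ha := han s l₀ trivial
      rw [Nat.cast_succ, ← analyticOrderAt_deriv_ge_iff ha (h₀ s),
        show deriv (φ s) = Complex.exp * φ (D s) from funext fun l => (h s l).deriv,
        analyticOrderAt_mul (by fun_prop) (han _ l₀ trivial)]
      exact (ih _).trans le_add_self
  have htop := analyticOrderAt_eq_top.1 (ENat.eq_top_iff_forall_ge.2 fun n => hord n s)
  exact congrFun (AnalyticOnNhd.eq_of_eventuallyEq (han s) analyticOnNhd_const htop) l

/-- In the variable l = log x one has d/dl = x d/dx, whence the factor e^l in front of the formal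
x-derivative. -/
theorem FinSupp.hasDerivAt_evalLog {a : ℂ → ℕ → ℂ} (ha : FinSupp a) (l : ℂ) :
    HasDerivAt (evalLog a) (Complex.exp l *
      evalLog (fun n k => (-n) * a (n - 1) k + ((k : ℂ) + 1) * a (n - 1) (k + 1)) l) l := by
  classical
  let N : Finset ℂ := ha.toFinset.image Prod.fst
  obtain ⟨K, hK⟩ : ∃ K : ℕ, ∀ q ∈ ha.toFinset, q.2 < K :=
    ⟨ha.toFinset.sup Prod.snd + 1, fun q hq => Nat.lt_succ_of_le (Finset.le_sup (f := Prod.snd) hq)⟩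
  have hout : ∀ n k, (n ∉ N ∨ K ≤ k) → a n k = 0 := by
    intro n k h
    by_contra hne
    have hm : (n, k) ∈ ha.toFinset := ha.mem_toFinset.2 hne
    rcases h with h | h
    · exact h (Finset.mem_image_of_mem Prod.fst hm)
    · exact absurd (hK _ hm) (by simpa using h)
  have h1 : evalLog a = fun l => ∑ n ∈ N, ∑ k ∈ Finset.range K,
      Complex.exp ((-n - 1) * l) * l ^ k * a n k := by
    funext l
    rw [evalLog_eq_sum (F := N ×ˢ Finset.range K), Finset.sum_product]
    · rfl
    · intro n k h
      refine hout n k ?_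
      simp only [Finset.mem_product, Finset.mem_range, not_and_or, not_lt] at h
      exact h
  have h2 : evalLog (fun n k => (-n) * a (n - 1) k + ((k : ℂ) + 1) * a (n - 1) (k + 1)) l =
      ∑ n ∈ N, ∑ k ∈ Finset.range K, Complex.exp ((-n - 2) * l) * l ^ k *
        ((-n - 1) * a n k + ((k : ℂ) + 1) * a n (k + 1)) := by
    rw [evalLog_eq_sum (F := N.image (fun n => n + 1) ×ˢ Finset.range K), Finset.sum_product,
      Finset.sum_image fun x _ y _ h => add_right_cancel h]
    · refine Finset.sum_congr rfl fun n _ => Finset.sum_congr rfl fun k _ => ?_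
      rw [add_sub_cancel_right, smul_eq_mul, show -(n + 1) - 1 = -n - 2 by ring,
        show -(n + 1) = -n - 1 by ring]
    · intro n k h
      have h' : n - 1 ∉ N ∨ K ≤ k := by
        by_contra hc
        rw [not_or, not_not, not_le] at hc
        refine h (Finset.mem_product.2 ⟨Finset.mem_image.2 ⟨n - 1, hc.1, by ring⟩, ?_⟩)
        simpa using hc.2
      rw [hout _ _ h', hout (n - 1) (k + 1) (h'.imp_right fun h => h.trans (Nat.le_succ k))]
      ring
  rw [h1, h2, Finset.mul_sum]
  refine HasDerivAt.fun_sum fun n _ => ?_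
  have hd : ∀ k : ℕ, HasDerivAt (fun l : ℂ => Complex.exp ((-n - 1) * l) * l ^ k * a n k)
      ((Complex.exp ((-n - 1) * l) * (-n - 1) * l ^ k + Complex.exp ((-n - 1) * l) *
        (k * l ^ (k - 1))) * a n k) l := by
    intro k
    refine HasDerivAt.mul_const (HasDerivAt.mul ?_ (hasDerivAt_pow k l)) _
    simpa using ((hasDerivAt_id l).const_mul (-n - 1)).cexp
  convert HasDerivAt.fun_sum (u := Finset.range K) fun k _ => hd k using 1
  have he : Complex.exp ((-n - 1) * l) = Complex.exp l * Complex.exp ((-n - 2) * l) := by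
    rw [← Complex.exp_add]
    congr 1
    ring
  have hshift : ∑ k ∈ Finset.range K, Complex.exp ((-n - 1) * l) * (k * l ^ (k - 1)) * a n k =
      ∑ k ∈ Finset.range K, Complex.exp ((-n - 1) * l) * (((k : ℂ) + 1) * l ^ k) * a n (k + 1) := by
    have e1 := Finset.sum_range_succ' (fun k : ℕ => Complex.exp ((-n - 1) * l) *
      (k * l ^ (k - 1)) * a n k) K
    rw [Finset.sum_range_succ, hout n K (Or.inr le_rfl)] at e1
    simpa using e1
  simp only [add_mul, Finset.sum_add_distrib]
  rw [hshift, ← Finset.sum_add_distrib, Finset.mul_sum]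
  refine Finset.sum_congr rfl fun k _ => ?_
  rw [he]
  ring

namespace TwData

section

variable {V : Type v} [AddCommGroup V] [Module ℂ V] {𝒱 : VOA V}
  {W₁ : Type u₁} [AddCommGroup W₁] [Module ℂ W₁] {M₁ : TwData 𝒱 W₁}
  {W₂ : Type u₂} [AddCommGroup W₂] [Module ℂ W₂] {M₂ : TwData 𝒱 W₂}

theorem IsTwistedIntertwining.locFin {W₃ : Type u₃} [AddCommGroup W₃] [Module ℂ W₃]
    {M₃ : TwData 𝒱 W₃} {𝒴 : LogOperator W₁ W₂ W₃} (h : IsTwistedIntertwining M₁ M₂ M₃ 𝒴)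
    (w₁ : W₁) (w₂ : W₂) : M₃.LocFin (fun n k => 𝒴 n k w₁ w₂) := by
  refine M₁.internal.induction (motive := fun w₁ => M₃.LocFin (fun n k => 𝒴 n k w₁ w₂))
    (fun r₁ w₁ h₁ => ?_) (by simpa using LocFin.zero) (fun x y hx hy => by simpa using hx.add hy) w₁
  refine M₂.internal.induction (motive := fun w₂ => M₃.LocFin (fun n k => 𝒴 n k w₁ w₂))
    (fun r₂ w₂ h₂ => ?_) (by simpa using LocFin.zero) (fun x y hx hy => by simpa using hx.add hy) w₂
  obtain ⟨K, hK⟩ := h.log_bounded w₁ w₂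
  refine locFin_of_homog (c := r₁ + r₂ - 1) (K := K + 1) (fun n k => ?_) fun n k hk => hK n k hk
  have := h.graded r₁ r₂ n k w₁ h₁ w₂ h₂
  rwa [show r₁ + r₂ - n - 1 = r₁ + r₂ - 1 - n by ring] at this

variable {ι : Type*} [Fintype ι] {X : ι → Type u₃} [∀ i, AddCommGroup (X i)]
  [∀ i, Module ℂ (X i)] (N : ∀ i, TwData 𝒱 (X i)) (𝒴 : ∀ i, LogOperator W₁ W₂ (X i))

/-- The families of functionals for which the sum of the matrix coefficients of the given
operators at `log x = l` vanishes. -/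
def relations (l : ℂ) : Submodule ℂ (∀ i, (N i).gradedDual) where
  carrier := {f | ∀ w₁ w₂, ∑ i, (N i).pairing (f i)
    ((N i).evalAt (fun n k => 𝒴 i n k w₁ w₂) l) = 0}
  zero_mem' := by
    intro w₁ w₂
    refine Finset.sum_eq_zero fun i _ => ?_
    exact ((N i).pairingLeft _).map_zero
  add_mem' := by
    intro f f' hf hf' w₁ w₂
    simp only [Pi.add_apply, pairing_add, Finset.sum_add_distrib, hf w₁ w₂, hf' w₁ w₂, add_zero]
  smul_mem' := by
    intro c f hf w₁ w₂
    simp only [Pi.smul_apply, pairing_smul, ← Finset.mul_sum, hf w₁ w₂, mul_zero]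

variable {N 𝒴}

/-- Relations do not depend on the point. -/
theorem relations_le (h : ∀ i, IsTwistedIntertwining M₁ M₂ (N i) (𝒴 i)) (l l' : ℂ) :
    relations N 𝒴 l ≤ relations N 𝒴 l' := by
  intro f hf w₁ w₂
  let φ : W₁ × W₂ → ℂ → ℂ := fun w l => ∑ i, (N i).pairing (f i)
      ((N i).evalAt (fun n k => 𝒴 i n k w.1 w.2) l)
  refine eq_zero_of_deriv_family (φ := φ) (D := fun w => (M₁.L (-1) w.1, w.2)) (fun w l => ?_)
    (l₀ := l) (fun w => hf w.1 w.2) (w₁, w₂) l'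
  simp only [φ]
  rw [Finset.mul_sum]
  refine HasDerivAt.fun_sum fun i _ => ?_
  have hlf := fun w₁ w₂ => (h i).locFin w₁ w₂
  simp only [(hlf _ _).pairing_evalAt]
  have he : (fun n k => (f i).1 (𝒴 i n k (M₁.L (-1) w.1) w.2)) = fun n k =>
      (-n) * (f i).1 (𝒴 i (n - 1) k w.1 w.2) +
        ((k : ℂ) + 1) * (f i).1 (𝒴 i (n - 1) (k + 1) w.1 w.2) := by
    funext n k
    rw [(h i).L_neg_one_derivative, map_add, map_smul, map_smul, smul_eq_mul, smul_eq_mul]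
  rw [he]
  exact ((hlf w.1 w.2).dual (f i)).hasDerivAt_evalLog l

end

end TwData

/-! ### Products with one twisted vertex operator -/

theorem argPos_of_re_neg {z : ℂ} (hz : z.re < 0) :
    Real.pi / 2 < argPos z ∧ argPos z < 3 * Real.pi / 2 := by
  have h1 : ¬ |Complex.arg z| ≤ Real.pi / 2 := by
    rw [Complex.abs_arg_le_pi_div_two_iff]
    exact not_le.2 hz
  have h2 := Complex.neg_pi_lt_arg z
  have h3 := Complex.arg_le_pi z
  rw [abs_le, not_and_or, not_le, not_le] at h1
  unfold argPos
  split_ifs with h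
  · rcases h1 with h1 | h1 <;> constructor <;> linarith [Real.pi_pos]
  · rcases h1 with h1 | h1 <;> constructor <;> linarith [Real.pi_pos]

theorem argPos_ofReal_of_neg {x : ℝ} (hx : x < 0) : argPos (x : ℂ) = Real.pi := by
  rw [argPos, Complex.arg_ofReal_of_neg hx, if_neg (not_lt.2 Real.pi_pos.le)]

theorem logBranch_neg_exp (t : ℝ) :
    logBranch 0 ((-Real.exp t : ℝ) : ℂ) = t + Real.pi * Complex.I := by
  have h : ((-Real.exp t : ℝ) : ℂ) = Complex.exp (t + Real.pi * Complex.I) := by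
    rw [Complex.exp_add, Complex.exp_pi_mul_I]
    push_cast
    ring
  rw [h]
  refine logBranch_exp ?_ ?_ <;> simp <;> linarith [Real.pi_pos]

theorem logBranch_neg_one : logBranch 0 (-1) = Real.pi * Complex.I := by
  have := logBranch_neg_exp 0
  simpa using this

/-- The complement of `[-1, ∞)`. -/
def cutPlane : Set ℂ := {z | -(z + 1) ∈ Complex.slitPlane}

theorem isPreconnected_cutPlane : IsPreconnected cutPlane := by
  have h : cutPlane = (fun z : ℂ => -z - 1) '' Complex.slitPlane := by
    ext z
    constructor
    · intro hz
      exact ⟨-(z + 1), hz, by ring⟩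
    · rintro ⟨y, hy, rfl⟩
      have : -(-y - 1 + 1) = y := by ring
      simpa [cutPlane, this] using hy
  rw [h]
  exact (Complex.starConvex_one_slitPlane.isPathConnected
    (by simp)).isConnected.isPreconnected.image _ (by fun_prop)

/-- At z₂ = -1 the numbers z₁, z₂ and z₁ - z₂ = z₁ + 1 all avoid the cuts exactly when z₁ lies
outside [-1, ∞). This domain is connected and joins the iterate region to the product region. -/
theorem IsPreferredBranch.analyticOnNhd_cutPlane {f : ℂ × ℂ → ℂ} (hf : IsPreferredBranch f) :
    AnalyticOnNhd ℂ (fun z => f (z, -1)) cutPlane := by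
  intro z hz
  have hz' : -(z + 1) ∈ Complex.slitPlane := hz
  have hm : (z, (-1 : ℂ)) ∈ M2Slit := by
    refine ⟨?_, ?_, ?_⟩
    · change -z ∈ Complex.slitPlane
      rw [Complex.mem_slitPlane_iff] at hz' ⊢
      simp only [Complex.neg_re, Complex.neg_im, Complex.add_re, Complex.add_im, Complex.one_re,
        Complex.one_im] at hz' ⊢
      rcases hz' with h | h
      · left; linarith
      · right; simpa using h
    · change -(-1 : ℂ) ∈ Complex.slitPlane
      simp
    · change -(z - -1) ∈ Complex.slitPlane
      rwa [sub_neg_eq_add]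
  exact (hf.analytic _ hm).comp₂ analyticAt_id analyticAt_const

namespace TwData

section

variable {V : Type v} [AddCommGroup V] [Module ℂ V] {𝒱 : VOA V} {g : V ≃ₗ[ℂ] V}
  {W₁ : Type u₁} [AddCommGroup W₁] [Module ℂ W₁] {M₁ : TwData 𝒱 W₁}
  {W₂ : Type u₂} [AddCommGroup W₂] [Module ℂ W₂] {M₂ : TwData 𝒱 W₂}
  {ι : Type*} [Fintype ι] {X : ι → Type u₃} [∀ i, AddCommGroup (X i)]
  [∀ i, Module ℂ (X i)] {N : ∀ i, TwData 𝒱 (X i)} {𝒴 : ∀ i, LogOperator W₁ W₂ (X i)}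

/-- A relation between matrix coefficients of intertwining operators is a relation between
products with a twisted vertex operator. -/
theorem exists_hasSum_of_mem_relations (h : ∀ i, IsTwistedIntertwining M₁ M₂ (N i) (𝒴 i))
    {f : ∀ i, (N i).gradedDual} (hf : f ∈ relations N 𝒴 (Real.pi * Complex.I)) (u : V) (w₁ : W₁)
    (w₂ : W₂) {t : ℝ} (ht : 0 < t) : ∃ S : ι → ℂ, ∑ i, S i = 0 ∧
      ∀ i, HasSum (fun r : ℂ => (N i).pairing (f i) ((N i).ev (t + Real.pi * Complex.I) u
        ((N i).evalAt (fun n k => 𝒴 i n k w₁ w₂) (Real.pi * Complex.I) r : X i))) (S i) := by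
  have hdual := fun i => (h i).duality u w₁ w₂ (f i)
  choose F hF hd using hdual
  have hop : ∀ i w₁, (N i).evalOp (𝒴 i) w₁ (-1) w₂ =
      (N i).evalAt (fun n k => 𝒴 i n k w₁ w₂) (Real.pi * Complex.I) := by
    intro i w₁
    rw [evalOp, logBranch_neg_one]
  let Gf : ℂ → ℂ := fun z => ∑ i, F i (z, -1)
  have hG : AnalyticOnNhd ℂ Gf cutPlane := by
    intro z hz
    exact Finset.analyticAt_fun_sum _ fun i _ => (hF i).analyticOnNhd_cutPlane z hz
  have hG0 : Set.EqOn Gf 0 cutPlane := by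
    -- Near -3/2 one has 0 < |z₁ + 1| < 1, and the real part is negative, so the argument is within
    -- π/2 of that of -1. The iterates are therefore governed by the preferred branch.
    have hz₀ : (-(3 / 2) : ℂ) ∈ cutPlane := by
      simp only [cutPlane, Set.mem_ofPred_eq, Complex.mem_slitPlane_iff]
      left
      norm_num
    refine hG.eqOn_zero_of_preconnected_of_eventuallyEq_zero isPreconnected_cutPlane hz₀ ?_
    filter_upwards [Metric.ball_mem_nhds (-(3 / 2) : ℂ) (by norm_num : (0 : ℝ) < 1 / 4)] with z hz
    have hz' : ‖z + 3 / 2‖ < 1 / 4 := by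
      rwa [Metric.mem_ball, dist_eq_norm, sub_neg_eq_add] at hz
    have h1 : ‖z - -1‖ < ‖(-1 : ℂ)‖ := by
      have := norm_add_le (z + 3 / 2) (-(1 / 2))
      rw [show z + 3 / 2 + -(1 / 2) = z - -1 by ring] at this
      have e : ‖(-(1 / 2) : ℂ)‖ = 1 / 2 := by norm_num
      rw [norm_neg, norm_one]
      linarith
    have h2 : 0 < ‖z - -1‖ := by
      have := norm_sub_le (z + 3 / 2) (z - -1)
      rw [show z + 3 / 2 - (z - -1) = 1 / 2 by ring] at this
      have e : ‖((1 / 2) : ℂ)‖ = 1 / 2 := by norm_num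
      linarith
    have hre : z.re < 0 := by
      have := (Complex.abs_re_le_norm (z + 3 / 2)).trans_lt hz'
      rw [abs_lt] at this
      have e : (z + 3 / 2).re = z.re + 3 / 2 := by
        simp
      linarith [this.2]
    have hreg : |argPos z - argPos (-1)| < Real.pi / 2 := by
      have e : argPos (-1) = Real.pi := by
        have := argPos_ofReal_of_neg (x := -1) (by norm_num)
        simpa using this
      obtain ⟨h3, h4⟩ := argPos_of_re_neg hre
      rw [e, abs_lt]
      constructor <;> linarith
    have hs := hasSum_sum fun i (_ : i ∈ Finset.univ) => ((hd i z (-1)).2.2 h1 h2).2 hreg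
    -- Every term is the given relation applied to a component of Y(u, z + 1)w₁ in place of w₁.
    have hzero : (fun r : ℂ => ∑ i, (N i).pairing (f i)
        ((N i).evalOp (𝒴 i) (M₁.evalY 0 u (z - -1) w₁ r : W₁) (-1) w₂)) = 0 := by
      funext r
      simp only [hop]
      exact hf _ _
    rw [hzero] at hs
    exact hs.unique hasSum_zero
  -- At z₁ = -e^t with t > 0 both z₁ and z₁ - z₂ have argument π, and |z₁| > |z₂|, so the product
  -- condition applies.
  have hneg : ((-Real.exp t : ℝ) : ℂ) ∈ cutPlane := by
    simp only [cutPlane, Set.mem_ofPred_eq, Complex.mem_slitPlane_iff]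
    left
    have := Real.one_lt_exp_iff.2 ht
    rw [show -(((-Real.exp t : ℝ) : ℂ) + 1) = ((Real.exp t - 1 : ℝ) : ℂ) by push_cast; ring,
      Complex.ofReal_re]
    linarith
  refine ⟨fun i => F i (((-Real.exp t : ℝ) : ℂ), -1), hG0 hneg, fun i => ?_⟩
  have h1 := ((hd i ((-Real.exp t : ℝ) : ℂ) (-1)).1 ?_ (by simp)).2 ?_
  · rw [hop] at h1
    simp only [evalY_eq_ev, logBranch_neg_exp] at h1
    exact h1
  · have := Real.one_lt_exp_iff.2 ht
    simpa using this
  · have := Real.one_lt_exp_iff.2 ht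
    rw [show ((-Real.exp t : ℝ) : ℂ) - -1 = ((1 - Real.exp t : ℝ) : ℂ) by push_cast; ring,
      argPos_ofReal_of_neg (by linarith), argPos_ofReal_of_neg (by linarith), sub_self, abs_zero]
    positivity

end

end TwData

/-! ### Extraction of coefficients from vanishing products. -/

namespace TwData

section

variable {V : Type v} [AddCommGroup V] [Module ℂ V] {𝒱 : VOA V} {g : V ≃ₗ[ℂ] V}
  {W : Type u} [AddCommGroup W] [Module ℂ W] {M : TwData 𝒱 W}

/-- `w' ∘ Y_{n,k}(u)`, for `w'` in the graded dual. -/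
def transposeY (M : TwData 𝒱 W) (n : ℂ) (k : ℕ) : V →ₗ[ℂ] M.gradedDual →ₗ[ℂ] M.gradedDual :=
  M.contragredient.opp n k

theorem transposeY_apply (n : ℂ) (k : ℕ) (u : V) (f : M.gradedDual) (w : W) :
    (M.transposeY n k u f).1 w = f.1 (M.Y n k u w) := M.contragredient_opp n k u f w

/-- The intermediate weight is r = n + s - d + 1, so the sum over weights is a sum over exponents,
and the operator can be moved onto the functional. -/
theorem hasSum_transposeY {d : ℤ} {u : V} (hu : u ∈ 𝒱.wt d) {K : ℕ}
    (hK : ∀ n k, K ≤ k → ∀ w, M.Y n k u w = 0) {s : ℂ} {f : M.gradedDual} (hf : f ∈ M.dualWt s)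
    {x : M.Completion} {l S : ℂ}
    (h : HasSum (fun r : ℂ => M.pairing f (M.ev l u (x r : W))) S) :
    HasSum (fun n : ℂ => Complex.exp ((-n - 1) * l) *
      ∑ k ∈ Finset.range K, l ^ k * M.pairing (M.transposeY n k u f) x) S := by
  rw [← (Equiv.addRight (s - d + 1)).hasSum_iff] at h
  convert h using 2 with n
  rw [Function.comp_apply, Equiv.coe_addRight, M.pairing_of_mem hf,
    ev_homog hu (x _).2 (fun n k hk => hK n k hk _), map_sum, Finset.mul_sum]
  refine Finset.sum_congr rfl fun k _ => ?_
  have hmem : M.transposeY n k u f ∈ M.dualWt (n + (s - d + 1)) := by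
    have := M.contragredient.opp_graded d s n k u f hu hf
    rwa [show s - d + n + 1 = n + (s - d + 1) by ring] at this
  rw [M.pairing_of_mem hmem, transposeY_apply, map_smul, smul_eq_mul,
    show s - (n + (s - d + 1)) - d = -n - 1 by ring,
    show n + (s - d + 1) + d - s - 1 = n by ring]
  ring

theorem IsGeneralizedTwisted.equivariance_transposeY (hM : M.IsGeneralizedTwisted g)
    (hg : 𝒱.IsAutomorphism g) {d : ℤ} {v : V} (hv : v ∈ 𝒱.wt d) {K : ℕ}
    (hK : ∀ n k, K ≤ k → ∀ w, M.Y n k v w = 0) (hK' : ∀ n k, K ≤ k → ∀ w, M.Y n k (g v) w = 0)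
    (l n : ℂ) (f : M.gradedDual) :
    ∑ k ∈ Finset.range K, (l + 2 * Real.pi * Complex.I) ^ k • M.transposeY n k (g v) f =
      Complex.exp (2 * Real.pi * Complex.I * (n + 1)) •
        ∑ k ∈ Finset.range K, l ^ k • M.transposeY n k v f := by
  apply Subtype.ext
  ext w
  have h := congrArg (fun T : W →ₗ[ℂ] W => f.1 (T w)) (hM.equivariance_op hg hv hK hK' l n)
  simpa [AddSubmonoidClass.coe_finsetSum, LinearMap.sum_apply, transposeY_apply] using h

end

section

variable {V : Type v} [AddCommGroup V] [Module ℂ V] {𝒱 : VOA V} {g : V ≃ₗ[ℂ] V}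
  {W₁ : Type u₁} [AddCommGroup W₁] [Module ℂ W₁] {M₁ : TwData 𝒱 W₁}
  {W₂ : Type u₂} [AddCommGroup W₂] [Module ℂ W₂] {M₂ : TwData 𝒱 W₂}
  {ι : Type*} [Fintype ι] {X : ι → Type u₃} [∀ i, AddCommGroup (X i)]
  [∀ i, Module ℂ (X i)] {N : ∀ i, TwData 𝒱 (X i)} {𝒴 : ∀ i, LogOperator W₁ W₂ (X i)}

theorem exists_common_log_bound (hN : ∀ i, (N i).IsGeneralizedTwisted g)
    (hg : 𝒱.IsAutomorphism g) (u : V) :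
    ∃ K : ℕ, ∀ i n k, K ≤ k → ∀ w, (N i).Y n k u w = 0 := by
  have h := fun i => (hN i).exists_log_bound hg u
  choose K hK using h
  exact ⟨Finset.univ.sup K, fun i n k hk => hK i n k
    ((Finset.le_sup (f := K) (Finset.mem_univ i)).trans hk)⟩

/-- Exponents in one coset of ℤ, truncated on one side, give after multiplication by a power a
Laurent series in x = -e^{-t}. It vanishes at points accumulating at 0, so all coefficients vanish;
that of n₀ sits at position T after clearing the pole. -/
theorem coeff_eq_zero_of_hasSum {A : ℂ → ℂ} {n₀ : ℂ} (hA : ∀ n, A n ≠ 0 → ∃ m : ℤ, n = n₀ + m)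
    {T : ℕ} (hT : ∀ m : ℤ, m < -T → A (n₀ + m) = 0)
    (h : ∀ t : ℝ, 0 < t →
      HasSum (fun n : ℂ => Complex.exp ((-n - 1) * (t + Real.pi * Complex.I)) * A n) 0) :
    A n₀ = 0 := by
  have hinj : Function.Injective (fun m : ℤ => n₀ + m) := by
    intro m m' e
    exact_mod_cast add_left_cancel e
  have h1 : ∀ t : ℝ, 0 < t → HasSum (fun k : ℕ => A (n₀ + ((k - T : ℤ) : ℂ)) *
      (-(Real.exp (-t) : ℂ)) ^ k) 0 := by
    intro t ht
    have h2 := h t ht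
    rw [← hinj.hasSum_iff] at h2
    · have hx : (-(Real.exp (-t) : ℂ)) = Complex.exp (-(t + Real.pi * Complex.I)) := by
        rw [neg_add, Complex.exp_add, Complex.exp_neg (Real.pi * Complex.I), Complex.exp_pi_mul_I]
        push_cast
        norm_num
      have h3 : HasSum (fun m : ℤ => (-(Real.exp (-t) : ℂ)) ^ m * A (n₀ + m)) 0 := by
        have h4 := h2.mul_left (Complex.exp ((n₀ + 1) * (t + Real.pi * Complex.I)))
        rw [mul_zero] at h4
        refine Eq.mp (congrArg (fun F => HasSum F 0) (funext fun m => ?_)) h4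
        simp only [Function.comp_apply]
        rw [← mul_assoc, ← Complex.exp_add, hx, ← Complex.exp_int_mul]
        congr 2
        ring
      rw [hasSum_int_iff hT (by simp)] at h3
      simpa using h3
    · intro n hn
      have : A n = 0 := by
        by_contra hne
        obtain ⟨m, rfl⟩ := hA n hne
        exact hn ⟨m, rfl⟩
      rw [this, mul_zero]
  have hten : Tendsto (fun t : ℝ => (-(Real.exp (-t) : ℂ))) atTop (𝓝[≠] 0) := by
    refine tendsto_nhdsWithin_iff.2 ⟨?_, Eventually.of_forall fun t => by simp⟩
    have := (Complex.continuous_ofReal.tendsto 0).comp Real.tendsto_exp_neg_atTop_nhds_zero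
    simpa using this.neg
  have h5 := hasSum_of_frequently (G := 0) (R := 1)
    (b := fun k : ℕ => A (n₀ + ((k - T : ℤ) : ℂ))) one_pos (by fun_prop)
    (hten.frequently (Eventually.frequently ((eventually_gt_atTop 0).mono fun t ht => h1 t ht)))
  have h6 := h5.1.eq_zero
  have h7 := ofScalars_apply_const (fun k : ℕ => A (n₀ + ((k - T : ℤ) : ℂ))) T 1
  rw [h6] at h7
  simpa using h7.symm

/-- Individual series may contain logarithms, but their combination does not. By induction (g -
lam)u contributes nothing, so equivariance makes the combined polynomial in log x periodic under
2πi, hence constant, and power series uniqueness finishes the argument. -/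
theorem transposeY_mem_relations_of_pure (h : ∀ i, IsTwistedIntertwining M₁ M₂ (N i) (𝒴 i))
    (hN : ∀ i, (N i).IsGeneralizedTwisted g) (hR : ∀ i, (N i).IsGradingRestricted)
    (hg : 𝒱.IsAutomorphism g) {f : ∀ i, (N i).gradedDual} {s : ι → ℂ}
    (hs : ∀ i, f i ∈ (N i).dualWt (s i)) (hf : f ∈ relations N 𝒴 (Real.pi * Complex.I))
    {d : ℤ} {lam : ℂ} (j : ℕ) {u : V} (hu : u ∈ 𝒱.wt d)
    (hj : ((g.toLinearMap - lam • LinearMap.id : Module.End ℂ V) ^ j) u = 0) (n : ℂ) (k : ℕ) :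
    (fun i => (N i).transposeY n k u (f i)) ∈ relations N 𝒴 (Real.pi * Complex.I) := by
  induction j generalizing u n k with
  | zero =>
    have hu0 : u = 0 := by simpa using hj
    have : (fun i => (N i).transposeY n k u (f i)) = 0 := by
      funext i
      rw [hu0, map_zero]
      rfl
    rw [this]
    exact Submodule.zero_mem _
  | succ j ih =>
    intro w₁ w₂
    let x : ∀ i, (N i).Completion := fun i =>
      (N i).evalAt (fun n k => 𝒴 i n k w₁ w₂) (Real.pi * Complex.I)
    let A : V → ℂ → ℕ → ℂ := fun u n k => ∑ i, (N i).pairing ((N i).transposeY n k u (f i)) (x i)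
    change A u n k = 0
    obtain ⟨K₁, hK₁⟩ := exists_common_log_bound hN hg u
    obtain ⟨K₂, hK₂⟩ := exists_common_log_bound hN hg (g u)
    let K := K₁ + K₂ + 1
    have hK : ∀ i n k, K ≤ k → ∀ w, (N i).Y n k u w = 0 := fun i n k hk =>
      hK₁ i n k (by omega)
    have hK' : ∀ i n k, K ≤ k → ∀ w, (N i).Y n k (g u) w = 0 := fun i n k hk =>
      hK₂ i n k (by omega)
    have hzero : ∀ n k, (∀ i w, (N i).Y n k u w = 0) → A u n k = 0 := by
      intro n k hz
      refine Finset.sum_eq_zero fun i _ => ?_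
      have : (N i).transposeY n k u (f i) = 0 := by
        apply Subtype.ext
        ext w
        rw [transposeY_apply, hz, map_zero]
        rfl
      rw [this]
      exact ((N i).pairingLeft _).map_zero
    -- The induction hypothesis for (g - lam)u lets g act on the combined coefficient as the scalar
    -- lam, although g is only generalized diagonal on u.
    have hgu : ∀ n k, A (g u) n k = lam * A u n k := by
      intro n k
      have h1 := ih (u := (g.toLinearMap - lam • LinearMap.id : Module.End ℂ V) u)
        (by
          exact (𝒱.wt d).sub_mem (hg.mem_wt hu) ((𝒱.wt d).smul_mem lam hu))
        (by rw [← Module.End.mul_apply, ← pow_succ]; exact hj) n k w₁ w₂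
      have e : g u = (g.toLinearMap - lam • LinearMap.id : Module.End ℂ V) u + lam • u := by
        simp
      simp only [A]
      rw [e]
      simp only [map_add, LinearMap.add_apply, map_smul, LinearMap.smul_apply, pairing_add,
        pairing_smul, Finset.sum_add_distrib, ← Finset.mul_sum]
      rw [h1, zero_add]
    have hlam : ∀ n, Complex.exp (2 * Real.pi * Complex.I * (n + 1)) ≠ lam → ∀ k, A u n k = 0 :=
      fun n hn k => hzero n k fun i w => (hN i).coeff_eq_zero hg hu hj (Or.inr hn) w
    -- The monodromy e^{2πi(n+1)} and the scalar lam cancel, so the combined logarithmic polynomial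
    -- is invariant under translation by 2πi.
    have hconst : ∀ n k, 1 ≤ k → A u n k = 0 := by
      intro n k hk
      by_cases hn : Complex.exp (2 * Real.pi * Complex.I * (n + 1)) = lam
      · have hl0 : lam ≠ 0 := by rw [← hn]; exact Complex.exp_ne_zero _
        have hAK : ∀ k, K ≤ k → A u n k = 0 := fun k hk => hzero n k fun i w => hK i n k hk w
        rw [← logPoly_coeff hAK k]
        have htay : Polynomial.taylor (2 * Real.pi * Complex.I) (logPoly K (A u n)) =
            (1 : ℂ) • logPoly K (A u n) := by
          refine Polynomial.taylor_eq_of_eval fun l => ?_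
          rw [logPoly_eval, logPoly_eval, one_mul]
          have h1 : ∀ i, ∑ k ∈ Finset.range K, (l + 2 * Real.pi * Complex.I) ^ k *
              (N i).pairing ((N i).transposeY n k (g u) (f i)) (x i) =
              lam * ∑ k ∈ Finset.range K, l ^ k *
                (N i).pairing ((N i).transposeY n k u (f i)) (x i) := by
            intro i
            have := congrArg ((N i).pairingLeft (x i))
              ((hN i).equivariance_transposeY hg hu (hK i) (hK' i) l n (f i))
            simpa only [map_sum, map_smul, smul_eq_mul, pairingLeft_apply, hn] using this
          have h2 : ∑ k ∈ Finset.range K, (l + 2 * Real.pi * Complex.I) ^ k * A (g u) n k =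
              lam * ∑ k ∈ Finset.range K, l ^ k * A u n k := by
            simp only [A, Finset.mul_sum] at h1 ⊢
            rw [Finset.sum_comm, Finset.sum_congr rfl fun i _ => h1 i, Finset.sum_comm]
          refine mul_left_cancel₀ hl0 ?_
          rw [mul_comm lam (∑ k ∈ Finset.range K, A u n k * l ^ k)]
          calc lam * ∑ k ∈ Finset.range K, A u n k * (l + 2 * Real.pi * Complex.I) ^ k =
              ∑ k ∈ Finset.range K, (l + 2 * Real.pi * Complex.I) ^ k * A (g u) n k := by
                rw [Finset.mul_sum]
                refine Finset.sum_congr rfl fun k _ => ?_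
                rw [hgu]
                ring
            _ = _ := by
                rw [h2, mul_comm lam]
                congr 1
                exact Finset.sum_congr rfl fun k _ => mul_comm _ _
        rw [one_smul] at htay
        exact Polynomial.coeff_eq_zero_of_taylor_sub Complex.two_pi_I_ne_zero (j := 0)
          (fun k _ => by rw [htay, sub_self, Polynomial.coeff_zero]) k (by simpa using hk)
      · exact hlam n hn k
    rcases Nat.eq_zero_or_pos k with rfl | hk
    swap
    · exact hconst n k hk
    by_cases hn : Complex.exp (2 * Real.pi * Complex.I * (n + 1)) = lam
    swap
    · exact hlam n hn 0
    have hB := fun i => (hR i).1 (s i - d + n + 1)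
    choose B hB using hB
    -- Grading restriction kills weights far enough down; T is a common truncation bound for the
    -- finitely many modules.
    let T : ℕ := ∑ i, ⌈|B i|⌉₊
    have hT : ∀ i, -(T : ℝ) ≤ B i := by
      intro i
      have h1 : (⌈|B i|⌉₊ : ℝ) ≤ T := by
        exact_mod_cast Finset.single_le_sum (f := fun i => ⌈|B i|⌉₊) (fun _ _ => Nat.zero_le _)
          (Finset.mem_univ i)
      have h2 := Nat.le_ceil |B i|
      linarith [neg_abs_le (B i)]
    refine coeff_eq_zero_of_hasSum (A := fun n => A u n 0) (n₀ := n) (T := T) (fun n' hn' => ?_)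
      (fun m hm => ?_) (fun t ht => ?_)
    · have h1 : Complex.exp (2 * Real.pi * Complex.I * (n' + 1)) = lam := by
        by_contra hne
        exact hn' (hlam n' hne 0)
      rw [← hn] at h1
      obtain ⟨m, hm⟩ := Complex.exp_eq_exp_iff_exists_int.1 h1
      refine ⟨m, ?_⟩
      refine mul_left_cancel₀ Complex.two_pi_I_ne_zero ?_
      linear_combination hm
    · refine Finset.sum_eq_zero fun i _ => ?_
      have hm' : ((m : ℤ) : ℝ) < B i := by
        have : ((m : ℤ) : ℝ) < -(T : ℝ) := by exact_mod_cast hm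
        exact this.trans_le (hT i)
      have hbot : (N i).wt (s i - d + n + 1 + m) = ⊥ := by
        have := hB i m hm'
        rwa [Complex.ofReal_intCast] at this
      have hx : ∀ c, (N i).wt c = ⊥ → (x i c : X i) = 0 := fun c hc => by
        have : (x i c : X i) ∈ (⊥ : Submodule ℂ (X i)) := hc.le (x i c).2
        exact (Submodule.mem_bot ℂ).1 this
      have hmem : (N i).transposeY (n + m) 0 u (f i) ∈ (N i).dualWt (s i - d + n + 1 + m) := by
        have := (N i).contragredient.opp_graded d (s i) (n + m) 0 u (f i) hu (hs i)
        rwa [show s i - d + (n + m) + 1 = s i - d + n + 1 + m by ring] at this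
      rw [(N i).pairing_of_mem hmem, hx _ hbot, map_zero]
    · obtain ⟨S, hS0, hS⟩ := exists_hasSum_of_mem_relations h hf u w₁ w₂ ht
      have h1 := hasSum_sum fun i (_ : i ∈ Finset.univ) => hasSum_transposeY hu (hK i) (hs i) (hS i)
      rw [hS0] at h1
      convert h1 using 2 with n'
      rw [← Finset.mul_sum, Finset.sum_comm]
      congr 1
      rw [Finset.sum_eq_single_of_mem 0 (Finset.mem_range.2 (Nat.succ_pos _))]
      · simp [A, x]
      · intro k _ hk
        rw [← Finset.mul_sum, show ∑ i, (N i).pairing ((N i).transposeY n' k u (f i)) _ =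
          A u n' k from rfl, hconst n' k (Nat.one_le_iff_ne_zero.2 hk), mul_zero]

end

end TwData

/-! ### Transport along module maps -/

theorem DirectSum.isInternal_of_proj {κ A : Type*} [DecidableEq κ] [AddCommGroup A] [Module ℂ A]
    {p : κ → Submodule ℂ A} (π : κ → A →ₗ[ℂ] A) (h : ∀ q, ∀ x ∈ p q, π q x = x)
    (h' : ∀ q q', q' ≠ q → ∀ x ∈ p q', π q x = 0) (htop : ∀ x, x ∈ ⨆ q, p q) :
    DirectSum.IsInternal p := by
  rw [DirectSum.isInternal_submodule_iff_iSupIndep_and_iSup_eq_top]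
  refine ⟨fun q => ?_, Submodule.eq_top_iff'.2 htop⟩
  rw [Submodule.disjoint_def]
  intro x hx hx'
  have hle : (⨆ q', ⨆ (_ : q' ≠ q), p q') ≤ LinearMap.ker (π q) :=
    iSup_le fun q' => iSup_le fun hq => fun y hy => h' q q' hq y hy
  rw [← h q x hx]
  exact hle hx'

theorem isInternal_pi {ι κ : Type*} [Fintype ι] [DecidableEq κ] {X : ι → Type*}
    [∀ i, AddCommGroup (X i)] [∀ i, Module ℂ (X i)] {B : Type*} [AddCommGroup B] [Module ℂ B]
    (e : (∀ i, X i) ≃ₗ[ℂ] B) {p : ∀ i, κ → Submodule ℂ (X i)}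
    (hp : ∀ i, DirectSum.IsInternal (p i)) :
    DirectSum.IsInternal fun q =>
      (Submodule.pi Set.univ fun i => p i q).map e.toLinearMap := by
  classical
  refine DirectSum.isInternal_of_proj (fun q => e.toLinearMap ∘ₗ
    LinearMap.pi (fun i => internalProj (hp i) q ∘ₗ LinearMap.proj i) ∘ₗ e.symm.toLinearMap) ?_ ?_ ?_
  · rintro q _ ⟨x, hx, rfl⟩
    simp only [LinearMap.comp_apply, LinearEquiv.coe_coe, LinearEquiv.symm_apply_apply]
    congr 1
    funext i
    exact internalProj_of_mem _ (hx i trivial)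
  · rintro q q' hq _ ⟨x, hx, rfl⟩
    have : ∀ i, internalProj (hp i) q (x i) = 0 :=
      fun i => internalProj_of_mem_ne _ (hx i trivial) hq
    simp only [LinearMap.comp_apply, LinearEquiv.coe_coe, LinearEquiv.symm_apply_apply]
    rw [LinearEquiv.map_eq_zero_iff]
    funext i
    exact this i
  · intro x
    obtain ⟨y, rfl⟩ := e.surjective x
    rw [← Finset.univ_sum_single y, map_sum]
    refine Submodule.sum_mem _ fun i _ => ?_
    refine (hp i).induction (motive := fun w => e (Pi.single i w) ∈ _) (fun q w hw => ?_)
      (by simp) (fun a b ha hb => ?_) (y i)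
    · refine Submodule.mem_iSup_of_mem q ⟨Pi.single i w, fun j _ => ?_, rfl⟩
      by_cases hij : j = i
      · subst hij
        simpa using hw
      · simp [hij]
    · rw [Pi.single_add, map_add]
      exact Submodule.add_mem _ ha hb

namespace TwData

section

variable {V : Type v} [AddCommGroup V] [Module ℂ V] {𝒱 : VOA V} {g : V ≃ₗ[ℂ] V}
  {X : Type u₁} [AddCommGroup X] [Module ℂ X] {N : TwData 𝒱 X}
  {W : Type u} [AddCommGroup W] [Module ℂ W] {M : TwData 𝒱 W} {φ : X →ₗ[ℂ] W}

/-- The transpose of a module map. -/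
def IsModuleMap.dualMap (hφ : N.IsModuleMap M φ) : M.gradedDual →ₗ[ℂ] N.gradedDual where
  toFun f := ⟨f.1 ∘ₗ φ, Set.Finite.subset f.2 (by
    rintro r ⟨w, hw, hne⟩
    exact ⟨φ w, hφ.2 r w hw, hne⟩)⟩
  map_add' f f' := rfl
  map_smul' c f := rfl

theorem IsModuleMap.dualMap_apply (hφ : N.IsModuleMap M φ) (f : M.gradedDual) (x : X) :
    (hφ.dualMap f).1 x = f.1 (φ x) := rfl

/-- This adjunction turns conditions on matrix coefficients in the target into conditions in the
source, against the pulled-back functional. -/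
theorem IsModuleMap.pairing_dualMap (hφ : N.IsModuleMap M φ) (f : M.gradedDual)
    {x : N.Completion} {y : M.Completion} (h : ∀ r, φ (x r : X) = (y r : W)) :
    N.pairing (hφ.dualMap f) x = M.pairing f y := by
  obtain ⟨F, hF⟩ := M.exists_finset_dual f
  rw [N.pairing_eq_sum (f := hφ.dualMap f) (F := F) fun r hr w hw => hF r hr _ (hφ.2 r w hw),
    M.pairing_eq_sum hF]
  refine Finset.sum_congr rfl fun r _ => ?_
  rw [hφ.dualMap_apply, h]

theorem IsModuleMap.locFin (hφ : N.IsModuleMap M φ) {s : ℂ → ℕ → X} (hs : N.LocFin s) :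
    M.LocFin (fun n k => φ (s n k)) := by
  intro r
  refine Set.Finite.subset (hs r) fun q hq => ?_
  rw [Set.mem_ofPred_eq] at hq ⊢
  intro h0
  apply hq
  apply Subtype.ext
  have h1 : N.proj r (s q.1 q.2) = 0 := h0
  change ((M.proj r (φ (s q.1 q.2)) : M.wt r) : W) = 0
  rw [← hφ.map_proj, h1, Submodule.coe_zero, map_zero]

theorem IsModuleMap.map_evalAt (hφ : N.IsModuleMap M φ) {s : ℂ → ℕ → X} (hs : N.LocFin s)
    (l r : ℂ) : φ (N.evalAt s l r : X) = (M.evalAt (fun n k => φ (s n k)) l r : W) := by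
  have h1 := (hs r).map_evalLog (φ ∘ₗ (N.wt r).subtype) l
  have h2 := (hφ.locFin hs r).map_evalLog (M.wt r).subtype l
  refine h1.trans (Eq.trans ?_ h2.symm)
  congr 1
  funext n k
  exact hφ.map_proj r (s n k)

theorem IsModuleMap.map_ev (hφ : N.IsModuleMap M φ) (hN : N.LogBounded) (l : ℂ) (v : V) (w : X)
    (r : ℂ) : φ (N.ev l v w r : X) = (M.ev l v (φ w) r : W) := by
  rw [ev, hφ.map_evalAt (hN.locFin v w)]
  simp only [hφ.1]
  rfl

theorem IsModuleMap.dual (hφ : N.IsModuleMap M φ) (hN : N.LogBounded) {u v : V} {w : X}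
    {f : M.gradedDual} (h : N.Dual u v w (hφ.dualMap f)) : M.Dual u v (φ w) f := by
  obtain ⟨F, hF, h⟩ := h
  have h1 : ∀ l l' u v r, N.pairing (hφ.dualMap f) (N.ev l u (N.ev l' v w r : X)) =
      M.pairing f (M.ev l u (M.ev l' v (φ w) r : W)) := by
    intro l l' u v r
    refine hφ.pairing_dualMap f fun r' => ?_
    rw [hφ.map_ev hN, hφ.map_ev hN]
  have h2 : ∀ l u, N.pairing (hφ.dualMap f) (N.ev l u w) = M.pairing f (M.ev l u (φ w)) :=
    fun l u => hφ.pairing_dualMap f fun r' => hφ.map_ev hN _ _ _ _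
  refine ⟨F, hF, fun p z₁ z₂ => ?_⟩
  have h3 := h p z₁ z₂
  simp only [h1, h2] at h3
  exact h3

theorem IsModuleMap.map_L_pow (hφ : N.IsModuleMap M φ) (c : ℂ) (K : ℕ) (x : X) :
    φ (((N.L 0 - c • LinearMap.id : Module.End ℂ X) ^ K) x) =
      ((M.L 0 - c • LinearMap.id : Module.End ℂ W) ^ K) (φ x) := by
  induction K generalizing x with
  | zero => simp
  | succ K ih =>
    rw [pow_succ, Module.End.mul_apply, ih, pow_succ, Module.End.mul_apply]
    congr 1
    have := hφ.1 (((0 : ℤ) : ℂ) + 1) 0 𝒱.ω x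
    simp only [LinearMap.sub_apply, LinearMap.smul_apply, LinearMap.id_apply, map_sub, map_smul, L,
      this]

end

section

variable {V : Type v} [AddCommGroup V] [Module ℂ V] {𝒱 : VOA V} {g : V ≃ₗ[ℂ] V}
  {ι : Type*} {X : ι → Type u₁} [∀ i, AddCommGroup (X i)] [∀ i, Module ℂ (X i)]
  {N : ∀ i, TwData 𝒱 (X i)}
  {W : Type u} [AddCommGroup W] [Module ℂ W] {M : TwData 𝒱 W} {φ : ∀ i, X i →ₗ[ℂ] W}

/-- Data spanned by images of twisted modules under module maps form a twisted module. -/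
theorem IsGeneralizedTwisted.of_span (hN : ∀ i, (N i).IsGeneralizedTwisted g)
    (hφ : ∀ i, (N i).IsModuleMap M (φ i)) (hspan : ⨆ i, LinearMap.range (φ i) = ⊤) :
    M.IsGeneralizedTwisted g := by
  have ind : ∀ {motive : W → Prop}, (∀ i x, motive (φ i x)) → motive 0 →
      (∀ x y, motive x → motive y → motive (x + y)) → ∀ w, motive w := by
    intro motive h1 h2 h3 w
    have hw : w ∈ ⨆ i, LinearMap.range (φ i) := hspan ▸ Submodule.mem_top
    induction hw using Submodule.iSup_induction' with
    | mem i x hx =>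
      obtain ⟨y, rfl⟩ := hx
      exact h1 i y
    | zero => exact h2
    | add x y _ _ hx hy => exact h3 x y hx hy
  have hlog : M.LogBounded := by
    intro v w
    refine ind (motive := fun w => ∃ K : ℕ, ∀ (n : ℂ) (k : ℕ), K < k → M.Y n k v w = 0)
      (fun i x => ?_) ⟨0, by simp⟩ ?_ w
    · obtain ⟨K, hK⟩ := (hN i).log_bounded v x
      exact ⟨K, fun n k hk => by rw [← (hφ i).1, hK n k hk, map_zero]⟩
    · rintro x y ⟨K, hK⟩ ⟨K', hK'⟩
      refine ⟨max K K', fun n k hk => ?_⟩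
      rw [map_add, hK n k (lt_of_le_of_lt (le_max_left _ _) hk),
        hK' n k (lt_of_le_of_lt (le_max_right _ _) hk), add_zero]
  refine ⟨hlog, fun p z hz v w => ?_, fun n k w => ?_, fun u v w f => ?_, fun r w hw => ?_,
    fun n k v w => ?_⟩
  · rw [evalY_eq_ev, evalY_eq_ev]
    refine ind (motive := fun w => M.ev (logBranch (p + 1) z) (g v) w = M.ev (logBranch p z) v w)
      (fun i x => ?_) (by simp [ev_zero_right]) (fun x y hx hy => ?_) w
    · funext r
      apply Subtype.ext
      rw [← (hφ i).map_ev (hN i).logBounded, ← (hφ i).map_ev (hN i).logBounded, ← evalY_eq_ev,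
        ← evalY_eq_ev, (hN i).equivariance p z hz]
    · rw [hlog.ev_add_right, hlog.ev_add_right, hx, hy]
  · refine ind (motive := fun w => M.Y n k 𝒱.vac w = if n = -1 ∧ k = 0 then w else 0)
      (fun i x => ?_) (by simp) (fun x y hx hy => ?_) w
    · rw [← (hφ i).1, (hN i).identity, apply_ite (φ i), map_zero]
    · rw [map_add, hx, hy]
      split_ifs <;> simp
  · refine Dual.exists_correlation (ind (motive := fun w => M.Dual u v w f) (fun i x => ?_)
      (dual_zero (by simp)) (fun x y hx hy => hx.add hy ?_ ?_ ?_) w)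
    · exact (hφ i).dual (hN i).logBounded ((hN i).dual u v x _)
    · intro l l' r
      rw [hlog.ev_add_right, Pi.add_apply, Submodule.coe_add, hlog.ev_add_right, map_add]
    · intro l l' r
      rw [hlog.ev_add_right, Pi.add_apply, Submodule.coe_add, hlog.ev_add_right, map_add]
    · intro l z r
      rw [hlog.ev_add_right, map_add]
  · rw [← M.proj_of_mem r w hw]
    refine ind (motive := fun w => ∃ K : ℕ,
      ((M.L 0 - r • LinearMap.id : Module.End ℂ W) ^ K) (M.proj r w : W) = 0)
      (fun i x => ?_) ⟨0, by simp⟩ ?_ w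
    · obtain ⟨K, hK⟩ := (hN i).L0_grading r _ ((N i).proj_mem r x)
      refine ⟨K, ?_⟩
      rw [← (hφ i).map_proj, ← (hφ i).map_L_pow, hK, map_zero]
    · rintro x y ⟨K, hK⟩ ⟨K', hK'⟩
      refine ⟨K + K', ?_⟩
      rw [map_add, Submodule.coe_add, map_add]
      nth_rewrite 1 [add_comm K K']
      rw [pow_add, pow_add, Module.End.mul_apply, Module.End.mul_apply, hK, hK', map_zero, map_zero,
        add_zero]
  · refine ind (motive := fun w => M.Y n k (𝒱.L (-1) v) w =
      (-n) • M.Y (n - 1) k v w + ((k : ℂ) + 1) • M.Y (n - 1) (k + 1) v w)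
      (fun i x => ?_) (by simp) (fun x y hx hy => ?_) w
    · simp only [← (hφ i).1, (hN i).L_neg_one_derivative, map_add, map_smul]
    · rw [map_add, hx, hy, map_add, map_add, smul_add, smul_add]
      abel

end

section

variable {V : Type v} [AddCommGroup V] [Module ℂ V] {𝒱 : VOA V} {g : V ≃ₗ[ℂ] V}
  {ι : Type*} [Fintype ι] {X : ι → Type u₁} [∀ i, AddCommGroup (X i)] [∀ i, Module ℂ (X i)]
  {B : Type u} [AddCommGroup B] [Module ℂ B]

/-- The structure on a space identified with a finite product of graded spaces with vertex
operator maps. -/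
def ofPiEquiv (e : (∀ i, X i) ≃ₗ[ℂ] B) (N : ∀ i, TwData 𝒱 (X i)) : TwData 𝒱 B where
  wt r := (Submodule.pi Set.univ fun i => (N i).wt r).map e.toLinearMap
  internal := isInternal_pi e fun i => (N i).internal
  Y n k := LinearMap.mk₂ ℂ (fun v b => e fun i => (N i).Y n k v (e.symm b i))
    (fun v v' b => by rw [← map_add]; congr 1; funext i; simp)
    (fun c v b => by rw [← map_smul]; congr 1; funext i; simp)
    (fun v b b' => by rw [← map_add]; congr 1; funext i; simp)
    (fun c v b => by rw [← map_smul]; congr 1; funext i; simp)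
  graded := by
    rintro d r n k v _ hv ⟨x, hx, rfl⟩
    refine ⟨_, fun i _ => ?_, rfl⟩
    rw [LinearEquiv.coe_coe, LinearEquiv.symm_apply_apply]
    exact (N i).graded d r n k v _ hv (hx i trivial)

variable (e : (∀ i, X i) ≃ₗ[ℂ] B) (N : ∀ i, TwData 𝒱 (X i))

theorem ofPiEquiv_Y (n : ℂ) (k : ℕ) (v : V) (x : ∀ i, X i) :
    (ofPiEquiv e N).Y n k v (e x) = e fun i => (N i).Y n k v (x i) := by
  change e (fun i => (N i).Y n k v (e.symm (e x) i)) = _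
  rw [LinearEquiv.symm_apply_apply]

theorem mem_ofPiEquiv_wt {r : ℂ} {x : ∀ i, X i} :
    e x ∈ (ofPiEquiv e N).wt r ↔ ∀ i, x i ∈ (N i).wt r := by
  constructor
  · rintro ⟨y, hy, h⟩ i
    rw [← e.injective h]
    exact hy i trivial
  · intro h
    exact ⟨x, fun i _ => h i, rfl⟩

theorem ofPiEquiv_single [DecidableEq ι] (i : ι) :
    (N i).IsModuleMap (ofPiEquiv e N) (e.toLinearMap ∘ₗ LinearMap.single ℂ X i) := by
  refine ⟨fun n k v w => ?_, fun r w hw => ?_⟩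
  · simp only [LinearMap.comp_apply, LinearEquiv.coe_coe, ofPiEquiv_Y]
    congr 1
    funext j
    by_cases hij : j = i
    · subst hij
      simp
    · simp [hij]
  · refine (mem_ofPiEquiv_wt e N).2 fun j => ?_
    by_cases hij : j = i
    · subst hij
      simpa using hw
    · simp [hij]

theorem ofPiEquiv_coord (i : ι) :
    (ofPiEquiv e N).IsModuleMap (N i) (LinearMap.proj i ∘ₗ e.symm.toLinearMap) := by
  refine ⟨fun n k v b => ?_, ?_⟩
  · obtain ⟨x, rfl⟩ := e.surjective b
    rw [ofPiEquiv_Y]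
    simp
  · rintro r _ ⟨x, hx, rfl⟩
    simpa using hx i trivial

theorem ofPiEquiv_proj (r : ℂ) (x : ∀ i, X i) :
    ((ofPiEquiv e N).proj r (e x) : B) = e fun i => ((N i).proj r (x i) : X i) := by
  apply e.symm.injective
  rw [LinearEquiv.symm_apply_apply]
  funext i
  simpa using (ofPiEquiv_coord e N i).map_proj r (e x)

variable {N}

theorem IsGeneralizedTwisted.ofPiEquiv (hN : ∀ i, (N i).IsGeneralizedTwisted g) :
    (ofPiEquiv e N).IsGeneralizedTwisted g := by
  classical
  refine IsGeneralizedTwisted.of_span hN (fun i => ofPiEquiv_single e N i) ?_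
  rw [Submodule.eq_top_iff']
  intro b
  obtain ⟨x, rfl⟩ := e.surjective b
  rw [← Finset.univ_sum_single x, map_sum]
  exact Submodule.sum_mem _ fun i _ => Submodule.mem_iSup_of_mem i ⟨x i, rfl⟩

theorem IsGradingRestricted.ofPiEquiv (hN : ∀ i, (N i).IsGradingRestricted) :
    (ofPiEquiv e N).IsGradingRestricted := by
  constructor
  · intro r
    have h := fun i => (hN i).1 r
    choose C hC using h
    obtain ⟨D, hD⟩ := (Set.finite_range C).bddBelow
    refine ⟨D, fun l hl => ?_⟩
    rw [eq_bot_iff]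
    rintro _ ⟨x, hx, rfl⟩
    have : x = 0 := by
      funext i
      have h1 := hx i trivial
      have h2 : (N i).wt (r + l) = ⊥ := hC i l (hl.trans_le (hD ⟨i, rfl⟩))
      exact (Submodule.mem_bot ℂ).1 (h2.le h1)
    rw [this, map_zero]
    exact Submodule.zero_mem _
  · intro r
    have := fun i => (hN i).2 r
    let ψ : (∀ i, (N i).wt r) →ₗ[ℂ] B := e.toLinearMap ∘ₗ
      LinearMap.pi fun i => ((N i).wt r).subtype ∘ₗ LinearMap.proj i
    have hle : (TwData.ofPiEquiv e N).wt r ≤ LinearMap.range ψ := by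
      rintro _ ⟨x, hx, rfl⟩
      exact ⟨fun i => ⟨x i, hx i trivial⟩, rfl⟩
    exact Submodule.finiteDimensional_of_le hle

end

end TwData

/-! ### Relations are stable under the vertex operators of the contragredients -/

namespace TwData

section

variable {V : Type v} [AddCommGroup V] [Module ℂ V] {𝒱 : VOA V} {g : V ≃ₗ[ℂ] V}
  {W₁ : Type u₁} [AddCommGroup W₁] [Module ℂ W₁] {M₁ : TwData 𝒱 W₁}
  {W₂ : Type u₂} [AddCommGroup W₂] [Module ℂ W₂] {M₂ : TwData 𝒱 W₂}

theorem exists_finset_proj {W : Type u} [AddCommGroup W] [Module ℂ W] (M : TwData 𝒱 W) (w : W) :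
    ∃ s : Finset ℂ, ∀ t, s ⊆ t → ∑ r ∈ t, (M.proj r w : W) = w := by
  refine M.internal.induction
    (motive := fun w => ∃ s : Finset ℂ, ∀ t, s ⊆ t → ∑ r ∈ t, (M.proj r w : W) = w)
    (fun r w hw => ⟨{r}, fun t h => ?_⟩) ⟨∅, by simp⟩ ?_ w
  · rw [Finset.sum_eq_single_of_mem r (h (by simp)), M.proj_of_mem r w hw]
    exact fun q _ h => M.proj_of_mem_ne r q h.symm w hw
  · rintro x y ⟨s, hs⟩ ⟨t, ht⟩
    refine ⟨s ∪ t, fun q h => ?_⟩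
    simp only [map_add, Submodule.coe_add, Finset.sum_add_distrib]
    rw [hs q (Finset.union_subset_left h), ht q (Finset.union_subset_right h)]

variable {ι : Type*} [Fintype ι] {X : ι → Type u₃} [∀ i, AddCommGroup (X i)]
  [∀ i, Module ℂ (X i)] {N : ∀ i, TwData 𝒱 (X i)} {𝒴 : ∀ i, LogOperator W₁ W₂ (X i)}

theorem transposeY_mem_relations_of_mem (h : ∀ i, IsTwistedIntertwining M₁ M₂ (N i) (𝒴 i))
    (hN : ∀ i, (N i).IsGeneralizedTwisted g) (hR : ∀ i, (N i).IsGradingRestricted)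
    (hg : 𝒱.IsAutomorphism g) {f : ∀ i, (N i).gradedDual} {s : ι → ℂ}
    (hs : ∀ i, f i ∈ (N i).dualWt (s i)) (hf : f ∈ relations N 𝒴 (Real.pi * Complex.I))
    (n : ℂ) (k : ℕ) (u : V) :
    (fun i => (N i).transposeY n k u (f i)) ∈ relations N 𝒴 (Real.pi * Complex.I) := by
  refine hg.induction (motive := fun u =>
    (fun i => (N i).transposeY n k u (f i)) ∈ relations N 𝒴 (Real.pi * Complex.I))
    (fun d lam j u hu hj => ?_) ?_ (fun x y hx hy => ?_) u
  · exact transposeY_mem_relations_of_pure h hN hR hg hs hf j hu hj n k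
  · simp only [map_zero, LinearMap.zero_apply]
    exact Submodule.zero_mem _
  · simp only [map_add, LinearMap.add_apply]
    exact Submodule.add_mem _ hx hy

/-- Each functional is split into homogeneous components, and the relation is read as one indexed by
pairs (module, weight). No component needs to be a relation by itself. The passage through log x =
πi is harmless because relations are independent of the point. -/
theorem transposeY_mem_relations (h : ∀ i, IsTwistedIntertwining M₁ M₂ (N i) (𝒴 i))
    (hN : ∀ i, (N i).IsGeneralizedTwisted g) (hR : ∀ i, (N i).IsGradingRestricted)
    (hg : 𝒱.IsAutomorphism g) {l : ℂ} {f : ∀ i, (N i).gradedDual} (hf : f ∈ relations N 𝒴 l)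
    (n : ℂ) (k : ℕ) (u : V) : (fun i => (N i).transposeY n k u (f i)) ∈ relations N 𝒴 l := by
  classical
  refine relations_le h (Real.pi * Complex.I) l ?_
  replace hf := relations_le h l (Real.pi * Complex.I) hf
  have hS := fun i => (N i).contragredient.exists_finset_proj (f i)
  choose S hS using hS
  let T : Finset ℂ := Finset.univ.biUnion S
  have hT : ∀ i, ∑ r : T, ((N i).contragredient.proj r (f i) : (N i).gradedDual) = f i := by
    intro i
    rw [Finset.sum_coe_sort T fun r => ((N i).contragredient.proj r (f i) : (N i).gradedDual)]
    exact hS i T (Finset.subset_biUnion_of_mem S (Finset.mem_univ i))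
  let N' : ∀ q : ι × T, TwData 𝒱 (X q.1) := fun q => N q.1
  let 𝒴' : ∀ q : ι × T, LogOperator W₁ W₂ (X q.1) := fun q => 𝒴 q.1
  let f' : ∀ q : ι × T, (N' q).gradedDual := fun q => (N q.1).contragredient.proj q.2 (f q.1)
  have hf' : f' ∈ relations N' 𝒴' (Real.pi * Complex.I) := by
    intro w₁ w₂
    rw [← hf w₁ w₂, Fintype.sum_prod_type]
    refine Finset.sum_congr rfl fun i _ => ?_
    refine (map_sum ((N i).pairingLeft
      ((N i).evalAt (fun n k => 𝒴 i n k w₁ w₂) (Real.pi * Complex.I))) (fun r : T =>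
      ((N i).contragredient.proj r (f i) : (N i).gradedDual)) Finset.univ).symm.trans ?_
    rw [hT, pairingLeft_apply]
  have h1 := transposeY_mem_relations_of_mem (N := N') (𝒴 := 𝒴') (fun q => h q.1)
    (fun q => hN q.1) (fun q => hR q.1) hg (f := f') (s := fun q => q.2)
    (fun q => (N q.1).contragredient.proj_mem _ _) hf' n k u
  intro w₁ w₂
  rw [← h1 w₁ w₂, Fintype.sum_prod_type]
  refine Finset.sum_congr rfl fun i _ => ?_
  refine Eq.trans ?_ (map_sum ((N i).pairingLeft
    ((N i).evalAt (fun n k => 𝒴 i n k w₁ w₂) (Real.pi * Complex.I)) ∘ₗ (N i).transposeY n k u) (fun r : T =>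
    ((N i).contragredient.proj r (f i) : (N i).gradedDual)) Finset.univ)
  rw [hT]
  rfl

theorem contragredient_Y_eq {W : Type u} [AddCommGroup W] [Module ℂ W] (M : TwData 𝒱 W) {d : ℤ}
    {v : V} (hv : v ∈ 𝒱.wt d) (n : ℂ) (k : ℕ) (f : M.gradedDual) :
    M.contragredient.Y n k v f = ∑ m ∈ Finset.range ((d - 𝒱.minWt).toNat + 1),
      ((-1 : ℂ) ^ k * (-1 : ℂ) ^ d / (m.factorial : ℂ)) •
        M.transposeY (2 * d - m - n - 2) k ((𝒱.L 1 ^ m : Module.End ℂ V) v) f := by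
  apply Subtype.ext
  ext w
  rw [contragredient_Y, opp_eq hv le_rfl, map_sum]
  simp [AddSubmonoidClass.coe_finsetSum, LinearMap.sum_apply, transposeY_apply]

theorem contragredient_Y_mem_relations (h : ∀ i, IsTwistedIntertwining M₁ M₂ (N i) (𝒴 i))
    (hN : ∀ i, (N i).IsGeneralizedTwisted g) (hR : ∀ i, (N i).IsGradingRestricted)
    (hg : 𝒱.IsAutomorphism g) {l : ℂ} {f : ∀ i, (N i).gradedDual} (hf : f ∈ relations N 𝒴 l)
    (n : ℂ) (k : ℕ) (v : V) :
    (fun i => (N i).contragredient.Y n k v (f i)) ∈ relations N 𝒴 l := by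
  refine 𝒱.internal.induction (motive := fun v =>
    (fun i => (N i).contragredient.Y n k v (f i)) ∈ relations N 𝒴 l)
    (fun d v hv => ?_) ?_ (fun x y hx hy => ?_) v
  · have : (fun i => (N i).contragredient.Y n k v (f i)) =
        ∑ m ∈ Finset.range ((d - 𝒱.minWt).toNat + 1),
          ((-1 : ℂ) ^ k * (-1 : ℂ) ^ d / (m.factorial : ℂ)) • fun i =>
            (N i).transposeY (2 * d - m - n - 2) k ((𝒱.L 1 ^ m : Module.End ℂ V) v) (f i) := by
      funext i
      rw [contragredient_Y_eq _ hv, Finset.sum_apply]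
      rfl
    rw [this]
    exact Submodule.sum_mem _ fun m _ =>
      Submodule.smul_mem _ _ (transposeY_mem_relations h hN hR hg hf _ _ _)
  · simp only [map_zero, LinearMap.zero_apply]
    exact Submodule.zero_mem _
  · simp only [map_add, LinearMap.add_apply]
    exact Submodule.add_mem _ hx hy

/-- Relations form a subspace of a finite product of contragredients, itself a twisted module. Being
stable under L(0), this subspace is graded. -/
theorem contragredient_proj_mem_relations (h : ∀ i, IsTwistedIntertwining M₁ M₂ (N i) (𝒴 i))
    (hN : ∀ i, (N i).IsGeneralizedTwisted g) (hR : ∀ i, (N i).IsGradingRestricted)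
    (hg : 𝒱.IsAutomorphism g) {l : ℂ} {f : ∀ i, (N i).gradedDual} (hf : f ∈ relations N 𝒴 l)
    (r : ℂ) :
    (fun i => ((N i).contragredient.proj r (f i) : (N i).gradedDual)) ∈ relations N 𝒴 l := by
  have hM := IsGeneralizedTwisted.ofPiEquiv (LinearEquiv.refl ℂ (∀ i, (N i).gradedDual))
    fun i => (hN i).contragredient hg (hR i).2
  have h1 := hM.proj_mem_of_stable (U := relations N 𝒴 l) (fun x hx =>
    contragredient_Y_mem_relations h hN hR hg hx _ _ _) hf r
  have h2 := ofPiEquiv_proj (LinearEquiv.refl ℂ (∀ i, (N i).gradedDual))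
    (fun i => (N i).contragredient) r f
  rw [LinearEquiv.refl_apply, LinearEquiv.refl_apply] at h2
  rwa [h2] at h1

end

end TwData

/-! ### Operations on intertwining operators -/

namespace TwData

section

variable {V : Type v} [AddCommGroup V] [Module ℂ V] {𝒱 : VOA V}
  {W₁ : Type u₁} [AddCommGroup W₁] [Module ℂ W₁] {M₁ : TwData 𝒱 W₁}
  {W₂ : Type u₂} [AddCommGroup W₂] [Module ℂ W₂] {M₂ : TwData 𝒱 W₂}
  {W₃ : Type u₃} [AddCommGroup W₃] [Module ℂ W₃] {M₃ : TwData 𝒱 W₃}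
  {W₄ : Type u} [AddCommGroup W₄] [Module ℂ W₄] {M₄ : TwData 𝒱 W₄}
  {𝒴 : LogOperator W₁ W₂ W₃} {φ : W₃ →ₗ[ℂ] W₄}

theorem IsModuleMap.map_evalOp (hφ : M₃.IsModuleMap M₄ φ)
    (h : IsTwistedIntertwining M₁ M₂ M₃ 𝒴) (w₁ : W₁) (z : ℂ) (w₂ : W₂) (r : ℂ) :
    φ (M₃.evalOp 𝒴 w₁ z w₂ r : W₃) =
      (M₄.evalOp (fun n k => (𝒴 n k).compr₂ φ) w₁ z w₂ r : W₄) :=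
  hφ.map_evalAt (h.locFin w₁ w₂) _ r

theorem IsModuleMap.map_nested (hφ : M₃.IsModuleMap M₄ φ) (hM : M₃.LogBounded) (m : ℕ)
    (u : Fin m → V) (z s : Fin m → ℂ) {x : M₃.Completion} {y : M₄.Completion}
    (h : ∀ r, φ (x r : W₃) = (y r : W₄)) (r : ℂ) :
    φ (M₃.nested m u z s x r : W₃) = (M₄.nested m u z s y r : W₄) := by
  induction m generalizing r with
  | zero => exact h r
  | succ m ih =>
    simp only [nested, evalY_eq_ev]
    rw [hφ.map_ev hM, ih]

/-- Matrix coefficients after composition with φ are those of 𝒴 against the pulled-back functional,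
so the analytic axioms transfer with the same functions. -/
theorem IsTwistedIntertwining.map (h : IsTwistedIntertwining M₁ M₂ M₃ 𝒴)
    (hφ : M₃.IsModuleMap M₄ φ) (hM : M₃.LogBounded) :
    IsTwistedIntertwining M₁ M₂ M₄ (fun n k => (𝒴 n k).compr₂ φ) := by
  have hprod : ∀ (m : ℕ) (u : Fin m → V) (w₁ : W₁) (w₂ : W₂) (w' : M₄.gradedDual)
      (z : Fin (m + 1) → ℂ) (s : Fin m → ℂ), M₄.pairing w' (M₄.nested m u (Fin.init z) s
        (M₄.evalOp (fun n k => (𝒴 n k).compr₂ φ) w₁ (z (Fin.last m)) w₂)) =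
      M₃.pairing (hφ.dualMap w') (M₃.nested m u (Fin.init z) s
        (M₃.evalOp 𝒴 w₁ (z (Fin.last m)) w₂)) := fun m u w₁ w₂ w' z s =>
    (hφ.pairing_dualMap w' (hφ.map_nested hM m u _ s (hφ.map_evalOp h _ _ _))).symm
  refine ⟨fun w₁ w₂ => ?_, fun r₁ r₂ n k w₁ h₁ w₂ h₂ => ?_, fun w₁ w₂ n k => ?_,
    fun u w₁ w₂ w' => ?_, fun m hm u w₁ w₂ w' => ?_, fun n k w₁ w₂ => ?_⟩
  · obtain ⟨K, hK⟩ := h.log_bounded w₁ w₂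
    exact ⟨K, fun n k hk => by rw [LinearMap.compr₂_apply, hK n k hk, map_zero]⟩
  · exact hφ.2 _ _ (h.graded r₁ r₂ n k w₁ h₁ w₂ h₂)
  · obtain ⟨B, hB⟩ := h.lower_truncation w₁ w₂ n k
    exact ⟨B, fun l hl => by rw [LinearMap.compr₂_apply, hB l hl, map_zero]⟩
  · obtain ⟨f, hf, hd⟩ := h.duality u w₁ w₂ (hφ.dualMap w')
    refine ⟨f, hf, fun z₁ z₂ => ?_⟩
    have e1 : ∀ r, M₃.pairing (hφ.dualMap w') (M₃.evalY 0 u z₁ (M₃.evalOp 𝒴 w₁ z₂ w₂ r : W₃)) =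
        M₄.pairing w' (M₄.evalY 0 u z₁
          (M₄.evalOp (fun n k => (𝒴 n k).compr₂ φ) w₁ z₂ w₂ r : W₄)) := fun r =>
      hφ.pairing_dualMap w' fun r' => by
        rw [evalY_eq_ev, hφ.map_ev hM, hφ.map_evalOp h, evalY_eq_ev]
    have e2 : ∀ w₁ w₂, M₃.pairing (hφ.dualMap w') (M₃.evalOp 𝒴 w₁ z₂ w₂) =
        M₄.pairing w' (M₄.evalOp (fun n k => (𝒴 n k).compr₂ φ) w₁ z₂ w₂) := fun w₁ w₂ =>
      hφ.pairing_dualMap w' (hφ.map_evalOp h _ _ _)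
    have h1 := hd z₁ z₂
    simp only [e1, e2] at h1
    exact h1
  · obtain ⟨h1, h2, h3⟩ := h.products m hm u w₁ w₂ (hφ.dualMap w')
    have e : M₄.productSum (fun n k => (𝒴 n k).compr₂ φ) m u w₁ w₂ w' =
        M₃.productSum 𝒴 m u w₁ w₂ (hφ.dualMap w') := by
      funext z
      simp only [productSum, hprod]
    rw [e]
    refine ⟨fun z hz => ?_, h2, h3⟩
    simp only [hprod]
    exact h1 z hz
  · simp only [LinearMap.compr₂_apply, h.L_neg_one_derivative, map_add, map_smul]

theorem LocFin.smul {W : Type*} [AddCommGroup W] [Module ℂ W] {M : TwData 𝒱 W} {s : ℂ → ℕ → W}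
    (hs : M.LocFin s) (c : ℂ) : M.LocFin (fun n k => c • s n k) := fun r => by
  simp only [map_smul]
  exact (hs r).map (c • LinearMap.id : M.wt r →ₗ[ℂ] M.wt r)

theorem evalAt_smul {W : Type*} [AddCommGroup W] [Module ℂ W] {M : TwData 𝒱 W} {s : ℂ → ℕ → W}
    (hs : M.LocFin s) (c l : ℂ) :
    M.evalAt (fun n k => c • s n k) l = c • M.evalAt s l := by
  funext r
  change evalLog (fun n k => M.proj r (c • s n k)) l = _
  simp only [map_smul]
  exact ((hs r).map_evalLog (c • LinearMap.id : M.wt r →ₗ[ℂ] M.wt r) l).symm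

/-- The `P(z)`-intertwining map of an intertwining operator. -/
def intertwiningMap (h : IsTwistedIntertwining M₁ M₂ M₃ 𝒴) (z : ℂ) :
    W₁ ⊗[ℂ] W₂ →ₗ[ℂ] M₃.Completion :=
  TensorProduct.lift (LinearMap.mk₂ ℂ (fun w₁ w₂ => M₃.evalOp 𝒴 w₁ z w₂)
    (fun w w' w₂ => by
      simp only [evalOp, map_add, LinearMap.add_apply]
      exact evalAt_add (h.locFin _ _) (h.locFin _ _) _)
    (fun c w w₂ => by
      simp only [evalOp, map_smul, LinearMap.smul_apply]
      exact evalAt_smul (h.locFin _ _) _ _)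
    (fun w₁ w w' => by
      simp only [evalOp, map_add]
      exact evalAt_add (h.locFin _ _) (h.locFin _ _) _)
    (fun c w₁ w => by
      simp only [evalOp, map_smul]
      exact evalAt_smul (h.locFin _ _) _ _))

theorem intertwiningMap_tmul (h : IsTwistedIntertwining M₁ M₂ M₃ 𝒴) (z : ℂ) (w₁ : W₁) (w₂ : W₂) :
    intertwiningMap h z (w₁ ⊗ₜ w₂) = M₃.evalOp 𝒴 w₁ z w₂ := rfl

theorem isPzIntertwiningMap_intertwiningMap (h : IsTwistedIntertwining M₁ M₂ M₃ 𝒴) (z : ℂ) :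
    IsPzIntertwiningMap M₁ M₂ M₃ z (intertwiningMap h z) := ⟨𝒴, h, intertwiningMap_tmul h z⟩

/-- Evaluation at z is linear in the operator, so a finite set of intertwining operators spanning
the operator space also spans the intertwining maps. -/
theorem IsTwistedIntertwining.exists_sum {t : Finset (LogOperator W₁ W₂ W₃)}
    (ht : ∀ 𝒴 ∈ t, IsTwistedIntertwining M₁ M₂ M₃ 𝒴)
    (hspan : intertwiningSpace M₁ M₂ M₃ ≤ Submodule.span ℂ t)
    (h : IsTwistedIntertwining M₁ M₂ M₃ 𝒴) : ∃ c : t → ℂ, ∀ z,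
      intertwiningMap h z = ∑ p : t, c p • intertwiningMap (ht p.1 p.2) z := by
  obtain ⟨c, hc⟩ := (Submodule.mem_span_finset' (R := ℂ)).1
    (hspan (Submodule.subset_span (s := {𝒴 | IsTwistedIntertwining M₁ M₂ M₃ 𝒴}) h))
  refine ⟨c, fun z => ?_⟩
  refine TensorProduct.ext' fun w₁ w₂ => ?_
  rw [intertwiningMap_tmul, LinearMap.sum_apply]
  simp only [LinearMap.smul_apply, intertwiningMap_tmul]
  have key : ∀ s : Finset t, M₃.LocFin (fun n k => ∑ p ∈ s, c p • p.1 n k w₁ w₂) ∧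
      M₃.evalAt (fun n k => ∑ p ∈ s, c p • p.1 n k w₁ w₂) (logBranch 0 z) =
        ∑ p ∈ s, c p • M₃.evalOp p.1 w₁ z w₂ := by
    classical
    intro s
    induction s using Finset.induction_on with
    | empty => simpa using ⟨LocFin.zero, evalAt_zero _⟩
    | insert p s hp ih =>
      have h1 := ((ht p.1 p.2).locFin w₁ w₂).smul (c p)
      simp only [Finset.sum_insert hp]
      refine ⟨h1.add ih.1, ?_⟩
      rw [evalAt_add h1 ih.1, ih.2, evalAt_smul ((ht p.1 p.2).locFin w₁ w₂)]
      rfl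
  rw [← (key Finset.univ).2, evalOp]
  congr 1
  funext n k
  rw [← hc]
  simp [Finset.sum_apply, LinearMap.sum_apply]

end

end TwData

/-! ### Group actions on products -/

namespace TwData

variable {V : Type v} [AddCommGroup V] [Module ℂ V] {𝒱 : VOA V} {G : Subgroup (V ≃ₗ[ℂ] V)} {g : G}
  {ι : Type*} {X : ι → Type u₁} [∀ i, AddCommGroup (X i)] [∀ i, Module ℂ (X i)]
  {N : ∀ i, TwData 𝒱 (X i)} {B : Type u} [AddCommGroup B] [Module ℂ B]

/-- The componentwise action on a product. -/
def piRep (e : (∀ i, X i) ≃ₗ[ℂ] B) (ρ : ∀ i, Representation ℂ G (X i)) :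
    Representation ℂ G B where
  toFun h := e.toLinearMap ∘ₗ LinearMap.pi (fun i => ρ i h ∘ₗ LinearMap.proj i) ∘ₗ
    e.symm.toLinearMap
  map_one' := by
    ext b
    obtain ⟨x, rfl⟩ := e.surjective b
    simp only [LinearMap.comp_apply, LinearEquiv.coe_coe, LinearEquiv.symm_apply_apply, map_one,
      Module.End.one_apply]
    rfl
  map_mul' h h' := by
    ext b
    obtain ⟨x, rfl⟩ := e.surjective b
    simp only [LinearMap.comp_apply, LinearEquiv.coe_coe, LinearEquiv.symm_apply_apply, map_mul,
      Module.End.mul_apply]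
    rfl

theorem piRep_apply (e : (∀ i, X i) ≃ₗ[ℂ] B) (ρ : ∀ i, Representation ℂ G (X i)) (h : G)
    (x : ∀ i, X i) : piRep e ρ h (e x) = e fun i => ρ i h (x i) := by
  change e (fun i => ρ i h (e.symm (e x) i)) = _
  rw [LinearEquiv.symm_apply_apply]

theorem piRep_sub_pow (e : (∀ i, X i) ≃ₗ[ℂ] B) (ρ : ∀ i, Representation ℂ G (X i)) (h : G) (c : ℂ)
    (K : ℕ) (x : ∀ i, X i) :
    ((piRep e ρ h - c • LinearMap.id : Module.End ℂ B) ^ K) (e x) =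
      e fun i => ((ρ i h - c • LinearMap.id : Module.End ℂ (X i)) ^ K) (x i) := by
  induction K generalizing x with
  | zero => simp
  | succ K ih =>
    have h1 : (piRep e ρ h - c • LinearMap.id : Module.End ℂ B) (e x) =
        e fun i => (ρ i h - c • LinearMap.id : Module.End ℂ (X i)) (x i) := by
      rw [LinearMap.sub_apply, piRep_apply, LinearMap.smul_apply, LinearMap.id_apply, ← map_smul,
        ← map_sub]
      rfl
    rw [pow_succ, Module.End.mul_apply, h1, ih]
    simp only [pow_succ, Module.End.mul_apply]

variable [Fintype ι]

/-- The action on a finite product of modules with `G`-action. -/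
def GAction.ofPiEquiv (e : (∀ i, X i) ≃ₗ[ℂ] B) (A : ∀ i, (N i).GAction G g) :
    (ofPiEquiv e N).GAction G g where
  ρ := piRep e fun i => (A i).ρ
  dual_preserved := by
    classical
    intro h f hf
    have h1 := fun i => (A i).dual_preserved h _ ((ofPiEquiv_single e N i).dualMap ⟨f, hf⟩).2
    refine (Set.finite_iUnion h1).subset ?_
    rintro r ⟨_, ⟨x, hx, rfl⟩, hne⟩
    by_contra hc
    apply hne
    rw [Set.mem_iUnion, not_exists] at hc
    rw [LinearMap.comp_apply, LinearEquiv.coe_coe, piRep_apply,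
      ← Finset.univ_sum_single (fun i => (A i).ρ h (x i)), map_sum, map_sum]
    refine Finset.sum_eq_zero fun i _ => ?_
    by_contra hi
    exact hc i ⟨x i, hx i trivial, hi⟩
  gwt r α := (Submodule.pi Set.univ fun i => (A i).gwt r α).map e.toLinearMap
  internal := by
    let _ := Classical.decEq (ℂ × AddCircle (1 : ℂ))
    exact isInternal_pi e fun i => (A i).internal
  iSup_gwt := by
    classical
    intro r
    apply le_antisymm
    · refine iSup_le fun α => Submodule.map_mono fun x hx i _ => ?_
      exact (A i).gwt_le r α (hx i trivial)
    · rintro _ ⟨x, hx, rfl⟩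
      rw [← Finset.univ_sum_single x, map_sum]
      refine Submodule.sum_mem _ fun i _ => ?_
      have hxi := hx i trivial
      have hi : x i ∈ ⨆ α, (A i).gwt r α := by
        rw [(A i).iSup_gwt]
        exact hxi
      refine Submodule.iSup_induction' _ (motive := fun y _ => e.toLinearMap (Pi.single i y) ∈
        ⨆ α, (Submodule.pi Set.univ fun i => (A i).gwt r α).map e.toLinearMap)
        (fun α y hy => ?_) (by simp) (fun a b _ _ ha hb => ?_) hi
      · refine Submodule.mem_iSup_of_mem α ⟨Pi.single i y, fun j _ => ?_, rfl⟩
        by_cases hij : j = i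
        · subst hij
          simpa using hy
        · simp [hij]
      · rw [Pi.single_add, map_add]
        exact Submodule.add_mem _ ha hb
  g_grading := by
    have h := fun i => (A i).g_grading
    choose Λ hΛ hA using h
    -- The exponent must dominate every Λ i; the added 1 keeps it positive for the empty product.
    refine ⟨∑ i, Λ i + 1, Nat.succ_pos _, fun α w hw => ?_⟩
    rw [← LinearMap.mem_ker]
    refine (iSup_le fun r => ?_ : (⨆ r, (Submodule.pi Set.univ fun i =>
      (A i).gwt r (α : AddCircle (1 : ℂ))).map e.toLinearMap) ≤ _) hw
    rintro _ ⟨x, hx, rfl⟩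
    rw [LinearMap.mem_ker, LinearEquiv.coe_coe, piRep_sub_pow, LinearEquiv.map_eq_zero_iff]
    funext i
    have h1 : Λ i ≤ ∑ i, Λ i + 1 :=
      (Finset.single_le_sum (fun _ _ => Nat.zero_le _) (Finset.mem_univ i)).trans (Nat.le_succ _)
    rw [← Nat.sub_add_cancel h1, pow_add, Module.End.mul_apply,
      hA i α (x i) (Submodule.mem_iSup_of_mem r (hx i trivial)), map_zero]
    rfl
  compatible := by
    intro n k v b
    obtain ⟨x, rfl⟩ := e.surjective b
    rw [ofPiEquiv_Y, piRep_apply, piRep_apply, ofPiEquiv_Y]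
    simp only [(A _).compatible]

end TwData

theorem InCat.ofPiEquiv {V : Type v} [AddCommGroup V] [Module ℂ V] {𝒱 : VOA V}
    {G : Subgroup (V ≃ₗ[ℂ] V)} {c : CatKind} {g : G} {ι : Type*} [Fintype ι] {X : ι → Type u}
    [∀ i, AddCommGroup (X i)] [∀ i, Module ℂ (X i)] {N : ∀ i, TwData 𝒱 (X i)}
    {B : Type u} [AddCommGroup B] [Module ℂ B] (e : (∀ i, X i) ≃ₗ[ℂ] B)
    (h : ∀ i, InCat G c g (N i)) : InCat G c g (TwData.ofPiEquiv e N) := by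
  refine ⟨TwData.IsGeneralizedTwisted.ofPiEquiv e fun i => (h i).1,
    TwData.IsGradingRestricted.ofPiEquiv e fun i => (h i).2.1, ?_⟩
  cases c with
  | noAction => trivial
  | withAction => exact ⟨TwData.GAction.ofPiEquiv e fun i => ((h i).2.2 : Nonempty _).some⟩

/-! ### Decomposition of functionals -/

/-- Among finitely many families of vectors parametrised by simple modules, with relations stable
under the operators, there are some which are independent and have the same span. -/
theorem exists_finset_injective {P J B : Type*} [Fintype P] {Y : P → Type*}
    [∀ p, AddCommGroup (Y p)] [∀ p, Module ℂ (Y p)] [AddCommGroup B] [Module ℂ B]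
    (lam : ∀ p, Y p →ₗ[ℂ] B) (T : J → ∀ p, Y p →ₗ[ℂ] Y p)
    (hirr : ∀ p (U : Submodule ℂ (Y p)), (∀ j, ∀ y ∈ U, T j p y ∈ U) → U = ⊥ ∨ U = ⊤)
    (hst : ∀ x : ∀ p, Y p, ∑ p, lam p (x p) = 0 → ∀ j, ∑ p, lam p (T j p (x p)) = 0) :
    ∃ S : Finset P, (∀ x : ∀ p, Y p, ∑ p ∈ S, lam p (x p) = 0 → ∀ p ∈ S, x p = 0) ∧
      ∀ p y, ∃ x : ∀ p, Y p, lam p y = ∑ q ∈ S, lam q (x q) := by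
  classical
  have hst' : ∀ (S : Finset P) (x : ∀ p, Y p), ∑ p ∈ S, lam p (x p) = 0 → ∀ j,
      ∑ p ∈ S, lam p (T j p (x p)) = 0 := by
    intro S x hx j
    have h := hst (fun p => if p ∈ S then x p else 0) (by
      rw [← hx, ← Finset.sum_subset (Finset.subset_univ S)]
      · exact Finset.sum_congr rfl fun p hp => by rw [if_pos hp]
      · intro p _ hp
        rw [if_neg hp, map_zero]) j
    rw [← h, ← Finset.sum_subset (Finset.subset_univ S)]
    · exact Finset.sum_congr rfl fun p hp => by rw [if_pos hp]
    · intro p _ hp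
      rw [if_neg hp, map_zero, map_zero]
  have key : ∀ Q : Finset P, ∃ S : Finset P, S ⊆ Q ∧
      (∀ x : ∀ p, Y p, ∑ p ∈ S, lam p (x p) = 0 → ∀ p ∈ S, x p = 0) ∧
      ∀ p ∈ Q, ∀ y, ∃ x : ∀ p, Y p, lam p y = ∑ q ∈ S, lam q (x q) := by
    intro Q
    induction Q using Finset.induction_on with
    | empty => exact ⟨∅, by simp⟩
    | insert p Q hp ih =>
      obtain ⟨S, hSQ, hinj, hspan⟩ := ih
      have hpS : p ∉ S := fun h => hp (hSQ h)
      let ΛS : (∀ p, Y p) →ₗ[ℂ] B := ∑ q ∈ S, lam q ∘ₗ LinearMap.proj q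
      have hΛ : ∀ x, ΛS x = ∑ q ∈ S, lam q (x q) := fun x => by simp [ΛS]
      have hupd : ∀ (x : ∀ p, Y p) y, ∑ q ∈ insert p S, lam q (Function.update x p y q) =
          lam p y + ∑ q ∈ S, lam q (x q) := by
        intro x y
        rw [Finset.sum_insert hpS, Function.update_self]
        congr 1
        refine Finset.sum_congr rfl fun q hq => ?_
        rw [Function.update_of_ne (by rintro rfl; exact hpS hq)]
      -- U consists of the vectors whose image lies in the sum already chosen. Stability of
      -- relations makes it a submodule, so by simplicity the new summand is either independent of
      -- the old ones or redundant.
      let U : Submodule ℂ (Y p) := (LinearMap.range ΛS).comap (lam p)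
      have hU : ∀ y, y ∈ U ↔ ∃ x : ∀ p, Y p, lam p y = ∑ q ∈ S, lam q (x q) := by
        intro y
        constructor
        · rintro ⟨x, hx⟩
          exact ⟨x, by rw [← hx, hΛ]⟩
        · rintro ⟨x, hx⟩
          exact ⟨x, by rw [hx, hΛ]⟩
      rcases hirr p U (fun j y hy => by
        obtain ⟨x, hx⟩ := (hU y).1 hy
        have h1 := hst' (insert p S) (Function.update (fun q => -x q) p y) (by
          rw [hupd, hx, ← Finset.sum_add_distrib]
          simp) j
        rw [Finset.sum_insert hpS, Function.update_self] at h1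
        refine (hU _).2 ⟨fun q => T j q (x q), ?_⟩
        rw [eq_neg_of_add_eq_zero_left h1, ← Finset.sum_neg_distrib]
        refine Finset.sum_congr rfl fun q hq => ?_
        rw [Function.update_of_ne (by rintro rfl; exact hpS hq)]
        simp) with h | h
      · refine ⟨insert p S, Finset.insert_subset_insert p hSQ, fun x hx => ?_, ?_⟩
        · rw [Finset.sum_insert hpS] at hx
          have hxp : x p ∈ U := (hU _).2 ⟨fun q => -x q, by
            rw [eq_neg_of_add_eq_zero_left hx, ← Finset.sum_neg_distrib]
            simp⟩
          rw [h, Submodule.mem_bot] at hxp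
          rw [hxp, map_zero, zero_add] at hx
          intro q hq
          rcases Finset.mem_insert.1 hq with rfl | hq
          · exact hxp
          · exact hinj x hx q hq
        · intro q hq y
          rcases Finset.mem_insert.1 hq with rfl | hq
          · exact ⟨Function.update 0 q y, by rw [hupd]; simp⟩
          · obtain ⟨x, hx⟩ := hspan q hq y
            exact ⟨Function.update x p 0, by rw [hupd, map_zero, zero_add, hx]⟩
      · refine ⟨S, hSQ.trans (Finset.subset_insert p Q), hinj, fun q hq y => ?_⟩
        rcases Finset.mem_insert.1 hq with rfl | hq
        · exact (hU y).1 (h ▸ Submodule.mem_top)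
        · exact hspan q hq y
  obtain ⟨S, -, h1, h2⟩ := key Finset.univ
  exact ⟨S, h1, fun p => h2 p (Finset.mem_univ p)⟩

theorem DirectSum.exists_finset_toModule {ι A : Type*} [DecidableEq ι] [AddCommGroup A]
    [Module ℂ A] {X : ι → Type*} [∀ i, AddCommGroup (X i)] [∀ i, Module ℂ (X i)]
    (f : ∀ i, X i →ₗ[ℂ] A) (d : DirectSum ι X) :
    ∃ s : Finset ι, ∀ t, s ⊆ t →
      ∑ i ∈ t, f i (DirectSum.component ℂ ι X i d) = DirectSum.toModule ℂ ι A f d := by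
  induction d using DirectSum.induction_on with
  | zero => exact ⟨∅, by simp⟩
  | of i x =>
    refine ⟨{i}, fun t ht => ?_⟩
    rw [Finset.sum_eq_single_of_mem i (ht (by simp))]
    · rw [← DirectSum.lof_eq_of ℂ, DirectSum.component.lof_self, DirectSum.toModule_lof]
    · intro j _ hj
      rw [← DirectSum.lof_eq_of ℂ, DirectSum.component.of, dif_neg hj.symm, map_zero]
  | add x y hx hy =>
    obtain ⟨s, hs⟩ := hx
    obtain ⟨t, ht⟩ := hy
    refine ⟨s ∪ t, fun q h => ?_⟩
    simp only [map_add, Finset.sum_add_distrib]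
    rw [hs q (Finset.union_subset_left h), ht q (Finset.union_subset_right h)]

namespace TwData

section

variable {V : Type v} [AddCommGroup V] [Module ℂ V] {𝒱 : VOA V}
  {W : Type u} [AddCommGroup W] [Module ℂ W] {M : TwData 𝒱 W}

section

variable {ι : Type*} [DecidableEq ι] {X : ι → Type u₁} [∀ i, AddCommGroup (X i)]
  [∀ i, Module ℂ (X i)] {N : ∀ i, TwData 𝒱 (X i)} {f : ∀ i, X i →ₗ[ℂ] W}

/-- The projections of a direct sum of submodules are module maps. -/
theorem isModuleMap_component (hf : ∀ i, (N i).IsModuleMap M (f i))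
    (hb : Function.Bijective (DirectSum.toModule ℂ ι W f)) (i : ι) :
    M.IsModuleMap (N i) (DirectSum.component ℂ ι X i ∘ₗ
      (LinearEquiv.ofBijective (DirectSum.toModule ℂ ι W f) hb).symm.toLinearMap) := by
  set e := LinearEquiv.ofBijective (DirectSum.toModule ℂ ι W f) hb with he
  have hsymm : ∀ j x, e.symm (f j x) = DirectSum.lof ℂ ι X j x := by
    intro j x
    rw [LinearEquiv.symm_apply_eq, he, LinearEquiv.ofBijective_apply, DirectSum.toModule_lof]
  set p : W →ₗ[ℂ] X i := DirectSum.component ℂ ι X i ∘ₗ e.symm.toLinearMap with hp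
  have hself : ∀ x, p (f i x) = x := by
    intro x
    rw [hp, LinearMap.comp_apply, LinearEquiv.coe_coe, hsymm, DirectSum.component.lof_self]
  have hne : ∀ j, j ≠ i → ∀ x, p (f j x) = 0 := by
    intro j hj x
    rw [hp, LinearMap.comp_apply, LinearEquiv.coe_coe, hsymm, DirectSum.component.of, dif_neg hj]
  have ind : ∀ {motive : W → Prop}, (∀ j x, motive (f j x)) → motive 0 →
      (∀ x y, motive x → motive y → motive (x + y)) → ∀ w, motive w := by
    intro motive h1 h2 h3 w
    obtain ⟨d, rfl⟩ := hb.2 w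
    induction d using DirectSum.induction_on with
    | zero => simpa using h2
    | of j x =>
      rw [← DirectSum.lof_eq_of ℂ, DirectSum.toModule_lof]
      exact h1 j x
    | add x y hx hy =>
      rw [map_add]
      exact h3 _ _ hx hy
  have hproj : ∀ r w, p (M.proj r w) = (N i).proj r (p w) := by
    intro r w
    refine ind (motive := fun w => p (M.proj r w) = (N i).proj r (p w)) (fun j x => ?_) (by simp)
      (fun x y hx hy => ?_) w
    · rw [← (hf j).map_proj]
      by_cases hj : j = i
      · subst hj
        rw [hself, hself]
      · rw [hne j hj, hne j hj, map_zero]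
        rfl
    · simp only [map_add, Submodule.coe_add, hx, hy]
  refine ⟨fun n k v w => ?_, fun r w hw => ?_⟩
  · refine ind (motive := fun w => p (M.Y n k v w) = (N i).Y n k v (p w)) (fun j x => ?_) (by simp)
      (fun x y hx hy => by simp only [map_add, hx, hy]) w
    rw [← (hf j).1]
    by_cases hj : j = i
    · subst hj
      rw [hself, hself]
    · rw [hne j hj, hne j hj, map_zero]
  · rw [← M.proj_of_mem r w hw, hproj]
    exact (N i).proj_mem _ _

end

/-- An element of the graded dual only sees finitely many summands of a direct sum. -/
theorem exists_finset_dualMap (hfin : ∀ r, FiniteDimensional ℂ (M.wt r)) {ι : Type*}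
    {X : ι → Type u₁} [∀ i, AddCommGroup (X i)] [∀ i, Module ℂ (X i)] {N : ∀ i, TwData 𝒱 (X i)}
    {f : ∀ i, X i →ₗ[ℂ] W} {p : ∀ i, W →ₗ[ℂ] X i} (hf : ∀ i, (N i).IsModuleMap M (f i))
    (hp : ∀ i, M.IsModuleMap (N i) (p i))
    (hsum : ∀ w, ∃ s : Finset ι, ∀ t, s ⊆ t → ∑ i ∈ t, f i (p i w) = w) (w' : M.gradedDual) :
    ∃ s : Finset ι, w' = ∑ i ∈ s, (hp i).dualMap ((hf i).dualMap w') := by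
  classical
  obtain ⟨F, hF⟩ := M.exists_finset_dual w'
  -- A finite basis of a weight space involves only finitely many summands.
  have hwt : ∀ r, ∃ s : Finset ι, ∀ t, s ⊆ t → ∀ w ∈ M.wt r, ∑ i ∈ t, f i (p i w) = w := by
    intro r
    obtain ⟨b, hb⟩ := Module.Finite.iff_fg.1 (hfin r)
    choose s hs using hsum
    refine ⟨b.biUnion s, fun t ht w hw => ?_⟩
    rw [← hb] at hw
    have := LinearMap.eqOn_span (f := ∑ i ∈ t, f i ∘ₗ p i) (g := LinearMap.id) (fun x hx => by
      simpa using hs x t ((Finset.subset_biUnion_of_mem s hx).trans ht)) hw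
    simpa using this
  choose s hs using hwt
  refine ⟨F.biUnion s, ?_⟩
  apply Subtype.ext
  rw [← sub_eq_zero]
  refine M.eq_zero_of_homogeneous _ fun r w hw => ?_
  rw [LinearMap.sub_apply, sub_eq_zero, AddSubmonoidClass.coe_finsetSum, LinearMap.sum_apply]
  simp only [IsModuleMap.dualMap_apply]
  by_cases hr : r ∈ F
  · rw [← map_sum, hs r _ (Finset.subset_biUnion_of_mem s hr) w hw]
  · rw [hF r hr w hw, Finset.sum_eq_zero]
    exact fun i _ => hF r hr _ ((hf i).2 r _ ((hp i).2 r w hw))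

variable {W₁ : Type u₁} [AddCommGroup W₁] [Module ℂ W₁] {M₁ : TwData 𝒱 W₁}
  {W₂ : Type u₂} [AddCommGroup W₂] [Module ℂ W₂] {M₂ : TwData 𝒱 W₂}
  {W₃ : Type u₃} [AddCommGroup W₃] [Module ℂ W₃] {M₃ : TwData 𝒱 W₃}

/-- The map `w' ↦ λ_{I, w'}`. -/
def lamHom (M₃ : TwData 𝒱 W₃) (I : W₁ ⊗[ℂ] W₂ →ₗ[ℂ] M₃.Completion) :
    M₃.gradedDual →ₗ[ℂ] Module.Dual ℂ (W₁ ⊗[ℂ] W₂) where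
  toFun := M₃.lam I
  map_add' f f' := by
    ext x
    exact M₃.pairing_add f f' _
  map_smul' c f := by
    ext x
    exact M₃.pairing_smul c f _

theorem lamHom_apply (I : W₁ ⊗[ℂ] W₂ →ₗ[ℂ] M₃.Completion) (f : M₃.gradedDual) :
    M₃.lamHom I f = M₃.lam I f := rfl

/-- This moves a functional along a module map: a pulled-back functional on the source of φ gives
the same λ as the original functional after composing the operator with φ. -/
theorem lam_dualMap {𝒴 : LogOperator W₁ W₂ W₃} (h : IsTwistedIntertwining M₁ M₂ M₃ 𝒴)
    {φ : W₃ →ₗ[ℂ] W} (hφ : M₃.IsModuleMap M φ) (hM : M₃.LogBounded) (z : ℂ) (f : M.gradedDual) :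
    M₃.lam (intertwiningMap h z) (hφ.dualMap f) = M.lam (intertwiningMap (h.map hφ hM) z) f := by
  refine TensorProduct.ext' fun w₁ w₂ => ?_
  exact hφ.pairing_dualMap f (hφ.map_evalOp h w₁ z w₂)

theorem sum_lam_eq_zero_iff {ι : Type*} [Fintype ι] {X : ι → Type u₃} [∀ i, AddCommGroup (X i)]
    [∀ i, Module ℂ (X i)] {N : ∀ i, TwData 𝒱 (X i)} {𝒴 : ∀ i, LogOperator W₁ W₂ (X i)}
    (h : ∀ i, IsTwistedIntertwining M₁ M₂ (N i) (𝒴 i)) (z : ℂ) (f : ∀ i, (N i).gradedDual) :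
    ∑ i, (N i).lam (intertwiningMap (h i) z) (f i) = 0 ↔ f ∈ relations N 𝒴 (logBranch 0 z) := by
  constructor
  · intro h0 w₁ w₂
    have := LinearMap.congr_fun h0 (w₁ ⊗ₜ[ℂ] w₂)
    rw [LinearMap.sum_apply] at this
    exact this
  · intro h0
    refine TensorProduct.ext' fun w₁ w₂ => ?_
    rw [LinearMap.sum_apply]
    exact h0 w₁ w₂

end

end TwData

/-! ### The tensor product assumption -/

theorem TwData.Equivalent.trans {V : Type v} [AddCommGroup V] [Module ℂ V] {𝒱 : VOA V}
    {W₁ : Type u₁} [AddCommGroup W₁] [Module ℂ W₁] {M₁ : TwData 𝒱 W₁}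
    {W₂ : Type u₂} [AddCommGroup W₂] [Module ℂ W₂] {M₂ : TwData 𝒱 W₂}
    {W₃ : Type u₃} [AddCommGroup W₃] [Module ℂ W₃] {M₃ : TwData 𝒱 W₃}
    (h : M₁.Equivalent M₂) (h' : M₂.Equivalent M₃) : M₁.Equivalent M₃ := by
  obtain ⟨e, he⟩ := h
  obtain ⟨e', he'⟩ := h'
  refine ⟨e.trans e', fun n k v w => ?_, fun r w hw => he'.2 r _ (he.2 r w hw)⟩
  exact (congrArg e' (he.1 n k v w)).trans (he'.1 n k v (e w))

section

variable {V : Type v} [AddCommGroup V] [Module ℂ V] {𝒱 : VOA V} {G : Subgroup (V ≃ₗ[ℂ] V)}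
  {c : CatKind}

/-- The listed X i need not belong to the category. Each one that is actually equivalent to an
irreducible object is replaced by such an object. -/
theorem FinitelyManyIrreducibles.exists_representatives
    (h : FinitelyManyIrreducibles.{v, u} 𝒱 G c) (g : G) :
    ∃ (κ : Type) (_ : Fintype κ) (A : κ → TwMod.{v, u} 𝒱),
      (∀ i, InCat G c g (A i).data ∧ (A i).data.IsIrreducible) ∧
      ∀ W : TwMod.{v, u} 𝒱, InCat G c g W.data → W.data.IsIrreducible →
        ∃ i, W.data.Equivalent (A i).data := by
  classical
  obtain ⟨N, X, hX⟩ := h g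
  let P : Fin N → Prop := fun i => ∃ W : TwMod.{v, u} 𝒱, InCat G c g W.data ∧
    W.data.IsIrreducible ∧ W.data.Equivalent (X i).data
  have hP : ∀ i : {i // P i}, P i := fun i => i.2
  choose A hA using hP
  refine ⟨{i // P i}, inferInstance, A, fun i => ⟨(hA i).1, (hA i).2.1⟩, fun W h1 h2 => ?_⟩
  obtain ⟨i, hi⟩ := hX W h1 h2
  exact ⟨⟨i, W, h1, h2, hi⟩, hi.trans (hA ⟨i, W, h1, h2, hi⟩).2.2.symm⟩

theorem TwData.IsPzIntertwiningMap.exists_eq {W₁ : Type u₁} [AddCommGroup W₁] [Module ℂ W₁]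
    {M₁ : TwData 𝒱 W₁} {W₂ : Type u₂} [AddCommGroup W₂] [Module ℂ W₂] {M₂ : TwData 𝒱 W₂}
    {W₃ : Type u₃} [AddCommGroup W₃] [Module ℂ W₃] {M₃ : TwData 𝒱 W₃} {z : ℂ}
    {I : W₁ ⊗[ℂ] W₂ →ₗ[ℂ] M₃.Completion} (hI : IsPzIntertwiningMap M₁ M₂ M₃ z I) :
    ∃ (𝒴 : LogOperator W₁ W₂ W₃) (h : IsTwistedIntertwining M₁ M₂ M₃ 𝒴),
      I = intertwiningMap h z := by
  obtain ⟨𝒴, h, hI⟩ := hI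
  exact ⟨𝒴, h, TensorProduct.ext' fun w₁ w₂ => hI w₁ w₂⟩

open TwData

variable {g₁ g₂ : G} {W₁ W₂ : TwMod.{v, u} 𝒱} {z : ℂ}

/-- Independence and covering identify the box with a finite product of contragredients, whose
structure is transported. Compatibility with an arbitrary product (W₃, I) is a relation between W₃
and the family, to which stability of relations applies. -/
theorem boxInCat_of_family (hG : ∀ g ∈ G, 𝒱.IsAutomorphism g) {P : Type*} [Fintype P]
    {F : P → TwMod.{v, u} 𝒱} (hF : ∀ p, InCat G c (g₁ * g₂) (F p).data)
    {𝒴 : ∀ p, LogOperator W₁.carrier W₂.carrier (F p).carrier}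
    (h : ∀ p, IsTwistedIntertwining W₁.data W₂.data (F p).data (𝒴 p))
    (hinj : ∀ f : ∀ p, (F p).data.gradedDual,
      ∑ p, (F p).data.lam (intertwiningMap (h p) z) (f p) = 0 → f = 0)
    (hcov : ∀ W₃ : TwMod.{v, u} 𝒱, InCat G c (g₁ * g₂) W₃.data →
      ∀ (𝒴₃ : LogOperator W₁.carrier W₂.carrier W₃.carrier)
        (h₃ : IsTwistedIntertwining W₁.data W₂.data W₃.data 𝒴₃) (w' : W₃.data.gradedDual),
        ∃ f : ∀ p, (F p).data.gradedDual, W₃.data.lam (intertwiningMap h₃ z) w' =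
          ∑ p, (F p).data.lam (intertwiningMap (h p) z) (f p)) :
    BoxInCat G c z g₁ g₂ W₁ W₂ := by
  have hg := hG _ (g₁ * g₂).2
  let Λ : (∀ p, (F p).data.gradedDual) →ₗ[ℂ] Module.Dual ℂ (W₁.carrier ⊗[ℂ] W₂.carrier) :=
    ∑ p, (F p).data.lamHom (intertwiningMap (h p) z) ∘ₗ LinearMap.proj p
  have hΛ : ∀ f, Λ f = ∑ p, (F p).data.lam (intertwiningMap (h p) z) (f p) := by
    intro f
    simp [Λ, lamHom_apply]
  have hmem : ∀ f, Λ f ∈ boxSpace G c z g₁ g₂ W₁ W₂ := by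
    intro f
    rw [hΛ]
    exact Submodule.sum_mem _ fun p _ => Submodule.subset_span
      ⟨F p, hF p, _, isPzIntertwiningMap_intertwiningMap (h p) z, f p, rfl⟩
  have hle : boxSpace G c z g₁ g₂ W₁ W₂ ≤ LinearMap.range Λ := by
    refine Submodule.span_le.2 ?_
    rintro _ ⟨W₃, hW₃, I, hI, w', rfl⟩
    obtain ⟨𝒴₃, h₃, rfl⟩ := hI.exists_eq
    obtain ⟨f, hf⟩ := hcov W₃ hW₃ 𝒴₃ h₃ w'
    exact ⟨f, by rw [hf, hΛ]⟩
  let e : (∀ p, (F p).data.gradedDual) ≃ₗ[ℂ] boxSpace G c z g₁ g₂ W₁ W₂ :=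
    LinearEquiv.ofBijective (Λ.codRestrict _ hmem) (by
      constructor
      · rw [injective_iff_map_eq_zero]
        intro f hf
        refine hinj f ?_
        rw [← hΛ]
        exact congrArg Subtype.val hf
      · intro x
        obtain ⟨f, hf⟩ := hle x.2
        exact ⟨f, Subtype.ext hf⟩)
  have he : ∀ f, (e f).1 = ∑ p, (F p).data.lam (intertwiningMap (h p) z) (f p) := fun f => hΛ f
  refine ⟨ofPiEquiv e fun p => (F p).data.contragredient, ?_,
    InCat.ofPiEquiv e fun p => (hF p).contragredient hG⟩
  intro W₃ hW₃ I hI w' x hx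
  obtain ⟨𝒴₃, h₃, rfl⟩ := hI.exists_eq
  obtain ⟨y, rfl⟩ := e.surjective x
  -- W₃ is adjoined as one more index, so that an equality of a functional from W₃ with an element
  -- of the box becomes a relation.
  let F' : Option P → TwMod.{v, u} 𝒱 := fun o => o.elim W₃ F
  let 𝒴' : ∀ o, LogOperator W₁.carrier W₂.carrier (F' o).carrier
    | none => 𝒴₃
    | some p => 𝒴 p
  have hF' : ∀ o, InCat G c (g₁ * g₂) (F' o).data
    | none => hW₃
    | some p => hF p
  have h' : ∀ o, IsTwistedIntertwining W₁.data W₂.data (F' o).data (𝒴' o)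
    | none => h₃
    | some p => h p
  -- The minus sign turns the equality into a vanishing sum.
  let mk : W₃.data.gradedDual → (∀ p, (F p).data.gradedDual) → ∀ o, (F' o).data.gradedDual :=
    fun a b o => match o with
      | none => a
      | some p => -b p
  have hrel : ∀ a b, W₃.data.lam (intertwiningMap h₃ z) a = (e b).1 ↔
      mk a b ∈ relations (fun o => (F' o).data) 𝒴' (logBranch 0 z) := by
    intro a b
    rw [← sum_lam_eq_zero_iff h' z, Fintype.sum_option, he]
    have h1 : ∀ p, (F' (some p)).data.lam (intertwiningMap (h' (some p)) z) (mk a b (some p)) =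
        -(F p).data.lam (intertwiningMap (h p) z) (b p) := fun p =>
      ((F p).data.lamHom (intertwiningMap (h p) z)).map_neg (b p)
    simp only [h1]
    rw [Finset.sum_neg_distrib, ← sub_eq_add_neg, sub_eq_zero]
    rfl
  have hr := (hrel w' y).1 hx.symm
  refine ⟨fun n k v => ?_, fun r hw' => ?_⟩
  · rw [ofPiEquiv_Y]
    refine ((hrel _ _).2 ?_).symm
    convert contragredient_Y_mem_relations h' (fun o => (hF' o).1) (fun o => (hF' o).2.1) hg hr n k
      v using 1
    funext o
    cases o with
    | none => rfl
    | some p => exact (((F p).data.contragredient.Y n k v).map_neg (y p)).symm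
  · have h1 := contragredient_proj_mem_relations h' (fun o => (hF' o).1) (fun o => (hF' o).2.1) hg
      hr r
    have h2 : W₃.data.lam (intertwiningMap h₃ z) w' =
        (e fun p => ((F p).data.contragredient.proj r (y p) : (F p).data.gradedDual)).1 := by
      refine (hrel _ _).2 ?_
      convert h1 using 1
      funext o
      cases o with
      | none => exact (W₃.data.contragredient.proj_of_mem r w' hw').symm
      | some p =>
        have h3 := (((F p).data.contragredient.wt r).subtype ∘ₗ
          (F p).data.contragredient.proj r).map_neg (y p)
        exact h3.symm
    have h3 : e y = e fun p => ((F p).data.contragredient.proj r (y p) : (F p).data.gradedDual) :=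
      Subtype.ext (hx.trans h2)
    rw [h3, mem_ofPiEquiv_wt]
    exact fun p => (F p).data.contragredient.proj_mem r _

theorem boxInCat (hG : ∀ g ∈ G, 𝒱.IsAutomorphism g)
    (h_irr : FinitelyManyIrreducibles.{v, u} 𝒱 G c)
    (h_red : CompletelyReducible.{v, u} 𝒱 G c) (h_fus : FiniteFusionRules.{v, u} 𝒱 G c)
    (h₁ : InCat G c g₁ W₁.data) (h₂ : InCat G c g₂ W₂.data) :
    BoxInCat G c z g₁ g₂ W₁ W₂ := by
  classical
  have hg := hG _ (g₁ * g₂).2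
  obtain ⟨κ, _, A, hA, hrep⟩ := h_irr.exists_representatives (g₁ * g₂)
  have hbasis : ∀ i, ∃ t : Finset (LogOperator W₁.carrier W₂.carrier (A i).carrier),
      (∀ 𝒴 ∈ t, IsTwistedIntertwining W₁.data W₂.data (A i).data 𝒴) ∧
      intertwiningSpace W₁.data W₂.data (A i).data ≤ Submodule.span ℂ t := by
    intro i
    have hfin := Module.Finite.iff_fg.1 (h_fus g₁ g₂ W₁ W₂ (A i) h₁ h₂ (hA i).1)
    obtain ⟨t, ht, hs⟩ := (Submodule.fg_span_iff_fg_span_finset_subset _).1 hfin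
    exact ⟨t, fun 𝒴 h => ht h, hs.le⟩
  choose t ht hspan using hbasis
  -- The index set consists of representatives of irreducibles paired with operators from their
  -- finite spanning sets.
  let P := Σ i, t i
  let lamP : ∀ p : P, (A p.1).data.gradedDual →ₗ[ℂ]
      Module.Dual ℂ (W₁.carrier ⊗[ℂ] W₂.carrier) := fun p =>
    (A p.1).data.lamHom (intertwiningMap (ht p.1 p.2.1 p.2.2) z)
  obtain ⟨S, hS, hS'⟩ := exists_finset_injective lamP
    (fun (j : ℂ × ℕ × V) p => (A p.1).data.contragredient.Y j.1 j.2.1 j.2.2)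
    (fun p U hU => ((hA p.1).2.contragredient ((hA p.1).1.1.contragredient hg (hA p.1).1.2.1.2)
      (hA p.1).1.2.1.2).2 U fun n k v => hU (n, k, v))
    (fun x hx j => (sum_lam_eq_zero_iff (fun p : P => ht p.1 p.2.1 p.2.2) z _).2
      (contragredient_Y_mem_relations (fun p : P => ht p.1 p.2.1 p.2.2) (fun p => (hA p.1).1.1)
        (fun p => (hA p.1).1.2.1) hg
        ((sum_lam_eq_zero_iff (fun p : P => ht p.1 p.2.1 p.2.2) z _).1 hx) _ _ _))
  let R : Submodule ℂ (Module.Dual ℂ (W₁.carrier ⊗[ℂ] W₂.carrier)) :=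
    LinearMap.range (∑ p : S, lamP p.1 ∘ₗ LinearMap.proj (R := ℂ)
      (φ := fun p : S => (A p.1.1).data.gradedDual) p)
  have hR : ∀ x, x ∈ R ↔ ∃ f : ∀ p : S, (A p.1.1).data.gradedDual,
      x = ∑ p : S, lamP p.1 (f p) := by
    intro x
    constructor
    · rintro ⟨f, rfl⟩
      exact ⟨f, by simp⟩
    · rintro ⟨f, rfl⟩
      exact ⟨f, by simp⟩
  have hP : ∀ p y, lamP p y ∈ R := by
    intro p y
    obtain ⟨x, hx⟩ := hS' p y
    exact (hR _).2 ⟨fun q => x q.1, by rw [hx, ← Finset.sum_coe_sort S]⟩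
  have hirr : ∀ W : TwMod.{v, u} 𝒱, InCat G c (g₁ * g₂) W.data → W.data.IsIrreducible →
      ∀ (𝒴 : LogOperator W₁.carrier W₂.carrier W.carrier)
        (h : IsTwistedIntertwining W₁.data W₂.data W.data 𝒴) (w' : W.data.gradedDual),
        W.data.lam (intertwiningMap h z) w' ∈ R := by
    intro W hW hWi 𝒴 h w'
    obtain ⟨i, e, he⟩ := hrep W hW hWi
    -- The functional is written as a pull-back along the equivalence with a representative, so that
    -- the intertwining operator can be moved there.
    have hw' : w' = he.dualMap (he.symm.dualMap w') := by
      apply Subtype.ext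
      ext w
      simp [IsModuleMap.dualMap_apply]
    rw [hw', lam_dualMap h he hW.1.logBounded]
    obtain ⟨a, ha⟩ := (h.map he hW.1.logBounded).exists_sum (ht i) (hspan i)
    have : (A i).data.lam (intertwiningMap (h.map he hW.1.logBounded) z) (he.symm.dualMap w') =
        ∑ p : t i, a p • lamP ⟨i, p⟩ (he.symm.dualMap w') := by
      rw [ha]
      ext x
      simp [lam, lamP, lamHom_apply]
    rw [this]
    exact Submodule.sum_mem _ fun p _ => Submodule.smul_mem _ _ (hP _ _)
  refine boxInCat_of_family hG (F := fun p : S => A p.1.1) (fun p => (hA p.1.1).1)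
    (fun p => ht p.1.1 p.1.2.1 p.1.2.2) (fun f hf => ?_) (fun W₃ hW₃ 𝒴₃ h₃ w' => ?_)
  · funext p
    have h0 := hS (fun q => if hq : q ∈ S then f ⟨q, hq⟩ else 0) (by
      rw [← Finset.sum_coe_sort S, ← hf]
      refine Finset.sum_congr rfl fun q _ => ?_
      rw [dif_pos q.2]
      rfl) p.1 p.2
    rwa [dif_pos p.2] at h0
  · refine (hR _).1 ?_
    -- Complete reducibility of W₃ and finiteness of the support of w' reduce the covering to
    -- irreducible targets, to which `hirr` applies.
    obtain ⟨ι, X, f, hX, hb⟩ := h_red (g₁ * g₂) W₃ hW₃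
    have hp := isModuleMap_component (fun i => (hX i).2.2) hb
    obtain ⟨s, hs⟩ := exists_finset_dualMap hW₃.2.1.2 (fun i => (hX i).2.2) hp (fun w => by
      obtain ⟨d, rfl⟩ := hb.2 w
      obtain ⟨s, hs⟩ := DirectSum.exists_finset_toModule f d
      refine ⟨s, fun t ht => ?_⟩
      rw [← hs t ht]
      refine Finset.sum_congr rfl fun i _ => ?_
      rw [LinearMap.comp_apply, LinearEquiv.coe_coe, hs t ht]
      congr 2
      exact (LinearEquiv.ofBijective _ hb).symm_apply_apply d) w'
    rw [hs, ← lamHom_apply, map_sum]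
    refine Submodule.sum_mem _ fun i _ => ?_
    rw [lamHom_apply, lam_dualMap h₃ (hp i) hW₃.1.logBounded]
    exact hirr (X i) (hX i).1 (hX i).2.1 _ _ _

end

end

theorem mainTheorem5 {V : Type v} [AddCommGroup V] [Module ℂ V] (𝒱 : VOA V)
    (G : Subgroup (V ≃ₗ[ℂ] V)) (hG : ∀ g ∈ G, 𝒱.IsAutomorphism g) (c : CatKind)
    (h_irr : FinitelyManyIrreducibles.{v, u} 𝒱 G c)
    (h_red : CompletelyReducible.{v, u} 𝒱 G c)
    (h_fus : FiniteFusionRules.{v, u} 𝒱 G c) :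
    (∀ z : ℂ, z ≠ 0 → ∀ (g₁ g₂ : G) (W₁ W₂ : TwMod.{v, u} 𝒱),
      InCat G c g₁ W₁.data → InCat G c g₂ W₂.data → BoxInCat G c z g₁ g₂ W₁ W₂) ∧
    (∀ z : ℂ, z ≠ 0 → TensorAssumption.{v, u} 𝒱 G c z) := by
  have hbox : ∀ (z : ℂ) (g₁ g₂ : G) (W₁ W₂ : TwMod.{v, u} 𝒱),
      InCat G c g₁ W₁.data → InCat G c g₂ W₂.data → BoxInCat G c z g₁ g₂ W₁ W₂ :=
    fun z g₁ g₂ W₁ W₂ h₁ h₂ => boxInCat hG h_irr h_red h_fus h₁ h₂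
  refine ⟨fun z _ => hbox z, fun z _ => ⟨hbox z, fun g W h => h.contragredient hG,
    fun g W h => ⟨?_, W.data.contragredient_contragredient_equivalent h.2.1.2⟩⟩⟩
  have := (h.contragredient hG).contragredient hG
  rwa [inv_inv] at this
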